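/- Let $T\subset\mathbb R^3$ be a nondegenerate tetrahedron with vertices $\texttt v$, edges $e$, faces $f$ and barycentric coordinates $\lambda_0,\dots,\lambda_3$. For each edge choose a tangent vector $t\neq0$ and two linearly independent normal vectors $n_1,n_2$; for each face choose a normal vector $n\ne0$ and two linearly independent tangent vectors $t_1,t_2$; $\Pi_f$ is the orthogonal projection to the plane of $f$ and $\mathrm{grad}_f=\Pi_f\nabla$. *Bubble spaces.* For an integer vector $r=(r^{\texttt v},r^e,r^f)$ and an integer $m$, $\mathbb B_m(T;r)$ is the span of all $\lambda^\alpha=\prod_i\lambda_i^{\alpha_i}$, $\alpha\in\mathbb N^4$, $|\alpha|=m$, such that $\sum_{i\notin g}\alpha_i>r^{\texttt v}$, $>r^e$, $>r^f$ for every vertex, edge, face $g$ of $T$, respectively (sub-simplices are identified with their vertex sets). For a face $f$, $\mathbb B_m(f;\binom{r^{\texttt v}}{r^e})$ is the span of all $\lambda^\alpha$ with $\alpha_i=0$ for $i\notin f$, $|\alpha|=m$, and $\sum_{i\in f\setminus g}\alpha_i>r^{\texttt v}$, $>r^e$ for every vertex, edge $g$ of $f$, respectively. These spaces are $0$ if $m<0$.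 $\mathbb B_m(f;\cdot)/\mathbb R$ is the subspace of functions with zero mean over $f$, and $\mathbb B^{\mathrm{div}}_m(r)=\{q\in\mathbb B_m(T;r)^3: q\cdot n=0 \text{ on }\partial T\}$. $\mathbb P_m(e)$ is the space of polynomials of degree at most $m$ on $e$, and $0$ if $m<0$. *Parameters.* Let $r_1,r_2\in\mathbb Z^3$ and $k\in\mathbb N$ satisfy - $r_1^f\ge-1$, $r_1^e\ge2r_1^f+1$, $r_1^{\texttt v}\ge2r_1^e+1$; - either $r_2^f\ge0$, $r_2^e\ge2r_2^f+1$, $r_2^{\texttt v}\ge2r_2^e$; or $r_2^f=-1$, $r_2^e\ge1$, $r_2^{\texttt v}\ge2r_2^e$; or $r_2^f=-1$, $r_2^e\in\{0,-1\}$, $r_2^{\texttt v}\ge2r_2^e+1$; - $r_2\ge r_1\ominus1$ componentwise, where $a\ominus1=\max\{a-1,-1\}$; - $k\ge\max\{2r_1^{\texttt v}+1,\,2r_2^{\texttt v}+1,\,1\}$ and $\dim\mathbb B_k(f;\binom{r_2^{\texttt v}}{r_2^e})\ge1$ for the faces $f$ of $T$. *Degrees of freedom* of $v\in\mathbb P_{k+1}(T;\mathbb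 R^3)$, for all vertices $\texttt v$, edges $e$ and faces $f$ of $T$: 1. $\nabla^iv(\texttt v)$, $0\le i\le r_1^{\texttt v}$; 2. $\nabla^j(\mathrm{curl}\,v)(\texttt v)$, $\max\{r_1^{\texttt v},0\}\le j\le r_2^{\texttt v}$; 3. $\int_e v\cdot t\,q\,ds$, $q\in\mathbb P_{k-1-2r_1^{\texttt v}}(e)$; 4. $\int_e\partial_{n_1}^i\partial_{n_2}^{j-i}(v\cdot n_1)\,q\,ds$, $q\in\mathbb P_{k-1-2r_1^{\texttt v}+j}(e)$, $0\le i\le j\le r_1^e$; 5. $\int_e\partial_{n_2}^{j}(v\cdot n_2)\,q\,ds$, $q\in\mathbb P_{k-1-2r_1^{\texttt v}+j}(e)$, $0\le j\le r_1^e$; 6. $\int_e\partial_{n_1}^{j}((\mathrm{curl}\,v)\cdot n_2)\,q\,ds$, $q\in\mathbb P_{k-2(r_2^{\texttt v}+1)+j}(e)$, $0\le j\le r_2^e$; 7. $\int_e\partial_{n_1}^i\partial_{n_2}^{j-i}((\mathrm{curl}\,v)\cdot t)\,q\,ds$ and $\int_e\partial_{n_1}^i\partial_{n_2}^{j-i}((\mathrm{curl}\,v)\cdot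 n_1)\,q\,ds$, $q\in\mathbb P_{k-2(r_2^{\texttt v}+1)+j}(e)$, $0\le i\le j\le r_2^e$; 8. $\int_f(\Pi_fv)\cdot q\,dS$, $q\in\mathrm{grad}_f\,\mathbb B_{k+2}(f;\binom{r_1^{\texttt v}}{r_1^e}+1)$; 9. $\int_f\partial_n^j(v\cdot n)\,q\,dS$, $q\in\mathbb B_{k+1-j}(f;\binom{r_1^{\texttt v}}{r_1^e}-j)$, $0\le j\le r_1^f$; 10. $\int_f(\mathrm{curl}\,v)\cdot n\,q\,dS$, $q\in\mathbb B_k(f;\binom{r_2^{\texttt v}}{r_2^e})/\mathbb R$; 11. $\int_f\partial_n^j((\mathrm{curl}\,v)\cdot t_\ell)\,q\,dS$, $q\in\mathbb B_{k-j}(f;\binom{r_2^{\texttt v}}{r_2^e}-j)$, $0\le j\le r_2^f$, $\ell=1,2$; 12. $\int_T(\mathrm{curl}\,v)\cdot q\,dx$, $q\in\mathbb B^{\mathrm{div}}_k(r_2)\cap\ker(\mathrm{div})$; 13. $\int_Tv\cdot q\,dx$, $q\in\mathrm{grad}\,\mathbb B_{k+2}(T;r_1+1)$. **Lemma.** These degrees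 of freedom are unisolvent for $\mathbb P_{k+1}(T;\mathbb R^3)$. That is: for arbitrary prescribed values (numbers for the components of the derivatives in 1 and 2, a linear functional of $q$ for each family of moments), there is exactly one $v\in\mathbb P_{k+1}(T;\mathbb R^3)$ whose degrees of freedom have these values, provided the values prescribed in 2 satisfy the relation that $\mathrm{div}\,\mathrm{curl}=0$ imposes on them, $\sum_c\partial_c\partial^\beta(\mathrm{curl}\,v)_c(\texttt v)=0$ for $\max\{r_1^{\texttt v},0\}\le|\beta|+1\le r_2^{\texttt v}$; and the degrees of freedom of every $v\in\mathbb P_{k+1}(T;\mathbb R^3)$ are values of this kind. Moreover the element is conforming, in the sense that single-valued degrees of freedom determine the traces which a piecewise polynomial field in $H(\mathrm{curl})$ with curl in the smooth $H(\mathrm{div})$ element $\mathbb V^{\mathrm{div}}_k(r_2)$ must have single-valued. Let $u,v\in\mathbb P_{k+1}(T;\mathbb R^3)$. - If $u$ and $v$ have the same degrees of freedom at a vertex $\texttt v$, then at $\texttt v$ all derivatives of order $\le r_1^{\texttt v}$ of $u$ and $v$ agree, and all derivatives of order $\le r_2^{\texttt v}$ of $\mathrm{curl}\,u$ and $\mathrm{curl}\,v$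 agree. - If they have the same degrees of freedom on an edge $e$ and at its end points, then on $e$ we have $u\cdot t=v\cdot t$, all derivatives of order $\le r_1^e$ of $u$ and $v$ agree, and all derivatives of order $\le r_2^e$ of $\mathrm{curl}\,u$ and $\mathrm{curl}\,v$ agree. - If they have the same degrees of freedom on a face $f$, on its edges and at its vertices, then on $f$ we have $\Pi_fu=\Pi_fv$ and $(\mathrm{curl}\,u)\cdot n=(\mathrm{curl}\,v)\cdot n$, all derivatives of order $\le r_1^f$ of $u$ and $v$ agree, and all derivatives of order $\le r_2^f$ of $\mathrm{curl}\,u$ and $\mathrm{curl}\,v$ agree. -/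

import Mathlib

open MvPolynomial

noncomputable section

namespace CurlFE

/-- Euclidean three-space. -/
abbrev E3 : Type := EuclideanSpace ℝ (Fin 3)

/-- A tetrahedron is given by its four vertices `T 0, …, T 3`, in general position;
`T.coord i` is its `i`-th barycentric coordinate. -/
abbrev Tetra : Type := AffineBasis (Fin 4) ℝ E3

/-- Polynomials on three-space. -/
abbrev Poly3 : Type := MvPolynomial (Fin 3) ℝ

/-- Polynomial vector fields on three-space, by their Cartesian components. -/
abbrev VField : Type := Fin 3 → Poly3

/-- The edges of a tetrahedron: pairs of vertices, each pair listed once. -/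
abbrev TetEdge : Type := {p : Fin 4 × Fin 4 // p.1 < p.2}

/-- A vector `(r^v, r^e, r^f)` of smoothness parameters at vertices, edges and faces. -/
structure SmoothParam where
  /-- smoothness at vertices -/
  v : ℤ
  /-- smoothness on edges -/
  e : ℤ
  /-- smoothness on faces -/
  f : ℤ

/-- The parameter that belongs to sub-simplices of dimension `0`, `1`, `2`. -/
def SmoothParam.atDim (r : SmoothParam) (l : ℕ) : ℤ :=
  if l = 0 then r.v else if l = 1 then r.e else r.f

/-- `r + j`, componentwise. -/
def SmoothParam.shift (r : SmoothParam) (j : ℤ) : SmoothParam := ⟨r.v + j, r.e + j, r.f + j⟩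

/-- `s ≥ r ⊖ 1` componentwise, where `a ⊖ 1 = max (a - 1) (-1)`. -/
def SmoothParam.GeOminusOne (s r : SmoothParam) : Prop :=
  max (r.v - 1) (-1) ≤ s.v ∧ max (r.e - 1) (-1) ≤ s.e ∧ max (r.f - 1) (-1) ≤ s.f

/-- `r = r₀ - 1` for a valid smoothness vector `r₀ ≥ 0`. -/
def SmoothParam.IsCurlParam (r : SmoothParam) : Prop :=
  -1 ≤ r.f ∧ 2 * r.f + 1 ≤ r.e ∧ 2 * r.e + 1 ≤ r.v

/-- The condition on the smoothness vector of an `H(div)` element under which `div` is onto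
between the bubble spaces. -/
def SmoothParam.IsDivParam (r : SmoothParam) : Prop :=
  (0 ≤ r.f ∧ 2 * r.f + 1 ≤ r.e ∧ 2 * r.e ≤ r.v) ∨
  (r.f = -1 ∧ 1 ≤ r.e ∧ 2 * r.e ≤ r.v) ∨
  (r.f = -1 ∧ (r.e = 0 ∨ r.e = -1) ∧ 2 * r.e + 1 ≤ r.v)

/-! ### Polynomial calculus -/

/-- Value of a polynomial at a point. -/
def evalAt (x : E3) (p : Poly3) : ℝ := MvPolynomial.eval (fun c => x c) p

/-- Order of a multi-index. -/
def multiOrder (β : Fin 3 → ℕ) : ℕ := ∑ c, β c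

/-- The partial derivative `∂^β p`. -/
def partialD (β : Fin 3 → ℕ) (p : Poly3) : Poly3 :=
  (pderiv 0)^[β 0] ((pderiv 1)^[β 1] ((pderiv 2)^[β 2] p))

/-- The derivative `∂_n p = n · ∇p` along the vector `n`. -/
def dirD (n : E3) (p : Poly3) : Poly3 := ∑ c, C (n c) * pderiv c p

/-- The component `w · t` of a field. -/
def dotVec (w : VField) (t : E3) : Poly3 := ∑ c, C (t c) * w c

/-- The pointwise scalar product of two fields. -/
def fdot (u w : VField) : Poly3 := ∑ c, u c * w c

/-- Gradient. -/
def gradP (p : Poly3) : VField := fun c => pderiv c p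

/-- Divergence. -/
def divF (w : VField) : Poly3 := ∑ c, pderiv c (w c)

/-- Curl. -/
def curlF (w : VField) : VField :=
  ![pderiv 1 (w 2) - pderiv 2 (w 1),
    pderiv 2 (w 0) - pderiv 0 (w 2),
    pderiv 0 (w 1) - pderiv 1 (w 0)]

/-- `Π_f w`: the projection of a field to the plane with normal vector `n`. -/
def tanProj (n : E3) (w : VField) : VField :=
  fun c => w c - C (n c / inner ℝ n n) * dotVec w n

/-- `P_m(T; ℝ³)`. -/
def VecPoly (m : ℕ) : Set VField := {w | ∀ c, (w c).totalDegree ≤ m}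

/-! ### Bernstein polynomials and bubble spaces -/

/-- The barycentric coordinate of vertex `i`, as a polynomial of degree one. -/
def bary (T : Tetra) (i : Fin 4) : Poly3 :=
  C (T.coord i 0) + ∑ c, C (T.coord i (EuclideanSpace.single c 1) - T.coord i 0) * X c

/-- The Bernstein polynomial `λ^α`. -/
def bernsteinPoly (T : Tetra) (α : Fin 4 → ℕ) : Poly3 := ∏ i, bary T i ^ α i

/-- The nodes of the simplicial lattice of degree `m` on the sub-simplex with vertex set `S`
whose distance `∑_{i ∉ G} α i` to every proper sub-simplex `G` of `S` is larger than the
smoothness parameter of that dimension. -/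
def bubbleNodes (S : Finset (Fin 4)) (m : ℤ) (r : SmoothParam) : Set (Fin 4 → ℕ) :=
  {α | (∀ i, i ∉ S → α i = 0) ∧ ((∑ i, α i : ℕ) : ℤ) = m ∧
    ∀ G : Finset (Fin 4), G.Nonempty → G ⊂ S →
      r.atDim (G.card - 1) < ((∑ i ∈ Gᶜ, α i : ℕ) : ℤ)}

/-- The bubble space `B_m(S; r)`, the span of the Bernstein polynomials of the bubble nodes.
For a face `S` only `r^v` and `r^e` matter, and restriction to `S` is injective on this span, so
that it is the space of face bubble functions. -/
def bubble (T : Tetra) (S : Finset (Fin 4)) (m : ℤ) (r : SmoothParam) : Submodule ℝ Poly3 :=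
  Submodule.span ℝ (bernsteinPoly T '' bubbleNodes S m r)

/-- The vertex set of the face opposite to vertex `o`. -/
def faceSet (o : Fin 4) : Finset (Fin 4) := {o}ᶜ

/-- The closed face opposite to vertex `o`. -/
def facePts (T : Tetra) (o : Fin 4) : Set E3 := convexHull ℝ (T '' (faceSet o : Set (Fin 4)))

/-! ### TetFrames and integrals -/

/-- A frame `t, n₁, n₂` on each edge and a frame `n, t₁, t₂` on each face. No vector is required
to have length one, and `n₁, n₂` and `t₁, t₂` need not be orthogonal. -/
structure TetFrames (T : Tetra) where
  /-- tangent of an edge -/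
  et : TetEdge → E3
  /-- first normal of an edge -/
  en1 : TetEdge → E3
  /-- second normal of an edge -/
  en2 : TetEdge → E3
  /-- normal of a face -/
  fn : Fin 4 → E3
  /-- two tangents of a face -/
  ft : Fin 4 → Fin 2 → E3
  et_ne : ∀ e, et e ≠ 0
  et_tangent : ∀ e, ∃ a : ℝ, et e = a • (T e.1.2 - T e.1.1)
  en1_normal : ∀ e, inner ℝ (en1 e) (T e.1.2 - T e.1.1) = 0
  en2_normal : ∀ e, inner ℝ (en2 e) (T e.1.2 - T e.1.1) = 0
  en_indep : ∀ e, LinearIndependent ℝ ![en1 e, en2 e]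
  fn_ne : ∀ o, fn o ≠ 0
  fn_normal : ∀ o i j, i ≠ o → j ≠ o → inner ℝ (fn o) (T i - T j) = 0
  ft_tangent : ∀ o l, inner ℝ (ft o l) (fn o) = 0
  ft_indep : ∀ o, LinearIndependent ℝ (ft o)

/-- `∫_e p q ds`, where `q` is a polynomial in the parameter `s ∈ [0, 1]` of the edge. -/
def edgeMoment (T : Tetra) (e : TetEdge) (p : Poly3) (q : Polynomial ℝ) : ℝ :=
  dist (T e.1.1) (T e.1.2) *
    ∫ s in (0 : ℝ)..1, evalAt (AffineMap.lineMap (T e.1.1) (T e.1.2) s) p * q.eval s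

/-- `P_m(e)`, for any integer `m`; it is zero if `m < 0`. -/
def edgeTest (m : ℤ) : Submodule ℝ (Polynomial ℝ) := Polynomial.degreeLT ℝ (m + 1).toNat

/-- `∫_f p dS` over the face opposite to vertex `o`. -/
def faceInt (T : Tetra) (o : Fin 4) (p : Poly3) : ℝ :=
  let a : Fin 3 → E3 := fun l => T (o.succAbove l)
  let u : E3 := a 1 - a 0
  let w : E3 := a 2 - a 0
  Real.sqrt (inner ℝ u u * inner ℝ w w - inner ℝ u w ^ 2) *
    ∫ s in (0 : ℝ)..1, ∫ t in (0 : ℝ)..(1 - s), evalAt (a 0 + s • u + t • w) p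

/-- `∫_T p dx`. -/
def cellInt (T : Tetra) (p : Poly3) : ℝ :=
  ∫ x in convexHull ℝ (Set.range T), evalAt x p

/-- `B_m^div(T; r)`: fields in `B_m(T; r)³` whose normal component vanishes on the boundary. -/
def divBubble (T : Tetra) (F : TetFrames T) (m : ℤ) (r : SmoothParam) : Set VField :=
  {w | (∀ c, w c ∈ bubble T Finset.univ m r) ∧
    ∀ o, ∀ x ∈ facePts T o, evalAt x (dotVec w (F.fn o)) = 0}

/-! ### Degrees of freedom -/

/-- Prescribed values for all degrees of freedom: numbers for the derivatives at vertices, and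
for each family of moments a linear functional of the test function. Values outside the index
ranges and test spaces of the degrees of freedom are never looked at. -/
structure DofData where
  /-- derivatives of the field at vertices -/
  vert : Fin 4 → (Fin 3 → ℕ) → Fin 3 → ℝ
  /-- derivatives of the curl at vertices -/
  vertCurl : Fin 4 → (Fin 3 → ℕ) → Fin 3 → ℝ
  /-- tangential component on edges -/
  edgeT : TetEdge → Module.Dual ℝ (Polynomial ℝ)
  /-- first normal component on edges -/
  edgeN1 : TetEdge → ℕ → ℕ → Module.Dual ℝ (Polynomial ℝ)
  /-- second normal component on edges -/
  edgeN2 : TetEdge → ℕ → Module.Dual ℝ (Polynomial ℝ)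
  /-- second normal component of the curl on edges -/
  edgeCurlN2 : TetEdge → ℕ → Module.Dual ℝ (Polynomial ℝ)
  /-- tangential component of the curl on edges -/
  edgeCurlT : TetEdge → ℕ → ℕ → Module.Dual ℝ (Polynomial ℝ)
  /-- first normal component of the curl on edges -/
  edgeCurlN1 : TetEdge → ℕ → ℕ → Module.Dual ℝ (Polynomial ℝ)
  /-- tangential component on faces -/
  faceT : Fin 4 → Module.Dual ℝ VField
  /-- normal component on faces -/
  faceN : Fin 4 → ℕ → Module.Dual ℝ Poly3
  /-- normal component of the curl on faces -/
  faceCurlN : Fin 4 → Module.Dual ℝ Poly3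
  /-- tangential components of the curl on faces -/
  faceCurlT : Fin 4 → ℕ → Fin 2 → Module.Dual ℝ Poly3
  /-- the curl in the interior -/
  cellCurl : Module.Dual ℝ VField
  /-- the field in the interior -/
  cell : Module.Dual ℝ VField

/-- The relation among the prescribed derivatives of the curl at the vertices that says that the
divergence of a curl vanishes: `∑_c ∂_c (∂^β w_c) = 0`. -/
def DofData.TraceFree (r1 r2 : SmoothParam) (d : DofData) : Prop :=
  ∀ (i : Fin 4) (β : Fin 3 → ℕ),
    max r1.v 0 ≤ (multiOrder β : ℤ) + 1 → (multiOrder β : ℤ) + 1 ≤ r2.v →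
      ∑ c, d.vertCurl i (β + Pi.single c 1) c = 0

/-- The degrees of freedom at the vertex `i` have the values `d`. -/
def HasVertexDofs (T : Tetra) (r1 r2 : SmoothParam) (v : VField) (d : DofData) (i : Fin 4) : Prop :=
  (∀ β c, (multiOrder β : ℤ) ≤ r1.v → evalAt (T i) (partialD β (v c)) = d.vert i β c) ∧
  (∀ β c, max r1.v 0 ≤ (multiOrder β : ℤ) → (multiOrder β : ℤ) ≤ r2.v →
    evalAt (T i) (partialD β (curlF v c)) = d.vertCurl i β c)

/-- The degrees of freedom on the edge `e` have the values `d`. -/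
def HasEdgeDofs (T : Tetra) (F : TetFrames T) (k : ℕ) (r1 r2 : SmoothParam) (v : VField) (d : DofData)
    (e : TetEdge) : Prop :=
  (∀ q ∈ edgeTest (k - 1 - 2 * r1.v),
    edgeMoment T e (dotVec v (F.et e)) q = d.edgeT e q) ∧
  (∀ i j : ℕ, i ≤ j → (j : ℤ) ≤ r1.e → ∀ q ∈ edgeTest (k - 1 - 2 * r1.v + j),
    edgeMoment T e ((dirD (F.en1 e))^[i] ((dirD (F.en2 e))^[j - i] (dotVec v (F.en1 e)))) q
      = d.edgeN1 e j i q) ∧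
  (∀ j : ℕ, (j : ℤ) ≤ r1.e → ∀ q ∈ edgeTest (k - 1 - 2 * r1.v + j),
    edgeMoment T e ((dirD (F.en2 e))^[j] (dotVec v (F.en2 e))) q = d.edgeN2 e j q) ∧
  (∀ j : ℕ, (j : ℤ) ≤ r2.e → ∀ q ∈ edgeTest (k - 2 * (r2.v + 1) + j),
    edgeMoment T e ((dirD (F.en1 e))^[j] (dotVec (curlF v) (F.en2 e))) q = d.edgeCurlN2 e j q) ∧
  (∀ i j : ℕ, i ≤ j → (j : ℤ) ≤ r2.e → ∀ q ∈ edgeTest (k - 2 * (r2.v + 1) + j),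
    edgeMoment T e ((dirD (F.en1 e))^[i] ((dirD (F.en2 e))^[j - i] (dotVec (curlF v) (F.et e)))) q
      = d.edgeCurlT e j i q) ∧
  (∀ i j : ℕ, i ≤ j → (j : ℤ) ≤ r2.e → ∀ q ∈ edgeTest (k - 2 * (r2.v + 1) + j),
    edgeMoment T e ((dirD (F.en1 e))^[i] ((dirD (F.en2 e))^[j - i] (dotVec (curlF v) (F.en1 e)))) q
      = d.edgeCurlN1 e j i q)

/-- The degrees of freedom on the face opposite to vertex `o` have the values `d`. -/
def HasFaceDofs (T : Tetra) (F : TetFrames T) (k : ℕ) (r1 r2 : SmoothParam) (v : VField) (d : DofData)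
    (o : Fin 4) : Prop :=
  (∀ p ∈ bubble T (faceSet o) (k + 2) (r1.shift 1),
    faceInt T o (fdot (tanProj (F.fn o) v) (tanProj (F.fn o) (gradP p)))
      = d.faceT o (tanProj (F.fn o) (gradP p))) ∧
  (∀ j : ℕ, (j : ℤ) ≤ r1.f → ∀ q ∈ bubble T (faceSet o) (k + 1 - j) (r1.shift (-j)),
    faceInt T o ((dirD (F.fn o))^[j] (dotVec v (F.fn o)) * q) = d.faceN o j q) ∧
  (∀ q ∈ bubble T (faceSet o) k r2, faceInt T o q = 0 →
    faceInt T o (dotVec (curlF v) (F.fn o) * q) = d.faceCurlN o q) ∧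
  (∀ j : ℕ, (j : ℤ) ≤ r2.f → ∀ l : Fin 2, ∀ q ∈ bubble T (faceSet o) (k - j) (r2.shift (-j)),
    faceInt T o ((dirD (F.fn o))^[j] (dotVec (curlF v) (F.ft o l)) * q) = d.faceCurlT o j l q)

/-- The degrees of freedom in the interior of the tetrahedron have the values `d`. -/
def HasCellDofs (T : Tetra) (F : TetFrames T) (k : ℕ) (r1 r2 : SmoothParam) (v : VField) (d : DofData) :
    Prop :=
  (∀ q ∈ divBubble T F k r2, divF q = 0 → cellInt T (fdot (curlF v) q) = d.cellCurl q) ∧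
  (∀ p ∈ bubble T Finset.univ (k + 2) (r1.shift 1),
    cellInt T (fdot v (gradP p)) = d.cell (gradP p))

/-- All degrees of freedom have the values `d`. -/
def HasDofs (T : Tetra) (F : TetFrames T) (k : ℕ) (r1 r2 : SmoothParam) (v : VField) (d : DofData) :
    Prop :=
  (∀ i, HasVertexDofs T r1 r2 v d i) ∧ (∀ e, HasEdgeDofs T F k r1 r2 v d e) ∧
  (∀ o, HasFaceDofs T F k r1 r2 v d o) ∧ HasCellDofs T F k r1 r2 v d

/-- The degrees of freedom on the edge `e` and at its end points have the values `d`. -/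
def HasDofsOnEdge (T : Tetra) (F : TetFrames T) (k : ℕ) (r1 r2 : SmoothParam) (v : VField) (d : DofData)
    (e : TetEdge) : Prop :=
  HasVertexDofs T r1 r2 v d e.1.1 ∧ HasVertexDofs T r1 r2 v d e.1.2 ∧
  HasEdgeDofs T F k r1 r2 v d e

/-- The degrees of freedom on the face opposite to vertex `o`, on its edges and at its vertices
have the values `d`. -/
def HasDofsOnFace (T : Tetra) (F : TetFrames T) (k : ℕ) (r1 r2 : SmoothParam) (v : VField) (d : DofData)
    (o : Fin 4) : Prop :=
  (∀ i, i ≠ o → HasVertexDofs T r1 r2 v d i) ∧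
  (∀ e : TetEdge, e.1.1 ≠ o → e.1.2 ≠ o → HasEdgeDofs T F k r1 r2 v d e) ∧
  HasFaceDofs T F k r1 r2 v d o

/-- All derivatives of `u` and `w` of order at most `r` agree at `x`. -/
def JetEq (r : ℤ) (u w : VField) (x : E3) : Prop :=
  ∀ β c, (multiOrder β : ℤ) ≤ r → evalAt x (partialD β (u c)) = evalAt x (partialD β (w c))

end CurlFE

end

open CurlFE

noncomputable section

namespace CurlFE

/-! ### Values and derivatives of polynomials -/

section Calculus

/-! No dimension is counted. Vanishing data force a field to be zero, and for arbitrary admissible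
data a field is constructed. Both halves rest on one dictionary: a polynomial of degree at most m is
a form of degree m in the barycentric coordinates, and it vanishes to order N on a sub-simplex
exactly if its coefficients at all nodes at distance less than N are zero (`phi_vanish_iff`). Thus
bubble spaces are spaces of polynomials with given orders of vanishing.

Uniqueness and conformity. On an edge or a face the moments fix only some derivatives of some
components. The others follow from two identities: div curl = 0, read in a frame (`smul_divF`),
gives a missing derivative of one component of the curl, and ∂_a(v·b) - ∂_b(v·a) = curl v · (a × b)
(`dirD_dotVec_sub`) exchanges derivatives of the field; r₂ ≥ r₁ ⊖ 1 says that the curl is known to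
the order this needs. On a face the normal component of the curl is tested only against functions of
mean zero; its own mean is zero by Stokes' theorem (`faceInt_curl`), since the tangential traces on
the edges vanish. Once it vanishes, the tangential trace of the field is the gradient of a face
bubble function (`exists_face_potential`), which is an admissible test function. Inside, the curl
can be tested with itself; hence the field is the gradient of a bubble function and can be tested
with itself as well (`cell_field_eq_zero`). Applied to u - v the same trace lemmas give conformity.

Existence. First the curl is built (`exists_curl_dofs`): local corrections at vertices, edges and
faces attain the degrees of freedom of the curl and the right fluxes through the faces, and make the
divergence vanish on each sub-simplex to the order it has for a bubble field. The remaining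
divergence then is a bubble function of mean zero, hence the divergence of a bubble field
(`exists_divBubble_divF_eq`). This is a combinatorial fact: modulo such divergences all normalised
Bernstein monomials coincide.

The fluxes must be those of a field whose circulations along the edges are the tangential moments
against constants, because gradients of functions that vanish at the vertices cannot change
circulations. A vector potential with these circulations exists (`exists_circ`, `exists_curl_eq`).
The degrees of freedom that do not involve the curl are then attained by adding the gradient of a
polynomial of degree k + 2, which is a scalar interpolation problem with smoothness r₁ + 1
(`exists_gradient_correction`). -/

@[simp] theorem evalAt_add (x : E3) (p q : Poly3) : evalAt x (p + q) = evalAt x p + evalAt x q := by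
  simp [evalAt]

@[simp] theorem evalAt_sub (x : E3) (p q : Poly3) : evalAt x (p - q) = evalAt x p - evalAt x q := by
  simp [evalAt]

@[simp] theorem evalAt_mul (x : E3) (p q : Poly3) : evalAt x (p * q) = evalAt x p * evalAt x q := by
  simp [evalAt]

@[simp] theorem evalAt_smul (x : E3) (a : ℝ) (p : Poly3) : evalAt x (a • p) = a * evalAt x p := by
  simp [evalAt]

@[simp] theorem evalAt_C (x : E3) (a : ℝ) : evalAt x (C a) = a := by simp [evalAt]

@[simp] theorem evalAt_X (x : E3) (c : Fin 3) : evalAt x (X c) = x c := by simp [evalAt]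

@[simp] theorem evalAt_zero (x : E3) : evalAt x 0 = 0 := by simp [evalAt]

@[simp] theorem evalAt_one (x : E3) : evalAt x 1 = 1 := by simp [evalAt]

@[simp] theorem evalAt_pow (x : E3) (p : Poly3) (n : ℕ) : evalAt x (p ^ n) = evalAt x p ^ n := by
  simp [evalAt]

theorem evalAt_sum {ι : Type*} (x : E3) (s : Finset ι) (f : ι → Poly3) :
    evalAt x (∑ i ∈ s, f i) = ∑ i ∈ s, evalAt x (f i) := by
  simp [evalAt]

theorem evalAt_prod {ι : Type*} (x : E3) (s : Finset ι) (f : ι → Poly3) :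
    evalAt x (∏ i ∈ s, f i) = ∏ i ∈ s, evalAt x (f i) := by
  simp [evalAt]

/-- The commutator of two derivations is a derivation, so it is enough that it kills the variables.
-/
theorem pderiv_comm {σ : Type*} (i j : σ) (p : MvPolynomial σ ℝ) :
    pderiv i (pderiv j p) = pderiv j (pderiv i p) := by
  classical
  have h : ⁅pderiv (R := ℝ) i, pderiv (R := ℝ) j⁆ = 0 := by
    apply MvPolynomial.derivation_ext
    intro k
    rw [Derivation.commutator_apply, pderiv_X, pderiv_X]
    by_cases h1 : k = j <;> by_cases h2 : k = i <;> simp [Pi.single_apply, h1, h2] <;>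
      split_ifs <;> simp
  have := congrArg (fun D => D p) h
  simpa [Derivation.commutator_apply, sub_eq_zero] using this

/-- The directional derivative as a derivation. -/
def dirDeriv (n : E3) : Derivation ℝ Poly3 Poly3 := ∑ c, n c • pderiv c

theorem dirDeriv_apply (n : E3) (p : Poly3) : dirDeriv n p = ∑ c, n c • pderiv c p := by
  simp only [dirDeriv]
  rw [Fin.sum_univ_three, Fin.sum_univ_three]
  rfl

theorem coe_dirDeriv (n : E3) : ⇑(dirDeriv n) = dirD n := by
  funext p
  rw [dirDeriv_apply]
  simp [dirD, MvPolynomial.C_mul']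

theorem dirD_eq (n : E3) (p : Poly3) : dirD n p = ∑ c, n c • pderiv c p := by
  rw [← coe_dirDeriv, dirDeriv_apply]

@[simp] theorem dirD_add (n : E3) (p q : Poly3) : dirD n (p + q) = dirD n p + dirD n q := by
  simp [← coe_dirDeriv]

@[simp] theorem dirD_sub (n : E3) (p q : Poly3) : dirD n (p - q) = dirD n p - dirD n q := by
  simp [← coe_dirDeriv]

@[simp] theorem dirD_smul (n : E3) (a : ℝ) (p : Poly3) : dirD n (a • p) = a • dirD n p := by
  simp [← coe_dirDeriv]

@[simp] theorem dirD_C (n : E3) (a : ℝ) : dirD n (C a) = 0 := by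
  simp [dirD]

theorem dirD_sum {ι : Type*} (n : E3) (s : Finset ι) (f : ι → Poly3) :
    dirD n (∑ i ∈ s, f i) = ∑ i ∈ s, dirD n (f i) := by
  simp [← coe_dirDeriv]

theorem dirD_mul (n : E3) (p q : Poly3) : dirD n (p * q) = p * dirD n q + dirD n p * q := by
  simp [← coe_dirDeriv, mul_comm]

theorem dirD_pow (n : E3) (p : Poly3) (l : ℕ) :
    dirD n (p ^ l) = l • (p ^ (l - 1) * dirD n p) := by
  simp [← coe_dirDeriv, Derivation.leibniz_pow]

theorem dirD_add_dir (a b : E3) (p : Poly3) : dirD (a + b) p = dirD a p + dirD b p := by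
  simp [dirD_eq, add_smul, Finset.sum_add_distrib]

theorem dirD_smul_dir (s : ℝ) (a : E3) (p : Poly3) : dirD (s • a) p = s • dirD a p := by
  simp [dirD_eq, Finset.smul_sum, smul_smul]

theorem dirD_comm (a b : E3) (p : Poly3) : dirD a (dirD b p) = dirD b (dirD a p) := by
  simp only [dirD_eq, Fin.sum_univ_three, map_add, Derivation.map_smul, smul_add, pderiv_comm 1 0 p,
    pderiv_comm 2 0 p, pderiv_comm 2 1 p, smul_smul, mul_comm (b _) (a _)]
  abel

theorem dirD_single (c : Fin 3) (p : Poly3) : dirD (EuclideanSpace.single c 1) p = pderiv c p := by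
  simp [dirD_eq, ite_smul]

theorem dirD_iterate_comm (a b : E3) (i : ℕ) (p : Poly3) :
    dirD a ((dirD b)^[i] p) = (dirD b)^[i] (dirD a p) := by
  induction i generalizing p with
  | zero => rfl
  | succ i ih => rw [Function.iterate_succ_apply, ih, dirD_comm, ← Function.iterate_succ_apply]

theorem iterate_dirD_add (a : E3) (i : ℕ) (p q : Poly3) :
    (dirD a)^[i] (p + q) = (dirD a)^[i] p + (dirD a)^[i] q := by
  simp only [← coe_dirDeriv, iterate_map_add]

theorem iterate_dirD_sub (a : E3) (i : ℕ) (p q : Poly3) :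
    (dirD a)^[i] (p - q) = (dirD a)^[i] p - (dirD a)^[i] q := by
  simp only [← coe_dirDeriv, iterate_map_sub]

theorem iterate_dirD_smul (a : E3) (i : ℕ) (s : ℝ) (p : Poly3) :
    (dirD a)^[i] (s • p) = s • (dirD a)^[i] p := by
  induction i generalizing p with
  | zero => rfl
  | succ i ih => simp [ih]

theorem iterate_dirD_sum {ι : Type*} (a : E3) (i : ℕ) (s : Finset ι) (f : ι → Poly3) :
    (dirD a)^[i] (∑ l ∈ s, f l) = ∑ l ∈ s, (dirD a)^[i] (f l) := by
  induction i generalizing f with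
  | zero => rfl
  | succ i ih => simp [dirD_sum, ih]

theorem totalDegree_pderiv_le {m : ℕ} {p : Poly3} (h : p.totalDegree ≤ m) (c : Fin 3) :
    (pderiv c p).totalDegree ≤ m - 1 := by
  rw [MvPolynomial.totalDegree, Finset.sup_le_iff] at h ⊢
  intro s hs
  rw [MvPolynomial.mem_support_iff, coeff_pderiv] at hs
  have h1 := h (s + Finsupp.single c 1) (by
    rw [MvPolynomial.mem_support_iff]
    exact left_ne_zero_of_mul hs)
  have h2 : (s + Finsupp.single c 1).degree = s.degree + 1 := by
    simp [Finsupp.degree_single]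
  have h3 : ∀ d : Fin 3 →₀ ℕ, (d.sum fun _ e => e) = d.degree := fun _ => rfl
  rw [h3] at h1 ⊢
  omega

theorem totalDegree_dirD_le {m : ℕ} {p : Poly3} (h : p.totalDegree ≤ m) (a : E3) :
    (dirD a p).totalDegree ≤ m - 1 := by
  rw [dirD_eq]
  apply MvPolynomial.totalDegree_finsetSum_le
  intro c _
  exact (MvPolynomial.totalDegree_smul_le _ _).trans (totalDegree_pderiv_le h c)

end Calculus

/-! ### Order of vanishing on a set -/

section Vanish

/-- The polynomials all of whose derivatives of order less than `N` vanish on `Z`. -/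
def vanish (Z : Set E3) : ℕ → Submodule ℝ Poly3
  | 0 => ⊤
  | N + 1 =>
    { carrier := {p | (∀ x ∈ Z, evalAt x p = 0) ∧ ∀ c, pderiv c p ∈ vanish Z N}
      add_mem' := fun {p q} hp hq => ⟨fun x hx => by simp [hp.1 x hx, hq.1 x hx], fun c => by
        rw [map_add]; exact Submodule.add_mem _ (hp.2 c) (hq.2 c)⟩
      zero_mem' := ⟨fun x _ => by simp, fun c => by simp⟩
      smul_mem' := fun a p hp => ⟨fun x hx => by simp [hp.1 x hx], fun c => by
        rw [Derivation.map_smul]; exact Submodule.smul_mem _ _ (hp.2 c)⟩ }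

variable {Z W : Set E3} {N M : ℕ} {p q : Poly3}

@[simp] theorem mem_vanish_zero : p ∈ vanish Z 0 := trivial

theorem mem_vanish_succ :
    p ∈ vanish Z (N + 1) ↔ (∀ x ∈ Z, evalAt x p = 0) ∧ ∀ c, pderiv c p ∈ vanish Z N := Iff.rfl

theorem vanish_anti_set (h : W ⊆ Z) (hp : p ∈ vanish Z N) : p ∈ vanish W N := by
  induction N generalizing p with
  | zero => trivial
  | succ N ih => exact ⟨fun x hx => hp.1 x (h hx), fun c => ih (hp.2 c)⟩

theorem vanish_succ_le (hp : p ∈ vanish Z (N + 1)) : p ∈ vanish Z N := by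
  induction N generalizing p with
  | zero => trivial
  | succ N ih => exact ⟨hp.1, fun c => ih (hp.2 c)⟩

theorem vanish_mono (h : M ≤ N) (hp : p ∈ vanish Z N) : p ∈ vanish Z M := by
  induction h with
  | refl => exact hp
  | step _ ih => exact ih (vanish_succ_le hp)

theorem mem_vanish_one : p ∈ vanish Z 1 ↔ ∀ x ∈ Z, evalAt x p = 0 :=
  ⟨fun h => h.1, fun h => ⟨h, fun _ => trivial⟩⟩

theorem evalAt_of_vanish (hp : p ∈ vanish Z N) (hN : 1 ≤ N) {x : E3} (hx : x ∈ Z) :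
    evalAt x p = 0 := mem_vanish_one.1 (vanish_mono hN hp) x hx

theorem pderiv_vanish (hp : p ∈ vanish Z N) (c : Fin 3) : pderiv c p ∈ vanish Z (N - 1) := by
  cases N with
  | zero => trivial
  | succ N => exact hp.2 c

theorem dirD_vanish (hp : p ∈ vanish Z N) (a : E3) : dirD a p ∈ vanish Z (N - 1) := by
  rw [dirD_eq]
  exact Submodule.sum_mem _ fun c _ => Submodule.smul_mem _ _ (pderiv_vanish hp c)

theorem iterate_dirD_vanish (hp : p ∈ vanish Z N) (a : E3) (i : ℕ) :
    (dirD a)^[i] p ∈ vanish Z (N - i) := by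
  induction i generalizing p N with
  | zero => exact hp
  | succ i ih =>
    rw [Function.iterate_succ_apply]
    have := ih (dirD_vanish hp a)
    rwa [Nat.sub_sub, add_comm 1 i] at this

/-- Leibniz rule, by induction on the total order. A factor of order 0 loses nothing when it is
differentiated (`0 - 1 = 0`); in that case the other factor, weakened by one, supplies the whole
order. -/
theorem mul_vanish (hp : p ∈ vanish Z N) (hq : q ∈ vanish Z M) : p * q ∈ vanish Z (N + M) := by
  induction h : N + M generalizing p q N M with
  | zero => trivial
  | succ L ih =>
    refine ⟨fun x hx => ?_, fun c => ?_⟩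
    · rw [evalAt_mul]
      rcases Nat.eq_zero_or_pos N with hN | hN
      · rw [evalAt_of_vanish hq (by omega) hx, mul_zero]
      · rw [evalAt_of_vanish hp hN hx, zero_mul]
    · rw [pderiv_mul]
      refine Submodule.add_mem _ ?_ ?_
      · rcases Nat.eq_zero_or_pos N with hN | hN
        · obtain rfl : M = L + 1 := by omega
          have h2 := ih (p := pderiv c p) (N := 0) trivial (vanish_succ_le hq) (by omega)
          exact h2
        · exact ih (pderiv_vanish hp c) hq (by omega)
      · rcases Nat.eq_zero_or_pos M with hN | hN
        · obtain rfl : N = L + 1 := by omega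
          exact ih (q := pderiv c q) (M := 0) (vanish_succ_le hp) trivial (by omega)
        · exact ih hp (pderiv_vanish hq c) (by omega)

theorem mul_left_vanish (p : Poly3) (hq : q ∈ vanish Z M) : p * q ∈ vanish Z M := by
  have := mul_vanish (p := p) (N := 0) trivial hq
  rwa [zero_add] at this

theorem pow_vanish (hp : p ∈ vanish Z N) (l : ℕ) : p ^ l ∈ vanish Z (l * N) := by
  induction l with
  | zero => simp
  | succ l ih => rw [pow_succ, add_mul, one_mul]; exact mul_vanish ih hp

theorem prod_vanish {ι : Type*} (s : Finset ι) (f : ι → Poly3) (g : ι → ℕ)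
    (h : ∀ i ∈ s, f i ∈ vanish Z (g i)) : ∏ i ∈ s, f i ∈ vanish Z (∑ i ∈ s, g i) := by
  classical
  induction s using Finset.induction_on with
  | empty => simp
  | insert a s ha ih =>
    rw [Finset.prod_insert ha, Finset.sum_insert ha]
    exact mul_vanish (h a (by simp)) (ih fun i hi => h i (by simp [hi]))

theorem pderiv_iterate_comm (c d : Fin 3) (i : ℕ) (p : Poly3) :
    (pderiv d)^[i] (pderiv c p) = pderiv c ((pderiv d)^[i] p) := by
  induction i generalizing p with
  | zero => rfl
  | succ i ih => rw [Function.iterate_succ_apply, Function.iterate_succ_apply, pderiv_comm, ih]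

theorem partialD_pderiv (β : Fin 3 → ℕ) (c : Fin 3) (p : Poly3) :
    partialD β (pderiv c p) = partialD (β + Pi.single c 1) p := by
  fin_cases c
  · simp [partialD, pderiv_iterate_comm, Function.iterate_succ_apply']
  · simp [partialD, pderiv_iterate_comm, Function.iterate_succ_apply']
  · simp [partialD, Function.iterate_succ_apply]

theorem partialD_zero (p : Poly3) : partialD 0 p = p := rfl

theorem partialD_add (β : Fin 3 → ℕ) (p q : Poly3) :
    partialD β (p + q) = partialD β p + partialD β q := by
  simp [partialD, iterate_map_add]

theorem partialD_sub (β : Fin 3 → ℕ) (p q : Poly3) :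
    partialD β (p - q) = partialD β p - partialD β q := by
  simp [partialD, iterate_map_sub]

theorem partialD_sum {ι : Type*} (β : Fin 3 → ℕ) (s : Finset ι) (f : ι → Poly3) :
    partialD β (∑ i ∈ s, f i) = ∑ i ∈ s, partialD β (f i) := by
  classical
  induction s using Finset.induction_on with
  | empty => simp [partialD]
  | insert a s ha ih => rw [Finset.sum_insert ha, Finset.sum_insert ha, partialD_add, ih]

theorem multiOrder_add_single (β : Fin 3 → ℕ) (c : Fin 3) :
    multiOrder (β + Pi.single c 1) = multiOrder β + 1 := by
  simp [multiOrder, Finset.sum_add_distrib]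

theorem exists_eq_add_single {β : Fin 3 → ℕ} (h : multiOrder β ≠ 0) :
    ∃ (c : Fin 3) (γ : Fin 3 → ℕ), β = γ + Pi.single c 1 := by
  have : ∃ c, β c ≠ 0 := by
    by_contra! h'
    exact h (by simp [multiOrder, h'])
  obtain ⟨c, hc⟩ := this
  refine ⟨c, β - Pi.single c 1, ?_⟩
  funext d
  by_cases hd : d = c
  · subst hd; simp; omega
  · simp [hd]

/-- Links the recursive definition, which peels off one partial derivative at a time, with the
multi-index derivatives in the degrees of freedom. -/
theorem mem_vanish_iff : p ∈ vanish Z N ↔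
    ∀ β, multiOrder β < N → ∀ x ∈ Z, evalAt x (partialD β p) = 0 := by
  induction N generalizing p with
  | zero => simp
  | succ N ih =>
    rw [mem_vanish_succ]
    constructor
    · rintro ⟨h0, h1⟩ β hβ x hx
      by_cases hz : multiOrder β = 0
      · obtain rfl : β = 0 := by
          funext c
          have := Finset.sum_eq_zero_iff.1 hz c (Finset.mem_univ _)
          simpa using this
        exact h0 x hx
      · obtain ⟨c, γ, rfl⟩ := exists_eq_add_single hz
        rw [← partialD_pderiv]
        rw [multiOrder_add_single] at hβ
        exact ih.1 (h1 c) γ (by omega) x hx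
    · intro h
      refine ⟨fun x hx => h 0 (by simp [multiOrder]) x hx, fun c => ih.2 fun β hβ x hx => ?_⟩
      rw [partialD_pderiv]
      exact h _ (by rw [multiOrder_add_single]; omega) x hx

/-- Polynomials whose derivatives along all directions in a spanning set vanish. -/
theorem vanish_succ_of_frame {a b d : E3} (hspan : ∀ c : Fin 3, ∃ s t u : ℝ,
      EuclideanSpace.single c (1 : ℝ) = s • a + t • b + u • d)
    (h0 : ∀ x ∈ Z, evalAt x p = 0) (ha : dirD a p ∈ vanish Z N) (hb : dirD b p ∈ vanish Z N)
    (hd : dirD d p ∈ vanish Z N) : p ∈ vanish Z (N + 1) := by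
  refine ⟨h0, fun c => ?_⟩
  obtain ⟨s, t, u, h⟩ := hspan c
  rw [← dirD_single, h]
  simp only [dirD_add_dir, dirD_smul_dir]
  exact Submodule.add_mem _ (Submodule.add_mem _ (Submodule.smul_mem _ _ ha)
    (Submodule.smul_mem _ _ hb)) (Submodule.smul_mem _ _ hd)

/-- The conversion used throughout: order at most `r` is order less than `(r + 1).toNat`, and for `r
≤ -1` the condition is empty. -/
theorem jetEq_iff (r : ℤ) (u w : VField) (x : E3) :
    JetEq r u w x ↔ ∀ c, u c - w c ∈ vanish {x} (r + 1).toNat := by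
  simp only [JetEq, mem_vanish_iff, Set.mem_singleton_iff, forall_eq, partialD_sub, evalAt_sub,
    sub_eq_zero]
  constructor
  · intro h c β hβ; exact h β c (by omega)
  · intro h c β hβ; exact h _ _ (by omega)

end Vanish

end CurlFE

end

noncomputable section

namespace CurlFE

/-! ### Barycentric coordinates and homogeneous polynomials in them -/

section Bary

/-- The closed sub-simplex with vertex set `S`. -/
def hull (T : Tetra) (S : Finset (Fin 4)) : Set E3 := convexHull ℝ (T '' (S : Set (Fin 4)))

/-- The derivative of the `i`-th barycentric coordinate along `d`. -/
def coordLin (T : Tetra) (d : E3) (i : Fin 4) : ℝ := (T.coord i).linear d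

variable (T : Tetra)

theorem coord_sub_eq (x y : E3) (i : Fin 4) : T.coord i x - T.coord i y = coordLin T (x - y) i := by
  have := (T.coord i).linearMap_vsub x y
  simpa [coordLin] using this.symm

theorem coordLin_sub (x y : E3) (i : Fin 4) :
    coordLin T (x - y) i = coordLin T x i - coordLin T y i := by
  simp only [coordLin, map_sub]

theorem coordLin_smul (a : ℝ) (x : E3) (i : Fin 4) :
    coordLin T (a • x) i = a * coordLin T x i := by simp [coordLin]

theorem coordLin_vertex_sub (a b i : Fin 4) :
    coordLin T (T b - T a) i = (if i = b then 1 else 0) - (if i = a then 1 else 0) := by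
  rw [← coord_sub_eq, AffineBasis.coord_apply, AffineBasis.coord_apply]

theorem E3_eq_sum (x : E3) : x = ∑ c, x c • EuclideanSpace.single c (1 : ℝ) := by
  ext d
  fin_cases d <;> simp [Fin.sum_univ_three]

theorem coordLin_eq_sum (d : E3) (i : Fin 4) :
    coordLin T d i = ∑ c, d c * (T.coord i (EuclideanSpace.single c 1) - T.coord i 0) := by
  conv_lhs => rw [E3_eq_sum d]
  simp only [coord_sub_eq, coordLin, map_sum, map_smul, smul_eq_mul, sub_zero]

@[simp] theorem evalAt_bary (x : E3) (i : Fin 4) : evalAt x (bary T i) = T.coord i x := by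
  have h := coord_sub_eq T x 0 i
  rw [sub_zero, coordLin_eq_sum] at h
  simp only [bary, evalAt_add, evalAt_C, evalAt_sum, evalAt_mul, evalAt_X]
  rw [sub_eq_iff_eq_add.1 h, add_comm]
  simp [mul_comm]

theorem dirD_bary (d : E3) (i : Fin 4) : dirD d (bary T i) = C (coordLin T d i) := by
  rw [coordLin_eq_sum, dirD_eq, bary]
  simp [pderiv_X, Fin.sum_univ_three, Pi.single_apply, MvPolynomial.smul_eq_C_mul]

theorem poly_ext {p q : Poly3} (h : ∀ x : E3, evalAt x p = evalAt x q) : p = q := by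
  apply MvPolynomial.funext
  intro x
  exact h (WithLp.toLp 2 x)

theorem sum_bary : ∑ i, bary T i = 1 := by
  apply poly_ext
  intro x
  rw [evalAt_sum]
  simp

theorem sum_vertex_bary (c : Fin 3) : ∑ i, (T i c) • bary T i = X c := by
  apply poly_ext
  intro x
  rw [evalAt_sum]
  have h := congrArg (fun y : E3 => y c) (AffineBasis.linear_combination_coord_eq_self T x)
  simp only [PiLp.smul_apply, smul_eq_mul, WithLp.ofLp_sum, Finset.sum_apply] at h
  simpa [mul_comm] using h

/-- Substitution of the barycentric coordinates. -/
def phi : MvPolynomial (Fin 4) ℝ →ₐ[ℝ] Poly3 := aeval (bary T)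

@[simp] theorem phi_X (i : Fin 4) : phi T (X i) = bary T i := by simp [phi]

theorem evalAt_phi (x : E3) (P : MvPolynomial (Fin 4) ℝ) :
    evalAt x (phi T P) = eval (fun i => T.coord i x) P := by
  induction P using MvPolynomial.induction_on with
  | C a => simp [phi, MvPolynomial.algebraMap_eq]
  | add p q hp hq => simp [hp, hq]
  | mul_X p i hp => simp [hp]

/-- The derivation `∑ c_i ∂_i` in the four barycentric variables. -/
def baryDer (c : Fin 4 → ℝ) (P : MvPolynomial (Fin 4) ℝ) : MvPolynomial (Fin 4) ℝ :=
  ∑ i, c i • pderiv i P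

theorem baryDer_mul (c : Fin 4 → ℝ) (P Q : MvPolynomial (Fin 4) ℝ) :
    baryDer c (P * Q) = P * baryDer c Q + baryDer c P * Q := by
  simp only [baryDer, pderiv_mul, Finset.mul_sum, Finset.sum_mul, ← Finset.sum_add_distrib]
  refine Finset.sum_congr rfl fun i _ => ?_
  simp only [smul_add, mul_smul_comm, smul_mul_assoc]
  rw [add_comm]

theorem baryDer_X (c : Fin 4 → ℝ) (i : Fin 4) : baryDer c (X i) = C (c i) := by
  simp [baryDer, pderiv_X, Pi.single_apply, MvPolynomial.smul_eq_C_mul]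

theorem dirD_phi (d : E3) (P : MvPolynomial (Fin 4) ℝ) :
    dirD d (phi T P) = phi T (baryDer (coordLin T d) P) := by
  induction P using MvPolynomial.induction_on with
  | C a => simp [phi, baryDer, MvPolynomial.algebraMap_eq]
  | add p q hp hq => simp [hp, hq, baryDer, Finset.sum_add_distrib]
  | mul_X p i hp =>
    rw [map_mul, dirD_mul, hp, phi_X, dirD_bary, baryDer_mul, baryDer_X, map_add, map_mul, map_mul,
      phi_X]
    simp [phi, MvPolynomial.algebraMap_eq]

theorem baryDer_isHomogeneous {P : MvPolynomial (Fin 4) ℝ} {m : ℕ} (hP : P.IsHomogeneous m)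
    (c : Fin 4 → ℝ) : (baryDer c P).IsHomogeneous (m - 1) := by
  apply MvPolynomial.IsHomogeneous.sum
  intro i _
  rw [MvPolynomial.smul_eq_C_mul]
  exact hP.pderiv.C_mul _

theorem totalDegree_phi_le {P : MvPolynomial (Fin 4) ℝ} {m : ℕ} (hP : P.IsHomogeneous m) :
    (phi T P).totalDegree ≤ m := by
  have hb : ∀ i, (bary T i).totalDegree ≤ 1 := by
    intro i
    refine (totalDegree_add _ _).trans (max_le (by simp) (totalDegree_finsetSum_le fun c _ => ?_))
    refine (totalDegree_mul _ _).trans ?_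
    rw [totalDegree_C, totalDegree_X]
  rw [phi, aeval_def, eval₂_eq']
  refine totalDegree_finsetSum_le fun β hβ => ?_
  refine (totalDegree_mul _ _).trans ?_
  have h1 : (∏ i, bary T i ^ β i).totalDegree ≤ ∑ i, β i := by
    refine (totalDegree_finsetProd _ _).trans (Finset.sum_le_sum fun i _ => ?_)
    exact (totalDegree_pow _ _).trans (by nlinarith [hb i])
  have h2 : β.degree = m := by
    by_contra h
    exact (mem_support_iff.1 hβ) (hP.coeff_eq_zero h)
  rw [Finsupp.degree_eq_sum] at h2
  have h3 : (algebraMap ℝ Poly3 (coeff β P)).totalDegree = 0 := totalDegree_C _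
  omega

/-- Homogenisation: the Cartesian coordinate X_c is the combination of the barycentric coordinates
with the coordinates of the vertices as weights, and missing degrees are filled with powers of their
sum, which is 1. -/
theorem exists_phi_eq {p : Poly3} {m : ℕ} (h : p.totalDegree ≤ m) :
    ∃ P : MvPolynomial (Fin 4) ℝ, P.IsHomogeneous m ∧ phi T P = p := by
  refine ⟨∑ γ ∈ p.support, C (coeff γ p) * ((∏ c, (∑ i, C (T i c) * X i) ^ γ c) *
    (∑ i, X i) ^ (m - γ.degree)), ?_, ?_⟩
  · refine IsHomogeneous.sum _ _ _ fun γ hγ => IsHomogeneous.C_mul ?_ _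
    have h1 : γ.degree ≤ m := (le_totalDegree hγ).trans h
    have h2 := (IsHomogeneous.prod Finset.univ
      (fun c => (∑ i, C (T i c) * X i : MvPolynomial (Fin 4) ℝ) ^ γ c) (fun c => 1 * γ c)
      (fun c _ => IsHomogeneous.pow (IsHomogeneous.sum _ _ _
        fun i _ => isHomogeneous_C_mul_X _ _) _)).mul
      (IsHomogeneous.pow (IsHomogeneous.sum Finset.univ (fun i : Fin 4 => X i) 1
        fun i _ => isHomogeneous_X ℝ i) (m - γ.degree))
    convert h2 using 1
    rw [Finsupp.degree_eq_sum] at *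
    simp only [one_mul]
    omega
  · rw [map_sum]
    conv_rhs => rw [p.as_sum]
    refine Finset.sum_congr rfl fun γ _ => ?_
    have h3 : ∀ c, phi T (∑ i, C (T i c) * X i) = X c := by
      intro c
      rw [← sum_vertex_bary T c]
      simp [MvPolynomial.C_mul']
    have h4 : phi T (∑ i, X i) = 1 := by rw [← sum_bary T]; simp
    rw [map_mul, map_mul, map_prod, map_pow, h4, one_pow, mul_one]
    simp only [map_pow, h3]
    rw [monomial_eq, Finsupp.prod_fintype _ _ (by simp)]
    simp [phi, MvPolynomial.algebraMap_eq]

theorem coord_of_mem_hull {S : Finset (Fin 4)} {x : E3} (hx : x ∈ hull T S) {i : Fin 4}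
    (hi : i ∉ S) : T.coord i x = 0 := by
  have h1 : hull T S ⊆ {y | T.coord i y = 0} := by
    apply convexHull_min
    · rintro _ ⟨j, hj, rfl⟩
      have : i ≠ j := by rintro rfl; exact hi hj
      simp [this]
    · have : {y : E3 | T.coord i y = 0} = (T.coord i) ⁻¹' {0} := rfl
      rw [this]
      exact (convex_singleton 0).affine_preimage _
  exact h1 hx

theorem coord_sum_smul {w : Fin 4 → ℝ} (hw : ∑ i, w i = 1) (i : Fin 4) :
    T.coord i (∑ j, w j • T j) = w i := by
  have := T.coord_apply_combination_of_mem (Finset.mem_univ i) hw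
  rwa [Finset.affineCombination_eq_linear_combination _ _ _ hw] at this

theorem sum_smul_mem_hull {S : Finset (Fin 4)} {w : Fin 4 → ℝ} (hw : ∑ i, w i = 1)
    (h0 : ∀ i, 0 ≤ w i) (hS : ∀ i, i ∉ S → w i = 0) : ∑ j, w j • T j ∈ hull T S := by
  have h1 : ∑ j, w j • T j = ∑ j ∈ S, w j • T j := by
    symm
    apply Finset.sum_subset (Finset.subset_univ _)
    intro i _ hi
    rw [hS i hi, zero_smul]
  rw [h1]
  refine (convex_convexHull ℝ _).sum_mem (fun i _ => h0 i) ?_ fun i hi =>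
    subset_convexHull _ _ ⟨i, hi, rfl⟩
  rw [← hw]
  apply Finset.sum_subset (Finset.subset_univ _)
  intro i _ hi
  exact hS i hi

theorem hull_mono {S S' : Finset (Fin 4)} (h : S ⊆ S') : hull T S ⊆ hull T S' :=
  convexHull_mono (Set.image_mono (by exact_mod_cast h))

theorem hull_singleton (i : Fin 4) : hull T {i} = {T i} := by
  simp [hull]

/-- The part of a polynomial with exponents satisfying a predicate. -/
def restrictExp {σ : Type*} (A : (σ →₀ ℕ) → Prop) [DecidablePred A] (P : MvPolynomial σ ℝ) :
    MvPolynomial σ ℝ :=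
  ∑ β ∈ P.support with A β, monomial β (coeff β P)

theorem coeff_restrictExp {σ : Type*} (A : (σ →₀ ℕ) → Prop) [DecidablePred A]
    (P : MvPolynomial σ ℝ) (β : σ →₀ ℕ) :
    coeff β (restrictExp A P) = if A β then coeff β P else 0 := by
  classical
  rw [restrictExp, coeff_sum]
  simp only [coeff_monomial]
  rw [Finset.sum_ite_eq']
  simp only [Finset.mem_filter, mem_support_iff]
  split_ifs <;> simp_all

theorem restrictExp_isHomogeneous {σ : Type*} (A : (σ →₀ ℕ) → Prop) [DecidablePred A]
    {P : MvPolynomial σ ℝ} {m : ℕ} (hP : P.IsHomogeneous m) :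
    (restrictExp A P).IsHomogeneous m := by
  intro β hβ
  rw [coeff_restrictExp] at hβ
  split_ifs at hβ with h
  · exact hP hβ
  · exact absurd rfl hβ

theorem bary_vanish {S : Finset (Fin 4)} {i : Fin 4} (hi : i ∉ S) :
    bary T i ∈ vanish (hull T S) 1 := by
  rw [mem_vanish_one]
  intro x hx
  rw [evalAt_bary, coord_of_mem_hull T hx hi]

theorem bernstein_vanish (S : Finset (Fin 4)) (α : Fin 4 → ℕ) :
    bernsteinPoly T α ∈ vanish (hull T S) (∑ i ∈ Sᶜ, α i) := by
  have h := prod_vanish (Z := hull T S) Finset.univ (fun i => bary T i ^ α i)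
    (fun i => if i ∈ Sᶜ then α i else 0) (fun i _ => by
      split_ifs with h
      · have := pow_vanish (bary_vanish T (Finset.mem_compl.1 h)) (α i)
        rwa [mul_one] at this
      · trivial)
  rwa [Finset.sum_ite_mem, Finset.univ_inter] at h

theorem phi_eq_sum (P : MvPolynomial (Fin 4) ℝ) :
    phi T P = ∑ β ∈ P.support, coeff β P • bernsteinPoly T β := by
  rw [phi, aeval_def, eval₂_eq']
  simp [bernsteinPoly, MvPolynomial.C_mul', MvPolynomial.algebraMap_eq]

/-- On the sub-simplex only the monomials in the variables of `S` survive. By homogeneity their sum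
vanishes on a whole positive orthant and not just where the weights add up to 1, so it is the zero
polynomial. -/
theorem coeff_eq_zero_of_phi {S : Finset (Fin 4)} (hS : S.Nonempty)
    {P : MvPolynomial (Fin 4) ℝ} {m : ℕ} (hP : P.IsHomogeneous m)
    (h : ∀ x ∈ hull T S, evalAt x (phi T P) = 0) (β : Fin 4 →₀ ℕ) (hβ : ∀ i, i ∉ S → β i = 0) :
    coeff β P = 0 := by
  classical
  let A : (Fin 4 →₀ ℕ) → Prop := fun β => ∀ i, i ∉ S → β i = 0
  have hQ : restrictExp A P = 0 := by
    apply MvPolynomial.funext_set (fun _ => Set.Ioi (0 : ℝ)) (fun _ => Set.Ioi_infinite 0)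
    intro y hy
    have hy' : ∀ i, 0 < y i := fun i => hy i (Set.mem_univ i)
    rw [map_zero]
    -- Drop the coordinates outside `S` and divide by the sum `σ` to reach a point of the
    -- sub-simplex; the form changes only by the factor σ⁻¹ to the power m.
    let z : Fin 4 → ℝ := fun i => if i ∈ S then y i else 0
    have hz0 : ∀ i, 0 ≤ z i := fun i => by simp only [z]; split_ifs; exacts [(hy' i).le, le_rfl]
    have hσ : 0 < ∑ i, z i := by
      obtain ⟨i, hi⟩ := hS
      exact Finset.sum_pos' (fun i _ => hz0 i) ⟨i, Finset.mem_univ _, by simp [z, hi, hy' i]⟩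
    set σ := ∑ i, z i with hσd
    have h1 : ∑ i, σ⁻¹ * z i = 1 := by rw [← Finset.mul_sum, ← hσd, inv_mul_cancel₀ hσ.ne']
    have h2 := h _ (sum_smul_mem_hull T (S := S) h1
      (fun i => mul_nonneg (inv_nonneg.2 hσ.le) (hz0 i)) (fun i hi => by simp [z, hi]))
    rw [evalAt_phi] at h2
    simp only [coord_sum_smul T h1] at h2
    have h3 : eval z P = 0 := by
      rw [eval_eq'] at h2 ⊢
      have : ∑ d ∈ P.support, coeff d P * ∏ i, (σ⁻¹ * z i) ^ d i
          = (σ⁻¹) ^ m * ∑ d ∈ P.support, coeff d P * ∏ i, z i ^ d i := by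
        rw [Finset.mul_sum]
        refine Finset.sum_congr rfl fun d hd => ?_
        have hd' : d.degree = m := by
          by_contra hne
          exact (mem_support_iff.1 hd) (hP.coeff_eq_zero hne)
        rw [Finsupp.degree_eq_sum] at hd'
        simp only [mul_pow, Finset.prod_mul_distrib, Finset.prod_pow_eq_pow_sum, hd']
        ring
      rw [this] at h2
      exact (mul_eq_zero.1 h2).resolve_left (pow_ne_zero _ (inv_ne_zero hσ.ne'))
    rw [← h3, restrictExp, map_sum, eval_eq', Finset.sum_filter]
    refine Finset.sum_congr rfl fun d _ => ?_
    split_ifs with hd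
    · rw [eval_monomial, Finsupp.prod_fintype _ _ (by simp)]
      congr 1
      refine Finset.prod_congr rfl fun i _ => ?_
      by_cases hi : i ∈ S
      · simp [z, hi]
      · simp [hd i hi]
    · have : ∃ i, i ∉ S ∧ d i ≠ 0 := by by_contra! h'; exact hd h'
      obtain ⟨i, hi, hdi⟩ := this
      rw [Finset.prod_eq_zero (Finset.mem_univ i) (by simp [z, hi, hdi]), mul_zero]
  have := coeff_restrictExp A P β
  rw [hQ, if_pos hβ] at this
  simpa using this.symm

theorem coeff_baryDer_vertex (P : MvPolynomial (Fin 4) ℝ) {a b : Fin 4} (γ : Fin 4 →₀ ℕ) :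
    coeff γ (baryDer (coordLin T (T b - T a)) P) =
      coeff (γ + Finsupp.single b 1) P * (γ b + 1) - coeff (γ + Finsupp.single a 1) P * (γ a + 1) := by
  simp [baryDer, coordLin_vertex_sub, sub_smul, coeff_pderiv]

/-- The order of vanishing on a sub-simplex is read off the exponents. The forward direction is a
double induction, on the order and on the distance of the node to `S`. The converse holds because
every single monomial vanishes to the order of its distance. -/
theorem phi_vanish_iff {S : Finset (Fin 4)} (hS : S.Nonempty) {N : ℕ}
    {P : MvPolynomial (Fin 4) ℝ} {m : ℕ} (hP : P.IsHomogeneous m) :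
    phi T P ∈ vanish (hull T S) N ↔ ∀ β : Fin 4 →₀ ℕ, ∑ i ∈ Sᶜ, β i < N → coeff β P = 0 := by
  constructor
  · induction N generalizing P m with
    | zero => simp
    | succ N ih =>
      intro h β hβ
      induction hl : ∑ i ∈ Sᶜ, β i generalizing β with
      | zero =>
        refine coeff_eq_zero_of_phi T hS hP h.1 β fun i hi => ?_
        exact Finset.sum_eq_zero_iff.1 hl i (by simpa using hi)
      | succ l ihl =>
        have : ∃ j ∈ Sᶜ, β j ≠ 0 := by
          by_contra! h'
          rw [Finset.sum_eq_zero h'] at hl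
          omega
        obtain ⟨j, hj, hβj⟩ := this
        obtain ⟨i, hi⟩ := hS
        obtain ⟨γ, rfl⟩ : ∃ γ : Fin 4 →₀ ℕ, β = γ + Finsupp.single j 1 :=
          ⟨β - Finsupp.single j 1, by
            rw [tsub_add_cancel_of_le]; simpa [Finsupp.single_le_iff] using Nat.one_le_iff_ne_zero.2 hβj⟩
        have hj' : j ∉ S := Finset.mem_compl.1 hj
        have hsum : ∑ i ∈ Sᶜ, (γ + Finsupp.single j 1 : Fin 4 →₀ ℕ) i = ∑ i ∈ Sᶜ, γ i + 1 := by
          simp [Finset.sum_add_distrib, Finsupp.single_apply, hj']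
        have hsum' : ∑ l ∈ Sᶜ, (γ + Finsupp.single i 1 : Fin 4 →₀ ℕ) l = ∑ l ∈ Sᶜ, γ l := by
          simp [Finset.sum_add_distrib, Finsupp.single_apply, hi]
        -- Differentiate from a vertex i of `S` towards the vertex j outside. The coefficient at γ
        -- combines those of P at γ + e_j and γ + e_i; the second node is one step closer to `S` and
        -- is already known to have coefficient zero.
        have h1 := ih (baryDer_isHomogeneous hP (coordLin T (T j - T i)))
          (by rw [← dirD_phi]; exact dirD_vanish h _) γ (by omega)
        rw [coeff_baryDer_vertex, ihl (γ + Finsupp.single i 1) (by omega) (by omega), zero_mul,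
          sub_zero] at h1
        refine (mul_eq_zero.1 h1).resolve_right ?_
        positivity
  · intro h
    rw [phi_eq_sum]
    refine Submodule.sum_mem _ fun β hβ => Submodule.smul_mem _ _ ?_
    refine vanish_mono ?_ (bernstein_vanish T S β)
    by_contra hlt
    exact mem_support_iff.1 hβ (h β (by omega))

/-- A derivative tangential to a sub-simplex preserves the order of vanishing on it. -/
theorem dirD_vanish_of_tangent {S : Finset (Fin 4)} (hS : S.Nonempty) {N : ℕ} {d : E3}
    (hd : ∀ i, i ∉ S → coordLin T d i = 0) {p : Poly3} (hp : p ∈ vanish (hull T S) N) :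
    dirD d p ∈ vanish (hull T S) N := by
  obtain ⟨P, hP, rfl⟩ := exists_phi_eq T (le_refl p.totalDegree)
  rw [dirD_phi, phi_vanish_iff T hS (baryDer_isHomogeneous hP _)]
  rw [phi_vanish_iff T hS hP] at hp
  intro β hβ
  simp only [baryDer, coeff_sum, coeff_smul, coeff_pderiv]
  refine Finset.sum_eq_zero fun i _ => ?_
  -- A unit at a vertex of `S` does not change the distance of a node to `S`; the other vertices
  -- have weight zero for a tangential direction.
  by_cases hi : i ∈ S
  · rw [hp, zero_mul, smul_zero]
    simpa [Finset.sum_add_distrib, Finsupp.single_apply, hi] using hβ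
  · rw [hd i hi, zero_smul]

end Bary

end CurlFE

end

noncomputable section

namespace CurlFE

/-! ### Bubble spaces and orders of vanishing -/

section Bubble

/-- The vertex set of an edge. -/
def edgeSet (e : TetEdge) : Finset (Fin 4) := {e.1.1, e.1.2}

variable (T : Tetra) {S : Finset (Fin 4)} {m : ℤ} {r : SmoothParam}

theorem finite_bubbleNodes (S : Finset (Fin 4)) (m : ℤ) (r : SmoothParam) :
    (bubbleNodes S m r).Finite := by
  refine (Set.finite_Iic (fun _ : Fin 4 => m.toNat)).subset fun α hα i => ?_
  have h1 : α i ≤ ∑ i, α i := Finset.single_le_sum (fun _ _ => Nat.zero_le _) (Finset.mem_univ i)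
  have h2 : ((∑ i, α i : ℕ) : ℤ) = m := hα.2.1
  change α i ≤ m.toNat
  omega

instance finite_bubble (S : Finset (Fin 4)) (m : ℤ) (r : SmoothParam) :
    Module.Finite ℝ (bubble T S m r) :=
  Module.Finite.span_of_finite ℝ ((finite_bubbleNodes S m r).image _)

theorem phi_mem_bubble {P : MvPolynomial (Fin 4) ℝ}
    (h : ∀ β : Fin 4 →₀ ℕ, coeff β P ≠ 0 → ⇑β ∈ bubbleNodes S m r) : phi T P ∈ bubble T S m r := by
  rw [phi_eq_sum]
  exact Submodule.sum_mem _ fun β hβ => Submodule.smul_mem _ _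
    (Submodule.subset_span ⟨β, h β (mem_support_iff.1 hβ), rfl⟩)

theorem phi_monomial (β : Fin 4 →₀ ℕ) (a : ℝ) :
    phi T (monomial β a) = a • bernsteinPoly T β := by
  rw [monomial_eq, Finsupp.prod_fintype _ _ (by simp), map_mul, map_prod]
  simp [phi, bernsteinPoly, Algebra.smul_def]

theorem exists_phi_of_mem_bubble {p : Poly3} (hp : p ∈ bubble T S m r) :
    ∃ P : MvPolynomial (Fin 4) ℝ, P.IsHomogeneous m.toNat ∧ phi T P = p ∧
      ∀ β : Fin 4 →₀ ℕ, coeff β P ≠ 0 → ⇑β ∈ bubbleNodes S m r := by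
  induction hp using Submodule.span_induction with
  | mem p hp =>
    obtain ⟨α, hα, rfl⟩ := hp
    refine ⟨monomial (Finsupp.equivFunOnFinite.symm α) 1, ?_, ?_, ?_⟩
    · apply isHomogeneous_monomial
      rw [Finsupp.degree_eq_sum]
      have := hα.2.1
      simp only [Finsupp.equivFunOnFinite_symm_apply_apply]
      omega
    · rw [phi_monomial]; simp
    · intro β hβ
      rw [coeff_monomial] at hβ
      split_ifs at hβ with h
      · rw [← h]; simpa using hα
      · exact absurd rfl hβ
  | zero => exact ⟨0, isHomogeneous_zero _ _ _, map_zero _, by simp⟩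
  | add p q _ _ hp hq =>
    obtain ⟨P, h1, rfl, h2⟩ := hp
    obtain ⟨Q, h3, rfl, h4⟩ := hq
    refine ⟨P + Q, h1.add h3, map_add _ _ _, fun β hβ => ?_⟩
    rw [coeff_add] at hβ
    by_cases h : coeff β P = 0
    · exact h4 β (by simpa [h] using hβ)
    · exact h2 β h
  | smul a p _ hp =>
    obtain ⟨P, h1, rfl, h2⟩ := hp
    refine ⟨a • P, by rw [MvPolynomial.smul_eq_C_mul]; exact h1.C_mul a, map_smul _ _ _,
      fun β hβ => h2 β ?_⟩
    rw [coeff_smul] at hβ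
    exact right_ne_zero_of_mul hβ

theorem totalDegree_of_mem_bubble {p : Poly3} (hp : p ∈ bubble T S m r) :
    p.totalDegree ≤ m.toNat := by
  obtain ⟨P, hP, rfl, -⟩ := exists_phi_of_mem_bubble T hp
  exact totalDegree_phi_le T hP

theorem bubble_vanish {p : Poly3} (hp : p ∈ bubble T S m r) {G : Finset (Fin 4)} {N : ℕ}
    (h : ∀ α ∈ bubbleNodes S m r, N ≤ ∑ i ∈ Gᶜ, α i) : p ∈ vanish (hull T G) N := by
  induction hp using Submodule.span_induction with
  | mem p hp =>
    obtain ⟨α, hα, rfl⟩ := hp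
    exact vanish_mono (h α hα) (bernstein_vanish T G α)
  | zero => exact Submodule.zero_mem _
  | add p q _ _ hp hq => exact Submodule.add_mem _ hp hq
  | smul a p _ hp => exact Submodule.smul_mem _ _ hp

theorem bubble_vanish_of_ssubset {p : Poly3} (hp : p ∈ bubble T S m r) {G : Finset (Fin 4)}
    (hG : G.Nonempty) (hGS : G ⊂ S) :
    p ∈ vanish (hull T G) (r.atDim (G.card - 1) + 1).toNat := by
  refine bubble_vanish T hp fun α hα => ?_
  have := hα.2.2 G hG hGS
  omega

/-- By `phi_vanish_iff` the inequalities that define bubble nodes are the orders of vanishing on the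
proper sub-simplices. -/
theorem mem_bubble_univ {p : Poly3} {k : ℕ} (hp : p.totalDegree ≤ k)
    (h : ∀ G : Finset (Fin 4), G.Nonempty → G ⊂ Finset.univ →
      p ∈ vanish (hull T G) (r.atDim (G.card - 1) + 1).toNat) :
    p ∈ bubble T Finset.univ k r := by
  obtain ⟨P, hP, rfl⟩ := exists_phi_eq T hp
  refine phi_mem_bubble T fun β hβ => ⟨by simp, ?_, fun G hG hGS => ?_⟩
  · have h2 : β.degree = k := by
      by_contra h
      exact hβ (hP.coeff_eq_zero h)
    rw [Finsupp.degree_eq_sum] at h2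
    exact_mod_cast h2
  · by_contra hlt
    exact hβ ((phi_vanish_iff T hG hP).1 (h G hG hGS) β (by omega))

theorem evalAt_bernstein_eq_zero {x : E3} (hx : x ∈ hull T S) {α : Fin 4 → ℕ}
    (h : ∃ i, i ∉ S ∧ α i ≠ 0) : evalAt x (bernsteinPoly T α) = 0 := by
  obtain ⟨i, hi, hα⟩ := h
  rw [bernsteinPoly, evalAt_prod]
  apply Finset.prod_eq_zero (Finset.mem_univ i)
  rw [evalAt_pow, evalAt_bary, coord_of_mem_hull T hx hi, zero_pow hα]

/-- Monomials that involve a vertex outside `S` vanish on the sub-simplex and can be dropped; what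
is left has its nodes in `S`. In this way a trace becomes an admissible test function. -/
theorem exists_bubble_eq_on {p : Poly3} {k : ℕ} (hp : p.totalDegree ≤ k)
    (h : ∀ G : Finset (Fin 4), G.Nonempty → G ⊂ S →
      p ∈ vanish (hull T G) (r.atDim (G.card - 1) + 1).toNat) :
    ∃ q ∈ bubble T S k r, ∀ x ∈ hull T S, evalAt x q = evalAt x p := by
  classical
  obtain ⟨P, hP, rfl⟩ := exists_phi_eq T hp
  refine ⟨phi T (restrictExp (fun β => ∀ i, i ∉ S → β i = 0) P), ?_, fun x hx => ?_⟩
  · refine phi_mem_bubble T fun β hβ => ?_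
    rw [coeff_restrictExp] at hβ
    split_ifs at hβ with hS
    · refine ⟨hS, ?_, fun G hG hGS => ?_⟩
      · have h2 : β.degree = k := by
          by_contra h
          exact hβ (hP.coeff_eq_zero h)
        rw [Finsupp.degree_eq_sum] at h2
        exact_mod_cast h2
      · by_contra hlt
        exact hβ ((phi_vanish_iff T hG hP).1 (h G hG hGS) β (by omega))
    · exact absurd rfl hβ
  · rw [phi_eq_sum T P, restrictExp, map_sum, evalAt_sum, evalAt_sum, Finset.sum_filter]
    refine Finset.sum_congr rfl fun β _ => ?_
    rw [phi_monomial]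
    split_ifs with hS
    · rfl
    · have : ∃ i, i ∉ S ∧ β i ≠ 0 := by by_contra! h'; exact hS h'
      rw [evalAt_smul, evalAt_bernstein_eq_zero T hx this, mul_zero]

theorem bubble_eq_zero_of_hull (hS : S.Nonempty) {p : Poly3} (hp : p ∈ bubble T S m r)
    (h : ∀ x ∈ hull T S, evalAt x p = 0) : p = 0 := by
  obtain ⟨P, hP, rfl, hP'⟩ := exists_phi_of_mem_bubble T hp
  have : P = 0 := by
    ext β
    by_contra hβ
    exact hβ (coeff_eq_zero_of_phi T hS hP h β (hP' β hβ).1)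
  rw [this, map_zero]

theorem eq_zero_of_hull_univ {p : Poly3} (h : ∀ x ∈ hull T Finset.univ, evalAt x p = 0) :
    p = 0 := by
  obtain ⟨P, hP, rfl⟩ := exists_phi_eq T (le_refl p.totalDegree)
  have : P = 0 := by
    ext β
    exact coeff_eq_zero_of_phi T Finset.univ_nonempty hP h β (by simp)
  rw [this, map_zero]

theorem sum_compl_singleton (α : Fin 4 → ℕ) (i : Fin 4) :
    α i + ∑ j ∈ ({i} : Finset (Fin 4))ᶜ, α j = ∑ j, α j := by
  rw [← Finset.sum_add_sum_compl {i}, Finset.sum_singleton]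

/-- Polynomials with prescribed Taylor polynomials at the vertices. -/
theorem exists_vertex_interpolant (g : Fin 4 → Poly3) {k N : ℕ} (hg : ∀ i, (g i).totalDegree ≤ k)
    (hN : 2 * N ≤ k + 1) :
    ∃ p : Poly3, p.totalDegree ≤ k ∧ ∀ i, p - g i ∈ vanish (hull T {i}) N := by
  classical
  choose P hP hPg using fun i => exists_phi_eq T (hg i)
  -- Keep only the nodes at distance less than `N` to the vertex i. Since 2N ≤ k + 1, no node of
  -- degree k is that close to two vertices, so the truncated forms do not disturb each other.
  let Q : Fin 4 → MvPolynomial (Fin 4) ℝ := fun i =>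
    restrictExp (fun β => ∑ l ∈ ({i} : Finset (Fin 4))ᶜ, β l < N) (P i)
  have hQ : ∀ i, (Q i).IsHomogeneous k := fun i => restrictExp_isHomogeneous _ (hP i)
  have hdeg : ∀ {R : MvPolynomial (Fin 4) ℝ} (_ : R.IsHomogeneous k) {β : Fin 4 →₀ ℕ},
      coeff β R ≠ 0 → ∑ i, β i = k := by
    intro R hR β hβ
    rw [← Finsupp.degree_eq_sum]
    by_contra h
    exact hβ (hR.coeff_eq_zero h)
  have h1 : ∀ i, phi T (Q i) - g i ∈ vanish (hull T {i}) N := by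
    intro i
    rw [← hPg, ← map_sub, phi_vanish_iff T (Finset.singleton_nonempty i) ((hQ i).sub (hP i))]
    intro β hβ
    rw [coeff_sub, coeff_restrictExp, if_pos hβ, sub_self]
  have h2 : ∀ i j, j ≠ i → phi T (Q j) ∈ vanish (hull T {i}) N := by
    intro i j hji
    rw [phi_vanish_iff T (Finset.singleton_nonempty i) (hQ j)]
    intro β hβ
    by_contra hne
    have h3 := hdeg (hQ j) hne
    rw [coeff_restrictExp] at hne
    split_ifs at hne with h4
    · have h5 := sum_compl_singleton β i
      have h6 := sum_compl_singleton β j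
      have h7 : β i ≤ ∑ l ∈ ({j} : Finset (Fin 4))ᶜ, β l :=
        Finset.single_le_sum (fun _ _ => Nat.zero_le _) (by simpa using hji.symm)
      omega
    · exact hne rfl
  refine ⟨∑ i, phi T (Q i), totalDegree_finsetSum_le fun i _ => totalDegree_phi_le T (hQ i),
    fun i => ?_⟩
  rw [← Finset.add_sum_erase _ _ (Finset.mem_univ i), add_sub_right_comm]
  exact Submodule.add_mem _ (h1 i)
    (Submodule.sum_mem _ fun j hj => h2 i j (Finset.ne_of_mem_erase hj))

/-- Vanishing to order `r` at all vertices, on all edges and on all faces. -/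
def VanishAll (r : SmoothParam) (p : Poly3) : Prop :=
  (∀ i, p ∈ vanish (hull T {i}) (r.v + 1).toNat) ∧
  (∀ e : TetEdge, p ∈ vanish (hull T (edgeSet e)) (r.e + 1).toNat) ∧
  ∀ o, p ∈ vanish (hull T (faceSet o)) (r.f + 1).toNat

theorem card_edgeSet (e : TetEdge) : (edgeSet e).card = 2 :=
  Finset.card_pair (ne_of_lt e.2)

theorem card_faceSet (o : Fin 4) : (faceSet o).card = 3 := by
  simp [faceSet, Finset.card_compl]

theorem exists_edgeSet_eq {a b : Fin 4} (h : a ≠ b) : ∃ e : TetEdge, edgeSet e = {a, b} := by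
  rcases lt_or_gt_of_ne h with h | h
  · exact ⟨⟨(a, b), h⟩, rfl⟩
  · exact ⟨⟨(b, a), h⟩, Finset.pair_comm _ _⟩

/-- Proper sub-simplices are vertices, edges and faces. -/
theorem forall_proper_subset {Q : Finset (Fin 4) → ℤ → Prop} (r : SmoothParam)
    (hv : ∀ i, {i} ⊂ S → Q {i} r.v) (he : ∀ e, edgeSet e ⊂ S → Q (edgeSet e) r.e)
    (hf : ∀ o, faceSet o ⊂ S → Q (faceSet o) r.f) (G : Finset (Fin 4)) (hG : G.Nonempty)
    (hGS : G ⊂ S) : Q G (r.atDim (G.card - 1)) := by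
  have h1 : G.card < 4 := by
    have := Finset.card_lt_card hGS
    have := Finset.card_le_univ S
    simp at this
    omega
  have h2 := hG.card_pos
  interval_cases hc : G.card
  · obtain ⟨i, rfl⟩ := Finset.card_eq_one.1 hc
    exact hv i hGS
  · obtain ⟨a, b, hab, rfl⟩ := Finset.card_eq_two.1 hc
    obtain ⟨e, he'⟩ := exists_edgeSet_eq hab
    rw [← he'] at hGS ⊢
    exact he e hGS
  · have : Gᶜ.card = 1 := by rw [Finset.card_compl, hc]; rfl
    obtain ⟨o, ho⟩ := Finset.card_eq_one.1 this
    have h3 : G = faceSet o := by rw [faceSet, ← ho, compl_compl]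
    rw [h3] at hGS ⊢
    exact hf o hGS

theorem singleton_ssubset_univ (i : Fin 4) : ({i} : Finset (Fin 4)) ⊂ Finset.univ :=
  Finset.ssubset_univ_iff.2 fun h => by simpa using congrArg Finset.card h

theorem edgeSet_ssubset_univ (e : TetEdge) : edgeSet e ⊂ Finset.univ :=
  Finset.ssubset_univ_iff.2 fun h => by simpa [card_edgeSet] using congrArg Finset.card h

theorem faceSet_ssubset_univ (o : Fin 4) : faceSet o ⊂ Finset.univ :=
  Finset.ssubset_univ_iff.2 fun h => by simpa [card_faceSet] using congrArg Finset.card h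

theorem singleton_ssubset_faceSet {i o : Fin 4} (h : i ≠ o) : {i} ⊂ faceSet o := by
  refine ⟨by simpa [faceSet] using h.symm, fun h' => ?_⟩
  simpa [card_faceSet] using Finset.card_le_card h'

theorem edgeSet_ssubset_faceSet {e : TetEdge} {o : Fin 4} (h1 : e.1.1 ≠ o) (h2 : e.1.2 ≠ o) :
    edgeSet e ⊂ faceSet o := by
  refine ⟨?_, fun h' => ?_⟩
  · intro x hx
    simp only [edgeSet, Finset.mem_insert, Finset.mem_singleton] at hx
    rcases hx with rfl | rfl <;> simpa [faceSet]
  · simpa [card_faceSet, card_edgeSet] using Finset.card_le_card h'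

theorem mem_bubble_of_vanishAll {p : Poly3} {k : ℕ} (hp : p.totalDegree ≤ k)
    (h : VanishAll T r p) : p ∈ bubble T Finset.univ k r :=
  mem_bubble_univ T hp (forall_proper_subset
    (Q := fun G s => p ∈ vanish (hull T G) (s + 1).toNat) r
    (fun i _ => h.1 i) (fun e _ => h.2.1 e) (fun o _ => h.2.2 o))

theorem vanishAll_of_mem_bubble {p : Poly3} (hp : p ∈ bubble T Finset.univ m r) :
    VanishAll T r p := by
  refine ⟨fun i => ?_, fun e => ?_, fun o => ?_⟩
  · simpa [SmoothParam.atDim] using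
      bubble_vanish_of_ssubset T hp (Finset.singleton_nonempty i) (singleton_ssubset_univ i)
  · simpa [SmoothParam.atDim, card_edgeSet] using
      bubble_vanish_of_ssubset T hp ⟨e.1.1, by simp [edgeSet]⟩ (edgeSet_ssubset_univ e)
  · simpa [SmoothParam.atDim, card_faceSet] using
      bubble_vanish_of_ssubset T hp (Finset.card_pos.1 (by simp [card_faceSet]))
        (faceSet_ssubset_univ o)

theorem mem_faceSet {i o : Fin 4} : i ∈ faceSet o ↔ i ≠ o := by simp [faceSet]

theorem faceSet_nonempty (o : Fin 4) : (faceSet o).Nonempty :=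
  Finset.card_pos.1 (by simp [card_faceSet])

theorem exists_face_bubble_eq_on {p : Poly3} {k : ℕ} (hp : p.totalDegree ≤ k) (o : Fin 4)
    (hv : ∀ i, i ≠ o → p ∈ vanish (hull T {i}) (r.v + 1).toNat)
    (he : ∀ e : TetEdge, e.1.1 ≠ o → e.1.2 ≠ o →
      p ∈ vanish (hull T (edgeSet e)) (r.e + 1).toNat) :
    ∃ q ∈ bubble T (faceSet o) k r, ∀ x ∈ hull T (faceSet o), evalAt x q = evalAt x p := by
  refine exists_bubble_eq_on T hp (forall_proper_subset
    (Q := fun G s => p ∈ vanish (hull T G) (s + 1).toNat) r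
    (fun i hi => hv i ?_) (fun e h => he e ?_ ?_) (fun o' h => ?_))
  · exact mem_faceSet.1 (hi.1 (by simp))
  · exact mem_faceSet.1 (h.1 (by simp [edgeSet]))
  · exact mem_faceSet.1 (h.1 (by simp [edgeSet]))
  · have := Finset.card_lt_card h
    simp [card_faceSet] at this

/-- The inequalities that describe the nodes of a face. -/
theorem face_node_ineq {o : Fin 4} {α : Fin 4 → ℕ} (h : α ∈ bubbleNodes (faceSet o) m r) :
    (∀ i, i ≠ o → r.v < ((∑ l ∈ ({i} : Finset (Fin 4))ᶜ, α l : ℕ) : ℤ)) ∧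
    (∀ e : TetEdge, e.1.1 ≠ o → e.1.2 ≠ o → r.e < ((∑ l ∈ (edgeSet e)ᶜ, α l : ℕ) : ℤ)) ∧
    α o = 0 := by
  refine ⟨fun i hi => ?_, fun e h1 h2 => ?_, h.1 o (by simp [faceSet])⟩
  · simpa [SmoothParam.atDim] using
      h.2.2 {i} (Finset.singleton_nonempty i) (singleton_ssubset_faceSet hi)
  · simpa [SmoothParam.atDim, card_edgeSet] using
      h.2.2 (edgeSet e) ⟨e.1.1, by simp [edgeSet]⟩ (edgeSet_ssubset_faceSet h1 h2)

end Bubble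

end CurlFE

end

noncomputable section

namespace CurlFE

/-! ### Integrals over edges, faces and the tetrahedron -/

section Integrals

/-- A functional on a finite-dimensional space is represented by a definite bilinear form. -/
theorem exists_representer {E : Type*} [AddCommGroup E] [Module ℝ E] (S : Submodule ℝ E)
    [Module.Finite ℝ S] (B : E →ₗ[ℝ] E →ₗ[ℝ] ℝ) (hB : ∀ u ∈ S, B u u = 0 → u = 0)
    (μ : S →ₗ[ℝ] ℝ) : ∃ u ∈ S, ∀ q (hq : q ∈ S), B u q = μ ⟨q, hq⟩ := by
  -- Definiteness makes `S → S*` injective, hence onto, because both spaces have the same finite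
  -- dimension.
  let L : S →ₗ[ℝ] Module.Dual ℝ S := (B.compl₁₂ S.subtype S.subtype)
  have hL : Function.Injective L := by
    rw [injective_iff_map_eq_zero]
    intro u hu
    have := LinearMap.congr_fun hu u
    exact Subtype.ext (hB u u.2 (by simpa [L] using this))
  have hL' : Function.Surjective L :=
    (LinearMap.injective_iff_surjective_of_finrank_eq_finrank
      (Subspace.dual_finrank_eq (V := S)).symm).1 hL
  obtain ⟨u, hu⟩ := hL' μ
  exact ⟨u, u.2, fun q hq => by rw [← hu]; simp [L]⟩

theorem eq_zero_of_integral_eq_zero {f : ℝ → ℝ} (hf : Continuous f) {a b : ℝ} (hab : a < b)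
    (h0 : ∀ x ∈ Set.Icc a b, 0 ≤ f x) (hi : ∫ x in a..b, f x = 0) :
    ∀ x ∈ Set.Icc a b, f x = 0 := by
  have h1 : f =ᵐ[MeasureTheory.volume.restrict (Set.Icc a b)] fun _ => 0 := by
    rw [intervalIntegral.integral_of_le hab.le, ← MeasureTheory.integral_Icc_eq_integral_Ioc] at hi
    refine (MeasureTheory.setIntegral_eq_zero_iff_of_nonneg_ae ?_ ?_).1 hi
    · exact (MeasureTheory.ae_restrict_iff' measurableSet_Icc).2 (Filter.Eventually.of_forall h0)
    · exact hf.continuousOn.integrableOn_Icc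
  exact MeasureTheory.Measure.eqOn_Icc_of_ae_eq _ hab.ne h1 hf.continuousOn continuousOn_const

theorem continuous_evalAt (p : Poly3) : Continuous fun x : E3 => evalAt x p := by
  have h : Continuous fun x : E3 => (fun c => x c : Fin 3 → ℝ) := by fun_prop
  exact (MvPolynomial.continuous_eval p).comp h

/-! #### Edges -/

variable (T : Tetra)

/-- The restriction of a polynomial to an edge, as a polynomial in the edge parameter. -/
def edgePoly (e : TetEdge) : Poly3 →ₐ[ℝ] Polynomial ℝ :=
  aeval fun c => Polynomial.C (T e.1.1 c) + Polynomial.C (T e.1.2 c - T e.1.1 c) * Polynomial.X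

theorem eval_edgePoly (e : TetEdge) (p : Poly3) (s : ℝ) :
    (edgePoly T e p).eval s = evalAt (AffineMap.lineMap (T e.1.1) (T e.1.2) s) p := by
  induction p using MvPolynomial.induction_on with
  | C a => simp [edgePoly]
  | add p q hp hq => simp [hp, hq]
  | mul_X p c hp =>
    rw [map_mul, Polynomial.eval_mul, hp, evalAt_mul, evalAt_X]
    simp [edgePoly, AffineMap.lineMap_apply]
    ring_nf
    simp

theorem derivative_edgePoly (e : TetEdge) (p : Poly3) :
    (edgePoly T e p).derivative = edgePoly T e (dirD (T e.1.2 - T e.1.1) p) := by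
  induction p using MvPolynomial.induction_on with
  | C a => simp [edgePoly]
  | add p q hp hq => simp [hp, hq]
  | mul_X p c hp =>
    rw [map_mul, Polynomial.derivative_mul, hp, dirD_mul, map_add, map_mul, map_mul, add_comm]
    congr 2
    have : dirD (T e.1.2 - T e.1.1) (X c) = C (T e.1.2 c - T e.1.1 c) := by
      rw [dirD_eq]
      fin_cases c <;> simp [Fin.sum_univ_three, pderiv_X, MvPolynomial.smul_eq_C_mul]
    rw [this]
    simp [edgePoly]

theorem iterate_derivative_edgePoly (e : TetEdge) (p : Poly3) (i : ℕ) :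
    (Polynomial.derivative^[i]) (edgePoly T e p)
      = edgePoly T e ((dirD (T e.1.2 - T e.1.1))^[i] p) := by
  induction i generalizing p with
  | zero => rfl
  | succ i ih => rw [Function.iterate_succ_apply, derivative_edgePoly, ih,
      Function.iterate_succ_apply]

theorem degree_edgePoly_le (e : TetEdge) (p : Poly3) :
    (edgePoly T e p).natDegree ≤ p.totalDegree := by
  rw [edgePoly, aeval_def, eval₂_eq']
  refine Polynomial.natDegree_sum_le_of_forall_le _ _ fun β hβ => ?_
  have h1 : ∀ c : Fin 3, (Polynomial.C (T e.1.1 c) +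
      Polynomial.C (T e.1.2 c - T e.1.1 c) * Polynomial.X).natDegree ≤ 1 := fun c => by
    compute_degree
  refine (Polynomial.natDegree_C_mul_le _ _).trans ?_
  refine (Polynomial.natDegree_prod_le _ _).trans ?_
  refine le_trans (Finset.sum_le_sum fun c _ =>
    (Polynomial.natDegree_pow_le_of_le (β c) (h1 c))) ?_
  have h2 : β.degree ≤ p.totalDegree := le_totalDegree hβ
  simpa [Finsupp.degree_eq_sum] using h2

theorem hull_edgeSet (e : TetEdge) : hull T (edgeSet e) = segment ℝ (T e.1.1) (T e.1.2) := by
  simp [hull, edgeSet, Set.image_pair]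

theorem edgePoly_eq_zero_iff (e : TetEdge) (p : Poly3) :
    edgePoly T e p = 0 ↔ ∀ x ∈ hull T (edgeSet e), evalAt x p = 0 := by
  rw [hull_edgeSet, segment_eq_image_lineMap]
  constructor
  · rintro h _ ⟨s, -, rfl⟩
    rw [← eval_edgePoly, h, Polynomial.eval_zero]
  · intro h
    apply Polynomial.eq_zero_of_infinite_isRoot
    refine (Set.Icc_infinite (zero_lt_one (α := ℝ))).mono fun s hs => ?_
    change Polynomial.eval s _ = 0
    rw [eval_edgePoly]
    exact h _ ⟨s, hs, rfl⟩

/-- Integration over the unit interval. -/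
def unitInt : Polynomial ℝ →ₗ[ℝ] ℝ where
  toFun f := ∫ s in (0 : ℝ)..1, f.eval s
  map_add' f g := by
    simp only [Polynomial.eval_add]
    exact intervalIntegral.integral_add (f.continuous.intervalIntegrable _ _)
      (g.continuous.intervalIntegrable _ _)
  map_smul' a f := by simp

theorem edgeMoment_eq (e : TetEdge) (p : Poly3) (q : Polynomial ℝ) :
    edgeMoment T e p q = dist (T e.1.1) (T e.1.2) * unitInt (edgePoly T e p * q) := by
  simp [edgeMoment, unitInt, eval_edgePoly]

theorem edge_dist_pos (e : TetEdge) : 0 < dist (T e.1.1) (T e.1.2) :=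
  dist_pos.2 fun h => (ne_of_lt e.2) (T.ind.injective h)

theorem edgeMoment_add_left (e : TetEdge) (p p' : Poly3) (q : Polynomial ℝ) :
    edgeMoment T e (p + p') q = edgeMoment T e p q + edgeMoment T e p' q := by
  simp [edgeMoment_eq, add_mul, mul_add]

theorem edgeMoment_sub_left (e : TetEdge) (p p' : Poly3) (q : Polynomial ℝ) :
    edgeMoment T e (p - p') q = edgeMoment T e p q - edgeMoment T e p' q := by
  simp [edgeMoment_eq, sub_mul, mul_sub]

theorem edgeMoment_smul_left (e : TetEdge) (a : ℝ) (p : Poly3) (q : Polynomial ℝ) :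
    edgeMoment T e (a • p) q = a * edgeMoment T e p q := by
  simp [edgeMoment_eq]; ring

/-- An edge moment as a functional of the test function. -/
def edgeMomentDual (e : TetEdge) (p : Poly3) : Module.Dual ℝ (Polynomial ℝ) where
  toFun q := edgeMoment T e p q
  map_add' q q' := by simp [edgeMoment_eq, mul_add]
  map_smul' a q := by simp [edgeMoment_eq]; ring

theorem edgeMoment_eq_zero (e : TetEdge) {p : Poly3} (h : ∀ x ∈ hull T (edgeSet e), evalAt x p = 0)
    (q : Polynomial ℝ) : edgeMoment T e p q = 0 := by
  rw [edgeMoment_eq, (edgePoly_eq_zero_iff T e p).2 h]; simp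

theorem eq_zero_of_unitInt {f : Polynomial ℝ} (h0 : ∀ s ∈ Set.Icc (0 : ℝ) 1, 0 ≤ f.eval s)
    (h : unitInt f = 0) : f = 0 := by
  apply Polynomial.eq_zero_of_infinite_isRoot
  exact (Set.Icc_infinite (zero_lt_one (α := ℝ))).mono
    (eq_zero_of_integral_eq_zero f.continuous zero_lt_one h0 h)

/-- The bubble function on the unit interval. -/
def intervalBubble : Polynomial ℝ := Polynomial.X * (1 - Polynomial.X)

theorem intervalBubble_ne_zero : intervalBubble ≠ 0 := by
  intro h
  have := congrArg (Polynomial.eval (1 / 2)) h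
  simp [intervalBubble] at this
  norm_num at this

/-- The weight is positive inside the interval, so the weighted L² product is definite on
polynomials. -/
theorem eq_zero_of_unitInt_bubble {g : Polynomial ℝ} {N : ℕ}
    (h : unitInt (intervalBubble ^ N * g * g) = 0) : g = 0 := by
  have := eq_zero_of_unitInt (fun s hs => ?_) h
  · rw [mul_assoc] at this
    rcases mul_eq_zero.1 this with h | h
    · exact absurd h (pow_ne_zero _ intervalBubble_ne_zero)
    · exact mul_self_eq_zero.1 h
  · have h1 : 0 ≤ s * (1 - s) := mul_nonneg hs.1 (by linarith [hs.2])
    simp only [Polynomial.eval_mul, Polynomial.eval_pow, intervalBubble, Polynomial.eval_X,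
      Polynomial.eval_sub, Polynomial.eval_one]
    rw [mul_assoc]
    exact mul_nonneg (pow_nonneg h1 _) (mul_self_nonneg _)

instance finite_degreeLT (M : ℕ) : Module.Finite ℝ (Polynomial.degreeLT ℝ M) :=
  Module.Finite.equiv (Polynomial.degreeLTEquiv ℝ M).symm

/-- Gives the profile `g` of an edge correction: after multiplication with the power of the bubble
that secures the orders at the end points, the moments are still arbitrary. -/
theorem exists_unitInt_representer (N M : ℕ) (μ : Module.Dual ℝ (Polynomial ℝ)) :
    ∃ g ∈ Polynomial.degreeLT ℝ M, ∀ q ∈ Polynomial.degreeLT ℝ M,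
      unitInt (intervalBubble ^ N * g * q) = μ q := by
  obtain ⟨u, hu, h⟩ := exists_representer (Polynomial.degreeLT ℝ M)
    ((LinearMap.mul ℝ (Polynomial ℝ)).compr₂
      (unitInt ∘ₗ LinearMap.mulLeft ℝ (intervalBubble ^ N)))
    (fun u _ h => eq_zero_of_unitInt_bubble (N := N) (by simpa [mul_assoc] using h))
    (μ ∘ₗ (Polynomial.degreeLT ℝ M).subtype)
  exact ⟨u, hu, fun q hq => by simpa [mul_assoc] using h q hq⟩

theorem pow_dvd_of_iterate_derivative {f : Polynomial ℝ} {a : ℝ} {N : ℕ}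
    (h : ∀ i < N, ((Polynomial.derivative^[i]) f).eval a = 0) :
    (Polynomial.X - Polynomial.C a) ^ N ∣ f := by
  by_cases hf : f = 0
  · simp [hf]
  rcases Nat.eq_zero_or_pos N with rfl | hN
  · simp
  rw [← Polynomial.le_rootMultiplicity_iff hf]
  have := (Polynomial.lt_rootMultiplicity_iff_isRoot_iterate_derivative (n := N - 1) (t := a) hf).2
    fun i hi => h i (by omega)
  omega

/-- The vanishing at both ends splits off the `N`-th power of the bubble; the cofactor has degree
less than `M`, so it is an admissible test function for itself. -/
theorem eq_zero_of_interval_moments {f : Polynomial ℝ} {N M : ℕ} (hdeg : f.natDegree < M + 2 * N)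
    (h0 : ∀ i < N, ((Polynomial.derivative^[i]) f).eval 0 = 0)
    (h1 : ∀ i < N, ((Polynomial.derivative^[i]) f).eval 1 = 0)
    (hm : ∀ q ∈ Polynomial.degreeLT ℝ M, unitInt (f * q) = 0) : f = 0 := by
  have hd0 := pow_dvd_of_iterate_derivative h0
  have hd1 := pow_dvd_of_iterate_derivative h1
  have hcop : IsCoprime ((Polynomial.X - Polynomial.C (0 : ℝ)) ^ N)
      ((Polynomial.X - Polynomial.C (1 : ℝ)) ^ N) :=
    (Polynomial.isCoprime_X_sub_C_of_isUnit_sub (by norm_num)).pow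
  obtain ⟨g, hg⟩ := hcop.mul_dvd hd0 hd1
  -- The divisor contains X - 1 and the bubble contains 1 - X; the sign goes into the cofactor.
  have h2 : f = intervalBubble ^ N * ((-1) ^ N * g) := by
    rw [hg, ← mul_pow, ← mul_assoc, ← mul_pow]
    congr 2
    rw [intervalBubble]
    simp
    ring
  set g' := (-1) ^ N * g
  by_contra hf
  have hg0 : g' ≠ 0 := by rintro h; exact hf (by rw [h2, h, mul_zero])
  have hb : intervalBubble.natDegree = 2 := by
    rw [intervalBubble]; compute_degree!
  have hdg : f.natDegree = 2 * N + g'.natDegree := by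
    rw [h2, Polynomial.natDegree_mul (pow_ne_zero _ intervalBubble_ne_zero) hg0,
      Polynomial.natDegree_pow, hb, mul_comm]
  have h3 := hm g' (by
    rw [Polynomial.mem_degreeLT, Polynomial.degree_eq_natDegree hg0]
    exact_mod_cast (by omega : g'.natDegree < M))
  rw [h2] at h3
  exact hg0 (eq_zero_of_unitInt_bubble h3)

end Integrals

end CurlFE

end

noncomputable section

namespace CurlFE

/-! ### Integrals over faces and over the tetrahedron as definite forms -/

section FaceIntegrals

variable (T : Tetra)

/-- Parametrization of the plane of a face. -/
def facePoint (o : Fin 4) (s t : ℝ) : E3 :=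
  T (o.succAbove 0) + s • (T (o.succAbove 1) - T (o.succAbove 0))
    + t • (T (o.succAbove 2) - T (o.succAbove 0))

/-- Twice the area of a face. -/
def faceJac (o : Fin 4) : ℝ :=
  Real.sqrt (inner ℝ (T (o.succAbove 1) - T (o.succAbove 0)) (T (o.succAbove 1) - T (o.succAbove 0))
    * inner ℝ (T (o.succAbove 2) - T (o.succAbove 0)) (T (o.succAbove 2) - T (o.succAbove 0))
    - inner ℝ (T (o.succAbove 1) - T (o.succAbove 0)) (T (o.succAbove 2) - T (o.succAbove 0)) ^ 2)

theorem faceInt_eq (o : Fin 4) (p : Poly3) : faceInt T o p =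
    faceJac T o * ∫ s in (0 : ℝ)..1, ∫ t in (0 : ℝ)..(1 - s), evalAt (facePoint T o s t) p := rfl

/-- Barycentric coordinates of a point of a face. -/
def faceWeights (o : Fin 4) (s t : ℝ) : Fin 4 → ℝ :=
  o.insertNth 0 ![1 - s - t, s, t]

theorem sum_faceWeights (o : Fin 4) (s t : ℝ) : ∑ i, faceWeights o s t i = 1 := by
  rw [Fin.sum_univ_succAbove _ o]
  simp [faceWeights, Fin.sum_univ_three]
  ring

theorem facePoint_eq (o : Fin 4) (s t : ℝ) :
    facePoint T o s t = ∑ i, faceWeights o s t i • T i := by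
  rw [Fin.sum_univ_succAbove _ o]
  simp only [faceWeights, facePoint, Fin.insertNth_apply_same, Fin.insertNth_apply_succAbove,
    Fin.sum_univ_three]
  simp
  module

theorem coord_facePoint (o : Fin 4) (s t : ℝ) (i : Fin 4) :
    T.coord i (facePoint T o s t) = faceWeights o s t i := by
  rw [facePoint_eq, coord_sum_smul T (sum_faceWeights o s t)]

theorem facePoint_mem {o : Fin 4} {s t : ℝ} (hs : 0 ≤ s) (ht : 0 ≤ t) (hst : s + t ≤ 1) :
    facePoint T o s t ∈ hull T (faceSet o) := by
  rw [facePoint_eq]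
  refine sum_smul_mem_hull T (sum_faceWeights o s t) (fun i => ?_) fun i hi => ?_
  · rcases Fin.eq_self_or_eq_succAbove o i with rfl | ⟨l, rfl⟩
    · simp [faceWeights]
    · fin_cases l <;> simp [faceWeights] <;> linarith
  · obtain rfl : i = o := by simpa [faceSet] using hi
    simp [faceWeights]

theorem hull_univ : hull T Finset.univ = {x | ∀ i, 0 ≤ T.coord i x} := by
  rw [← AffineBasis.convexHull_eq_nonneg_coord]
  simp [hull]

theorem exists_facePoint {o : Fin 4} {x : E3} (hx : x ∈ hull T (faceSet o)) :
    ∃ s t, 0 ≤ s ∧ 0 ≤ t ∧ s + t ≤ 1 ∧ x = facePoint T o s t := by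
  have h0 : ∀ i, 0 ≤ T.coord i x := by
    have := hull_mono T (Finset.subset_univ _) hx
    rwa [hull_univ] at this
  have ho : T.coord o x = 0 := coord_of_mem_hull T hx (by simp [faceSet])
  have hsum := T.sum_coord_apply_eq_one x
  rw [Fin.sum_univ_succAbove _ o, ho, Fin.sum_univ_three] at hsum
  refine ⟨T.coord (o.succAbove 1) x, T.coord (o.succAbove 2) x, h0 _, h0 _,
    by linarith [h0 (o.succAbove 0)], ?_⟩
  apply T.ext_elem
  intro i
  rw [coord_facePoint]
  rcases Fin.eq_self_or_eq_succAbove o i with rfl | ⟨l, rfl⟩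
  · simp [faceWeights, ho]
  · fin_cases l
    · simp [faceWeights]; linarith
    · simp [faceWeights]
    · simp [faceWeights]

/-- The Gram determinant of u and w times |u|² is |z|², where z = |u|² w - ⟨u,w⟩ u. The derivative
along z of the barycentric coordinate of the third vertex is |u|², hence z ≠ 0. -/
theorem faceJac_pos (o : Fin 4) : 0 < faceJac T o := by
  apply Real.sqrt_pos.2
  set u := T (o.succAbove 1) - T (o.succAbove 0)
  set w := T (o.succAbove 2) - T (o.succAbove 0)
  have h01 : (1 : Fin 3) ≠ 0 := by decide
  have h02 : (2 : Fin 3) ≠ 0 := by decide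
  have h12 : (2 : Fin 3) ≠ 1 := by decide
  have hinj := Fin.succAbove_right_injective (p := o)
  have hu : 0 < inner ℝ u u := by
    rw [real_inner_self_pos]
    intro h
    have h1 : coordLin T u (o.succAbove 1) = 1 := by
      simp [u, coordLin_vertex_sub, hinj.eq_iff]
    rw [h] at h1
    simp [coordLin] at h1
  set z := (inner ℝ u u : ℝ) • w - (inner ℝ u w : ℝ) • u with hz
  have hz0 : 0 < inner ℝ z z := by
    rw [real_inner_self_pos]
    intro h
    have h1 : coordLin T z (o.succAbove 2) = inner ℝ u u := by
      rw [hz, coordLin_sub, coordLin_smul, coordLin_smul, coordLin_vertex_sub, coordLin_vertex_sub]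
      simp [hinj.eq_iff]
    rw [h] at h1
    simp [coordLin] at h1
    rw [real_inner_self_eq_norm_sq, ← h1] at hu
    exact lt_irrefl _ hu
  have h2 : inner ℝ z z = inner ℝ u u * (inner ℝ u u * inner ℝ w w - inner ℝ u w ^ 2) := by
    simp only [hz, inner_sub_left, inner_sub_right, real_inner_smul_left, real_inner_smul_right,
      real_inner_comm u w]
    ring
  rw [h2] at hz0
  exact (pos_iff_pos_of_mul_pos hz0).1 hu

theorem continuous_face (o : Fin 4) (p : Poly3) :
    Continuous (Function.uncurry fun s t => evalAt (facePoint T o s t) p) := by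
  have h : Continuous fun z : ℝ × ℝ => facePoint T o z.1 z.2 := by
    simp only [facePoint]
    fun_prop
  exact (continuous_evalAt p).comp h

theorem continuous_face_inner (o : Fin 4) (p : Poly3) :
    Continuous fun s => ∫ t in (0 : ℝ)..(1 - s), evalAt (facePoint T o s t) p :=
  intervalIntegral.continuous_parametric_intervalIntegral_of_continuous (continuous_face T o p)
    (by fun_prop)

theorem continuous_face_right (o : Fin 4) (p : Poly3) (s : ℝ) :
    Continuous fun t => evalAt (facePoint T o s t) p := by
  have h : Continuous fun t => facePoint T o s t := by
    simp only [facePoint]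
    fun_prop
  exact (continuous_evalAt p).comp h

/-- Integration over a face as a linear functional. -/
def faceLin (o : Fin 4) : Poly3 →ₗ[ℝ] ℝ where
  toFun := faceInt T o
  map_add' p q := by
    simp only [faceInt_eq, ← mul_add]
    congr 1
    rw [← intervalIntegral.integral_add ((continuous_face_inner T o p).intervalIntegrable _ _)
      ((continuous_face_inner T o q).intervalIntegrable _ _)]
    congr 1
    funext s
    rw [← intervalIntegral.integral_add ((continuous_face_right T o p s).intervalIntegrable _ _)
      ((continuous_face_right T o q s).intervalIntegrable _ _)]
    simp
  map_smul' a p := by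
    simp only [faceInt_eq, evalAt_smul, intervalIntegral.integral_const_mul, smul_eq_mul,
      RingHom.id_apply]
    ring

theorem faceLin_apply (o : Fin 4) (p : Poly3) : faceLin T o p = faceInt T o p := rfl

theorem faceInt_add (o : Fin 4) (p q : Poly3) :
    faceInt T o (p + q) = faceInt T o p + faceInt T o q := (faceLin T o).map_add p q

theorem faceInt_sub (o : Fin 4) (p q : Poly3) :
    faceInt T o (p - q) = faceInt T o p - faceInt T o q := (faceLin T o).map_sub p q

theorem faceInt_smul (o : Fin 4) (a : ℝ) (p : Poly3) :
    faceInt T o (a • p) = a * faceInt T o p := (faceLin T o).map_smul a p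

theorem faceInt_sum {ι : Type*} (o : Fin 4) (s : Finset ι) (f : ι → Poly3) :
    faceInt T o (∑ i ∈ s, f i) = ∑ i ∈ s, faceInt T o (f i) := map_sum (faceLin T o) f s

theorem faceInt_congr (o : Fin 4) {p q : Poly3}
    (h : ∀ x ∈ hull T (faceSet o), evalAt x p = evalAt x q) : faceInt T o p = faceInt T o q := by
  rw [faceInt_eq, faceInt_eq]
  congr 1
  apply intervalIntegral.integral_congr
  intro s hs
  rw [Set.uIcc_of_le zero_le_one] at hs
  apply intervalIntegral.integral_congr
  intro t ht
  rw [Set.uIcc_of_le (by linarith [hs.2])] at ht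
  exact h _ (facePoint_mem T hs.1 ht.1 (by linarith [ht.2]))

theorem faceInt_eq_zero (o : Fin 4) {p : Poly3}
    (h : ∀ x ∈ hull T (faceSet o), evalAt x p = 0) : faceInt T o p = 0 := by
  rw [faceInt_congr T o (q := 0) (by simpa using h), ← faceLin_apply, map_zero]

/-- The one-dimensional statement is applied to the outer integral and then to the integral over
each slice. -/
theorem eq_zero_of_faceInt {o : Fin 4} {p : Poly3}
    (h0 : ∀ x ∈ hull T (faceSet o), 0 ≤ evalAt x p) (h : faceInt T o p = 0) :
    ∀ x ∈ hull T (faceSet o), evalAt x p = 0 := by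
  have h1 : ∫ s in (0 : ℝ)..1, ∫ t in (0 : ℝ)..(1 - s), evalAt (facePoint T o s t) p = 0 := by
    rw [faceInt_eq] at h
    exact (mul_eq_zero.1 h).resolve_left (faceJac_pos T o).ne'
  have hnn : ∀ s ∈ Set.Icc (0 : ℝ) 1, ∀ t ∈ Set.Icc 0 (1 - s), 0 ≤ evalAt (facePoint T o s t) p :=
    fun s hs t ht => h0 _ (facePoint_mem T hs.1 ht.1 (by linarith [ht.2]))
  have h2 := eq_zero_of_integral_eq_zero (continuous_face_inner T o p) zero_lt_one
    (fun s hs => intervalIntegral.integral_nonneg (by linarith [hs.2]) (hnn s hs)) h1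
  have h3 : ∀ s ∈ Set.Ico (0 : ℝ) 1, ∀ t ∈ Set.Icc 0 (1 - s), evalAt (facePoint T o s t) p = 0 :=
    fun s hs => eq_zero_of_integral_eq_zero (continuous_face_right T o p s) (by linarith [hs.2])
      (hnn s ⟨hs.1, hs.2.le⟩) (h2 s ⟨hs.1, hs.2.le⟩)
  intro x hx
  obtain ⟨s, t, hs, ht, hst, rfl⟩ := exists_facePoint T hx
  rcases lt_or_eq_of_le (show s ≤ 1 by linarith) with hs1 | rfl
  · exact h3 s ⟨hs, hs1⟩ t ⟨ht, by linarith⟩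
  -- The slice s = 1 is a single point, where the inner integral says nothing; its value is a limit
  -- along t = 0.
  · obtain rfl : t = 0 := by linarith
    have hc0 : Continuous fun s => facePoint T o s 0 := by
      simp only [facePoint]
      fun_prop
    have hc : IsClosed {s : ℝ | evalAt (facePoint T o s 0) p = 0} :=
      isClosed_eq ((continuous_evalAt p).comp hc0) continuous_const
    have h4 : closure (Set.Ico (0 : ℝ) 1) ⊆ {s : ℝ | evalAt (facePoint T o s 0) p = 0} :=
      hc.closure_subset_iff.2 fun s hs => h3 s hs 0 ⟨le_rfl, by linarith [hs.2]⟩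
    rw [closure_Ico zero_ne_one] at h4
    exact h4 ⟨zero_le_one, le_rfl⟩

theorem eq_zero_of_faceInt_mul_self {o : Fin 4} {p : Poly3} (h : faceInt T o (p * p) = 0) :
    ∀ x ∈ hull T (faceSet o), evalAt x p = 0 := by
  intro x hx
  have := eq_zero_of_faceInt T (fun x _ => by rw [evalAt_mul]; exact mul_self_nonneg _) h x hx
  rw [evalAt_mul] at this
  exact mul_self_eq_zero.1 this

/-! #### The tetrahedron -/

theorem isCompact_hull_range : IsCompact (convexHull ℝ (Set.range T)) :=
  (Set.finite_range T).isCompact_convexHull ℝ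

theorem integrableOn_cell (p : Poly3) :
    MeasureTheory.IntegrableOn (fun x => evalAt x p) (convexHull ℝ (Set.range T)) :=
  (continuous_evalAt p).continuousOn.integrableOn_compact (isCompact_hull_range T)

/-- Integration over the tetrahedron as a linear functional. -/
def cellLin : Poly3 →ₗ[ℝ] ℝ where
  toFun := cellInt T
  map_add' p q := by
    simp only [cellInt, evalAt_add]
    exact MeasureTheory.integral_add (integrableOn_cell T p) (integrableOn_cell T q)
  map_smul' a p := by
    simp [cellInt, MeasureTheory.integral_const_mul]

theorem cellLin_apply (p : Poly3) : cellLin T p = cellInt T p := rfl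

theorem eq_zero_of_cellInt {p : Poly3} (h0 : ∀ x, 0 ≤ evalAt x p) (h : cellInt T p = 0) :
    p = 0 := by
  have hK := (isCompact_hull_range T)
  have h1 : (fun x => evalAt x p) =ᵐ[MeasureTheory.volume.restrict (convexHull ℝ (Set.range T))]
      fun _ => 0 := by
    refine (MeasureTheory.setIntegral_eq_zero_iff_of_nonneg_ae ?_ (integrableOn_cell T p)).1 h
    exact Filter.Eventually.of_forall h0
  have hne : (interior (convexHull ℝ (Set.range T))).Nonempty :=
    interior_convexHull_nonempty_iff_affineSpan_eq_top.2 T.tot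
  have h2 := MeasureTheory.Measure.eqOn_of_ae_eq h1 (continuous_evalAt p).continuousOn
    continuousOn_const (by
      rw [(convex_convexHull ℝ _).closure_interior_eq_closure_of_nonempty_interior hne]
      exact subset_closure)
  apply eq_zero_of_hull_univ T
  intro x hx
  exact h2 (by simpa [hull] using hx)

end FaceIntegrals

/-! ### Integrals of monomials in barycentric coordinates -/

section Dirichlet

/-- Beta integral: the derivative of t^(b+1) (u-t)^(c+1) has integral zero, which trades one power
of u - t for one of t. -/
theorem integral_pow_mul_sub_pow (b c : ℕ) (u : ℝ) :
    ∫ t in (0 : ℝ)..u, t ^ b * (u - t) ^ c =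
      u ^ (b + c + 1) * (b.factorial * c.factorial / (b + c + 1).factorial) := by
  induction c generalizing b with
  | zero =>
    simp [integral_pow, Nat.factorial_succ]
    field_simp
  | succ c ih =>
    have h1 : ∫ t in (0 : ℝ)..u, ((b + 1) * (t ^ b * (u - t) ^ (c + 1))
        - (c + 1) * (t ^ (b + 1) * (u - t) ^ c)) = 0 := by
      rw [intervalIntegral.integral_eq_sub_of_hasDerivAt
        (f := fun t => t ^ (b + 1) * (u - t) ^ (c + 1))]
      · simp
      · intro t _
        have h2 := (hasDerivAt_pow (b + 1) t).mul (((hasDerivAt_id t).const_sub u).pow (c + 1))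
        convert! h2 using 1
        simp
        ring
      · exact Continuous.intervalIntegrable (by fun_prop) _ _
    rw [intervalIntegral.integral_sub (Continuous.intervalIntegrable (by fun_prop) _ _)
      (Continuous.intervalIntegrable (by fun_prop) _ _), intervalIntegral.integral_const_mul,
      intervalIntegral.integral_const_mul, ih] at h1
    have h3 : ((b : ℝ) + 1) ≠ 0 := by positivity
    apply mul_left_cancel₀ h3
    rw [sub_eq_zero.1 h1, show b + 1 + c + 1 = b + (c + 1) + 1 by ring, Nat.factorial_succ b,
      Nat.factorial_succ c]
    push_cast
    ring

/-- The sum of the coefficients of a polynomial in the variables of `S`, weighted by factorials: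
the integral over the sub-simplex, up to a constant factor. -/
def lam (S : Finset (Fin 4)) : MvPolynomial (Fin 4) ℝ →ₗ[ℝ] ℝ :=
  (MvPolynomial.basisMonomials (Fin 4) ℝ).constr ℝ fun β =>
    if ∀ i, i ∉ S → β i = 0 then ∏ i, ((β i).factorial : ℝ) else 0

theorem lam_monomial (S : Finset (Fin 4)) (β : Fin 4 →₀ ℕ) (a : ℝ) :
    lam S (monomial β a) = a * if ∀ i, i ∉ S → β i = 0 then ∏ i, ((β i).factorial : ℝ) else 0 := by
  have : (monomial β a : MvPolynomial (Fin 4) ℝ)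
      = a • MvPolynomial.basisMonomials (Fin 4) ℝ β := by
    simp [coe_basisMonomials, smul_monomial]
  rw [this, map_smul, lam, Module.Basis.constr_basis, smul_eq_mul]

/-- Integration by parts on coefficients. The factor β_i turns (β - e_i)! into β!, so the derivative
preserves the weight of every monomial that contains the variable i. The monomials without it are
killed; they form the boundary term on the opposite sub-simplex. -/
theorem lam_pderiv {S : Finset (Fin 4)} {i : Fin 4} (hi : i ∈ S) (P : MvPolynomial (Fin 4) ℝ) :
    lam S (pderiv i P) = lam S P - lam (S.erase i) P := by
  induction P using MvPolynomial.induction_on' with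
  | add p q hp hq => rw [map_add, map_add, map_add, map_add, hp, hq]; ring
  | monomial β a =>
    rw [pderiv_monomial, lam_monomial, lam_monomial, lam_monomial]
    by_cases hβ : β i = 0
    · have : (∀ j, j ∉ S.erase i → β j = 0) ↔ ∀ j, j ∉ S → β j = 0 := by
        constructor
        · intro h j hj; exact h j fun h' => hj (Finset.mem_of_mem_erase h')
        · intro h j hj
          by_cases hji : j = i
          · rw [hji, hβ]
          · exact h j fun h' => hj (Finset.mem_erase.2 ⟨hji, h'⟩)
      simp only [this, hβ]
      simp
    · have h1 : ¬ ∀ j, j ∉ S.erase i → β j = 0 := fun h => hβ (h i (by simp))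
      have h2 : (∀ j, j ∉ S → (β - Finsupp.single i 1 : Fin 4 →₀ ℕ) j = 0) ↔ ∀ j, j ∉ S → β j = 0 := by
        refine forall_congr' fun j => forall_congr' fun hj => ?_
        have : i ≠ j := by rintro rfl; exact hj hi
        simp [this]
      have h3 : (β i : ℝ) * ∏ j, (((β - Finsupp.single i 1 : Fin 4 →₀ ℕ) j).factorial : ℝ)
          = ∏ j, ((β j).factorial : ℝ) := by
        rw [← Finset.mul_prod_erase _ _ (Finset.mem_univ i),
          ← Finset.mul_prod_erase Finset.univ (fun j => ((β j).factorial : ℝ)) (Finset.mem_univ i),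
          ← mul_assoc]
        congr 1
        · simp only [Finsupp.coe_tsub, Pi.sub_apply, Finsupp.single_eq_same]
          rw [← Nat.cast_mul, Nat.mul_factorial_pred hβ]
        · refine Finset.prod_congr rfl fun j hj => ?_
          have : i ≠ j := fun h => Finset.ne_of_mem_erase hj h.symm
          simp [this]
      simp only [h2, h1, if_false, mul_zero, sub_zero]
      split_ifs
      · rw [mul_assoc, h3]
      · simp

/-- Divergence theorem for a constant direction on the tetrahedron: the volume terms cancel because
the weights of a direction add up to zero. -/
theorem lam_baryDer_univ {c : Fin 4 → ℝ} (hc : ∑ i, c i = 0) (P : MvPolynomial (Fin 4) ℝ) :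
    lam Finset.univ (baryDer c P) = -∑ i, c i * lam (faceSet i) P := by
  have h : ∀ i : Fin 4, Finset.univ.erase i = faceSet i := fun i => by
    ext j; simp [faceSet]
  simp only [baryDer, map_sum, map_smul, smul_eq_mul, lam_pderiv (Finset.mem_univ _), h, mul_sub,
    Finset.sum_sub_distrib, ← Finset.sum_mul, hc]
  simp

/-- The same on any sub-simplex for the direction of one of its edges; on a face this is the source
of Stokes' theorem. -/
theorem lam_baryDer_vertex (T : Tetra) {S : Finset (Fin 4)} {a b : Fin 4} (ha : a ∈ S)
    (hb : b ∈ S) (P : MvPolynomial (Fin 4) ℝ) :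
    lam S (baryDer (coordLin T (T b - T a)) P) = lam (S.erase a) P - lam (S.erase b) P := by
  have : baryDer (coordLin T (T b - T a)) P = pderiv b P - pderiv a P := by
    simp [baryDer, coordLin_vertex_sub, sub_smul]
  rw [this, map_sub, lam_pderiv ha, lam_pderiv hb]
  ring

variable (T : Tetra)

/-- Dirichlet's formula. The factor in front depends only on the face and the degree, so the linear
identities between the functionals `lam` are identities between integrals of forms of equal degree.
-/
theorem faceInt_phi {P : MvPolynomial (Fin 4) ℝ} {m : ℕ} (hP : P.IsHomogeneous m) (o : Fin 4) :
    faceInt T o (phi T P) = faceJac T o / (m + 2).factorial * lam (faceSet o) P := by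
  conv_lhs => rw [P.as_sum, map_sum, faceInt_sum]
  conv_rhs => rw [P.as_sum, map_sum, Finset.mul_sum]
  refine Finset.sum_congr rfl fun β hβ => ?_
  rw [phi_monomial, faceInt_smul, lam_monomial]
  have hdeg : ∑ i, β i = m := by
    rw [← Finsupp.degree_eq_sum]
    by_contra h
    exact mem_support_iff.1 hβ (hP.coeff_eq_zero h)
  split_ifs with h
  · have ho : β o = 0 := h o (by simp [faceSet])
    rw [Fin.sum_univ_succAbove _ o, ho, Fin.sum_univ_three] at hdeg
    have h1 : ∀ s t, evalAt (facePoint T o s t) (bernsteinPoly T β) =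
        s ^ β (o.succAbove 1) * (t ^ β (o.succAbove 2) * (1 - s - t) ^ β (o.succAbove 0)) := by
      intro s t
      rw [bernsteinPoly, evalAt_prod, Fin.prod_univ_succAbove _ o, Fin.prod_univ_three]
      simp only [evalAt_pow, evalAt_bary, coord_facePoint, ho, pow_zero]
      simp [faceWeights]
      ring
    rw [faceInt_eq]
    simp only [h1, intervalIntegral.integral_const_mul, integral_pow_mul_sub_pow]
    simp only [← mul_assoc, intervalIntegral.integral_mul_const, integral_pow_mul_sub_pow]
    rw [Fin.prod_univ_succAbove _ o, Fin.prod_univ_three, ho]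
    have h2 : β (o.succAbove 1) + (β (o.succAbove 2) + β (o.succAbove 0) + 1) + 1 = m + 2 := by
      omega
    rw [h2]
    have h3 : ((β (o.succAbove 2) + β (o.succAbove 0) + 1).factorial : ℝ) ≠ 0 := by positivity
    have h4 : ((m + 2).factorial : ℝ) ≠ 0 := by positivity
    field_simp
    simp
  · have : ∃ i, i ∉ faceSet o ∧ β i ≠ 0 := by by_contra! h'; exact h h'
    rw [faceInt_eq_zero T o fun x hx => evalAt_bernstein_eq_zero T hx this]
    simp

theorem unitInt_phi {P : MvPolynomial (Fin 4) ℝ} {m : ℕ} (hP : P.IsHomogeneous m) (e : TetEdge) :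
    unitInt (edgePoly T e (phi T P)) = lam (edgeSet e) P / (m + 1).factorial := by
  conv_lhs => rw [P.as_sum, map_sum, map_sum, map_sum]
  conv_rhs => rw [P.as_sum, map_sum, Finset.sum_div]
  refine Finset.sum_congr rfl fun β hβ => ?_
  rw [phi_monomial, lam_monomial, map_smul, map_smul, smul_eq_mul, mul_div_assoc]
  congr 1
  have hdeg : ∑ i, β i = m := by
    rw [← Finsupp.degree_eq_sum]
    by_contra h
    exact mem_support_iff.1 hβ (hP.coeff_eq_zero h)
  have hne : e.1.1 ≠ e.1.2 := ne_of_lt e.2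
  split_ifs with h
  · have hsum : ∀ f : Fin 4 → ℝ, (∀ i, i ∉ edgeSet e → f i = 1) →
        ∏ i, f i = f e.1.1 * f e.1.2 := by
      intro f hf
      rw [← Finset.prod_subset (Finset.subset_univ (edgeSet e)) (fun i _ hi => hf i hi), edgeSet,
        Finset.prod_pair hne]
    have hdeg' : β e.1.1 + β e.1.2 = m := by
      rw [← hdeg, ← Finset.sum_subset (Finset.subset_univ (edgeSet e)) (fun i _ hi => h i hi),
        edgeSet, Finset.sum_pair hne]
    have h1 : ∀ s : ℝ, (edgePoly T e (bernsteinPoly T β)).eval s =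
        s ^ β e.1.2 * (1 - s) ^ β e.1.1 := by
      intro s
      rw [eval_edgePoly, bernsteinPoly, evalAt_prod, hsum _ (fun i hi => by simp [h i hi])]
      simp only [evalAt_pow, evalAt_bary, AffineMap.apply_lineMap, AffineBasis.coord_apply,
        hne, hne.symm, if_true, if_false]
      simp [AffineMap.lineMap_apply]
      ring
    change ∫ s in (0 : ℝ)..1, _ = _
    simp only [h1]
    rw [integral_pow_mul_sub_pow, hsum _ (fun i hi => by simp [h i hi]),
      show β e.1.2 + β e.1.1 + 1 = m + 1 by omega]
    ring
  · have : ∃ i, i ∉ edgeSet e ∧ β i ≠ 0 := by by_contra! h'; exact h h'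
    rw [(edgePoly_eq_zero_iff T e _).2 fun x hx => evalAt_bernstein_eq_zero T hx this]
    simp

end Dirichlet

end CurlFE

end

noncomputable section

namespace CurlFE

/-! ### Frames -/

section Frames

/-- The cross product. -/
def cross (a b : E3) : E3 :=
  WithLp.toLp 2 ![a 1 * b 2 - a 2 * b 1, a 2 * b 0 - a 0 * b 2, a 0 * b 1 - a 1 * b 0]

@[simp] theorem cross_zero (a b : E3) : cross a b 0 = a 1 * b 2 - a 2 * b 1 := rfl
@[simp] theorem cross_one (a b : E3) : cross a b 1 = a 2 * b 0 - a 0 * b 2 := rfl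
@[simp] theorem cross_two (a b : E3) : cross a b 2 = a 0 * b 1 - a 1 * b 0 := rfl

theorem inner_eq (a b : E3) : inner ℝ a b = a 0 * b 0 + a 1 * b 1 + a 2 * b 2 := by
  simp [PiLp.inner_apply, Fin.sum_univ_three, mul_comm]

/-- The determinant of three vectors. -/
def det3 (a b c : E3) : ℝ := inner ℝ a (cross b c)

theorem det3_eq (a b c : E3) : det3 a b c = a 0 * (b 1 * c 2 - b 2 * c 1)
    + a 1 * (b 2 * c 0 - b 0 * c 2) + a 2 * (b 0 * c 1 - b 1 * c 0) := by
  simp [det3, inner_eq]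

theorem det3_cycle (a b c : E3) : det3 b c a = det3 a b c := by
  simp only [det3_eq]; ring

theorem E3_ext {a b : E3} (h0 : a 0 = b 0) (h1 : a 1 = b 1) (h2 : a 2 = b 2) : a = b := by
  ext c; fin_cases c <;> assumption

/-- Cramer's rule. -/
theorem det3_smul_eq (a b c x : E3) : det3 a b c • x =
    (inner ℝ x (cross b c) : ℝ) • a + (inner ℝ x (cross c a) : ℝ) • b
      + (inner ℝ x (cross a b) : ℝ) • c := by
  apply E3_ext <;> simp [det3_eq, inner_eq] <;> ring

theorem exists_frame_coord {a b c : E3} (h : det3 a b c ≠ 0) (x : E3) :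
    ∃ s t u : ℝ, x = s • a + t • b + u • c := by
  refine ⟨(det3 a b c)⁻¹ * inner ℝ x (cross b c), (det3 a b c)⁻¹ * inner ℝ x (cross c a),
    (det3 a b c)⁻¹ * inner ℝ x (cross a b), ?_⟩
  have := congrArg (fun y => (det3 a b c)⁻¹ • y) (det3_smul_eq a b c x)
  simpa only [smul_smul, inv_mul_cancel₀ h, one_smul, smul_add] using this

theorem dotVec_eq (w : VField) (t : E3) : dotVec w t = ∑ c, t c • w c := by
  simp [dotVec, MvPolynomial.C_mul']

theorem dotVec_add (w : VField) (s t : E3) : dotVec w (s + t) = dotVec w s + dotVec w t := by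
  simp [dotVec_eq, add_smul, Finset.sum_add_distrib]

theorem dotVec_smul (w : VField) (a : ℝ) (t : E3) : dotVec w (a • t) = a • dotVec w t := by
  simp [dotVec_eq, Finset.smul_sum, smul_smul]

theorem dotVec_sub_right (w : VField) (s t : E3) :
    dotVec w (s - t) = dotVec w s - dotVec w t := by
  simp [dotVec_eq, sub_smul, Finset.sum_sub_distrib]

theorem dotVec_add_left (u w : VField) (t : E3) :
    dotVec (u + w) t = dotVec u t + dotVec w t := by
  simp [dotVec_eq, Finset.sum_add_distrib]

theorem dotVec_sub_left (u w : VField) (t : E3) :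
    dotVec (u - w) t = dotVec u t - dotVec w t := by
  simp [dotVec_eq, smul_sub, Finset.sum_sub_distrib]

theorem dotVec_smul_left (a : ℝ) (w : VField) (t : E3) :
    dotVec (a • w) t = a • dotVec w t := by
  simp [dotVec_eq, Finset.smul_sum, smul_comm a]

theorem dotVec_single (w : VField) (c : Fin 3) :
    dotVec w (EuclideanSpace.single c 1) = w c := by
  simp [dotVec_eq, ite_smul]

theorem dotVec_gradP (p : Poly3) (t : E3) : dotVec (gradP p) t = dirD t p := rfl

theorem dotVec_mem {W : Submodule ℝ Poly3} {w : VField} (h : ∀ c, w c ∈ W) (t : E3) :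
    dotVec w t ∈ W := by
  rw [dotVec_eq]
  exact Submodule.sum_mem _ fun c _ => Submodule.smul_mem _ _ (h c)

theorem totalDegree_dotVec_le {w : VField} {k : ℕ} (h : ∀ c, (w c).totalDegree ≤ k) (t : E3) :
    (dotVec w t).totalDegree ≤ k := by
  rw [dotVec_eq]
  exact totalDegree_finsetSum_le fun c _ => (totalDegree_smul_le _ _).trans (h c)

/-- The components of a field in a frame determine it. -/
theorem field_mem_of_frame {W : Submodule ℝ Poly3} {w : VField} {a b c : E3}
    (h : det3 a b c ≠ 0) (ha : dotVec w a ∈ W) (hb : dotVec w b ∈ W) (hc : dotVec w c ∈ W)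
    (d : Fin 3) : w d ∈ W := by
  obtain ⟨s, t, u, hx⟩ := exists_frame_coord h (EuclideanSpace.single d 1)
  rw [← dotVec_single w d, hx]
  simp only [dotVec_add, dotVec_smul]
  exact W.add_mem (W.add_mem (W.smul_mem _ ha) (W.smul_mem _ hb)) (W.smul_mem _ hc)

/-- Up to the determinant, b × c, c × a, a × b is the dual frame. If the divergence and two
components are under control, the derivative of the third component along its dual direction is as
well. -/
theorem smul_divF (w : VField) (a b c : E3) : det3 a b c • divF w =
    dirD (cross b c) (dotVec w a) + dirD (cross c a) (dotVec w b)
      + dirD (cross a b) (dotVec w c) := by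
  simp only [divF, dotVec_eq, dirD_eq, Fin.sum_univ_three, map_add, Derivation.map_smul, det3_eq,
    cross_zero, cross_one, cross_two]
  module

/-- The component of the curl along a × b is the antisymmetrised derivative in the plane of a and b.
-/
theorem dirD_dotVec_sub (v : VField) (a b : E3) :
    dirD a (dotVec v b) - dirD b (dotVec v a) = dotVec (curlF v) (cross a b) := by
  simp only [curlF, dotVec_eq, dirD_eq, Fin.sum_univ_three, map_add, Derivation.map_smul,
    cross_zero, cross_one, cross_two, Matrix.cons_val_zero, Matrix.cons_val_one, Matrix.cons_val]
  module

theorem divF_curlF (v : VField) : divF (curlF v) = 0 := by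
  simp only [divF, curlF, Fin.sum_univ_three, Matrix.cons_val_zero, Matrix.cons_val_one,
    Matrix.cons_val, map_sub, pderiv_comm (1 : Fin 3) 0, pderiv_comm (2 : Fin 3) 0, pderiv_comm (2 : Fin 3) 1]
  abel

theorem curlF_gradP (p : Poly3) : curlF (gradP p) = 0 := by
  funext c
  fin_cases c <;> simp [curlF, gradP, pderiv_comm (1 : Fin 3) 0, pderiv_comm (2 : Fin 3) 0, pderiv_comm (2 : Fin 3) 1]

theorem curlF_add (u v : VField) : curlF (u + v) = curlF u + curlF v := by
  funext c
  fin_cases c <;> simp [curlF] <;> ring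

theorem curlF_sub (u v : VField) : curlF (u - v) = curlF u - curlF v := by
  funext c
  fin_cases c <;> simp [curlF] <;> ring

theorem divF_add (u v : VField) : divF (u + v) = divF u + divF v := by
  simp [divF, Finset.sum_add_distrib]

theorem divF_sub (u v : VField) : divF (u - v) = divF u - divF v := by
  simp [divF, Finset.sum_sub_distrib]

theorem divF_smul (a : ℝ) (u : VField) : divF (a • u) = a • divF u := by
  simp [divF, Finset.smul_sum]

theorem divF_vanish {Z : Set E3} {N : ℕ} {w : VField} (h : ∀ c, w c ∈ vanish Z N) :
    divF w ∈ vanish Z (N - 1) :=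
  Submodule.sum_mem _ fun c _ => pderiv_vanish (h c) c

theorem curlF_vanish {Z : Set E3} {N : ℕ} {w : VField} (h : ∀ c, w c ∈ vanish Z N) (c : Fin 3) :
    curlF w c ∈ vanish Z (N - 1) := by
  fin_cases c <;> exact Submodule.sub_mem _ (pderiv_vanish (h _) _) (pderiv_vanish (h _) _)

theorem gradP_vanish {Z : Set E3} {N : ℕ} {p : Poly3} (h : p ∈ vanish Z N) (c : Fin 3) :
    gradP p c ∈ vanish Z (N - 1) := pderiv_vanish h c

theorem totalDegree_curlF_le {w : VField} {k : ℕ} (h : ∀ c, (w c).totalDegree ≤ k) (c : Fin 3) :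
    (curlF w c).totalDegree ≤ k - 1 := by
  have : ∀ i j : Fin 3, (pderiv i (w j)).totalDegree ≤ k - 1 := fun i j =>
    totalDegree_pderiv_le (h j) i
  have h2 : ∀ p q : Poly3, p.totalDegree ≤ k - 1 → q.totalDegree ≤ k - 1 →
      (p - q).totalDegree ≤ k - 1 := fun p q hp hq => (totalDegree_sub p q).trans (max_le hp hq)
  fin_cases c <;> exact h2 _ _ (this _ _) (this _ _)

theorem totalDegree_divF_le {w : VField} {k : ℕ} (h : ∀ c, (w c).totalDegree ≤ k) :
    (divF w).totalDegree ≤ k - 1 :=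
  totalDegree_finsetSum_le fun c _ => totalDegree_pderiv_le (h c) c

theorem totalDegree_gradP_le {p : Poly3} {k : ℕ} (h : p.totalDegree ≤ k + 1) (c : Fin 3) :
    (gradP p c).totalDegree ≤ k := totalDegree_pderiv_le h c

/-- An affine function with gradient `d` that vanishes at `x`. -/
def linPoly (d x : E3) : Poly3 := ∑ c, C (d c) * (X c - C (x c))

theorem dirD_linPoly (n d x : E3) : dirD n (linPoly d x) = C (inner ℝ n d) := by
  simp [linPoly, dirD_eq, Fin.sum_univ_three, pderiv_X, MvPolynomial.smul_eq_C_mul, inner_eq]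

theorem evalAt_linPoly (d x y : E3) : evalAt y (linPoly d x) = inner ℝ (y - x) d := by
  simp [linPoly, Fin.sum_univ_three, inner_eq]
  ring

theorem totalDegree_linPoly_le (d x : E3) : (linPoly d x).totalDegree ≤ 1 := by
  refine totalDegree_finsetSum_le fun c _ => ?_
  rw [MvPolynomial.C_mul']
  refine (totalDegree_smul_le _ _).trans ((totalDegree_sub _ _).trans ?_)
  simp

theorem totalDegree_bary_le (T : Tetra) (i : Fin 4) : (bary T i).totalDegree ≤ 1 := by
  have := totalDegree_phi_le T (isHomogeneous_X ℝ i)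
  rwa [phi_X] at this

end Frames

/-! ### Scalar degrees of freedom on edges -/

section Edge

variable (T : Tetra)

/-- The vector from the first to the second end point of an edge. -/
def edgeVec (e : TetEdge) : E3 := T e.1.2 - T e.1.1

theorem edgeVec_tangent (e : TetEdge) (i : Fin 4) (hi : i ∉ edgeSet e) :
    coordLin T (edgeVec T e) i = 0 := by
  simp only [edgeSet, Finset.mem_insert, Finset.mem_singleton, not_or] at hi
  simp [edgeVec, coordLin_vertex_sub, hi.1, hi.2]

theorem edgeSet_nonempty (e : TetEdge) : (edgeSet e).Nonempty := ⟨e.1.1, by simp [edgeSet]⟩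

/-- Tangential derivatives keep the order of vanishing (`dirD_vanish_of_tangent`), so only
derivatives along two directions that complete the tangent to a frame have to be checked; they need
not be normal. -/
theorem edge_vanish_of_normals {e : TetEdge} {a b : E3} (hdet : det3 (edgeVec T e) a b ≠ 0)
    {N : ℕ} {p : Poly3} (h : ∀ i l, i + l < N → ∀ x ∈ hull T (edgeSet e),
      evalAt x ((dirD a)^[i] ((dirD b)^[l] p)) = 0) : p ∈ vanish (hull T (edgeSet e)) N := by
  induction N generalizing p with
  | zero => trivial
  | succ N ih =>
    refine vanish_succ_of_frame (fun c => exists_frame_coord hdet _)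
      (fun x hx => h 0 0 (by omega) x hx) ?_ ?_ ?_
    · exact dirD_vanish_of_tangent T (edgeSet_nonempty e) (edgeVec_tangent T e)
        (ih fun i l hil => h i l (by omega))
    · refine ih fun i l hil x hx => ?_
      rw [← dirD_iterate_comm, ← Function.iterate_succ_apply]
      exact h (i + 1) l (by omega) x hx
    · refine ih fun i l hil x hx => ?_
      rw [← Function.iterate_succ_apply]
      exact h i (l + 1) (by omega) x hx

theorem totalDegree_iterate_dirD_le {p : Poly3} {k : ℕ} (h : p.totalDegree ≤ k) (a : E3) (i : ℕ) :
    ((dirD a)^[i] p).totalDegree ≤ k - i := by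
  induction i generalizing p k with
  | zero => exact h
  | succ i ih =>
    rw [Function.iterate_succ_apply]
    exact (ih (totalDegree_dirD_le h a)).trans (by omega)

theorem lineMap_mem_vertex (e : TetEdge) :
    AffineMap.lineMap (T e.1.1) (T e.1.2) (0 : ℝ) ∈ hull T {e.1.1} ∧
    AffineMap.lineMap (T e.1.1) (T e.1.2) (1 : ℝ) ∈ hull T {e.1.2} := by
  simp [hull_singleton]

/-- Edge moments and derivatives at the end points determine the derivatives on an edge. -/
theorem edge_vanish_of_moments {e : TetEdge} {a b : E3} (hdet : det3 (edgeVec T e) a b ≠ 0)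
    {p : Poly3} {k : ℕ} {sv se : ℤ} (hp : p.totalDegree ≤ k) (hk : 2 * sv + 1 ≤ k)
    (hse : se ≤ sv + 1)
    (h1 : p ∈ vanish (hull T {e.1.1}) (sv + 1).toNat)
    (h2 : p ∈ vanish (hull T {e.1.2}) (sv + 1).toNat)
    (hm : ∀ i j : ℕ, i ≤ j → (j : ℤ) ≤ se → ∀ q ∈ edgeTest (k - 2 * (sv + 1) + j),
      edgeMoment T e ((dirD a)^[i] ((dirD b)^[j - i] p)) q = 0) :
    p ∈ vanish (hull T (edgeSet e)) (se + 1).toNat := by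
  apply edge_vanish_of_normals T hdet
  intro i l hil
  rw [← edgePoly_eq_zero_iff]
  set f := (dirD a)^[i] ((dirD b)^[l] p) with hf
  have hdeg : f.totalDegree ≤ k - (i + l) := by
    have := totalDegree_iterate_dirD_le (totalDegree_iterate_dirD_le hp b l) a i
    rwa [Nat.sub_sub, add_comm l i] at this
  have hv : ∀ {Z : Set E3}, p ∈ vanish Z (sv + 1).toNat →
      f ∈ vanish Z ((sv + 1).toNat - (i + l)) := by
    intro Z hZ
    have := iterate_dirD_vanish (iterate_dirD_vanish hZ b l) a i
    rwa [Nat.sub_sub, add_comm l i] at this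
  have hN : ((sv + 1).toNat : ℤ) = sv + 1 := by omega
  have hM : (((k : ℤ) - 2 * (sv + 1) + (i + l : ℕ) + 1).toNat : ℤ) =
    (k : ℤ) - 2 * (sv + 1) + (i + l : ℕ) + 1 := by omega
  -- `f` has degree at most k - (i + l) and vanishes to order sv + 1 - (i + l) at both ends. This
  -- leaves a cofactor of degree k - 2(sv + 1) + i + l, exactly the degree of the test polynomials.
  refine eq_zero_of_interval_moments (N := (sv + 1).toNat - (i + l))
    (M := ((k : ℤ) - 2 * (sv + 1) + (i + l : ℕ) + 1).toNat) ?_ ?_ ?_ ?_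
  · have := (degree_edgePoly_le T e f).trans hdeg
    omega
  · intro n hn
    rw [iterate_derivative_edgePoly, eval_edgePoly]
    exact evalAt_of_vanish (iterate_dirD_vanish (hv h1) _ n) (by omega) (lineMap_mem_vertex T e).1
  · intro n hn
    rw [iterate_derivative_edgePoly, eval_edgePoly]
    exact evalAt_of_vanish (iterate_dirD_vanish (hv h2) _ n) (by omega) (lineMap_mem_vertex T e).2
  · intro q hq
    have := hm i (i + l) (by omega) (by omega) q hq
    rw [Nat.add_sub_cancel_left, edgeMoment_eq] at this
    exact (mul_eq_zero.1 this).resolve_left (edge_dist_pos T e).ne'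

/-- The functions ν₁, ν₂ vanish on `Z`, so all i + l derivatives have to be spent on their powers;
they match only if ν₁ takes i of them and ν₂ takes l, and nothing is left for `h`. -/
theorem iterate_dirD_mul_pow {Z : Set E3} {a b : E3} {ν₁ ν₂ : Poly3} (h1 : ν₁ ∈ vanish Z 1)
    (h2 : ν₂ ∈ vanish Z 1) (ha1 : dirD a ν₁ = 1) (ha2 : dirD a ν₂ = 0) (hb1 : dirD b ν₁ = 0)
    (hb2 : dirD b ν₂ = 1) {x : E3} (hx : x ∈ Z) (i' l' i l : ℕ) (h : Poly3)
    (hil : i' + l' = i + l) :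
    evalAt x ((dirD a)^[i'] ((dirD b)^[l'] (ν₁ ^ i * ν₂ ^ l * h))) =
      if i' = i then (i.factorial * l.factorial : ℝ) * evalAt x h else 0 := by
  have hvan : ∀ (i l : ℕ) (g : Poly3), ν₁ ^ i * ν₂ ^ l * g ∈ vanish Z (i + l) := fun i l g => by
    have := mul_vanish (mul_vanish (pow_vanish h1 i) (pow_vanish h2 l)) (q := g) (M := 0) trivial
    simpa using this
  induction l' generalizing i l h with
  | zero =>
    induction i' generalizing i l h with
    | zero =>
      obtain rfl : i = 0 := by omega
      obtain rfl : l = 0 := by omega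
      simp
    | succ i' ih =>
      rw [Function.iterate_zero, id, Function.iterate_succ_apply]
      have hD : dirD a (ν₁ ^ i * ν₂ ^ l * h) =
          (i : ℝ) • (ν₁ ^ (i - 1) * ν₂ ^ l * h) + ν₁ ^ i * ν₂ ^ l * dirD a h := by
        rw [dirD_mul, dirD_mul, dirD_pow, dirD_pow, ha1, ha2]
        simp only [mul_zero, smul_zero, mul_one, zero_add, MvPolynomial.smul_eq_C_mul,
          nsmul_eq_mul, map_natCast]
        ring
      rw [hD, iterate_dirD_add, evalAt_add, iterate_dirD_smul, evalAt_smul,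
        evalAt_of_vanish (iterate_dirD_vanish (hvan i l (dirD a h)) a i') (by omega) hx, add_zero]
      cases i with
      | zero => simp
      | succ i =>
        rw [Nat.add_sub_cancel, ← id_eq (ν₁ ^ i * ν₂ ^ l * h),
          ← Function.iterate_zero (dirD b), ih i l h (by omega)]
        simp only [Nat.add_right_cancel_iff, Nat.factorial_succ]
        split_ifs
        · push_cast; ring
        · simp
  | succ l' ih =>
    rw [Function.iterate_succ_apply]
    have hD : dirD b (ν₁ ^ i * ν₂ ^ l * h) =
        (l : ℝ) • (ν₁ ^ i * ν₂ ^ (l - 1) * h) + ν₁ ^ i * ν₂ ^ l * dirD b h := by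
      rw [dirD_mul, dirD_mul, dirD_pow, dirD_pow, hb1, hb2]
      simp only [mul_zero, smul_zero, mul_one, zero_mul, add_zero, MvPolynomial.smul_eq_C_mul,
        nsmul_eq_mul, map_natCast]
      ring
    rw [hD, iterate_dirD_add, iterate_dirD_add, evalAt_add, iterate_dirD_smul, iterate_dirD_smul,
      evalAt_smul, evalAt_of_vanish (iterate_dirD_vanish (iterate_dirD_vanish
        (hvan i l (dirD b h)) b l') a i') (by omega) hx, add_zero]
    cases l with
    | zero =>
      have : i' ≠ i := by omega
      simp [this]
    | succ l =>
      rw [Nat.add_sub_cancel, ih i l h (by omega)]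
      simp only [Nat.factorial_succ]
      split_ifs
      · push_cast; ring
      · simp

theorem edgePoly_bary (e : TetEdge) : edgePoly T e (bary T e.1.1) = 1 - Polynomial.X ∧
    edgePoly T e (bary T e.1.2) = Polynomial.X := by
  have hne : e.1.1 ≠ e.1.2 := ne_of_lt e.2
  constructor <;>
  · apply Polynomial.funext
    intro s
    rw [eval_edgePoly, evalAt_bary, AffineMap.apply_lineMap, AffineBasis.coord_apply,
      AffineBasis.coord_apply]
    simp [hne, hne.symm, AffineMap.lineMap_apply]
    try ring

theorem totalDegree_aeval_le {p : Poly3} (hp : p.totalDegree ≤ 1) (g : Polynomial ℝ) :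
    (Polynomial.aeval p g).totalDegree ≤ g.natDegree := by
  rw [Polynomial.aeval_eq_sum_range]
  refine totalDegree_finsetSum_le fun i hi => (totalDegree_smul_le _ _).trans ?_
  refine (totalDegree_pow _ _).trans ?_
  have := Finset.mem_range.1 hi
  nlinarith

theorem notMem_edgeSet_of_ne {e e' : TetEdge} (h : e' ≠ e) :
    e.1.1 ∉ edgeSet e' ∨ e.1.2 ∉ edgeSet e' := by
  by_contra! hcon
  obtain ⟨h1, h2⟩ := hcon
  have h3 := e.2
  have h4 := e'.2
  simp only [edgeSet, Finset.mem_insert, Finset.mem_singleton] at h1 h2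
  apply h
  have h5 : e'.1.1 = e.1.1 ∧ e'.1.2 = e.1.2 := by
    rcases h1 with h1 | h1 <;> rcases h2 with h2 | h2 <;> rw [h1, h2] at h3
    · exact absurd h3 (lt_irrefl _)
    · exact ⟨h1.symm, h2.symm⟩
    · exact absurd h3 (lt_asymm h4)
    · exact absurd h3 (lt_irrefl _)
  exact Subtype.ext (Prod.ext h5.1 h5.2)

set_option maxHeartbeats 1600000 in
/-- Corrections with prescribed edge moments. -/
theorem exists_edge_correction (e : TetEdge) {a b : E3} (hdet : det3 (edgeVec T e) a b ≠ 0)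
    {k : ℕ} {sv se : ℤ} (hk : 2 * sv + 1 ≤ k) (hs : 2 * se ≤ sv)
    (μ : ℕ → ℕ → Module.Dual ℝ (Polynomial ℝ)) :
    ∃ δ : Poly3, δ.totalDegree ≤ k ∧
      (∀ i j : ℕ, i ≤ j → (j : ℤ) ≤ se → ∀ q ∈ edgeTest (k - 2 * (sv + 1) + j),
        edgeMoment T e ((dirD a)^[i] ((dirD b)^[j - i] δ)) q = μ j i q) ∧
      (∀ i, δ ∈ vanish (hull T {i}) (sv + 1).toNat) ∧
      ∀ e' ≠ e, δ ∈ vanish (hull T (edgeSet e')) (se + 1).toNat := by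
  set D := det3 (edgeVec T e) a b with hD
  -- Affine functions that vanish on the edge and are dual to the transversal directions `a` and
  -- `b`.
  set ν₁ := linPoly (D⁻¹ • cross b (edgeVec T e)) (T e.1.1) with hν₁
  set ν₂ := linPoly (D⁻¹ • cross (edgeVec T e) a) (T e.1.1) with hν₂
  have hvan : ∀ d : E3, inner ℝ (edgeVec T e) d = 0 →
      linPoly d (T e.1.1) ∈ vanish (hull T (edgeSet e)) 1 := by
    intro d hd
    rw [mem_vanish_one, hull_edgeSet, segment_eq_image_lineMap]
    rintro _ ⟨s, -, rfl⟩
    rw [evalAt_linPoly, AffineMap.lineMap_apply]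
    simp only [vsub_eq_sub, vadd_eq_add, add_sub_cancel_right]
    rw [real_inner_smul_left]
    change s * inner ℝ (edgeVec T e) d = 0
    rw [hd, mul_zero]
  have hv1 : ν₁ ∈ vanish (hull T (edgeSet e)) 1 :=
    hvan _ (by rw [real_inner_smul_right]; simp [inner_eq]; right; ring)
  have hv2 : ν₂ ∈ vanish (hull T (edgeSet e)) 1 :=
    hvan _ (by rw [real_inner_smul_right]; simp [inner_eq]; right; ring)
  have ha1 : dirD a ν₁ = 1 := by
    rw [hν₁, dirD_linPoly, real_inner_smul_right, ← C_1]
    congr 1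
    change D⁻¹ * det3 a b (edgeVec T e) = 1
    rw [det3_cycle, inv_mul_cancel₀ hdet]
  have ha2 : dirD a ν₂ = 0 := by
    rw [hν₂, dirD_linPoly, real_inner_smul_right, ← C_0]
    congr 1
    simp [inner_eq]; right; ring
  have hb1 : dirD b ν₁ = 0 := by
    rw [hν₁, dirD_linPoly, real_inner_smul_right, ← C_0]
    congr 1
    simp [inner_eq]; right; ring
  have hb2 : dirD b ν₂ = 1 := by
    rw [hν₂, dirD_linPoly, real_inner_smul_right, ← C_1]
    congr 1
    change D⁻¹ * det3 b (edgeVec T e) a = 1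
    rw [← det3_cycle, ← hD, inv_mul_cancel₀ hdet]
  -- The orders of derivatives are treated one after the other: a correction for order n vanishes on
  -- the edge to order n and leaves the moments of lower order alone.
  suffices H : ∀ n : ℕ, (n : ℤ) ≤ se + 1 → ∃ δ : Poly3, δ.totalDegree ≤ k ∧
      (∀ i j : ℕ, i ≤ j → j < n → ∀ q ∈ edgeTest (k - 2 * (sv + 1) + j),
        edgeMoment T e ((dirD a)^[i] ((dirD b)^[j - i] δ)) q = μ j i q) ∧
      (∀ i, δ ∈ vanish (hull T {i}) (sv + 1).toNat) ∧
      ∀ e' ≠ e, δ ∈ vanish (hull T (edgeSet e')) (se + 1).toNat by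
    by_cases h0 : 0 ≤ se + 1
    · obtain ⟨δ, h1, h2, h3⟩ := H (se + 1).toNat (by omega)
      exact ⟨δ, h1, fun i j hij hj => h2 i j hij (by omega), h3⟩
    · exact ⟨0, by simp, fun i j hij hj => by omega, fun i => Submodule.zero_mem _,
        fun e' _ => Submodule.zero_mem _⟩
  intro n
  induction n with
  | zero => intro _; exact ⟨0, by simp, fun i j hij hj => by omega, fun i => Submodule.zero_mem _,
        fun e' _ => Submodule.zero_mem _⟩
  | succ n ih =>
    intro hn
    obtain ⟨δ, hδ1, hδ2, hδ3, hδ4⟩ := ih (by omega)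
    set N := (sv + 1).toNat with hNdef
    have hN : (N : ℤ) = sv + 1 := by omega
    -- At an end point n orders come from ν₁, ν₂, the other L from a barycentric coordinate. As n ≤
    -- se and 2 se ≤ sv, L ≥ se + 1 also suffices on the other edges. The degree adds up to n + 2L +
    -- (M - 1) = k if M is positive.
    set L := N - n with hL
    set M := ((k : ℤ) - 2 * (sv + 1) + n + 1).toNat with hM
    have hdist := (edge_dist_pos T e).ne'
    -- What is still missing from the moments of `δ`, divided by the length of the edge and by the
    -- factorials that differentiating ν₁ⁱ ν₂ⁿ⁻ⁱ produces.
    choose g hg1 hg2 using fun i : ℕ => exists_unitInt_representer L M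
      (((dist (T e.1.1) (T e.1.2))⁻¹ * ((i.factorial : ℝ) * (n - i).factorial)⁻¹) •
        (μ n i - edgeMomentDual T e ((dirD a)^[i] ((dirD b)^[n - i] δ))))
    set h : ℕ → Poly3 := fun i =>
      (bary T e.1.1 * bary T e.1.2) ^ L * Polynomial.aeval (bary T e.1.2) (g i) with hh
    have hhe : ∀ i, edgePoly T e (h i) = intervalBubble ^ L * g i := by
      intro i
      rw [hh, map_mul, map_pow, map_mul, (edgePoly_bary T e).1, (edgePoly_bary T e).2,
        ← Polynomial.aeval_algHom_apply, (edgePoly_bary T e).2, Polynomial.aeval_X_left_apply,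
        intervalBubble, mul_comm Polynomial.X]
    set η : ℕ → Poly3 := fun i => ν₁ ^ i * ν₂ ^ (n - i) * h i with hη
    have hηv : ∀ i ≤ n, η i ∈ vanish (hull T (edgeSet e)) n := by
      intro i hi
      have := mul_vanish (mul_vanish (pow_vanish hv1 i) (pow_vanish hv2 (n - i)))
        (q := h i) (M := 0) trivial
      exact vanish_mono (by omega) this
    have hb : ∀ {S : Finset (Fin 4)} {i : Fin 4} (_ : i ∉ S) (l : ℕ),
        bary T i ^ l ∈ vanish (hull T S) l := by
      intro S i hi l
      have := pow_vanish (bary_vanish T hi) l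
      rwa [mul_one] at this
    have hη1 : ∀ {S : Finset (Fin 4)} (_ : e.1.1 ∉ S) (i : ℕ), η i ∈ vanish (hull T S) L := by
      intro S hS i
      have : η i = (ν₁ ^ i * ν₂ ^ (n - i) * bary T e.1.2 ^ L
          * Polynomial.aeval (bary T e.1.2) (g i)) * bary T e.1.1 ^ L := by
        simp only [hη, hh]; ring
      rw [this]
      exact mul_left_vanish _ (hb hS L)
    have hη2 : ∀ {S : Finset (Fin 4)} (_ : e.1.2 ∉ S) (i : ℕ), η i ∈ vanish (hull T S) L := by
      intro S hS i
      have : η i = (ν₁ ^ i * ν₂ ^ (n - i) * bary T e.1.1 ^ L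
          * Polynomial.aeval (bary T e.1.2) (g i)) * bary T e.1.2 ^ L := by
        simp only [hη, hh]; ring
      rw [this]
      exact mul_left_vanish _ (hb hS L)
    have hne : e.1.1 ≠ e.1.2 := ne_of_lt e.2
    -- At an end point n + L = N. At the other two vertices both barycentric coordinates vanish, and
    -- 2L ≥ N.
    have hηvert : ∀ i ≤ n, ∀ v, η i ∈ vanish (hull T {v}) N := by
      intro i hi v
      have hνv : ∀ {v}, v ∈ edgeSet e → ν₁ ^ i * ν₂ ^ (n - i) ∈ vanish (hull T {v}) n := by
        intro v hv
        have := mul_vanish (pow_vanish hv1 i) (pow_vanish hv2 (n - i))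
        exact vanish_anti_set (hull_mono T (by simpa using hv)) (vanish_mono (by omega) this)
      by_cases hv1' : v = e.1.1
      · have : η i = (ν₁ ^ i * ν₂ ^ (n - i)) * (bary T e.1.2 ^ L * (bary T e.1.1 ^ L
          * Polynomial.aeval (bary T e.1.2) (g i))) := by
          simp only [hη, hh]; ring
        rw [this]
        have h3 := mul_vanish (hνv (v := v) (by simp [edgeSet, hv1']))
          (mul_vanish (hb (S := {v}) (i := e.1.2) (by simp [hv1', hne.symm]) L)
          (q := bary T e.1.1 ^ L * Polynomial.aeval (bary T e.1.2) (g i)) (M := 0) trivial)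
        exact vanish_mono (by omega) h3
      by_cases hv2' : v = e.1.2
      · have : η i = (ν₁ ^ i * ν₂ ^ (n - i)) * (bary T e.1.1 ^ L * (bary T e.1.2 ^ L
          * Polynomial.aeval (bary T e.1.2) (g i))) := by
          simp only [hη, hh]; ring
        rw [this]
        have h3 := mul_vanish (hνv (v := v) (by simp [edgeSet, hv2']))
          (mul_vanish (hb (S := {v}) (i := e.1.1) (by simp [hv2', hne]) L)
          (q := bary T e.1.2 ^ L * Polynomial.aeval (bary T e.1.2) (g i)) (M := 0) trivial)
        exact vanish_mono (by omega) h3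
      · have : η i = (ν₁ ^ i * ν₂ ^ (n - i) * Polynomial.aeval (bary T e.1.2) (g i)) *
            (bary T e.1.1 ^ L * bary T e.1.2 ^ L) := by
          simp only [hη, hh]; ring
        rw [this]
        have h3 := mul_left_vanish (ν₁ ^ i * ν₂ ^ (n - i) * Polynomial.aeval (bary T e.1.2) (g i))
          (mul_vanish (hb (S := {v}) (i := e.1.1) (by simpa using Ne.symm hv1') L)
          (hb (S := {v}) (i := e.1.2) (by simpa using Ne.symm hv2') L))
        exact vanish_mono (by omega) h3
    have hηedge : ∀ i, ∀ e' ≠ e, η i ∈ vanish (hull T (edgeSet e')) (se + 1).toNat := by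
      intro i e' he'
      rcases notMem_edgeSet_of_ne he' with h' | h'
      · exact vanish_mono (by omega) (hη1 h' i)
      · exact vanish_mono (by omega) (hη2 h' i)
    have hηdeg : ∀ i ≤ n, (η i).totalDegree ≤ k := by
      intro i hi
      by_cases hg0 : g i = 0
      · simp [hη, hh, hg0]
      have hgd : (g i).natDegree < M := by
        have := Polynomial.mem_degreeLT.1 (hg1 i)
        rw [Polynomial.degree_eq_natDegree hg0] at this
        exact_mod_cast this
      have hp : ∀ {p : Poly3} (_ : p.totalDegree ≤ 1) (l : ℕ), (p ^ l).totalDegree ≤ l :=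
        fun hp l => (totalDegree_pow _ _).trans (by nlinarith)
      have h1 : (ν₁ ^ i).totalDegree ≤ i := hp (totalDegree_linPoly_le (D⁻¹ • cross b (edgeVec T e)) (T e.1.1)) i
      have h2 : (ν₂ ^ (n - i)).totalDegree ≤ n - i :=
        hp (totalDegree_linPoly_le (D⁻¹ • cross (edgeVec T e) a) (T e.1.1)) (n - i)
      have h3 := hp (totalDegree_bary_le T e.1.1) L
      have h4 := hp (totalDegree_bary_le T e.1.2) L
      have h5 := totalDegree_aeval_le (totalDegree_bary_le T e.1.2) (g i)
      have h6 := totalDegree_mul (ν₁ ^ i * ν₂ ^ (n - i)) (h i)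
      have h7 := totalDegree_mul (ν₁ ^ i) (ν₂ ^ (n - i))
      have h8 := totalDegree_mul ((bary T e.1.1 * bary T e.1.2) ^ L)
        (Polynomial.aeval (bary T e.1.2) (g i))
      rw [mul_pow] at h8
      have h9 := totalDegree_mul (bary T e.1.1 ^ L) (bary T e.1.2 ^ L)
      have h10 : (h i).totalDegree ≤ L + L + (g i).natDegree := by
        simp only [hh, mul_pow]; omega
      simp only [hη]
      omega
    refine ⟨δ + ∑ i ∈ Finset.range (n + 1), η i, ?_, ?_, ?_, ?_⟩
    · refine (totalDegree_add _ _).trans (max_le hδ1 (totalDegree_finsetSum_le fun i hi =>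
        hηdeg i (by have := Finset.mem_range.1 hi; omega)))
    · intro i j hij hj q hq
      rw [iterate_dirD_add, iterate_dirD_add, edgeMoment_add_left, iterate_dirD_sum,
        iterate_dirD_sum]
      rcases Nat.lt_or_ge j n with hjn | hjn
      · rw [hδ2 i j hij hjn q hq, edgeMoment_eq_zero, add_zero]
        intro x hx
        rw [evalAt_sum]
        refine Finset.sum_eq_zero fun l hl => ?_
        have hl' := Finset.mem_range.1 hl
        exact evalAt_of_vanish (iterate_dirD_vanish (iterate_dirD_vanish (hηv l (by omega)) b _)
          a i) (by omega) hx
      · obtain rfl : j = n := by omega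
        -- The mixed derivatives of order n are dual to the monomials ν₁ˡ ν₂ⁿ⁻ˡ, so only the i-th
        -- summand contributes on the edge.
        have hsum : edgePoly T e (∑ l ∈ Finset.range (j + 1),
            (dirD a)^[i] ((dirD b)^[j - i] (η l)))
            = ((i.factorial : ℝ) * (j - i).factorial) • (intervalBubble ^ L * g i) := by
          rw [← hhe, ← map_smul, ← sub_eq_zero, ← map_sub, edgePoly_eq_zero_iff]
          intro x hx
          rw [evalAt_sub, evalAt_sum, evalAt_smul, Finset.sum_eq_single i]
          · rw [iterate_dirD_mul_pow hv1 hv2 ha1 ha2 hb1 hb2 hx i (j - i) i (j - i) _ rfl]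
            simp
          · intro l hl hli
            have hl' := Finset.mem_range.1 hl
            rw [iterate_dirD_mul_pow hv1 hv2 ha1 ha2 hb1 hb2 hx i (j - i) l (j - l) _ (by omega),
              if_neg hli.symm]
          · intro hi
            exact absurd (Finset.mem_range.2 (by omega)) hi
        rw [edgeMoment_eq T e (∑ l ∈ Finset.range (j + 1), _), hsum, smul_mul_assoc, map_smul,
          hg2 i q hq]
        have hf1 : (i.factorial : ℝ) ≠ 0 := by positivity
        have hf2 : ((j - i).factorial : ℝ) ≠ 0 := by positivity
        simp only [LinearMap.smul_apply, LinearMap.sub_apply, smul_eq_mul, edgeMomentDual,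
          LinearMap.coe_mk, AddHom.coe_mk]
        field_simp
        ring
    · exact fun v => Submodule.add_mem _ (hδ3 v) (Submodule.sum_mem _ fun i hi =>
        hηvert i (by have := Finset.mem_range.1 hi; omega) v)
    · exact fun e' he' => Submodule.add_mem _ (hδ4 e' he') (Submodule.sum_mem _ fun i _ =>
        hηedge i e' he')

end Edge

end CurlFE

end

noncomputable section

namespace CurlFE

/-! ### Scalar degrees of freedom on faces -/

section Face

variable (T : Tetra)

/-- A direction is tangential to a face if the barycentric coordinate of the opposite vertex does
not change along it. -/
theorem face_tangent {o : Fin 4} {d : E3} (hd : coordLin T d o = 0) (i : Fin 4)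
    (hi : i ∉ faceSet o) : coordLin T d i = 0 := by
  obtain rfl : i = o := by simpa [faceSet] using hi
  exact hd

theorem sum_coordLin (d : E3) : ∑ i, coordLin T d i = 0 := by
  have h1 := T.sum_coord_apply_eq_one d
  have h2 := T.sum_coord_apply_eq_one (0 : E3)
  have h3 : ∀ i, coordLin T d i = T.coord i d - T.coord i 0 := fun i => by
    rw [coord_sub_eq, sub_zero]
  simp only [h3, Finset.sum_sub_distrib, h1, h2, sub_self]

theorem eq_sum_coordLin (d : E3) : d = ∑ i, coordLin T d i • T i := by
  have h1 := AffineBasis.linear_combination_coord_eq_self T d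
  have h2 := AffineBasis.linear_combination_coord_eq_self T (0 : E3)
  have h3 : ∀ i, coordLin T d i = T.coord i d - T.coord i 0 := fun i => by
    rw [coord_sub_eq, sub_zero]
  simp only [h3, sub_smul, Finset.sum_sub_distrib, h1, h2, sub_zero]

/-- The normal is proportional to the gradient of the barycentric coordinate of the opposite vertex:
both functionals kill the differences of vertices of the face. -/
theorem exists_height (F : TetFrames T) (o : Fin 4) :
    ∃ h : ℝ, h ≠ 0 ∧ ∀ d : E3, inner ℝ (F.fn o) d = h * coordLin T d o := by
  have key : ∀ d : E3, inner ℝ (F.fn o) d =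
      inner ℝ (F.fn o) (T o - T (o.succAbove 0)) * coordLin T d o := by
    intro d
    conv_lhs => rw [eq_sum_coordLin T d]
    have h1 : ∑ i, coordLin T d i • T i =
        ∑ i, coordLin T d i • (T i - T (o.succAbove 0)) := by
      simp only [smul_sub, Finset.sum_sub_distrib, ← Finset.sum_smul, sum_coordLin, zero_smul,
        sub_zero]
    rw [h1, inner_sum, Finset.sum_eq_single o]
    · rw [real_inner_smul_right, mul_comm]
    · intro i _ hi
      rw [real_inner_smul_right, F.fn_normal o i _ hi (Fin.succAbove_ne o 0), mul_zero]
    · simp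
  refine ⟨_, fun h0 => F.fn_ne o ?_, key⟩
  have := key (F.fn o)
  rw [h0, zero_mul] at this
  exact inner_self_eq_zero.1 this

theorem cross_ne_zero {a b : E3} (h : LinearIndependent ℝ ![a, b]) : cross a b ≠ 0 := by
  intro h0
  rw [LinearIndependent.pair_iff] at h
  have e0 := congrArg (fun x : E3 => x 0) h0
  have e1 := congrArg (fun x : E3 => x 1) h0
  have e2 := congrArg (fun x : E3 => x 2) h0
  simp only [cross_zero, cross_one, cross_two, PiLp.zero_apply] at e0 e1 e2
  have k0 := h (b 0) (-a 0) (by apply E3_ext <;> simp <;> linarith)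
  have k1 := h (b 1) (-a 1) (by apply E3_ext <;> simp <;> linarith)
  have k2 := h (b 2) (-a 2) (by apply E3_ext <;> simp <;> linarith)
  have hb : b = 0 := E3_ext k0.1 k1.1 k2.1
  have := (h 0 1 (by simp [hb])).2
  norm_num at this

theorem lagrange_identity (n m : E3) : inner ℝ n n * inner ℝ m m =
    inner ℝ n m ^ 2 + (inner ℝ (cross n m) (cross n m) : ℝ) := by
  simp only [inner_eq, cross_zero, cross_one, cross_two]; ring

/-- A vector orthogonal to two independent vectors completes them to a frame. -/
theorem det3_ne_zero {n a b : E3} (hn : n ≠ 0) (ha : inner ℝ a n = 0) (hb : inner ℝ b n = 0)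
    (h : LinearIndependent ℝ ![a, b]) : det3 n a b ≠ 0 := by
  intro hdet
  have h1 := lagrange_identity n (cross a b)
  have h2 : cross n (cross a b) = 0 := by
    rw [inner_eq] at ha hb
    apply E3_ext <;> simp
    · linear_combination a 0 * hb - b 0 * ha
    · linear_combination a 1 * hb - b 1 * ha
    · linear_combination a 2 * hb - b 2 * ha
  rw [h2, inner_zero_left, show inner ℝ n (cross a b) = 0 from hdet] at h1
  have h3 : inner ℝ n n ≠ (0 : ℝ) := inner_self_ne_zero.2 hn
  have h4 : inner ℝ (cross a b) (cross a b) ≠ (0 : ℝ) := inner_self_ne_zero.2 (cross_ne_zero h)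
  simp [hn, cross_ne_zero h] at h1

theorem face_det_ne_zero (F : TetFrames T) (o : Fin 4) :
    det3 (F.fn o) (F.ft o 0) (F.ft o 1) ≠ 0 := by
  refine det3_ne_zero (F.fn_ne o) (F.ft_tangent o 0) (F.ft_tangent o 1) ?_
  convert F.ft_indep o using 1
  funext i
  fin_cases i <;> rfl

theorem exists_edge_scale (F : TetFrames T) (e : TetEdge) :
    ∃ a : ℝ, a ≠ 0 ∧ F.et e = a • edgeVec T e := by
  have ⟨a, ha⟩ := F.et_tangent e
  exact ⟨a, fun h0 => F.et_ne e (by rw [ha, h0, zero_smul]), ha⟩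

theorem edge_det_ne_zero (F : TetFrames T) (e : TetEdge) :
    det3 (F.et e) (F.en1 e) (F.en2 e) ≠ 0 := by
  obtain ⟨a, -, ha'⟩ := exists_edge_scale T F e
  refine det3_ne_zero (F.et_ne e) ?_ ?_ (F.en_indep e)
  · rw [ha', real_inner_smul_right, edgeVec, F.en1_normal e, mul_zero]
  · rw [ha', real_inner_smul_right, edgeVec, F.en2_normal e, mul_zero]

theorem face_tangent_coord (F : TetFrames T) {o : Fin 4} {d : E3} (hd : inner ℝ (F.fn o) d = 0) :
    coordLin T d o = 0 := by
  obtain ⟨h, h0, h1⟩ := exists_height T F o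
  rw [h1] at hd
  exact (mul_eq_zero.1 hd).resolve_left h0

theorem ft_tangent_coord (F : TetFrames T) (o : Fin 4) (l : Fin 2) :
    coordLin T (F.ft o l) o = 0 :=
  face_tangent_coord T F (by rw [real_inner_comm]; exact F.ft_tangent o l)

theorem fn_coord_ne_zero (F : TetFrames T) (o : Fin 4) : coordLin T (F.fn o) o ≠ 0 := by
  obtain ⟨h, h0, h1⟩ := exists_height T F o
  intro h2
  have := h1 (F.fn o)
  rw [h2, mul_zero] at this
  exact F.fn_ne o (inner_self_eq_zero.1 this)

/-- As on edges, tangential derivatives come for free, so one transversal direction decides. -/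
theorem face_vanish_of_normals (F : TetFrames T) {o : Fin 4} {N : ℕ} {p : Poly3}
    (h : ∀ j < N, ∀ x ∈ hull T (faceSet o), evalAt x ((dirD (F.fn o))^[j] p) = 0) :
    p ∈ vanish (hull T (faceSet o)) N := by
  induction N generalizing p with
  | zero => trivial
  | succ N ih =>
    have h1 := ih fun j hj => h j (by omega)
    refine vanish_succ_of_frame (fun c => exists_frame_coord (face_det_ne_zero T F o) _)
      (fun x hx => h 0 (by omega) x hx) ?_ ?_ ?_
    · exact ih fun j hj x hx => by
        rw [← Function.iterate_succ_apply]; exact h (j + 1) (by omega) x hx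
    · exact dirD_vanish_of_tangent T (faceSet_nonempty o)
        (face_tangent T (ft_tangent_coord T F o 0)) h1
    · exact dirD_vanish_of_tangent T (faceSet_nonempty o)
        (face_tangent T (ft_tangent_coord T F o 1)) h1

theorem toNat_sub_shift (a : ℤ) (j : ℕ) : (a + 1).toNat - j = (a + -(j : ℤ) + 1).toNat := by omega

/-- Face moments and the derivatives on the boundary determine the normal derivatives. -/
theorem face_vanish_of_moments (F : TetFrames T) {o : Fin 4} {p : Poly3} {k : ℕ}
    {r : SmoothParam} (hp : p.totalDegree ≤ k) (hk : r.f ≤ k)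
    (hv : ∀ i, i ≠ o → p ∈ vanish (hull T {i}) (r.v + 1).toNat)
    (he : ∀ e : TetEdge, e.1.1 ≠ o → e.1.2 ≠ o →
      p ∈ vanish (hull T (edgeSet e)) (r.e + 1).toNat)
    (hm : ∀ j : ℕ, (j : ℤ) ≤ r.f → ∀ q ∈ bubble T (faceSet o) (k - j) (r.shift (-j)),
      faceInt T o ((dirD (F.fn o))^[j] p * q) = 0) :
    p ∈ vanish (hull T (faceSet o)) (r.f + 1).toNat := by
  apply face_vanish_of_normals T F
  intro j hj
  have hjk : j ≤ k := by omega
  -- The trace of the j-th normal derivative is a face bubble function with degree and smoothness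
  -- lowered by j. It is an admissible test function for itself.
  obtain ⟨q, hq, hqe⟩ := exists_face_bubble_eq_on T (r := r.shift (-j))
    (totalDegree_iterate_dirD_le hp (F.fn o) j) o
    (fun i hi => by
      have := iterate_dirD_vanish (hv i hi) (F.fn o) j
      rwa [toNat_sub_shift] at this)
    (fun e h1 h2 => by
      have := iterate_dirD_vanish (he e h1 h2) (F.fn o) j
      rwa [toNat_sub_shift] at this)
  have h1 := hm j (by omega) q (by rwa [Nat.cast_sub hjk] at hq)
  rw [faceInt_congr T o (q := q * q) (fun x hx => by rw [evalAt_mul, evalAt_mul, hqe x hx])] at h1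
  intro x hx
  rw [← hqe x hx]
  exact eq_zero_of_faceInt_mul_self T h1 x hx

/-- Only the test function that equals `p` on the face is used. It may be checked beforehand to
satisfy a side condition, such as having mean zero. -/
theorem face_eq_zero_of_moments {o : Fin 4} {p : Poly3} {k : ℕ}
    {r : SmoothParam} (hp : p.totalDegree ≤ k)
    (hv : ∀ i, i ≠ o → p ∈ vanish (hull T {i}) (r.v + 1).toNat)
    (he : ∀ e : TetEdge, e.1.1 ≠ o → e.1.2 ≠ o →
      p ∈ vanish (hull T (edgeSet e)) (r.e + 1).toNat)
    (hm : ∀ q ∈ bubble T (faceSet o) k r, (∀ x ∈ hull T (faceSet o), evalAt x q = evalAt x p) →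
      faceInt T o (p * q) = 0) :
    ∀ x ∈ hull T (faceSet o), evalAt x p = 0 := by
  obtain ⟨q, hq, hqe⟩ := exists_face_bubble_eq_on T (r := r) hp o hv he
  have h1 := hm q hq hqe
  rw [faceInt_congr T o (q := q * q) (fun x hx => by rw [evalAt_mul, evalAt_mul, hqe x hx])] at h1
  intro x hx
  rw [← hqe x hx]
  exact eq_zero_of_faceInt_mul_self T h1 x hx

/-- Distances of the nodes of a face to all sub-simplices of the tetrahedron. -/
theorem face_node_bounds {o : Fin 4} {α : Fin 4 → ℕ} {m : ℤ} {r : SmoothParam}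
    (h : α ∈ bubbleNodes (faceSet o) m r) :
    α o = 0 ∧ (∀ i, i ≠ o → r.v < ((∑ l ∈ ({i} : Finset (Fin 4))ᶜ, α l : ℕ) : ℤ)) ∧
    ((∑ l ∈ ({o} : Finset (Fin 4))ᶜ, α l : ℕ) : ℤ) = m ∧
    (∀ e : TetEdge, o ∉ edgeSet e → r.e < ((∑ l ∈ (edgeSet e)ᶜ, α l : ℕ) : ℤ)) ∧
    (∀ e : TetEdge, o ∈ edgeSet e → r.v < ((∑ l ∈ (edgeSet e)ᶜ, α l : ℕ) : ℤ)) ∧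
    ∀ o', o' ≠ o → r.e < (α o' : ℤ) := by
  obtain ⟨h1, h2, h3⟩ := face_node_ineq h
  have hm := h.2.1
  refine ⟨h3, h1, ?_, fun e he => ?_, fun e he => ?_, fun o' ho' => ?_⟩
  · have := sum_compl_singleton α o
    omega
  · simp only [edgeSet, Finset.mem_insert, Finset.mem_singleton, not_or] at he
    exact h2 e (Ne.symm he.1) (Ne.symm he.2)
  · have hne : e.1.1 ≠ e.1.2 := ne_of_lt e.2
    have hsum := Finset.sum_add_sum_compl (edgeSet e) α
    rw [edgeSet, Finset.sum_pair hne, ← edgeSet] at hsum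
    simp only [edgeSet, Finset.mem_insert, Finset.mem_singleton] at he
    rcases he with rfl | rfl
    · have := h1 e.1.2 hne.symm
      have := sum_compl_singleton α e.1.2
      omega
    · have := h1 e.1.1 hne
      have := sum_compl_singleton α e.1.1
      omega
  -- The exponent at o' is the distance to the edge of the face opposite to o', because the exponent
  -- at o is zero.
  · have hc : ({o, o'} : Finset (Fin 4))ᶜ.card = 2 := by
      rw [Finset.card_compl, Finset.card_pair ho'.symm]; rfl
    obtain ⟨a, b, hab, habe⟩ := Finset.card_eq_two.1 hc
    obtain ⟨e, he⟩ := exists_edgeSet_eq hab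
    rw [← habe] at he
    have hoe : o ∉ edgeSet e := by rw [he]; simp
    have h4 := h2 e
      (fun h => hoe (by simp [edgeSet, h])) (fun h => hoe (by simp [edgeSet, h]))
    rw [he, compl_compl, Finset.sum_pair ho'.symm, h3, zero_add] at h4
    exact h4

theorem compl_faceSet (o : Fin 4) : (faceSet o)ᶜ = {o} := by simp [faceSet]

theorem iterate_dirD_pow_mul {Z : Set E3} {a : E3} {ν : Poly3} {c : ℝ} (h1 : ν ∈ vanish Z 1)
    (ha : dirD a ν = C c) {x : E3} (hx : x ∈ Z) (n : ℕ) (h : Poly3) :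
    evalAt x ((dirD a)^[n] (ν ^ n * h)) = n.factorial * c ^ n * evalAt x h := by
  induction n generalizing h with
  | zero => simp
  | succ n ih =>
    have hD : dirD a (ν ^ (n + 1) * h) =
        ((n + 1 : ℝ) * c) • (ν ^ n * h) + ν ^ (n + 1) * dirD a h := by
      rw [dirD_mul, dirD_pow, ha]
      simp only [Nat.add_sub_cancel, MvPolynomial.smul_eq_C_mul, nsmul_eq_mul, map_mul, map_add,
        map_natCast, map_one]
      push_cast
      ring
    have hv : ν ^ (n + 1) * dirD a h ∈ vanish Z (n + 1) := by
      have := mul_vanish (pow_vanish h1 (n + 1)) (q := dirD a h) (M := 0) trivial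
      simpa using this
    rw [Function.iterate_succ_apply, hD, iterate_dirD_add, evalAt_add, iterate_dirD_smul,
      evalAt_smul, ih, evalAt_of_vanish (iterate_dirD_vanish hv a n) (by omega) hx,
      Nat.factorial_succ]
    push_cast
    ring

/-- A face bubble function represents a functional. -/
theorem exists_face_representer (o : Fin 4) (m : ℤ) (r : SmoothParam) (μ : Module.Dual ℝ Poly3) :
    ∃ u ∈ bubble T (faceSet o) m r, ∀ q ∈ bubble T (faceSet o) m r,
      faceInt T o (u * q) = μ q := by
  obtain ⟨u, hu, h⟩ := exists_representer (bubble T (faceSet o) m r)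
    ((LinearMap.mul ℝ Poly3).compr₂ (faceLin T o))
    (fun u hu h => bubble_eq_zero_of_hull T (faceSet_nonempty o) hu
      (eq_zero_of_faceInt_mul_self T h))
    (μ ∘ₗ (bubble T (faceSet o) m r).subtype)
  exact ⟨u, hu, fun q hq => h q hq⟩

/-- A face moment as a functional of the test function. -/
def faceMomentDual (o : Fin 4) (p : Poly3) : Module.Dual ℝ Poly3 :=
  faceLin T o ∘ₗ LinearMap.mulLeft ℝ p

theorem faceMomentDual_apply (o : Fin 4) (p q : Poly3) :
    faceMomentDual T o p q = faceInt T o (p * q) := rfl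

/-- Corrections with prescribed face moments. -/
theorem exists_face_correction (F : TetFrames T) (o : Fin 4) {k : ℕ} {r : SmoothParam}
    (hk : 2 * r.v + 1 ≤ k) (hf : 2 * r.f ≤ r.e) (he : 2 * r.e ≤ r.v)
    (μ : ℕ → Module.Dual ℝ Poly3) :
    ∃ δ : Poly3, δ.totalDegree ≤ k ∧
      (∀ j : ℕ, (j : ℤ) ≤ r.f → ∀ q ∈ bubble T (faceSet o) (k - j) (r.shift (-j)),
        faceInt T o ((dirD (F.fn o))^[j] δ * q) = μ j q) ∧
      (∀ i, δ ∈ vanish (hull T {i}) (r.v + 1).toNat) ∧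
      (∀ e, δ ∈ vanish (hull T (edgeSet e)) (r.e + 1).toNat) ∧
      ∀ o' ≠ o, δ ∈ vanish (hull T (faceSet o')) (r.f + 1).toNat := by
  suffices H : ∀ n : ℕ, (n : ℤ) ≤ r.f + 1 → ∃ δ : Poly3, δ.totalDegree ≤ k ∧
      (∀ j : ℕ, j < n → ∀ q ∈ bubble T (faceSet o) (k - j) (r.shift (-j)),
        faceInt T o ((dirD (F.fn o))^[j] δ * q) = μ j q) ∧
      (∀ i, δ ∈ vanish (hull T {i}) (r.v + 1).toNat) ∧
      (∀ e, δ ∈ vanish (hull T (edgeSet e)) (r.e + 1).toNat) ∧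
      ∀ o' ≠ o, δ ∈ vanish (hull T (faceSet o')) (r.f + 1).toNat by
    by_cases h0 : 0 ≤ r.f + 1
    · obtain ⟨δ, h1, h2, h3⟩ := H (r.f + 1).toNat (by omega)
      exact ⟨δ, h1, fun j hj => h2 j (by omega), h3⟩
    · exact ⟨0, by simp, fun j hj => by omega, fun i => Submodule.zero_mem _,
        fun e => Submodule.zero_mem _, fun o' _ => Submodule.zero_mem _⟩
  intro n
  induction n with
  | zero => intro _; exact ⟨0, by simp, fun j hj => by omega, fun i => Submodule.zero_mem _,
        fun e => Submodule.zero_mem _, fun o' _ => Submodule.zero_mem _⟩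
  | succ n ih =>
    intro hn
    obtain ⟨δ, hδ1, hδ2, hδ3, hδ4, hδ5⟩ := ih (by omega)
    set c := coordLin T (F.fn o) o with hc
    have hc0 : c ≠ 0 := fn_coord_ne_zero T F o
    -- The correction for order n is λ_oⁿ u; its n-th normal derivative on the face is n! cⁿ u,
    -- which explains the factor. The power of λ_o restores the n orders by which the smoothness of
    -- u is lowered.
    obtain ⟨u, hu1, hu2⟩ := exists_face_representer T o (k - n) (r.shift (-n))
      (((n.factorial : ℝ) * c ^ n)⁻¹ •
        (μ n - faceMomentDual T o ((dirD (F.fn o))^[n] δ)))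
    have hbo : ∀ {S : Finset (Fin 4)}, o ∉ S → ∀ {N : ℕ}, (u ∈ vanish (hull T S) N) →
        bary T o ^ n * u ∈ vanish (hull T S) (n + N) := by
      intro S hS N hN
      have := mul_vanish (pow_vanish (bary_vanish T hS) n) hN
      rwa [mul_one] at this
    have hoF : o ∉ faceSet o := by simp [faceSet]
    have hηF : bary T o ^ n * u ∈ vanish (hull T (faceSet o)) n := hbo hoF (N := 0) trivial
    refine ⟨δ + bary T o ^ n * u, ?_, ?_, ?_, ?_, ?_⟩
    · refine (totalDegree_add _ _).trans (max_le hδ1 ((totalDegree_mul _ _).trans ?_))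
      have h1 := totalDegree_pow (bary T o) n
      have h2 := totalDegree_bary_le T o
      have h3 := totalDegree_of_mem_bubble T hu1
      have h4 : n * (bary T o).totalDegree ≤ n := by nlinarith
      omega
    · intro j hj q hq
      rw [iterate_dirD_add, add_mul, faceInt_add]
      rcases Nat.lt_or_ge j n with hjn | hjn
      · rw [hδ2 j hjn q hq, faceInt_eq_zero, add_zero]
        intro x hx
        rw [evalAt_mul, evalAt_of_vanish (iterate_dirD_vanish hηF _ j) (by omega) hx, zero_mul]
      · obtain rfl : j = n := by omega
        have h1 : faceInt T o ((dirD (F.fn o))^[j] (bary T o ^ j * u) * q) =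
            faceInt T o (((j.factorial : ℝ) * c ^ j) • (u * q)) := by
          apply faceInt_congr
          intro x hx
          rw [evalAt_mul, iterate_dirD_pow_mul (bary_vanish T hoF) (dirD_bary T (F.fn o) o) hx]
          simp only [evalAt_smul, evalAt_mul]
          ring
        rw [h1, faceInt_smul, hu2 q hq]
        have hf1 : (j.factorial : ℝ) ≠ 0 := by positivity
        have hf2 : c ^ j ≠ 0 := pow_ne_zero _ hc0
        simp only [LinearMap.smul_apply, LinearMap.sub_apply, smul_eq_mul, faceMomentDual_apply]
        field_simp
        ring
    -- On sub-simplices through the vertex o the power of λ_o is of no use. There the order comes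
    -- from u: from its degree at o, from the vertex parameter on edges, from the edge parameter on
    -- faces. The factors of 2 in the hypotheses pay for the loss of n.
    · intro i
      refine Submodule.add_mem _ (hδ3 i) ?_
      by_cases hi : i = o
      · subst hi
        refine mul_left_vanish _ (bubble_vanish T hu1 fun α hα => ?_)
        have := (face_node_bounds hα).2.2.1
        omega
      · have h1 : u ∈ vanish (hull T {i}) ((r.v + 1).toNat - n) :=
          bubble_vanish T hu1 fun α hα => by
            have := (face_node_bounds hα).2.1 i hi
            simp only [SmoothParam.shift] at this
            omega
        exact vanish_mono (by omega) (hbo (S := {i}) (by simpa using Ne.symm hi) h1)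
    · intro e
      refine Submodule.add_mem _ (hδ4 e) ?_
      by_cases hoe : o ∈ edgeSet e
      · refine mul_left_vanish _ (bubble_vanish T hu1 fun α hα => ?_)
        have := (face_node_bounds hα).2.2.2.2.1 e hoe
        simp only [SmoothParam.shift] at this
        omega
      · have h1 : u ∈ vanish (hull T (edgeSet e)) ((r.e + 1).toNat - n) :=
          bubble_vanish T hu1 fun α hα => by
            have := (face_node_bounds hα).2.2.2.1 e hoe
            simp only [SmoothParam.shift] at this
            omega
        exact vanish_mono (by omega) (hbo hoe h1)
    · intro o' ho'
      refine Submodule.add_mem _ (hδ5 o' ho') ?_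
      refine mul_left_vanish _ (bubble_vanish T hu1 fun α hα => ?_)
      have := (face_node_bounds hα).2.2.2.2.2 o' ho'
      simp only [SmoothParam.shift] at this
      rw [compl_faceSet, Finset.sum_singleton]
      omega

end Face

end CurlFE

end

noncomputable section

namespace CurlFE

/-! ### Homotopy operators for the de Rham complex of polynomials -/

section Poincare

/-- The operator `p ↦ ∫_0^1 τ^s p(τ x) dτ`. -/
def scaleInt (s : ℕ) : Poly3 →ₗ[ℝ] Poly3 :=
  (MvPolynomial.basisMonomials (Fin 3) ℝ).constr ℝ fun γ =>
    monomial γ ((γ.degree + s + 1 : ℝ)⁻¹)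

theorem scaleInt_monomial (s : ℕ) (γ : Fin 3 →₀ ℕ) (a : ℝ) :
    scaleInt s (monomial γ a) = monomial γ (a * (γ.degree + s + 1 : ℝ)⁻¹) := by
  have : (monomial γ a : Poly3) = a • MvPolynomial.basisMonomials (Fin 3) ℝ γ := by
    simp [coe_basisMonomials, smul_monomial]
  rw [this, map_smul, scaleInt, Module.Basis.constr_basis, smul_monomial, smul_eq_mul]

/-- Chain rule: differentiating p(τx) produces one more factor τ. -/
theorem pderiv_scaleInt (s : ℕ) (c : Fin 3) (p : Poly3) :
    pderiv c (scaleInt s p) = scaleInt (s + 1) (pderiv c p) := by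
  induction p using MvPolynomial.induction_on' with
  | add p q hp hq => simp [hp, hq]
  | monomial γ a =>
    rw [scaleInt_monomial, pderiv_monomial, pderiv_monomial, scaleInt_monomial]
    by_cases h : γ c = 0
    · simp [h]
    · have h1 : (γ - Finsupp.single c 1).degree + 1 = γ.degree := by
        have h2 : γ - Finsupp.single c 1 + Finsupp.single c 1 = γ :=
          tsub_add_cancel_of_le (by simpa [Finsupp.single_le_iff] using Nat.one_le_iff_ne_zero.2 h)
        conv_rhs => rw [← h2]
        simp [Finsupp.degree_single]
      rw [← h1]
      push_cast
      congr 1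
      ring

/-- The integral over [0, 1] of d/dτ (τ^(s+1) p(τx)) is p(x). -/
theorem euler_scaleInt (s : ℕ) (p : Poly3) :
    ∑ c, X c * pderiv c (scaleInt s p) + (s + 1 : ℝ) • scaleInt s p = p := by
  induction p using MvPolynomial.induction_on' with
  | add p q hp hq =>
    conv_rhs => rw [← hp, ← hq]
    simp only [map_add, mul_add, Finset.sum_add_distrib, smul_add]
    abel
  | monomial γ a =>
    simp only [scaleInt_monomial, X_mul_pderiv_monomial]
    rw [← Finset.sum_smul, ← Finsupp.degree_eq_sum, ← Nat.cast_smul_eq_nsmul ℝ, ← add_smul, smul_monomial]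
    congr 1
    have : (γ.degree + s + 1 : ℝ) ≠ 0 := by positivity
    rw [smul_eq_mul]
    field_simp
    ring

theorem totalDegree_scaleInt_le (s : ℕ) (p : Poly3) :
    (scaleInt s p).totalDegree ≤ p.totalDegree := by
  conv_lhs => rw [p.as_sum, map_sum]
  refine totalDegree_finsetSum_le fun γ hγ => ?_
  rw [scaleInt_monomial]
  exact (totalDegree_monomial_le _ _).trans (le_totalDegree hγ)

theorem evalAt_scaleInt (s : ℕ) (p : Poly3) (x : E3) :
    evalAt x (scaleInt s p) = ∫ τ in (0 : ℝ)..1, τ ^ s * evalAt (τ • x) p := by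
  conv_lhs => rw [p.as_sum, map_sum, evalAt_sum]
  have h : ∀ τ : ℝ, τ ^ s * evalAt (τ • x) p =
      ∑ γ ∈ p.support, τ ^ (γ.degree + s) * evalAt x (monomial γ (coeff γ p)) := by
    intro τ
    conv_lhs => rw [p.as_sum, evalAt_sum, Finset.mul_sum]
    refine Finset.sum_congr rfl fun γ _ => ?_
    simp only [evalAt, eval_monomial, PiLp.smul_apply, smul_eq_mul]
    rw [Finsupp.prod_fintype _ _ (fun _ => pow_zero _), Finsupp.prod_fintype _ _ (fun _ => pow_zero _),
      Finsupp.degree_eq_sum]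
    simp only [mul_pow, Finset.prod_mul_distrib, Finset.prod_pow_eq_pow_sum]
    ring
  simp only [h]
  rw [intervalIntegral.integral_finsetSum fun γ _ =>
    Continuous.intervalIntegrable (by fun_prop) _ _]
  refine Finset.sum_congr rfl fun γ _ => ?_
  rw [intervalIntegral.integral_mul_const, integral_pow, scaleInt_monomial]
  simp [evalAt, eval_monomial]
  ring

/-- Translation of polynomials. -/
def shiftPoly (a : E3) : Poly3 →ₐ[ℝ] Poly3 := aeval fun c => X c + C (a c)

theorem evalAt_shiftPoly (a x : E3) (p : Poly3) : evalAt x (shiftPoly a p) = evalAt (x + a) p := by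
  induction p using MvPolynomial.induction_on with
  | C b => simp [shiftPoly, MvPolynomial.algebraMap_eq]
  | add p q hp hq => simp [hp, hq]
  | mul_X p c hp => rw [map_mul, evalAt_mul, hp, evalAt_mul]; simp [shiftPoly]

theorem pderiv_shiftPoly (a : E3) (c : Fin 3) (p : Poly3) :
    pderiv c (shiftPoly a p) = shiftPoly a (pderiv c p) := by
  induction p using MvPolynomial.induction_on with
  | C b => simp [shiftPoly, MvPolynomial.algebraMap_eq]
  | add p q hp hq => simp [hp, hq]
  | mul_X p d hp =>
    have : pderiv c (shiftPoly a (X d)) = shiftPoly a (pderiv c (X d)) := by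
      simp only [shiftPoly, aeval_X, map_add, pderiv_C, add_zero, pderiv_X]
      by_cases h : d = c <;> simp [h]
    rw [map_mul, pderiv_mul, hp, this, pderiv_mul, map_add, map_mul, map_mul]

theorem shiftPoly_neg (a : E3) (p : Poly3) : shiftPoly (-a) (shiftPoly a p) = p := by
  apply poly_ext
  intro x
  rw [evalAt_shiftPoly, evalAt_shiftPoly]
  simp

theorem totalDegree_shiftPoly_le (a : E3) (p : Poly3) :
    (shiftPoly a p).totalDegree ≤ p.totalDegree := by
  rw [shiftPoly, aeval_def, eval₂_eq']
  refine totalDegree_finsetSum_le fun β hβ => ?_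
  refine (totalDegree_mul _ _).trans ?_
  have h1 : (∏ c, (X c + C (a c) : Poly3) ^ β c).totalDegree ≤ ∑ c, β c := by
    refine (totalDegree_finsetProd _ _).trans (Finset.sum_le_sum fun c _ => ?_)
    have h2 : (X c + C (a c) : Poly3).totalDegree ≤ 1 := by
      refine (totalDegree_add _ _).trans ?_
      simp
    exact (totalDegree_pow _ _).trans (by nlinarith)
  have h2 : β.degree ≤ p.totalDegree := le_totalDegree hβ
  rw [Finsupp.degree_eq_sum] at h2
  have h3 : (algebraMap ℝ Poly3 (coeff β p)).totalDegree = 0 := totalDegree_C _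
  omega

/-- The operator `p ↦ ∫_0^1 τ^s p(a + τ (x - a)) dτ`. -/
def coneInt (a : E3) (s : ℕ) (p : Poly3) : Poly3 := shiftPoly (-a) (scaleInt s (shiftPoly a p))

theorem coneInt_sub (a : E3) (s : ℕ) (p q : Poly3) :
    coneInt a s (p - q) = coneInt a s p - coneInt a s q := by simp [coneInt]

theorem coneInt_sum (a : E3) (s : ℕ) {ι : Type*} (t : Finset ι) (f : ι → Poly3) :
    coneInt a s (∑ i ∈ t, f i) = ∑ i ∈ t, coneInt a s (f i) := by simp [coneInt]

theorem coneInt_smul (a : E3) (s : ℕ) (b : ℝ) (p : Poly3) :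
    coneInt a s (b • p) = b • coneInt a s p := by simp [coneInt]

theorem coneInt_zero (a : E3) (s : ℕ) : coneInt a s 0 = 0 := by simp [coneInt]

theorem pderiv_coneInt (a : E3) (s : ℕ) (c : Fin 3) (p : Poly3) :
    pderiv c (coneInt a s p) = coneInt a (s + 1) (pderiv c p) := by
  rw [coneInt, pderiv_shiftPoly, pderiv_scaleInt, pderiv_shiftPoly, coneInt]

theorem euler_coneInt (a : E3) (s : ℕ) (p : Poly3) :
    ∑ c, (X c - C (a c)) * pderiv c (coneInt a s p) + (s + 1 : ℝ) • coneInt a s p = p := by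
  have h := congrArg (shiftPoly (-a)) (euler_scaleInt s (shiftPoly a p))
  rw [shiftPoly_neg, map_add, map_sum, map_smul] at h
  refine Eq.trans ?_ h
  simp only [map_mul, coneInt, pderiv_shiftPoly]
  simp [shiftPoly, sub_eq_add_neg]

theorem totalDegree_coneInt_le (a : E3) (s : ℕ) {p : Poly3} {k : ℕ} (h : p.totalDegree ≤ k) :
    (coneInt a s p).totalDegree ≤ k :=
  (totalDegree_shiftPoly_le _ _).trans ((totalDegree_scaleInt_le _ _).trans
    ((totalDegree_shiftPoly_le _ _).trans h))

theorem evalAt_coneInt (a : E3) (s : ℕ) (p : Poly3) (x : E3) : evalAt x (coneInt a s p) =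
    ∫ τ in (0 : ℝ)..1, τ ^ s * evalAt (AffineMap.lineMap a x τ) p := by
  rw [coneInt, evalAt_shiftPoly, evalAt_scaleInt]
  simp only [evalAt_shiftPoly, AffineMap.lineMap_apply, vsub_eq_sub, vadd_eq_add, ← sub_eq_add_neg]

theorem coneInt_vanish {a : E3} {s N : ℕ} {p : Poly3} (h : p ∈ vanish {a} N) :
    coneInt a s p ∈ vanish {a} N := by
  induction N generalizing p s with
  | zero => trivial
  | succ N ih =>
    refine ⟨fun x hx => ?_, fun c => by rw [pderiv_coneInt]; exact ih (h.2 c)⟩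
    obtain rfl : x = a := hx
    rw [evalAt_coneInt]
    simp [h.1 x rfl]

theorem coneInt_eq_zero_of_convex {Z : Set E3} (hZ : Convex ℝ Z) {a : E3} (ha : a ∈ Z) {s : ℕ}
    {p : Poly3} (h : ∀ x ∈ Z, evalAt x p = 0) : ∀ x ∈ Z, evalAt x (coneInt a s p) = 0 := by
  intro x hx
  rw [evalAt_coneInt, intervalIntegral.integral_congr (g := fun _ => 0), intervalIntegral.integral_zero]
  intro τ hτ
  rw [Set.uIcc_of_le zero_le_one] at hτ
  change τ ^ s * _ = 0
  rw [h _ (hZ.lineMap_mem ha hx hτ), mul_zero]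

/-- The potential of a field along rays from `a`. -/
def potential (a : E3) (v : VField) : Poly3 := ∑ c, (X c - C (a c)) * coneInt a 0 (v c)

/-- Homotopy formula for 1-forms: Euler's identity recovers the field from the derivative of the
potential, and the remainder involves only the entries of the curl. -/
theorem sub_pderiv_potential (a : E3) (v : VField) (b : Fin 3) :
    v b - pderiv b (potential a v) =
      ∑ c, (X c - C (a c)) * coneInt a 1 (pderiv c (v b) - pderiv b (v c)) := by
  have h := euler_coneInt a 0 (v b)
  simp only [pderiv_coneInt, zero_add, CharP.cast_eq_zero, one_smul] at h
  have h2 : pderiv b (potential a v) =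
      ∑ c, (X c - C (a c)) * coneInt a 1 (pderiv b (v c)) + coneInt a 0 (v b) := by
    simp only [potential, map_sum, pderiv_mul, pderiv_coneInt, map_sub, pderiv_C, sub_zero,
      zero_add, Finset.sum_add_distrib]
    rw [add_comm]
    congr 1
    fin_cases b <;> simp [Fin.sum_univ_three, pderiv_X]
  simp only [coneInt_sub, mul_sub, Finset.sum_sub_distrib]
  rw [h2]
  nth_rewrite 1 [← h]
  abel

theorem pderiv_sub_mem_of_curlF {W : Submodule ℝ Poly3} {v : VField} (h : ∀ c, curlF v c ∈ W)
    (b c : Fin 3) : pderiv c (v b) - pderiv b (v c) ∈ W := by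
  have h0 := h 0
  have h1 := h 1
  have h2 := h 2
  simp only [curlF, Matrix.cons_val_zero, Matrix.cons_val_one, Matrix.cons_val] at h0 h1 h2
  have h0' := W.neg_mem h0
  have h1' := W.neg_mem h1
  have h2' := W.neg_mem h2
  rw [neg_sub] at h0' h1' h2'
  match b, c with
  | 0, 0 | 1, 1 | 2, 2 => rw [sub_self]; exact W.zero_mem
  | 0, 1 => exact h2'
  | 0, 2 => exact h1
  | 1, 0 => exact h2
  | 1, 2 => exact h0'
  | 2, 0 => exact h1'
  | 2, 1 => exact h0

theorem gradP_potential {a : E3} {v : VField} (h : curlF v = 0) : gradP (potential a v) = v := by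
  funext b
  have h1 := sub_pderiv_potential a v b
  rw [Finset.sum_eq_zero] at h1
  · exact (sub_eq_zero.1 h1).symm
  · intro c _
    have := pderiv_sub_mem_of_curlF (W := ⊥) (v := v) (by simp [h]) b c
    rw [(Submodule.mem_bot ℝ).1 this, coneInt_zero, mul_zero]

/-- The remainder of the homotopy formula carries a factor that vanishes at `a`, so its order is one
more than that of the curl. -/
theorem sub_gradP_potential_vanish {a : E3} {v : VField} {N : ℕ}
    (h : ∀ c, curlF v c ∈ vanish {a} N) (b : Fin 3) :
    v b - gradP (potential a v) b ∈ vanish {a} (N + 1) := by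
  rw [gradP, sub_pderiv_potential]
  refine Submodule.sum_mem _ fun c _ => ?_
  rw [add_comm]
  refine mul_vanish (mem_vanish_one.2 ?_) (coneInt_vanish (pderiv_sub_mem_of_curlF h b c))
  intro x hx
  obtain rfl : x = a := hx
  simp

theorem evalAt_potential_self (a : E3) (v : VField) : evalAt a (potential a v) = 0 := by
  simp [potential, evalAt_sum]

theorem totalDegree_X_sub_C_mul_le {p : Poly3} {k : ℕ} (h : p.totalDegree ≤ k) (c : Fin 3) (b : ℝ) :
    ((X c - C b) * p).totalDegree ≤ k + 1 := by
  refine (totalDegree_mul _ _).trans ?_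
  have : (X c - C b : Poly3).totalDegree ≤ 1 := (totalDegree_sub _ _).trans (by simp)
  omega

theorem totalDegree_potential_le {a : E3} {v : VField} {k : ℕ} (h : ∀ c, (v c).totalDegree ≤ k) :
    (potential a v).totalDegree ≤ k + 1 :=
  totalDegree_finsetSum_le fun c _ =>
    totalDegree_X_sub_C_mul_le (totalDegree_coneInt_le a 0 (h c)) c _

/-- On a convex set through `a`, the gradient of the potential has the same components as the
field along directions `t` such that the curl vanishes suitably. -/
theorem evalAt_sub_dirD_potential (a : E3) (v : VField) (t x : E3) :
    evalAt x (dotVec v t - dirD t (potential a v)) =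
      evalAt x (coneInt a 1 (dotVec (curlF v) (cross (x - a) t))) := by
  have h1 : dotVec v t - dirD t (potential a v) =
      ∑ b, t b • (v b - pderiv b (potential a v)) := by
    rw [dotVec_eq, dirD_eq, ← Finset.sum_sub_distrib]
    simp only [smul_sub]
  rw [h1, ← dirD_dotVec_sub]
  have hadd : ∀ p q : Poly3, coneInt a 1 (p + q) = coneInt a 1 p + coneInt a 1 q := fun p q => by
    simp [coneInt]
  simp only [sub_pderiv_potential, dotVec_eq, dirD_eq, Fin.sum_univ_three, map_add,
    Derivation.map_smul, coneInt_sub, hadd, coneInt_smul, evalAt_add, evalAt_smul, evalAt_mul,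
    evalAt_sub, evalAt_X, evalAt_C, PiLp.sub_apply]
  ring

/-- A vector potential along rays from `a`. -/
def vectorPotential (a : E3) (w : VField) : VField :=
  ![coneInt a 1 (w 1) * (X 2 - C (a 2)) - coneInt a 1 (w 2) * (X 1 - C (a 1)),
    coneInt a 1 (w 2) * (X 0 - C (a 0)) - coneInt a 1 (w 0) * (X 2 - C (a 2)),
    coneInt a 1 (w 0) * (X 1 - C (a 1)) - coneInt a 1 (w 1) * (X 0 - C (a 0))]

/-- With W the cone integral of w, the potential is W × (x - a), whose curl is 2W + ((x - a)·∇)W -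
(x - a) div W. The last term vanishes, and the others add up to w by Euler's identity with s = 1. -/
theorem curlF_vectorPotential {a : E3} {w : VField} (h : divF w = 0) :
    curlF (vectorPotential a w) = w := by
  have hd : ∑ c, pderiv c (coneInt a 1 (w c)) = 0 := by
    simp only [pderiv_coneInt, ← coneInt_sum]
    rw [show ∑ c, pderiv c (w c) = divF w from rfl, h, coneInt_zero]
  rw [Fin.sum_univ_three] at hd
  have he : ∀ b, ∑ c, (X c - C (a c)) * pderiv c (coneInt a 1 (w b))
      + (2 : Poly3) * coneInt a 1 (w b) = w b := by
    intro b
    have := euler_coneInt a 1 (w b)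
    rw [MvPolynomial.smul_eq_C_mul] at this
    convert this using 3
    rw [show ((1 : ℕ) : ℝ) + 1 = 2 by norm_num]
    exact (map_ofNat C 2).symm
  simp only [Fin.sum_univ_three] at he
  funext b
  fin_cases b
  · simp only [curlF, vectorPotential, Matrix.cons_val_zero, Matrix.cons_val_one, Matrix.cons_val,
      map_sub, pderiv_mul, pderiv_C, pderiv_X, Pi.single_apply]
    simp
    linear_combination he 0 - (X 0 - C (a 0)) * hd
  · simp only [curlF, vectorPotential, Matrix.cons_val_zero, Matrix.cons_val_one, Matrix.cons_val,
      map_sub, pderiv_mul, pderiv_C, pderiv_X, Pi.single_apply]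
    simp
    linear_combination he 1 - (X 1 - C (a 1)) * hd
  · simp only [curlF, vectorPotential, Matrix.cons_val_zero, Matrix.cons_val_one, Matrix.cons_val,
      map_sub, pderiv_mul, pderiv_C, pderiv_X, Pi.single_apply]
    simp
    linear_combination he 2 - (X 2 - C (a 2)) * hd

theorem totalDegree_vectorPotential_le {a : E3} {w : VField} {k : ℕ}
    (h : ∀ c, (w c).totalDegree ≤ k) (b : Fin 3) :
    (vectorPotential a w b).totalDegree ≤ k + 1 := by
  have h1 : ∀ c d, (coneInt a 1 (w c) * (X d - C (a d))).totalDegree ≤ k + 1 := fun c d => by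
    rw [mul_comm]
    exact totalDegree_X_sub_C_mul_le (totalDegree_coneInt_le a 1 (h c)) d _
  fin_cases b <;> exact (totalDegree_sub _ _).trans (max_le (h1 _ _) (h1 _ _))

theorem vectorPotential_vanish {a : E3} {w : VField} {N : ℕ} (h : ∀ c, w c ∈ vanish {a} N)
    (b : Fin 3) : vectorPotential a w b ∈ vanish {a} (N + 1) := by
  have h1 : ∀ c d, coneInt a 1 (w c) * (X d - C (a d)) ∈ vanish {a} (N + 1) := fun c d => by
    refine mul_vanish (coneInt_vanish (h c)) (mem_vanish_one.2 fun x hx => ?_)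
    obtain rfl : x = a := hx
    simp
  fin_cases b <;> exact Submodule.sub_mem _ (h1 _ _) (h1 _ _)

end Poincare

end CurlFE

end

noncomputable section

namespace CurlFE

/-! ### The divergence maps bubble fields onto bubble functions of mean zero -/

section DivStability

variable (T : Tetra)

/-- Distances become upper bounds for exponents and sums of two exponents, so that node conditions
are linear inequalities. -/
theorem mem_bubbleNodes_univ_iff {α : Fin 4 → ℕ} {m : ℤ} {r : SmoothParam} :
    α ∈ bubbleNodes Finset.univ m r ↔ ((α 0 + α 1 + α 2 + α 3 : ℕ) : ℤ) = m ∧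
      (∀ i, r.v + α i < m) ∧ (∀ i j, i ≠ j → r.e + α i + α j < m) ∧ ∀ i, r.f < α i := by
  have hc : ∀ G : Finset (Fin 4), ∑ i ∈ Gᶜ, α i + ∑ i ∈ G, α i = α 0 + α 1 + α 2 + α 3 := by
    intro G
    rw [Finset.sum_compl_add_sum, Fin.sum_univ_four]
  constructor
  · rintro ⟨-, h1, h2⟩
    rw [Fin.sum_univ_four] at h1
    refine ⟨h1, fun i => ?_, fun i j hij => ?_, fun i => ?_⟩
    · have h3 := h2 {i} (Finset.singleton_nonempty i) (singleton_ssubset_univ i)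
      have h4 := hc {i}
      rw [Finset.sum_singleton] at h4
      simp only [Finset.card_singleton, SmoothParam.atDim, Nat.sub_self, if_true] at h3
      omega
    · obtain ⟨e, he⟩ := exists_edgeSet_eq hij
      have h3 := h2 _ (edgeSet_nonempty e) (edgeSet_ssubset_univ e)
      have h4 := hc (edgeSet e)
      rw [card_edgeSet] at h3
      rw [he, Finset.sum_pair hij] at h4
      rw [he] at h3
      rw [show r.atDim (2 - 1) = r.e from rfl] at h3
      omega
    · have h3 := h2 _ (faceSet_nonempty i) (faceSet_ssubset_univ i)
      rw [card_faceSet, compl_faceSet, Finset.sum_singleton] at h3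
      simpa [SmoothParam.atDim] using h3
  · rintro ⟨h1, h2, h3, h4⟩
    refine ⟨fun i hi => absurd (Finset.mem_univ i) hi, by rw [Fin.sum_univ_four]; exact h1,
      forall_proper_subset (Q := fun G s => s < ((∑ i ∈ Gᶜ, α i : ℕ) : ℤ)) r ?_ ?_ ?_⟩
    · intro i _
      have h5 := hc {i}
      rw [Finset.sum_singleton] at h5
      have := h2 i
      omega
    · intro e _
      have h5 := hc (edgeSet e)
      rw [edgeSet, Finset.sum_pair e.2.ne] at h5
      have := h3 _ _ e.2.ne
      rw [edgeSet]
      omega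
    · intro o _
      rw [compl_faceSet, Finset.sum_singleton]
      exact h4 o

/-- The divergence-conforming bubble fields as a subspace. -/
def divBubbleSubmodule (F : TetFrames T) (m : ℤ) (r : SmoothParam) : Submodule ℝ VField where
  carrier := divBubble T F m r
  add_mem' := fun {u w} hu hw => ⟨fun c => Submodule.add_mem _ (hu.1 c) (hw.1 c), fun o x hx => by
    rw [dotVec_add_left, evalAt_add, hu.2 o x hx, hw.2 o x hx, add_zero]⟩
  zero_mem' := ⟨fun _ => Submodule.zero_mem _, fun o x _ => by simp [dotVec]⟩
  smul_mem' := fun a w hw => ⟨fun c => Submodule.smul_mem _ a (hw.1 c), fun o x hx => by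
    rw [dotVec_smul_left, evalAt_smul, hw.2 o x hx, mul_zero]⟩

/-- The divergence as a linear map. -/
def divLin : VField →ₗ[ℝ] Poly3 where
  toFun := divF
  map_add' := divF_add
  map_smul' := divF_smul

/-- The barycentric forms that represent divergences of bubble fields. -/
def divRange (F : TetFrames T) (m : ℤ) (r : SmoothParam) : Submodule ℝ (MvPolynomial (Fin 4) ℝ) :=
  ((divBubbleSubmodule T F m r).map divLin).comap (phi T).toLinearMap

/-- The Bernstein form `X^β / β!`. -/
def dividedMonomial (β : Fin 4 →₀ ℕ) : MvPolynomial (Fin 4) ℝ :=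
  monomial β ((∏ i, ((β i).factorial : ℝ))⁻¹)

/-- With division by β! derivatives shift exponents without any factor, and every normalised
monomial has the same value under `lam Finset.univ`. -/
theorem pderiv_dividedMonomial (β : Fin 4 →₀ ℕ) (i : Fin 4) :
    pderiv i (dividedMonomial (β + Finsupp.single i 1)) = dividedMonomial β := by
  rw [dividedMonomial, pderiv_monomial, dividedMonomial]
  congr 1
  · rw [add_tsub_cancel_right]
  · have h : ∏ l, (((β + Finsupp.single i 1 : Fin 4 →₀ ℕ) l).factorial : ℝ) =
        (β i + 1) * ∏ l, ((β l).factorial : ℝ) := by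
      rw [← Finset.mul_prod_erase _ _ (Finset.mem_univ i),
        ← Finset.mul_prod_erase _ (fun l => ((β l).factorial : ℝ)) (Finset.mem_univ i), ← mul_assoc]
      congr 1
      · simp [Nat.factorial_succ]
      · refine Finset.prod_congr rfl fun l hl => ?_
        simp [(Finset.ne_of_mem_erase hl).symm]
    have h2 : (∏ l, ((β l).factorial : ℝ)) ≠ 0 :=
      Finset.prod_ne_zero_iff.2 fun l _ => by positivity
    rw [h]
    simp only [Finsupp.add_apply, Finsupp.single_eq_same, Nat.cast_add, Nat.cast_one]
    have h3 : (β i + 1 : ℝ) ≠ 0 := by positivity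
    field_simp

theorem baryDer_vertex (P : MvPolynomial (Fin 4) ℝ) (a b : Fin 4) :
    baryDer (coordLin T (T b - T a)) P = pderiv b P - pderiv a P := by
  simp only [baryDer, coordLin_vertex_sub, sub_smul, ite_smul, one_smul, zero_smul,
    Finset.sum_sub_distrib, Finset.sum_ite_eq', Finset.mem_univ, if_true]

/-- The field is (T j - T i) λ^β / β!. On a face that contains both vertices its direction is
tangential; on the other faces λ_i or λ_j vanishes. Its divergence is a derivative along an edge, a
difference of two neighbouring monomials. -/
theorem dividedMonomial_sub_mem (F : TetFrames T) {m : ℤ} {r : SmoothParam} {δ : Fin 4 →₀ ℕ}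
    {i j : Fin 4}
    (h : ⇑(δ + Finsupp.single i 1 + Finsupp.single j 1 : Fin 4 →₀ ℕ) ∈ bubbleNodes Finset.univ m r) :
    dividedMonomial (δ + Finsupp.single i 1) - dividedMonomial (δ + Finsupp.single j 1) ∈
      divRange T F m r := by
  set β := δ + Finsupp.single i 1 + Finsupp.single j 1 with hβ
  have hb : phi T (dividedMonomial β) ∈ bubble T Finset.univ m r := by
    rw [dividedMonomial, phi_monomial]
    exact Submodule.smul_mem _ _ (Submodule.subset_span ⟨_, h, rfl⟩)
  refine ⟨fun c => (T j - T i) c • phi T (dividedMonomial β), ⟨fun c => Submodule.smul_mem _ _ hb, ?_⟩, ?_⟩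
  · intro o x hx
    have h1 : dotVec (fun c => (T j - T i) c • phi T (dividedMonomial β)) (F.fn o) =
        (inner ℝ (F.fn o) (T j - T i) : ℝ) • phi T (dividedMonomial β) := by
      rw [dotVec_eq, inner_eq, Fin.sum_univ_three]
      module
    rw [h1, evalAt_smul]
    by_cases ho : i ≠ o ∧ j ≠ o
    · rw [F.fn_normal o j i ho.2 ho.1, zero_mul]
    · rw [dividedMonomial, phi_monomial, evalAt_smul,
        evalAt_bernstein_eq_zero T (S := faceSet o) hx ⟨o, by simp [mem_faceSet], ?_⟩, mul_zero, mul_zero]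
      rw [hβ]
      simp only [Finsupp.add_apply, Finsupp.single_apply]
      by_cases h2 : i = o
      · simp [h2]
      · have : j = o := by tauto
        simp [this]
  · have h1 : divLin (fun c => (T j - T i) c • phi T (dividedMonomial β)) =
        dirD (T j - T i) (phi T (dividedMonomial β)) := by
      rw [dirD_eq]
      change ∑ c, pderiv c (_ • _) = _
      exact Finset.sum_congr rfl fun c _ => Derivation.map_smul _ _ _
    rw [h1, dirD_phi, baryDer_vertex, AlgHom.toLinearMap_apply]
    congr 2
    · rw [hβ, pderiv_dividedMonomial]
    · rw [hβ, add_right_comm, pderiv_dividedMonomial]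

/-- A unit added at the smallest exponent raises degree and smoothness by one at the same time. This
is the node of the bubble field that moves a unit to i; the edge and face conditions use
`IsDivParam`. -/
theorem add_single_mem_bubbleNodes {k : ℕ} {r : SmoothParam} (hr : r.IsDivParam)
    (hk : 2 ≤ k) (hk2 : 2 * r.v + 1 ≤ k) {γ : Fin 4 →₀ ℕ}
    (h : ⇑γ ∈ bubbleNodes Finset.univ ((k : ℤ) - 1) (r.shift (-1))) {i : Fin 4}
    (hi : ∀ l, γ i ≤ γ l) :
    ⇑(γ + Finsupp.single i 1 : Fin 4 →₀ ℕ) ∈ bubbleNodes Finset.univ k r := by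
  rw [mem_bubbleNodes_univ_iff] at h ⊢
  simp only [SmoothParam.shift] at h
  obtain ⟨h1, h2, h3, h4⟩ := h
  -- The exponents add up to k - 1, and all of them are at least γ i.
  have hv : ∀ j, j ≠ i → 3 * (γ i : ℤ) + γ j ≤ k - 1 := by
    have := hi 0
    have := hi 1
    have := hi 2
    have := hi 3
    intro j hj
    clear h2 h3 h4 hi hr
    fin_cases i <;> fin_cases j <;> first | exact absurd rfl hj | (simp at *; omega)
  have hi4 : 4 * (γ i : ℤ) ≤ k - 1 := by
    obtain ⟨j, hj⟩ := exists_ne i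
    have := hv j hj
    have := hi j
    omega
  -- The node condition at the edge without i and j. If r.e ≥ 2 r.f + 1, it gives γ j > r.f because
  -- γ i ≤ γ j; for r.f = -1 the face condition is trivial.
  have he : ∀ j, j ≠ i → r.e ≤ γ i + γ j := by
    have e01 := h3 0 1 (by decide)
    have e02 := h3 0 2 (by decide)
    have e03 := h3 0 3 (by decide)
    have e12 := h3 1 2 (by decide)
    have e13 := h3 1 3 (by decide)
    have e23 := h3 2 3 (by decide)
    intro j hj
    clear h2 h3 h4 hi hr hv hi4
    fin_cases i <;> fin_cases j <;> first | exact absurd rfl hj | (simp at *; omega)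
  have hs : ∑ l, (Finsupp.single i 1 : Fin 4 →₀ ℕ) l = 1 := by simp [Finsupp.single_apply]
  rw [Fin.sum_univ_four] at hs
  have hsi : ∀ l, l ≠ i → (Finsupp.single i 1 : Fin 4 →₀ ℕ) l = 0 := fun l hl =>
    Finsupp.single_eq_of_ne hl
  have hpair : ∀ j, j ≠ i → r.e + γ i + 1 + γ j < k := by
    intro j hj
    have := h2 j
    have := h3 i j hj.symm
    have := hv j hj
    unfold SmoothParam.IsDivParam at hr
    omega
  simp only [Finsupp.add_apply]
  refine ⟨by push_cast at h1 ⊢; omega, fun l => ?_, fun l l' hl => ?_, fun l => ?_⟩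
  · by_cases hli : l = i
    · subst hli
      rw [Finsupp.single_eq_same]
      push_cast
      omega
    · rw [hsi l hli]
      have := h2 l
      omega
  · by_cases hli : l = i
    · subst hli
      rw [Finsupp.single_eq_same, hsi l' hl.symm]
      have := hpair l' hl.symm
      push_cast
      omega
    · by_cases hli' : l' = i
      · subst hli'
        rw [Finsupp.single_eq_same, hsi l hli]
        have := hpair l hli
        push_cast
        omega
      · rw [hsi l hli, hsi l' hli']
        have := h3 l l' hl
        omega
  · by_cases hli : l = i
    · subst hli
      rw [Finsupp.single_eq_same]
      have := h4 l
      push_cast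
      omega
    · rw [hsi l hli]
      have := he l hli
      have := hi l
      unfold SmoothParam.IsDivParam at hr
      omega

/-- The balanced lattice node of degree `K`. -/
def balancedNode (K : ℕ) : Fin 4 →₀ ℕ :=
  Finsupp.equivFunOnFinite.symm fun j => K / 4 + if (j : ℕ) < K % 4 then 1 else 0

/-- A walk on the lattice: as long as the node is not balanced, a unit is moved from a larger
exponent to the smallest one. Each move changes the monomial by the divergence of a bubble field,
and the quantity bounded by `M` decreases. -/
theorem dividedMonomial_sub_balanced_mem (F : TetFrames T) {k : ℕ} {r : SmoothParam}
    (hr : r.IsDivParam) (hk : 2 ≤ k) (hk2 : 2 * r.v + 1 ≤ k) (M : ℕ) : ∀ γ : Fin 4 →₀ ℕ,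
    ⇑γ ∈ bubbleNodes Finset.univ ((k : ℤ) - 1) (r.shift (-1)) →
    ∑ l, (2 * γ l ^ 2 + (l : ℕ) * γ l) < M →
    dividedMonomial γ - dividedMonomial (balancedNode (k - 1)) ∈ divRange T F k r := by
  induction M with
  | zero => exact fun γ _ h => absurd h (Nat.not_lt_zero _)
  | succ M ih =>
    intro γ hγ hM
    -- The first index with the smallest exponent; taking the first makes the end of the walk
    -- unique.
    obtain ⟨i, hi, hi'⟩ : ∃ i, (∀ l, γ i ≤ γ l) ∧ ∀ l, l < i → γ i < γ l := by
      obtain ⟨i₀, -, h0⟩ := Finset.exists_min_image Finset.univ (fun l => γ l) ⟨0, Finset.mem_univ _⟩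
      obtain ⟨i, hi, hmin⟩ := Finset.exists_min_image
        (Finset.univ.filter fun i => ∀ l, γ i ≤ γ l) (fun i => i) ⟨i₀, by simpa using h0⟩
      simp only [Finset.mem_filter, Finset.mem_univ, true_and] at hi hmin
      refine ⟨i, hi, fun l hl => lt_of_le_of_ne (hi l) fun he => ?_⟩
      exact absurd (hmin l fun l' => he ▸ hi l') (not_le.2 hl)
    have hnode := add_single_mem_bubbleNodes hr hk hk2 hγ hi
    by_cases hj : ∃ j, γ i + 2 ≤ γ j ∨ (γ j = γ i + 1 ∧ i < j)
    · obtain ⟨j, hj⟩ := hj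
      have hij : i ≠ j := by
        rintro rfl
        omega
      obtain ⟨δ, rfl⟩ : ∃ δ, γ = δ + Finsupp.single j 1 :=
        ⟨γ - Finsupp.single j 1, (tsub_add_cancel_of_le
          (Finsupp.single_le_iff.2 (by omega))).symm⟩
      rw [add_right_comm] at hnode
      have h1 := dividedMonomial_sub_mem T F hnode
      have h2 := ih (δ + Finsupp.single i 1) ?_ ?_
      · rw [← sub_sub_sub_cancel_left _ _ (dividedMonomial (δ + Finsupp.single i 1))]
        have := Submodule.sub_mem _ h2 h1
        convert this using 1
      · rw [mem_bubbleNodes_univ_iff] at hnode ⊢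
        simp only [Finsupp.add_apply, SmoothParam.shift] at hnode ⊢
        obtain ⟨n1, n2, n3, n4⟩ := hnode
        have hs : ∀ l, (Finsupp.single j 1 : Fin 4 →₀ ℕ) l ≤ 1 := fun l => by
          rw [Finsupp.single_apply]
          split_ifs <;> simp
        refine ⟨?_, fun l => ?_, fun l l' hl => ?_, fun l => ?_⟩
        · have h5 : ∑ l, (Finsupp.single j 1 : Fin 4 →₀ ℕ) l = 1 := by simp [Finsupp.single_apply]
          rw [Fin.sum_univ_four] at h5
          push_cast at n1 ⊢
          omega
        · have := n2 l
          push_cast at this ⊢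
          omega
        · have := n3 l l' hl
          push_cast at this ⊢
          omega
        · have := n4 l
          have := hs l
          push_cast at *
          omega
      · simp only [Finsupp.add_apply] at hj hM ⊢
        -- The quadratic part decreases by at least 4 if the exponents differ by 2 or more, while
        -- the linear part changes by at most 3. If they differ by 1, the quadratic part stays and
        -- the linear part decreases because i < j.
        have key : ∀ a : Fin 4, ∑ l, (2 * (δ l + (Finsupp.single a 1 : Fin 4 →₀ ℕ) l) ^ 2 +
            (l : ℕ) * (δ l + (Finsupp.single a 1 : Fin 4 →₀ ℕ) l)) =
            ∑ l, (2 * δ l ^ 2 + (l : ℕ) * δ l) + (4 * δ a + 2 + a) := by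
          intro a
          have h6 : ∀ l, 2 * (δ l + (Finsupp.single a 1 : Fin 4 →₀ ℕ) l) ^ 2 +
            (l : ℕ) * (δ l + (Finsupp.single a 1 : Fin 4 →₀ ℕ) l) = (2 * δ l ^ 2 + (l : ℕ) * δ l) +
              (if l = a then 4 * δ l + 2 + l else 0) := by
            intro l
            rw [Finsupp.single_apply]
            by_cases h : a = l
            · subst h
              simp
              ring
            · simp [h, Ne.symm h]
          simp only [h6, Finset.sum_add_distrib, Finset.sum_ite_eq', Finset.mem_univ, if_true]
        rw [key] at hM ⊢
        simp only [Finsupp.single_eq_same, Finsupp.single_apply, if_neg hij.symm] at hj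
        have hi4 := i.2
        rcases hj with hj | ⟨hj, hlt⟩
        · omega
        · have : (i : ℕ) < j := hlt
          omega
    -- No move is left: all exponents equal γ i, except that those at the indices before i are
    -- larger by one. This is the balanced node.
    · push Not at hj
      have hbal : γ = balancedNode (k - 1) := by
        rw [mem_bubbleNodes_univ_iff] at hγ
        have h1 := hγ.1
        have hl : ∀ l, γ l = γ i + if l < i then 1 else 0 := by
          intro l
          have := hj l
          have := hi l
          split_ifs with h
          · have := hi' l h
            omega
          · by_contra h3
            have h4 : i ≠ l := by
              rintro rfl
              simp at h3
            have := this
            have h5 := (hj l).2 (by omega)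
            exact h4 (le_antisymm (not_lt.1 h) h5)
        rw [hl 0, hl 1, hl 2, hl 3] at h1
        have hsum : ((if (0 : Fin 4) < i then 1 else 0) + (if (1 : Fin 4) < i then 1 else 0) +
            (if (2 : Fin 4) < i then 1 else 0) + (if (3 : Fin 4) < i then 1 else 0) : ℕ) = i := by
          clear * -
          revert i
          decide
        have hi4 := i.2
        ext l
        rw [hl l, balancedNode]
        simp only [Finsupp.equivFunOnFinite_symm_apply_apply]
        have hK : k - 1 = 4 * γ i + i := by
          push_cast at h1
          zify at hsum
          omega
        have h8 : (l < i) ↔ (l : ℕ) < (k - 1) % 4 := by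
          rw [show (k - 1) % 4 = i by omega]
          exact Iff.rfl
        simp only [h8]
        congr 1
        omega
      rw [hbal, sub_self]
      exact Submodule.zero_mem _

/-- Modulo divergences all normalised monomials equal the balanced one, so the form is congruent to
`lam Finset.univ P` times this monomial. The mean is the only obstruction. -/
theorem mem_divRange_of_lam (F : TetFrames T) {k : ℕ} {r : SmoothParam}
    (hr : r.IsDivParam) (hk : 1 ≤ k) (hk2 : 2 * r.v + 1 ≤ k) {P : MvPolynomial (Fin 4) ℝ}
    (hP : P.IsHomogeneous (k - 1))
    (hs : ∀ β : Fin 4 →₀ ℕ, coeff β P ≠ 0 →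
      ⇑β ∈ bubbleNodes Finset.univ ((k : ℤ) - 1) (r.shift (-1)))
    (h0 : lam Finset.univ P = 0) : P ∈ divRange T F k r := by
  -- For k = 1 the form is a constant, and mean zero already makes it zero.
  rcases Nat.lt_or_ge k 2 with h2 | h2
  · have hk1 : k - 1 = 0 := by omega
    rw [hk1, ← totalDegree_zero_iff_isHomogeneous, totalDegree_eq_zero_iff_eq_C] at hP
    rw [hP, ← monomial_zero', lam_monomial] at h0
    simp at h0
    rw [hP, h0, C_0]
    exact Submodule.zero_mem _
  · have hne : ∀ β : Fin 4 →₀ ℕ, (∏ i, ((β i).factorial : ℝ)) ≠ 0 := fun β =>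
      Finset.prod_ne_zero_iff.2 fun l _ => by positivity
    have h1 : lam Finset.univ P = ∑ β ∈ P.support, coeff β P * ∏ i, ((β i).factorial : ℝ) := by
      conv_lhs => rw [P.as_sum, map_sum]
      refine Finset.sum_congr rfl fun β _ => ?_
      rw [lam_monomial, if_pos fun i hi => absurd (Finset.mem_univ i) hi]
    have h3 : P = ∑ β ∈ P.support, (coeff β P * ∏ i, ((β i).factorial : ℝ)) •
        (dividedMonomial β - dividedMonomial (balancedNode (k - 1))) := by
      simp only [smul_sub, Finset.sum_sub_distrib, ← Finset.sum_smul]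
      rw [← h1, h0, zero_smul, sub_zero]
      conv_lhs => rw [P.as_sum]
      refine Finset.sum_congr rfl fun β _ => ?_
      rw [dividedMonomial, smul_monomial, smul_eq_mul, mul_assoc, mul_inv_cancel₀ (hne β), mul_one]
    rw [h3]
    exact Submodule.sum_mem _ fun β hβ => Submodule.smul_mem _ _
      (dividedMonomial_sub_balanced_mem T F hr h2 hk2 _ β (hs β (mem_support_iff.1 hβ))
        (Nat.lt_succ_self _))

/-- Divergence theorem: `lam_baryDer_univ` writes the mean of the divergence as a sum over the
faces, each term proportional to the flux through that face. -/
theorem divF_eq_phi {w : VField} {k : ℕ} (hw : ∀ c, (w c).totalDegree ≤ k) (F : TetFrames T)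
    (h0 : ∀ o, faceInt T o (dotVec w (F.fn o)) = 0) :
    ∃ P : MvPolynomial (Fin 4) ℝ, P.IsHomogeneous (k - 1) ∧ phi T P = divF w ∧
      lam Finset.univ P = 0 := by
  choose P hP hPw using fun c => exists_phi_eq T (hw c)
  refine ⟨∑ c, baryDer (coordLin T (EuclideanSpace.single c 1)) (P c),
    IsHomogeneous.sum _ _ _ fun c _ => baryDer_isHomogeneous (hP c) _, ?_, ?_⟩
  · rw [map_sum]
    refine Finset.sum_congr rfl fun c _ => ?_
    rw [← dirD_phi, hPw, dirD_single]
  · rw [map_sum]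
    simp only [lam_baryDer_univ (sum_coordLin T _)]
    rw [Finset.sum_neg_distrib, Finset.sum_comm, neg_eq_zero]
    refine Finset.sum_eq_zero fun o _ => ?_
    obtain ⟨h, hne, hh⟩ := exists_height T F o
    have h1 : dotVec w (F.fn o) = phi T (h • ∑ c, coordLin T (EuclideanSpace.single c 1) o • P c) := by
      rw [map_smul, map_sum, dotVec_eq, Finset.smul_sum]
      refine Finset.sum_congr rfl fun c _ => ?_
      rw [map_smul, hPw, smul_smul, ← hh, EuclideanSpace.inner_single_right]
      simp
    have h2 := h0 o
    rw [h1, faceInt_phi T (m := k) _ o, map_smul, map_sum] at h2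
    · have h3 : faceJac T o / ((k + 2).factorial : ℝ) ≠ 0 :=
        div_ne_zero (faceJac_pos T o).ne' (by positivity)
      have h4 := (mul_eq_zero.1 h2).resolve_left h3
      rw [smul_eq_mul] at h4
      have h5 := (mul_eq_zero.1 h4).resolve_left hne
      simpa using h5
    · rw [smul_eq_C_mul, ← zero_add k]
      refine (isHomogeneous_C _ _).mul (IsHomogeneous.sum _ _ _ fun c _ => ?_)
      rw [smul_eq_C_mul, ← zero_add k]
      exact (isHomogeneous_C _ _).mul (hP c)

/-- The divergence maps the bubble fields onto the bubble functions of mean zero. -/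
theorem exists_divBubble_divF_eq (F : TetFrames T) {k : ℕ} {r : SmoothParam}
    (hr : r.IsDivParam) (hk : 1 ≤ k) (hk2 : 2 * r.v + 1 ≤ k) {w : VField}
    (hw : ∀ c, (w c).totalDegree ≤ k) (h0 : ∀ o, faceInt T o (dotVec w (F.fn o)) = 0)
    (hv : ∀ i, divF w ∈ vanish (hull T {i}) ((r.v + 1).toNat - 1))
    (he : ∀ e, divF w ∈ vanish (hull T (edgeSet e)) ((r.e + 1).toNat - 1))
    (hf : ∀ o, divF w ∈ vanish (hull T (faceSet o)) ((r.f + 1).toNat - 1)) :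
    ∃ u ∈ divBubble T F k r, divF u = divF w := by
  obtain ⟨P, hP, hPw, hl⟩ := divF_eq_phi T hw F h0
  have hmem : P ∈ divRange T F k r := by
    refine mem_divRange_of_lam T F hr hk hk2 hP (fun β hβ => ?_) hl
    refine ⟨fun i hi => absurd (Finset.mem_univ i) hi, ?_,
      forall_proper_subset (Q := fun G s => s < ((∑ i ∈ Gᶜ, β i : ℕ) : ℤ)) _ ?_ ?_ ?_⟩
    · have := hP hβ
      rw [Finsupp.weight_apply, Finsupp.sum_fintype _ _ (fun i => by simp)] at this
      simp only [Pi.one_apply, smul_eq_mul, mul_one] at this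
      omega
    · intro i _
      by_contra h
      refine hβ ((phi_vanish_iff T (Finset.singleton_nonempty i) hP).1 (hPw ▸ hv i) β ?_)
      simp only [SmoothParam.shift] at h
      omega
    · intro e _
      by_contra h
      refine hβ ((phi_vanish_iff T (edgeSet_nonempty e) hP).1 (hPw ▸ he e) β ?_)
      simp only [SmoothParam.shift] at h
      omega
    · intro o _
      by_contra h
      refine hβ ((phi_vanish_iff T (faceSet_nonempty o) hP).1 (hPw ▸ hf o) β ?_)
      simp only [SmoothParam.shift] at h
      omega
  obtain ⟨u, hu, hu'⟩ := hmem
  exact ⟨u, hu, hu'.trans hPw⟩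

end DivStability

end CurlFE

end

noncomputable section

namespace CurlFE

/-! ### Linearity of the degrees of freedom -/

section Linear

theorem tanProj_eq (n : E3) (w : VField) (c : Fin 3) : tanProj n w c =
    dotVec w (EuclideanSpace.single c 1 - (n c / inner ℝ n n) • n) := by
  rw [dotVec_sub_right, dotVec_smul, dotVec_single, tanProj, smul_eq_C_mul]

theorem inner_tangent_part (n : E3) (hn : n ≠ 0) (c : Fin 3) :
    inner ℝ n (EuclideanSpace.single c 1 - (n c / inner ℝ n n) • n) = (0 : ℝ) := by
  have h : (inner ℝ n n : ℝ) ≠ 0 := inner_self_ne_zero.2 hn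
  rw [inner_sub_right, real_inner_smul_right, div_mul_cancel₀ _ h, EuclideanSpace.inner_single_right]
  simp

theorem tanProj_add (n : E3) (u w : VField) : tanProj n (u + w) = tanProj n u + tanProj n w := by
  funext c
  simp only [tanProj_eq, dotVec_add_left, Pi.add_apply]

theorem tanProj_smul (n : E3) (a : ℝ) (w : VField) : tanProj n (a • w) = a • tanProj n w := by
  funext c
  simp only [tanProj_eq, dotVec_smul_left, Pi.smul_apply]

theorem tanProj_sub (n : E3) (u w : VField) : tanProj n (u - w) = tanProj n u - tanProj n w := by
  funext c
  simp only [tanProj_eq, dotVec_sub_left, Pi.sub_apply]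

/-- The scalar product with a fixed field as a linear map. -/
def fdotLin : VField →ₗ[ℝ] VField →ₗ[ℝ] Poly3 :=
  LinearMap.mk₂ ℝ fdot
    (fun u u' w => by simp [fdot, add_mul, Finset.sum_add_distrib])
    (fun a u w => by simp [fdot, Finset.smul_sum])
    (fun u w w' => by simp [fdot, mul_add, Finset.sum_add_distrib])
    (fun a u w => by simp [fdot, Finset.smul_sum])

theorem fdot_sub_left (u u' w : VField) : fdot (u - u') w = fdot u w - fdot u' w :=
  LinearMap.congr_fun (map_sub fdotLin u u') w

theorem fdot_add_left (u u' w : VField) : fdot (u + u') w = fdot u w + fdot u' w :=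
  LinearMap.congr_fun (map_add fdotLin u u') w

theorem evalAt_fdot (x : E3) (u w : VField) :
    evalAt x (fdot u w) = ∑ c, evalAt x (u c) * evalAt x (w c) := by
  simp [fdot, evalAt_sum]

/-- The zero values. -/
def DofData.zero : DofData :=
  ⟨0, 0, 0, 0, 0, 0, 0, 0, 0, 0, 0, 0, 0, 0⟩

variable {T : Tetra} {F : TetFrames T} {k : ℕ} {r1 r2 : SmoothParam} {u v : VField} {d : DofData}

theorem HasVertexDofs.sub {i : Fin 4} (hu : HasVertexDofs T r1 r2 u d i)
    (hv : HasVertexDofs T r1 r2 v d i) : HasVertexDofs T r1 r2 (u - v) DofData.zero i := by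
  refine ⟨fun β c h => ?_, fun β c h h' => ?_⟩
  · rw [Pi.sub_apply, partialD_sub, evalAt_sub, hu.1 β c h, hv.1 β c h, sub_self]
    rfl
  · rw [curlF_sub, Pi.sub_apply, partialD_sub, evalAt_sub, hu.2 β c h h', hv.2 β c h h', sub_self]
    rfl

theorem HasEdgeDofs.sub {e : TetEdge} (hu : HasEdgeDofs T F k r1 r2 u d e)
    (hv : HasEdgeDofs T F k r1 r2 v d e) : HasEdgeDofs T F k r1 r2 (u - v) DofData.zero e := by
  obtain ⟨u1, u2, u3, u4, u5, u6⟩ := hu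
  obtain ⟨v1, v2, v3, v4, v5, v6⟩ := hv
  refine ⟨fun q hq => ?_, fun i j h h' q hq => ?_, fun j h q hq => ?_, fun j h q hq => ?_,
    fun i j h h' q hq => ?_, fun i j h h' q hq => ?_⟩
  all_goals simp only [curlF_sub, dotVec_sub_left, iterate_dirD_sub, edgeMoment_sub_left]
  · rw [u1 q hq, v1 q hq, sub_self]
    rfl
  · rw [u2 i j h h' q hq, v2 i j h h' q hq, sub_self]
    rfl
  · rw [u3 j h q hq, v3 j h q hq, sub_self]
    rfl
  · rw [u4 j h q hq, v4 j h q hq, sub_self]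
    rfl
  · rw [u5 i j h h' q hq, v5 i j h h' q hq, sub_self]
    rfl
  · rw [u6 i j h h' q hq, v6 i j h h' q hq, sub_self]
    rfl

theorem HasFaceDofs.sub {o : Fin 4} (hu : HasFaceDofs T F k r1 r2 u d o)
    (hv : HasFaceDofs T F k r1 r2 v d o) : HasFaceDofs T F k r1 r2 (u - v) DofData.zero o := by
  obtain ⟨u1, u2, u3, u4⟩ := hu
  obtain ⟨v1, v2, v3, v4⟩ := hv
  refine ⟨fun p hp => ?_, fun j h q hq => ?_, fun q hq h0 => ?_, fun j h l q hq => ?_⟩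
  all_goals simp only [curlF_sub, dotVec_sub_left, iterate_dirD_sub, tanProj_sub, fdot_sub_left,
    sub_mul, faceInt_sub]
  · rw [u1 p hp, v1 p hp, sub_self]
    rfl
  · rw [u2 j h q hq, v2 j h q hq, sub_self]
    rfl
  · rw [u3 q hq h0, v3 q hq h0, sub_self]
    rfl
  · rw [u4 j h l q hq, v4 j h l q hq, sub_self]
    rfl

theorem HasCellDofs.sub (hu : HasCellDofs T F k r1 r2 u d)
    (hv : HasCellDofs T F k r1 r2 v d) : HasCellDofs T F k r1 r2 (u - v) DofData.zero := by
  refine ⟨fun q hq h0 => ?_, fun p hp => ?_⟩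
  all_goals simp only [curlF_sub, fdot_sub_left, ← cellLin_apply, map_sub]
  · rw [cellLin_apply, cellLin_apply, hu.1 q hq h0, hv.1 q hq h0, sub_self]
    rfl
  · rw [cellLin_apply, cellLin_apply, hu.2 p hp, hv.2 p hp, sub_self]
    rfl

theorem vecPoly_sub (hu : u ∈ VecPoly k) (hv : v ∈ VecPoly k) : u - v ∈ VecPoly k := fun c =>
  (totalDegree_sub _ _).trans (max_le (hu c) (hv c))

theorem vecPoly_add (hu : u ∈ VecPoly k) (hv : v ∈ VecPoly k) : u + v ∈ VecPoly k := fun c =>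
  (totalDegree_add _ _).trans (max_le (hu c) (hv c))

end Linear

/-! ### Uniqueness of the traces at vertices and on edges -/

section EdgeTraces

variable (T : Tetra)

/-- Derivatives of the curl of order below `max r1.v 0` are not prescribed separately; they are
combinations of derivatives of the field of order at most r1.v. -/
theorem vertex_vanish {r1 r2 : SmoothParam} {z : VField} {i : Fin 4}
    (h : HasVertexDofs T r1 r2 z DofData.zero i) :
    (∀ c, z c ∈ vanish (hull T {i}) (r1.v + 1).toNat) ∧
      ∀ c, curlF z c ∈ vanish (hull T {i}) (r2.v + 1).toNat := by
  rw [hull_singleton]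
  have h1 : ∀ c, z c ∈ vanish {T i} (r1.v + 1).toNat := fun c => by
    rw [mem_vanish_iff]
    intro β hβ x hx
    obtain rfl : x = T i := hx
    exact h.1 β c (by omega)
  refine ⟨h1, fun c => ?_⟩
  rw [mem_vanish_iff]
  intro β hβ x hx
  by_cases hm : max r1.v 0 ≤ (multiOrder β : ℤ)
  · obtain rfl : x = T i := hx
    exact h.2 β c hm (by omega)
  · exact mem_vanish_iff.1 (curlF_vanish h1 c) β (by omega) x hx

/-- A normal vector that completes the first edge normal. -/
def edgeNormalStar (F : TetFrames T) (e : TetEdge) : E3 := cross (edgeVec T e) (F.en1 e)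

theorem edgeVec_det_ne_zero (F : TetFrames T) (e : TetEdge) :
    det3 (edgeVec T e) (F.en1 e) (F.en2 e) ≠ 0 := by
  obtain ⟨a, h0, ha⟩ := exists_edge_scale T F e
  have h1 := edge_det_ne_zero T F e
  rw [ha, det3, real_inner_smul_left] at h1
  exact right_ne_zero_of_mul h1

theorem edgeStar_det_ne_zero (F : TetFrames T) (e : TetEdge) :
    det3 (edgeVec T e) (F.en1 e) (edgeNormalStar T F e) ≠ 0 := by
  rw [← det3_cycle, ← det3_cycle]
  refine inner_self_ne_zero.2 fun h => edgeVec_det_ne_zero T F e ?_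
  rw [← det3_cycle, ← det3_cycle, det3]
  change cross (edgeVec T e) (F.en1 e) = 0 at h
  rw [h, inner_zero_right]

theorem evalAt_iterate_iterate {Z : Set E3} {N : ℕ} {p : Poly3} (hp : p ∈ vanish Z N) (a b : E3)
    (i l : ℕ) (h : i + l < N) {x : E3} (hx : x ∈ Z) :
    evalAt x ((dirD a)^[i] ((dirD b)^[l] p)) = 0 :=
  evalAt_of_vanish (iterate_dirD_vanish (iterate_dirD_vanish hp b l) a i) (by omega) hx

/-- If the tangential and first normal component of a divergence-free field vanish on an edge, then
so does the derivative of the second normal component in the direction that completes the frame. -/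
theorem dirD_star_vanish (F : TetFrames T) {e : TetEdge} {w : VField} {Z : Set E3} {N M : ℕ}
    (hdiv : divF w ∈ vanish Z M) (hM : N - 1 ≤ M) (ht : dotVec w (edgeVec T e) ∈ vanish Z N)
    (h1 : dotVec w (F.en1 e) ∈ vanish Z N) :
    dirD (edgeNormalStar T F e) (dotVec w (F.en2 e)) ∈ vanish Z (N - 1) := by
  have h := smul_divF w (edgeVec T e) (F.en1 e) (F.en2 e)
  rw [← sub_eq_iff_eq_add'] at h
  rw [edgeNormalStar, ← h]
  exact Submodule.sub_mem _ (Submodule.smul_mem _ _ (vanish_mono hM hdiv))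
    (Submodule.add_mem _ (dirD_vanish ht _) (dirD_vanish h1 _))

/-- The moments settle the tangential and the first normal component completely. The divergence then
settles the derivative of w·n₂ along t × n₁, and only pure n₁-derivatives of w·n₂ need degrees of
freedom. -/
theorem edge_curl_vanish (F : TetFrames T) {e : TetEdge} {w : VField} {k : ℕ} {r : SmoothParam}
    (hr : r.IsDivParam) (hk : 2 * r.v + 1 ≤ k) (hw : ∀ c, (w c).totalDegree ≤ k)
    (hdiv : divF w = 0)
    (hv1 : ∀ c, w c ∈ vanish (hull T {e.1.1}) (r.v + 1).toNat)
    (hv2 : ∀ c, w c ∈ vanish (hull T {e.1.2}) (r.v + 1).toNat)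
    (hn2 : ∀ j : ℕ, (j : ℤ) ≤ r.e → ∀ q ∈ edgeTest (k - 2 * (r.v + 1) + j),
      edgeMoment T e ((dirD (F.en1 e))^[j] (dotVec w (F.en2 e))) q = 0)
    (ht : ∀ i j : ℕ, i ≤ j → (j : ℤ) ≤ r.e → ∀ q ∈ edgeTest (k - 2 * (r.v + 1) + j),
      edgeMoment T e ((dirD (F.en1 e))^[i] ((dirD (F.en2 e))^[j - i] (dotVec w (F.et e)))) q = 0)
    (hn1 : ∀ i j : ℕ, i ≤ j → (j : ℤ) ≤ r.e → ∀ q ∈ edgeTest (k - 2 * (r.v + 1) + j),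
      edgeMoment T e ((dirD (F.en1 e))^[i] ((dirD (F.en2 e))^[j - i] (dotVec w (F.en1 e)))) q = 0)
    (c : Fin 3) : w c ∈ vanish (hull T (edgeSet e)) (r.e + 1).toNat := by
  have hse : r.e ≤ r.v + 1 := by
    unfold SmoothParam.IsDivParam at hr
    omega
  have htot := fun t => totalDegree_dotVec_le hw t
  have t1 := edge_vanish_of_moments T (edgeVec_det_ne_zero T F e) (htot _) hk hse
    (dotVec_mem hv1 _) (dotVec_mem hv2 _) ht
  have n1 := edge_vanish_of_moments T (edgeVec_det_ne_zero T F e) (htot _) hk hse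
    (dotVec_mem hv1 _) (dotVec_mem hv2 _) hn1
  obtain ⟨a, ha, hta⟩ := exists_edge_scale T F e
  have t1' : dotVec w (edgeVec T e) ∈ vanish (hull T (edgeSet e)) (r.e + 1).toNat := by
    rw [hta, dotVec_smul] at t1
    have := Submodule.smul_mem _ a⁻¹ t1
    rwa [smul_smul, inv_mul_cancel₀ ha, one_smul] at this
  have hstar := dirD_star_vanish T F (e := e) (M := (r.e + 1).toNat)
    (by rw [hdiv]; exact Submodule.zero_mem _) (Nat.sub_le _ _) t1' n1
  have n2 : dotVec w (F.en2 e) ∈ vanish (hull T (edgeSet e)) (r.e + 1).toNat := by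
    refine edge_vanish_of_moments T (edgeStar_det_ne_zero T F e) (htot _) hk hse
      (dotVec_mem hv1 _) (dotVec_mem hv2 _) fun i j hij hj q hq => ?_
    -- Only n₁-derivatives: a degree of freedom. At least one derivative in the completing
    -- direction: zero on the edge by the divergence.
    rcases Nat.eq_or_lt_of_le hij with rfl | hlt
    · rw [Nat.sub_self]
      exact hn2 i hj q hq
    · obtain ⟨l, rfl⟩ := Nat.exists_eq_add_of_lt hlt
      refine edgeMoment_eq_zero T e (fun x hx => ?_) q
      rw [show i + l + 1 - i = l + 1 by omega, Function.iterate_succ_apply]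
      exact evalAt_iterate_iterate hstar _ _ _ _ (by push_cast at hj; omega) hx
  exact field_mem_of_frame (edgeVec_det_ne_zero T F e) t1' n1 n2 c

/-- Modulo the curl, direction of differentiation and component may be exchanged. -/
theorem dirD_dotVec_mem {W : Submodule ℝ Poly3} {v : VField} {a b : E3}
    (h : dirD a (dotVec v b) ∈ W) (hc : ∀ c, curlF v c ∈ W) : dirD b (dotVec v a) ∈ W := by
  rw [← sub_sub_cancel (dirD a (dotVec v b)) (dirD b (dotVec v a)), dirD_dotVec_sub]
  exact W.sub_mem h (dotVec_mem hc _)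

/-- Beyond v·n₁ few moments are needed. Exchanging direction and component modulo the curl gives the
n₁-derivatives of v·n₂ from v·n₁, and all normal derivatives of v·t from the tangential derivatives
of v·n₁ and v·n₂. What remains is v·t itself and the pure n₂-derivatives of v·n₂. -/
theorem edge_field_vanish (F : TetFrames T) {e : TetEdge} {z : VField} {k : ℕ}
    {r1 r2 : SmoothParam} (hr1 : r1.IsCurlParam) (hr12 : r2.GeOminusOne r1)
    (hk1 : 2 * r1.v + 1 ≤ k) (hz : ∀ c, (z c).totalDegree ≤ k + 1)
    (hv1 : ∀ c, z c ∈ vanish (hull T {e.1.1}) (r1.v + 1).toNat)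
    (hv2 : ∀ c, z c ∈ vanish (hull T {e.1.2}) (r1.v + 1).toNat)
    (hcurl : ∀ c, curlF z c ∈ vanish (hull T (edgeSet e)) (r2.e + 1).toNat)
    (ht : ∀ q ∈ edgeTest (k - 1 - 2 * r1.v), edgeMoment T e (dotVec z (F.et e)) q = 0)
    (hn1 : ∀ i j : ℕ, i ≤ j → (j : ℤ) ≤ r1.e → ∀ q ∈ edgeTest (k - 1 - 2 * r1.v + j),
      edgeMoment T e ((dirD (F.en1 e))^[i] ((dirD (F.en2 e))^[j - i] (dotVec z (F.en1 e)))) q = 0)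
    (hn2 : ∀ j : ℕ, (j : ℤ) ≤ r1.e → ∀ q ∈ edgeTest (k - 1 - 2 * r1.v + j),
      edgeMoment T e ((dirD (F.en2 e))^[j] (dotVec z (F.en2 e))) q = 0) :
    dotVec z (edgeVec T e) ∈ vanish (hull T (edgeSet e)) 1 ∧
      ∀ c, z c ∈ vanish (hull T (edgeSet e)) (r1.e + 1).toNat := by
  obtain ⟨hf1, hf2, hf3⟩ := hr1
  obtain ⟨-, he2, -⟩ := hr12
  have htot := fun t => totalDegree_dotVec_le hz t
  obtain ⟨a, ha, hta⟩ := exists_edge_scale T F e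
  have hN : (r1.e + 1).toNat - 1 ≤ (r2.e + 1).toNat := by omega
  have hcurl' : ∀ c, curlF z c ∈ vanish (hull T (edgeSet e)) ((r1.e + 1).toNat - 1) := fun c =>
    vanish_mono hN (hcurl c)
  have hcast : ((k + 1 : ℕ) : ℤ) - 2 * (r1.v + 1) = k - 1 - 2 * r1.v := by
    push_cast
    ring
  have t0 : dotVec z (edgeVec T e) ∈ vanish (hull T (edgeSet e)) 1 := by
    have h := edge_vanish_of_moments T (edgeVec_det_ne_zero T F e) (htot (F.et e)) (sv := r1.v)
      (se := 0) (by push_cast; omega) (by omega) (dotVec_mem hv1 _) (dotVec_mem hv2 _)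
      (fun i j hij hj q hq => by
        have hj0 : j = 0 := by exact_mod_cast le_antisymm hj (by positivity)
        subst hj0
        obtain rfl : i = 0 := by omega
        rw [hcast] at hq
        exact ht q (by simpa using hq))
    rw [hta, dotVec_smul] at h
    have := Submodule.smul_mem _ a⁻¹ h
    rwa [smul_smul, inv_mul_cancel₀ ha, one_smul] at this
  refine ⟨t0, ?_⟩
  have n1 : dotVec z (F.en1 e) ∈ vanish (hull T (edgeSet e)) (r1.e + 1).toNat :=
    edge_vanish_of_moments T (edgeVec_det_ne_zero T F e) (htot _) (sv := r1.v)
      (by push_cast; omega) (by omega) (dotVec_mem hv1 _) (dotVec_mem hv2 _)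
      (by rw [hcast]; exact hn1)
  have d12 : dirD (F.en1 e) (dotVec z (F.en2 e)) ∈
      vanish (hull T (edgeSet e)) ((r1.e + 1).toNat - 1) :=
    dirD_dotVec_mem (dirD_vanish n1 _) hcurl'
  have n2 : dotVec z (F.en2 e) ∈ vanish (hull T (edgeSet e)) (r1.e + 1).toNat := by
    refine edge_vanish_of_moments T (edgeVec_det_ne_zero T F e) (htot _) (sv := r1.v)
      (by push_cast; omega) (by omega) (dotVec_mem hv1 _) (dotVec_mem hv2 _)
      fun i j hij hj q hq => ?_
    rw [hcast] at hq
    rcases Nat.eq_zero_or_pos i with rfl | hi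
    · exact hn2 j hj q hq
    · obtain ⟨l, rfl⟩ := Nat.exists_eq_add_of_lt hi
      refine edgeMoment_eq_zero T e (fun x hx => ?_) q
      rw [Function.iterate_succ_apply, dirD_iterate_comm]
      exact evalAt_iterate_iterate d12 _ _ _ _ (by omega) hx
  have dt1 := dirD_dotVec_mem (dirD_vanish n1 (edgeVec T e)) hcurl'
  have dt2 := dirD_dotVec_mem (dirD_vanish n2 (edgeVec T e)) hcurl'
  have t1 : dotVec z (edgeVec T e) ∈ vanish (hull T (edgeSet e)) (r1.e + 1).toNat := by
    refine edge_vanish_of_normals T (edgeVec_det_ne_zero T F e) fun i l hil x hx => ?_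
    rcases Nat.eq_zero_or_pos l with rfl | hl
    · rcases Nat.eq_zero_or_pos i with rfl | hi
      · exact evalAt_of_vanish t0 le_rfl hx
      · obtain ⟨i, rfl⟩ := Nat.exists_eq_add_of_lt hi
        rw [Function.iterate_succ_apply, dirD_iterate_comm]
        exact evalAt_iterate_iterate dt1 _ _ _ _ (by omega) hx
    · obtain ⟨l, rfl⟩ := Nat.exists_eq_add_of_lt hl
      rw [Function.iterate_succ_apply]
      exact evalAt_iterate_iterate dt2 _ _ _ _ (by omega) hx
  exact field_mem_of_frame (edgeVec_det_ne_zero T F e) t1 n1 n2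

end EdgeTraces

end CurlFE

end

noncomputable section

namespace CurlFE

/-! ### Potentials in the plane of a face -/

section FaceGeometry

variable (T : Tetra)

theorem cross_eq_smul_normal {n a b : E3} (hn : n ≠ 0) (ha : inner ℝ n a = (0 : ℝ))
    (hb : inner ℝ n b = (0 : ℝ)) : ∃ μ : ℝ, cross a b = μ • n := by
  have h0 : (inner ℝ n n : ℝ) ≠ 0 := inner_self_ne_zero.2 hn
  refine ⟨inner ℝ n (cross a b) / inner ℝ n n, ?_⟩
  have h1 : (inner ℝ n n : ℝ) • cross a b = (inner ℝ n (cross a b) : ℝ) • n := by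
    rw [inner_eq] at ha hb
    apply E3_ext
    · simp only [PiLp.smul_apply, smul_eq_mul, inner_eq, cross_zero, cross_one, cross_two]
      linear_combination (n 1 * b 2 - n 2 * b 1) * ha + (-n 1 * a 2 + n 2 * a 1) * hb
    · simp only [PiLp.smul_apply, smul_eq_mul, inner_eq, cross_zero, cross_one, cross_two]
      linear_combination (-n 0 * b 2 + n 2 * b 0) * ha + (n 0 * a 2 - n 2 * a 0) * hb
    · simp only [PiLp.smul_apply, smul_eq_mul, inner_eq, cross_zero, cross_one, cross_two]
      linear_combination (n 0 * b 1 - n 1 * b 0) * ha + (-n 0 * a 1 + n 1 * a 0) * hb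
  rw [div_eq_inv_mul, mul_smul, ← h1, smul_smul, inv_mul_cancel₀ h0, one_smul]

/-- A polynomial that vanishes on a face vanishes on the plane of this face. -/
theorem evalAt_eq_zero_of_plane {o : Fin 4} {p : Poly3}
    (h : ∀ x ∈ hull T (faceSet o), evalAt x p = 0) {x : E3} (hx : T.coord o x = 0) :
    evalAt x p = 0 := by
  obtain ⟨P, hP, rfl⟩ := exists_phi_eq T le_rfl (p := p)
  rw [phi_eq_sum, evalAt_sum]
  refine Finset.sum_eq_zero fun β hβ => ?_
  have h1 : β o ≠ 0 := fun h0 => mem_support_iff.1 hβ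
    (coeff_eq_zero_of_phi T (faceSet_nonempty o) hP h β fun i hi => by
      obtain rfl : i = o := by simpa [mem_faceSet] using hi
      exact h0)
  rw [evalAt_smul, bernsteinPoly, evalAt_prod, Finset.prod_eq_zero (Finset.mem_univ o), mul_zero]
  rw [evalAt_pow, evalAt_bary, hx, zero_pow h1]

theorem convex_plane (o : Fin 4) : Convex ℝ {x | T.coord o x = 0} := by
  intro x hx y hy a b _ _ hab
  have hx' : T.coord o x = 0 := hx
  have hy' : T.coord o y = 0 := hy
  change T.coord o (a • x + b • y) = 0
  obtain rfl : a = 1 - b := by linarith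
  rw [show (1 - b) • x + b • y = AffineMap.lineMap x y b by
    rw [AffineMap.lineMap_apply_module], AffineMap.apply_lineMap, hx', hy',
    AffineMap.lineMap_same_apply]

theorem inner_normal_eq_zero (F : TetFrames T) {o : Fin 4} {d : E3} (hd : coordLin T d o = 0) :
    inner ℝ (F.fn o) d = (0 : ℝ) := by
  obtain ⟨h, -, h1⟩ := exists_height T F o
  rw [h1, hd, mul_zero]

/-- The tangential derivative of the potential agrees with the field where the normal component of
the curl vanishes. -/
theorem evalAt_dirD_potential_of_plane (F : TetFrames T) {o : Fin 4} {z : VField} {a : E3}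
    (ha : T.coord o a = 0) (hw : ∀ x ∈ hull T (faceSet o), evalAt x (dotVec (curlF z) (F.fn o)) = 0)
    {t : E3} (ht : coordLin T t o = 0) {x : E3} (hx : T.coord o x = 0) :
    evalAt x (dirD t (potential a z)) = evalAt x (dotVec z t) := by
  rw [eq_comm, ← sub_eq_zero, ← evalAt_sub, evalAt_sub_dirD_potential]
  have hxa : coordLin T (x - a) o = 0 := by rw [← coord_sub_eq, hx, ha, sub_zero]
  -- Both x - a and t are tangential, so the remainder of the homotopy formula sees only the normal
  -- component of the curl.
  obtain ⟨μ, hμ⟩ := cross_eq_smul_normal (F.fn_ne o) (inner_normal_eq_zero T F hxa)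
    (inner_normal_eq_zero T F ht)
  rw [hμ, dotVec_smul]
  refine coneInt_eq_zero_of_convex (convex_plane T o) (Z := {x | T.coord o x = 0}) ha
    (fun y hy => ?_) x hx
  rw [evalAt_smul, evalAt_eq_zero_of_plane T hw hy, mul_zero]

/-- The extension of the restriction of a polynomial to a plane, constant in normal direction. -/
def flatten (n a : E3) : Poly3 →ₐ[ℝ] Poly3 :=
  aeval fun c => X c - C (n c / inner ℝ n n) * linPoly n a

/-- The tangential part of a vector. -/
def tangentPart (n d : E3) : E3 := d - ((inner ℝ n d : ℝ) / inner ℝ n n) • n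

theorem inner_tangentPart {n : E3} (hn : n ≠ 0) (d : E3) :
    inner ℝ n (tangentPart n d) = (0 : ℝ) := by
  have h : (inner ℝ n n : ℝ) ≠ 0 := inner_self_ne_zero.2 hn
  rw [tangentPart, inner_sub_right, real_inner_smul_right, div_mul_cancel₀ _ h, sub_self]

theorem evalAt_flatten (n a x : E3) (p : Poly3) :
    evalAt x (flatten n a p) = evalAt (a + tangentPart n (x - a)) p := by
  induction p using MvPolynomial.induction_on with
  | C b => simp [flatten, MvPolynomial.algebraMap_eq]
  | add p q hp hq => simp [hp, hq]
  | mul_X p c hp =>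
    rw [map_mul, evalAt_mul, hp, evalAt_mul]
    congr 1
    simp only [flatten, aeval_X, evalAt_sub, evalAt_X, evalAt_mul, evalAt_C, evalAt_linPoly,
      tangentPart, PiLp.add_apply, PiLp.sub_apply, PiLp.smul_apply, smul_eq_mul]
    rw [real_inner_comm n (x - a)]
    ring

/-- A flattened function has only tangential derivatives. This is what makes all derivatives of a
flattened potential computable from the tangential trace of the field. -/
theorem dirD_flatten (n a d : E3) (p : Poly3) :
    dirD d (flatten n a p) = flatten n a (dirD (tangentPart n d) p) := by
  induction p using MvPolynomial.induction_on with
  | C b => simp [flatten, MvPolynomial.algebraMap_eq]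
  | add p q hp hq => simp [hp, hq]
  | mul_X p c hp =>
    have hX : ∀ (m : E3), dirD m (X c) = C (m c) := fun m => by
      simp [dirD_eq, pderiv_X, Pi.single_apply, smul_eq_C_mul]
    have : dirD d (flatten n a (X c)) = flatten n a (dirD (tangentPart n d) (X c)) := by
      rw [hX]
      simp only [flatten, aeval_X, dirD_sub, dirD_mul, hX, dirD_linPoly, dirD_C, zero_mul,
        add_zero, ← C_mul, ← C_sub]
      rw [← MvPolynomial.algebraMap_eq, AlgHom.commutes, MvPolynomial.algebraMap_eq]
      congr 1
      simp only [tangentPart, PiLp.sub_apply, PiLp.smul_apply, smul_eq_mul]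
      rw [real_inner_comm n d]
      ring
    rw [map_mul, dirD_mul, hp, this, dirD_mul, map_add, map_mul, map_mul]

theorem totalDegree_flatten_le (n a : E3) {p : Poly3} {k : ℕ} (h : p.totalDegree ≤ k) :
    (flatten n a p).totalDegree ≤ k := by
  refine le_trans ?_ h
  rw [flatten, aeval_def, eval₂_eq']
  refine totalDegree_finsetSum_le fun β hβ => ?_
  refine (totalDegree_mul _ _).trans ?_
  have h1 : (∏ c, (X c - C (n c / inner ℝ n n) * linPoly n a : Poly3) ^ β c).totalDegree ≤
      ∑ c, β c := by
    refine (totalDegree_finsetProd _ _).trans (Finset.sum_le_sum fun c _ => ?_)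
    have h2 : (X c - C (n c / inner ℝ n n) * linPoly n a : Poly3).totalDegree ≤ 1 := by
      refine (totalDegree_sub _ _).trans (max_le (by simp) ?_)
      refine (totalDegree_mul _ _).trans ?_
      rw [totalDegree_C, zero_add]
      exact totalDegree_linPoly_le n a
    exact (totalDegree_pow _ _).trans (by nlinarith)
  have h2 : β.degree ≤ p.totalDegree := le_totalDegree hβ
  rw [Finsupp.degree_eq_sum] at h2
  have h3 : (algebraMap ℝ Poly3 (coeff β p)).totalDegree = 0 := totalDegree_C _
  omega

theorem flatten_point {n a x : E3} (hx : inner ℝ n (x - a) = (0 : ℝ)) :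
    a + tangentPart n (x - a) = x := by
  rw [tangentPart, hx, zero_div, zero_smul, sub_zero, add_sub_cancel]

theorem flatten_vanish {n a : E3} {Z : Set E3} (hZ : ∀ x ∈ Z, inner ℝ n (x - a) = (0 : ℝ)) {N : ℕ}
    {p : Poly3} (hp : p ∈ vanish Z N) : flatten n a p ∈ vanish Z N := by
  induction N generalizing p with
  | zero => trivial
  | succ N ih =>
    refine ⟨fun x hx => ?_, fun c => ?_⟩
    · rw [evalAt_flatten, flatten_point (hZ x hx)]
      exact evalAt_of_vanish hp (by omega) hx
    · rw [← dirD_single, dirD_flatten]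
      exact ih (dirD_vanish hp _)

end FaceGeometry

/-! ### Stokes' theorem on a face -/

section Stokes

variable (T : Tetra)

/-- The edge of a face with two given local vertex numbers. -/
def faceEdge (o : Fin 4) (a b : Fin 3) (h : a < b) : TetEdge :=
  ⟨(o.succAbove a, o.succAbove b), Fin.strictMono_succAbove o h⟩

/-- The circulation along an edge. -/
def circ (e : TetEdge) (v : VField) : ℝ := unitInt (edgePoly T e (dotVec v (edgeVec T e)))

/-- For two edge vectors u, w of the face, curl v · n is a multiple of ∂_u(v·w) - ∂_w(v·u).
Integration by parts on coefficients turns each term into a difference of two edge terms; the two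
terms on the edge opposite to the common vertex combine to its tangent w - u. Only `c ≠ 0` is
recorded, since the orientation of the normal is arbitrary. -/
theorem faceInt_curl (F : TetFrames T) (o : Fin 4) : ∃ c : ℝ, c ≠ 0 ∧ ∀ v : VField,
    faceInt T o (dotVec (curlF v) (F.fn o)) = c * (circ T (faceEdge o 0 1 (by decide)) v
      + circ T (faceEdge o 1 2 (by decide)) v - circ T (faceEdge o 0 2 (by decide)) v) := by
  set u := T (o.succAbove 1) - T (o.succAbove 0) with hu
  set w := T (o.succAbove 2) - T (o.succAbove 0) with hw
  have hin : ∀ l, o.succAbove l ∈ faceSet o := fun l => mem_faceSet.2 (Fin.succAbove_ne o l)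
  have hne : ∀ l, o.succAbove l ≠ o := Fin.succAbove_ne o
  obtain ⟨μ, hμ⟩ := cross_eq_smul_normal (F.fn_ne o) (F.fn_normal o _ _ (hne 1) (hne 0))
    (F.fn_normal o _ _ (hne 2) (hne 0))
  have hμ0 : μ ≠ 0 := by
    rintro rfl
    rw [zero_smul] at hμ
    refine cross_ne_zero (a := u) (b := w) ?_ hμ
    rw [LinearIndependent.pair_iff]
    intro s t hst
    have hc : ∀ i, s * coordLin T u i + t * coordLin T w i = 0 := fun i => by
      have : coordLin T (s • u + t • w) i = 0 := by
        rw [hst]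
        simp [coordLin]
      rw [← this]
      simp only [coordLin, map_add, map_smul, smul_eq_mul]
    have h1 := hc (o.succAbove 1)
    have h2 := hc (o.succAbove 2)
    rw [hu, hw, coordLin_vertex_sub, coordLin_vertex_sub] at h1 h2
    simp at h1 h2
    exact ⟨h1, h2⟩
  have he : ∀ a b c : Fin 3, a ≠ b → a ≠ c → b ≠ c → (faceSet o).erase (o.succAbove a) =
      {o.succAbove b, o.succAbove c} := by
    clear * -
    revert o
    decide
  refine ⟨faceJac T o / μ, div_ne_zero (faceJac_pos T o).ne' hμ0, fun v => ?_⟩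
  obtain ⟨m, hm⟩ : ∃ m, ∀ c, (v c).totalDegree ≤ m + 1 :=
    ⟨∑ c, (v c).totalDegree, fun c => (Finset.single_le_sum (f := fun c => (v c).totalDegree)
      (fun _ _ => Nat.zero_le _) (Finset.mem_univ c)).trans (Nat.le_succ _)⟩
  obtain ⟨A, hA, hAv⟩ := exists_phi_eq T (totalDegree_dotVec_le hm w)
  obtain ⟨B, hB, hBv⟩ := exists_phi_eq T (totalDegree_dotVec_le hm u)
  have h1 : dotVec (curlF v) (F.fn o) =
      phi T (μ⁻¹ • (baryDer (coordLin T u) A - baryDer (coordLin T w) B)) := by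
    rw [map_smul, map_sub, ← dirD_phi, ← dirD_phi, hAv, hBv, dirD_dotVec_sub, hμ, dotVec_smul,
      smul_smul, inv_mul_cancel₀ hμ0, one_smul]
  have hhom : (μ⁻¹ • (baryDer (coordLin T u) A - baryDer (coordLin T w) B)).IsHomogeneous m := by
    rw [smul_eq_C_mul, ← zero_add m]
    exact (isHomogeneous_C _ _).mul (((baryDer_isHomogeneous hA _)).sub (baryDer_isHomogeneous hB _))
  rw [h1, faceInt_phi T hhom, map_smul, map_sub, hu, hw, lam_baryDer_vertex T (hin 0) (hin 1),
    lam_baryDer_vertex T (hin 0) (hin 2), he 0 1 2 (by decide) (by decide) (by decide),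
    he 1 0 2 (by decide) (by decide) (by decide), he 2 0 1 (by decide) (by decide) (by decide)]
  have c01 : circ T (faceEdge o 0 1 (by decide)) v =
      lam {o.succAbove 0, o.succAbove 1} B / (m + 2).factorial := by
    rw [circ, show edgeVec T (faceEdge o 0 1 (by decide)) = u from rfl, ← hBv, unitInt_phi T hB]
    rfl
  have c02 : circ T (faceEdge o 0 2 (by decide)) v =
      lam {o.succAbove 0, o.succAbove 2} A / (m + 2).factorial := by
    rw [circ, show edgeVec T (faceEdge o 0 2 (by decide)) = w from rfl, ← hAv, unitInt_phi T hA]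
    rfl
  have c12 : circ T (faceEdge o 1 2 (by decide)) v =
      lam {o.succAbove 1, o.succAbove 2} (A - B) / (m + 2).factorial := by
    rw [circ, show edgeVec T (faceEdge o 1 2 (by decide)) = w - u by
      rw [hu, hw, sub_sub_sub_cancel_right]; rfl, dotVec_sub_right, ← hAv, ← hBv, ← map_sub,
      unitInt_phi T (hA.sub hB)]
    rfl
  rw [c01, c02, c12, map_sub, smul_eq_mul]
  field_simp
  ring

theorem circ_eq_zero {e : TetEdge} {v : VField}
    (h : dotVec v (edgeVec T e) ∈ vanish (hull T (edgeSet e)) 1) : circ T e v = 0 := by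
  rw [circ, (edgePoly_eq_zero_iff T e _).2 (mem_vanish_one.1 h), map_zero]

theorem faceInt_curl_eq_zero (F : TetFrames T) {o : Fin 4} {v : VField}
    (h : ∀ e : TetEdge, e.1.1 ≠ o → e.1.2 ≠ o → circ T e v = 0) :
    faceInt T o (dotVec (curlF v) (F.fn o)) = 0 := by
  obtain ⟨c, -, hc⟩ := faceInt_curl T F o
  have hne : ∀ l, o.succAbove l ≠ o := Fin.succAbove_ne o
  rw [hc, h _ (hne _) (hne _), h _ (hne _) (hne _), h _ (hne _) (hne _)]
  simp

end Stokes

end CurlFE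

end

noncomputable section

namespace CurlFE

/-! ### Uniqueness on faces and in the interior, and conformity -/

section FaceTraces

variable (T : Tetra)

theorem edge_const_of_dirD {e : TetEdge} {p : Poly3}
    (h : ∀ x ∈ hull T (edgeSet e), evalAt x (dirD (edgeVec T e) p) = 0) :
    evalAt (T e.1.1) p = evalAt (T e.1.2) p ∧
      (evalAt (T e.1.1) p = 0 → p ∈ vanish (hull T (edgeSet e)) 1) := by
  have h1 : Polynomial.derivative (edgePoly T e p) = 0 := by
    rw [derivative_edgePoly]
    exact (edgePoly_eq_zero_iff T e _).2 h
  obtain ⟨c, hc⟩ := Polynomial.natDegree_eq_zero.1 (Polynomial.derivative_eq_zero.1 h1)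
  have h2 := eval_edgePoly T e p 0
  have h3 := eval_edgePoly T e p 1
  rw [← hc, Polynomial.eval_C, AffineMap.lineMap_apply_zero] at h2
  rw [← hc, Polynomial.eval_C, AffineMap.lineMap_apply_one] at h3
  refine ⟨h2.symm.trans h3, fun h4 => mem_vanish_one.2 ((edgePoly_eq_zero_iff T e p).1 ?_)⟩
  rw [← hc, h2, h4, Polynomial.C_0]

theorem vertex_mem_hull {S : Finset (Fin 4)} {i : Fin 4} (h : i ∈ S) : T i ∈ hull T S :=
  subset_convexHull ℝ _ ⟨i, h, rfl⟩

theorem edge_subset_face {e : TetEdge} {o : Fin 4} (h1 : e.1.1 ≠ o) (h2 : e.1.2 ≠ o) :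
    hull T (edgeSet e) ⊆ hull T (faceSet o) :=
  hull_mono T (edgeSet_ssubset_faceSet h1 h2).subset

theorem edgeVec_coord {e : TetEdge} {o : Fin 4} (h1 : e.1.1 ≠ o) (h2 : e.1.2 ≠ o) :
    coordLin T (edgeVec T e) o = 0 := by
  rw [edgeVec, coordLin_vertex_sub, if_neg h2.symm, if_neg h1.symm, sub_zero]

theorem face_sub_coord {o : Fin 4} {x y : E3} (hx : x ∈ hull T (faceSet o))
    (hy : y ∈ hull T (faceSet o)) : coordLin T (x - y) o = 0 := by
  rw [← coord_sub_eq, coord_of_mem_hull T hx (by simp [mem_faceSet]),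
    coord_of_mem_hull T hy (by simp [mem_faceSet]), sub_zero]

theorem tangentPart_coord (F : TetFrames T) (o : Fin 4) (d : E3) :
    coordLin T (tangentPart (F.fn o) d) o = 0 :=
  face_tangent_coord T F (inner_tangentPart (F.fn_ne o) d)

/-- On a face with vanishing normal component of the curl, a field with vanishing tangential
components on the edges is tangentially the gradient of a bubble function. -/
theorem exists_face_potential (F : TetFrames T) {o : Fin 4} {z : VField} {k : ℕ}
    {r : SmoothParam} (hr : -1 ≤ r.e) (hrv : -1 ≤ r.v)
    (hz : ∀ c, (z c).totalDegree ≤ k + 1)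
    (hv : ∀ i, i ≠ o → ∀ c, z c ∈ vanish (hull T {i}) (r.v + 1).toNat)
    (he0 : ∀ e : TetEdge, e.1.1 ≠ o → e.1.2 ≠ o →
      dotVec z (edgeVec T e) ∈ vanish (hull T (edgeSet e)) 1)
    (he : ∀ e : TetEdge, e.1.1 ≠ o → e.1.2 ≠ o →
      ∀ c, z c ∈ vanish (hull T (edgeSet e)) (r.e + 1).toNat)
    (hw : ∀ x ∈ hull T (faceSet o), evalAt x (dotVec (curlF z) (F.fn o)) = 0) :
    ∃ q ∈ bubble T (faceSet o) (k + 2) (r.shift 1), ∀ d, coordLin T d o = 0 →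
      ∀ x ∈ hull T (faceSet o), evalAt x (dirD d q) = evalAt x (dotVec z d) := by
  set i₀ := o.succAbove 0 with hi₀
  have hi0 : i₀ ≠ o := Fin.succAbove_ne o 0
  set a := T i₀ with ha
  have hamem : a ∈ hull T (faceSet o) := vertex_mem_hull T (mem_faceSet.2 hi0)
  have hao : T.coord o a = 0 := coord_of_mem_hull T hamem (by simp [mem_faceSet])
  set p := potential a z with hp
  have hdp : ∀ t, coordLin T t o = 0 → ∀ x, T.coord o x = 0 →
      evalAt x (dirD t p) = evalAt x (dotVec z t) := fun t ht x hx =>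
    evalAt_dirD_potential_of_plane T F hao hw ht hx
  have hplane : ∀ x ∈ hull T (faceSet o), T.coord o x = 0 := fun x hx =>
    coord_of_mem_hull T hx (by simp [mem_faceSet])
  have hedge : ∀ e : TetEdge, e.1.1 ≠ o → e.1.2 ≠ o →
      ∀ x ∈ hull T (edgeSet e), evalAt x (dirD (edgeVec T e) p) = 0 := fun e h1 h2 x hx => by
    rw [hdp _ (edgeVec_coord T h1 h2) x (hplane x (edge_subset_face T h1 h2 hx))]
    exact mem_vanish_one.1 (he0 e h1 h2) x hx
  -- The potential is constant along each edge of the face, and every other vertex of the face is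
  -- joined to the base vertex by an edge.
  have hvert : ∀ i, i ≠ o → evalAt (T i) p = 0 := by
    intro i hi
    rcases lt_trichotomy i i₀ with h | h | h
    · have := (edge_const_of_dirD T (hedge ⟨(i, i₀), h⟩ hi hi0)).1
      exact this.trans (evalAt_potential_self a z)
    · rw [h]
      exact evalAt_potential_self a z
    · have := (edge_const_of_dirD T (hedge ⟨(i₀, i), h⟩ hi0 hi)).1
      exact this.symm.trans (evalAt_potential_self a z)
  -- On the plane of the face the tangential derivatives of the potential are components of z, so
  -- the derivatives of the flattened potential are flattened components of z.
  have hflat : ∀ d, dirD d (flatten (F.fn o) a p) =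
      flatten (F.fn o) a (dotVec z (tangentPart (F.fn o) d)) := by
    intro d
    rw [dirD_flatten]
    refine poly_ext fun x => ?_
    rw [evalAt_flatten, evalAt_flatten]
    refine hdp _ (tangentPart_coord T F o d) _ ?_
    have := coord_sub_eq T (a + tangentPart (F.fn o) (x - a)) a o
    rw [add_sub_cancel_left, tangentPart_coord, hao, sub_zero] at this
    exact this
  have hin : ∀ {G : Finset (Fin 4)}, G ⊆ faceSet o → ∀ x ∈ hull T G,
      inner ℝ (F.fn o) (x - a) = (0 : ℝ) := fun hG x hx =>
    inner_normal_eq_zero T F (face_sub_coord T (hull_mono T hG hx) hamem)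
  -- Value zero and a gradient of order N give order N + 1; this is the shift of the smoothness by
  -- one.
  have hstep : ∀ {G : Finset (Fin 4)}, G ⊆ faceSet o → ∀ N, (∀ c, z c ∈ vanish (hull T G) N) →
      p ∈ vanish (hull T G) 1 → flatten (F.fn o) a p ∈ vanish (hull T G) (N + 1) := by
    intro G hG N hzN h0
    refine ⟨fun x => evalAt_of_vanish (flatten_vanish (hin hG) h0) le_rfl, fun c => ?_⟩
    rw [← dirD_single, hflat]
    exact flatten_vanish (hin hG) (dotVec_mem hzN _)
  have hdeg : (flatten (F.fn o) a p).totalDegree ≤ k + 2 :=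
    totalDegree_flatten_le _ _ (totalDegree_potential_le hz)
  obtain ⟨q, hq, hqp⟩ := exists_face_bubble_eq_on T (r := r.shift 1) hdeg o
    (fun i hi => by
      simp only [SmoothParam.shift]
      rw [show (r.v + 1 + 1).toNat = (r.v + 1).toNat + 1 by omega]
      refine hstep (by simpa [mem_faceSet] using hi) _ (hv i hi) (mem_vanish_one.2 fun x hx => ?_)
      rw [hull_singleton] at hx
      obtain rfl : x = T i := hx
      exact hvert i hi)
    (fun e h1 h2 => by
      simp only [SmoothParam.shift]
      rw [show (r.e + 1 + 1).toNat = (r.e + 1).toNat + 1 by omega]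
      exact hstep (edgeSet_ssubset_faceSet h1 h2).subset _ (he e h1 h2)
        ((edge_const_of_dirD T (hedge e h1 h2)).2 (hvert _ h1)))
  refine ⟨q, by exact_mod_cast hq, fun d hd x hx => ?_⟩
  have h1 : dirD d (q - p) ∈ vanish (hull T (faceSet o)) 1 := by
    refine dirD_vanish_of_tangent T (faceSet_nonempty o) (face_tangent T hd) (mem_vanish_one.2 ?_)
    intro y hy
    rw [evalAt_sub, hqp y hy, evalAt_flatten, flatten_point (hin subset_rfl y hy), sub_self]
  have h2 := mem_vanish_one.1 h1 x hx
  rw [dirD_sub, evalAt_sub, sub_eq_zero] at h2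
  rw [h2, hdp d hd x (hplane x hx)]

theorem evalAt_tanProj_congr {n : E3} {u w : VField} {x : E3}
    (h : ∀ d, inner ℝ n d = (0 : ℝ) → evalAt x (dotVec u d) = evalAt x (dotVec w d)) (hn : n ≠ 0)
    (c : Fin 3) : evalAt x (tanProj n u c) = evalAt x (tanProj n w c) := by
  rw [tanProj_eq, tanProj_eq]
  exact h _ (inner_tangent_part n hn c)

theorem dotVec_tanProj {n d : E3} (hd : inner ℝ n d = (0 : ℝ)) (w : VField) :
    dotVec (tanProj n w) d = dotVec w d := by
  have h : ∀ c, tanProj n w c = w c - (n c / inner ℝ n n) • dotVec w n := fun c => by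
    rw [tanProj, smul_eq_C_mul]
  rw [dotVec_eq, dotVec_eq]
  simp only [h, smul_sub, Finset.sum_sub_distrib]
  rw [sub_eq_self]
  simp only [smul_smul, ← Finset.sum_smul]
  have : ∑ c, d c * (n c / inner ℝ n n) = (inner ℝ n d : ℝ) / inner ℝ n n := by
    rw [inner_eq n d, Fin.sum_univ_three]
    ring
  rw [this, hd, zero_div, zero_smul]

theorem evalAt_eq_zero_of_fdot_self {x : E3} {w : VField} (h : evalAt x (fdot w w) = 0) (c : Fin 3) :
    evalAt x (w c) = 0 := by
  rw [evalAt_fdot, Finset.sum_eq_zero_iff_of_nonneg fun c _ => mul_self_nonneg _] at h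
  exact mul_self_eq_zero.1 (h c (Finset.mem_univ c))

theorem fdot_self_nonneg (x : E3) (w : VField) : 0 ≤ evalAt x (fdot w w) := by
  rw [evalAt_fdot]
  exact Finset.sum_nonneg fun c _ => mul_self_nonneg _

theorem iterate_dirD_eq_zero {Z : Set E3} {N j : ℕ} {p : Poly3} {a : E3} (hj : 1 ≤ j) (hjN : j ≤ N)
    (hp : dirD a p ∈ vanish Z N) {x : E3} (hx : x ∈ Z) : evalAt x ((dirD a)^[j] p) = 0 := by
  obtain ⟨l, rfl⟩ := Nat.exists_eq_add_of_lt hj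
  rw [show 0 + l + 1 = l + 1 by omega, Function.iterate_succ_apply]
  exact evalAt_of_vanish (iterate_dirD_vanish hp a l) (by omega) hx

/-- The curl comes first: its tangential components by moments, its normal component by moments
together with Stokes' theorem, the normal derivatives of the latter by the divergence. Then the
tangential trace of the field is a gradient of a face bubble function and vanishes by its moments.
Finally, moments give z·n, and the curl gives the normal derivatives of the tangential components.
-/
theorem face_field_vanish (F : TetFrames T) {o : Fin 4} {z : VField} {k : ℕ}
    {r1 r2 : SmoothParam} (hr1 : r1.IsCurlParam) (hr2 : r2.IsDivParam) (hr12 : r2.GeOminusOne r1)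
    (hk1 : 2 * r1.v + 1 ≤ k) (hk2 : 2 * r2.v + 1 ≤ k) (hz : ∀ c, (z c).totalDegree ≤ k + 1)
    (hv : ∀ i, i ≠ o → ∀ c, z c ∈ vanish (hull T {i}) (r1.v + 1).toNat)
    (hvw : ∀ i, i ≠ o → ∀ c, curlF z c ∈ vanish (hull T {i}) (r2.v + 1).toNat)
    (he0 : ∀ e : TetEdge, e.1.1 ≠ o → e.1.2 ≠ o →
      dotVec z (edgeVec T e) ∈ vanish (hull T (edgeSet e)) 1)
    (he : ∀ e : TetEdge, e.1.1 ≠ o → e.1.2 ≠ o →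
      ∀ c, z c ∈ vanish (hull T (edgeSet e)) (r1.e + 1).toNat)
    (hew : ∀ e : TetEdge, e.1.1 ≠ o → e.1.2 ≠ o →
      ∀ c, curlF z c ∈ vanish (hull T (edgeSet e)) (r2.e + 1).toNat)
    (hd : HasFaceDofs T F k r1 r2 z DofData.zero o) :
    (∀ d, coordLin T d o = 0 → dotVec z d ∈ vanish (hull T (faceSet o)) 1) ∧
      dotVec (curlF z) (F.fn o) ∈ vanish (hull T (faceSet o)) 1 ∧
      (∀ c, z c ∈ vanish (hull T (faceSet o)) (r1.f + 1).toNat) ∧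
      ∀ c, curlF z c ∈ vanish (hull T (faceSet o)) (r2.f + 1).toNat := by
  obtain ⟨d8, d9, d10, d11⟩ := hd
  obtain ⟨hf1, hf2, hf3⟩ := hr1
  obtain ⟨-, -, hf12⟩ := hr12
  have hwdeg : ∀ c, (curlF z c).totalDegree ≤ k := totalDegree_curlF_le hz
  have wt : ∀ l, dotVec (curlF z) (F.ft o l) ∈ vanish (hull T (faceSet o)) (r2.f + 1).toNat := by
    intro l
    refine face_vanish_of_moments T F (totalDegree_dotVec_le hwdeg _) ?_
      (fun i hi => dotVec_mem (hvw i hi) _) (fun e h1 h2 => dotVec_mem (hew e h1 h2) _)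
      fun j hj q hq => d11 j hj l q hq
    unfold SmoothParam.IsDivParam at hr2
    omega
  have wn0 : ∀ x ∈ hull T (faceSet o), evalAt x (dotVec (curlF z) (F.fn o)) = 0 := by
    refine face_eq_zero_of_moments T (totalDegree_dotVec_le hwdeg _)
      (fun i hi => dotVec_mem (hvw i hi) _) (fun e h1 h2 => dotVec_mem (hew e h1 h2) _)
      fun q hq hqw => d10 q hq ?_
    -- The test function is the normal component of the curl itself. Its mean is zero by Stokes'
    -- theorem, since the circulations along the edges vanish, so it is admissible.
    rw [faceInt_congr T o hqw]
    exact faceInt_curl_eq_zero T F fun e h1 h2 => circ_eq_zero T (he0 e h1 h2)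
  have wn : dotVec (curlF z) (F.fn o) ∈ vanish (hull T (faceSet o)) (r2.f + 1).toNat := by
    obtain ⟨μ, hμ⟩ := cross_eq_smul_normal (a := F.ft o 0) (b := F.ft o 1) (F.fn_ne o)
      (by rw [real_inner_comm]; exact F.ft_tangent o 0)
      (by rw [real_inner_comm]; exact F.ft_tangent o 1)
    have hdet := face_det_ne_zero T F o
    have hμ0 : μ ≠ 0 := by
      rintro rfl
      rw [det3, hμ, zero_smul, inner_zero_right] at hdet
      exact hdet rfl
    have h := smul_divF (curlF z) (F.fn o) (F.ft o 0) (F.ft o 1)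
    -- In the face frame, div = 0 expresses the normal derivative of the normal component by
    -- derivatives of the tangential ones.
    rw [divF_curlF, smul_zero, hμ, dirD_smul_dir, add_assoc, eq_comm, add_eq_zero_iff_eq_neg] at h
    have h1 : dirD (F.fn o) (dotVec (curlF z) (F.fn o)) ∈
        vanish (hull T (faceSet o)) ((r2.f + 1).toNat - 1) := by
      have h2 : μ • dirD (F.fn o) (dotVec (curlF z) (F.fn o)) ∈
          vanish (hull T (faceSet o)) ((r2.f + 1).toNat - 1) := by
        rw [h]
        exact Submodule.neg_mem _ (Submodule.add_mem _ (dirD_vanish (wt 0) _) (dirD_vanish (wt 1) _))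
      have := Submodule.smul_mem _ μ⁻¹ h2
      rwa [smul_smul, inv_mul_cancel₀ hμ0, one_smul] at this
    refine face_vanish_of_normals T F fun j hj x hx => ?_
    rcases Nat.eq_zero_or_pos j with rfl | hj0
    · exact wn0 x hx
    · exact iterate_dirD_eq_zero hj0 (by omega) h1 hx
  have hw : ∀ c, curlF z c ∈ vanish (hull T (faceSet o)) (r2.f + 1).toNat :=
    field_mem_of_frame (face_det_ne_zero T F o) wn (wt 0) (wt 1)
  obtain ⟨q, hq, hqz⟩ := exists_face_potential T F (r := r1) (by omega) (by omega) hz hv he0 he wn0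
  have hzt : ∀ d, coordLin T d o = 0 → dotVec z d ∈ vanish (hull T (faceSet o)) 1 := by
    have h1 : ∀ x ∈ hull T (faceSet o), ∀ c, evalAt x (tanProj (F.fn o) (gradP q) c) =
        evalAt x (tanProj (F.fn o) z c) := fun x hx =>
      evalAt_tanProj_congr (fun d hd => by
        rw [dotVec_gradP]
        exact hqz d (face_tangent_coord T F hd) x hx) (F.fn_ne o)
    have h2 : faceInt T o (fdot (tanProj (F.fn o) z) (tanProj (F.fn o) z)) = 0 := by
      refine Eq.trans ?_ (d8 q hq)
      refine faceInt_congr T o fun x hx => ?_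
      rw [evalAt_fdot, evalAt_fdot]
      simp only [h1 x hx]
    have h3 := eq_zero_of_faceInt T (fun x _ => fdot_self_nonneg x _) h2
    intro d hd
    rw [← dotVec_tanProj (inner_normal_eq_zero T F hd)]
    exact dotVec_mem (fun c => mem_vanish_one.2 fun x hx =>
      evalAt_eq_zero_of_fdot_self (h3 x hx) c) d
  refine ⟨hzt, mem_vanish_one.2 wn0, ?_, hw⟩
  have zn : dotVec z (F.fn o) ∈ vanish (hull T (faceSet o)) (r1.f + 1).toNat := by
    refine face_vanish_of_moments T F (totalDegree_dotVec_le hz _) (by push_cast; omega)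
      (fun i hi => dotVec_mem (hv i hi) _) (fun e h1 h2 => dotVec_mem (he e h1 h2) _)
      fun j hj q hq => d9 j hj q (by exact_mod_cast hq)
  have zt : ∀ l, dotVec z (F.ft o l) ∈ vanish (hull T (faceSet o)) (r1.f + 1).toNat := by
    intro l
    have h1 := dirD_dotVec_mem (W := vanish (hull T (faceSet o)) ((r1.f + 1).toNat - 1))
      (dirD_vanish zn (F.ft o l)) fun c => vanish_mono (by omega) (hw c)
    refine face_vanish_of_normals T F fun j hj x hx => ?_
    rcases Nat.eq_zero_or_pos j with rfl | hj0
    · exact mem_vanish_one.1 (hzt _ (ft_tangent_coord T F o l)) x hx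
    · exact iterate_dirD_eq_zero hj0 (by omega) h1 hx
  exact field_mem_of_frame (face_det_ne_zero T F o) zn (zt 0) (zt 1)

theorem evalAt_potential (a : E3) (v : VField) (x : E3) :
    evalAt x (potential a v) = evalAt x (coneInt a 0 (dotVec v (x - a))) := by
  have : coneInt a 0 (dotVec v (x - a)) = ∑ c, (x - a) c • coneInt a 0 (v c) := by
    rw [dotVec_eq, coneInt_sum]
    simp only [coneInt_smul]
  rw [this, potential, evalAt_sum, evalAt_sum]
  simp

/-- Segments from a vertex of the face stay in the face, so the potential integrates tangential
components only. -/
theorem potential_vanish_face {o i : Fin 4} (hi : i ≠ o) {z : VField}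
    (h : ∀ d, coordLin T d o = 0 → dotVec z d ∈ vanish (hull T (faceSet o)) 1) :
    potential (T i) z ∈ vanish (hull T (faceSet o)) 1 := by
  have hmem := vertex_mem_hull T (mem_faceSet.2 hi)
  refine mem_vanish_one.2 fun x hx => ?_
  rw [evalAt_potential]
  exact coneInt_eq_zero_of_convex (convex_convexHull ℝ _) hmem
    (mem_vanish_one.1 (h _ (face_sub_coord T hx hmem))) x hx

theorem eq_of_gradP_eq {p q : Poly3} (h : gradP p = gradP q) (x y : E3) :
    evalAt x p - evalAt x q = evalAt y p - evalAt y q := by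
  have h0 : ∀ c, pderiv c (p - q) = 0 := fun c => by
    rw [map_sub, sub_eq_zero]
    exact congrFun h c
  have h1 : p - q = C (coeff 0 (p - q)) := by
    ext β
    rw [coeff_C]
    split_ifs with hβ
    · rw [hβ]
    · obtain ⟨c, hc⟩ := Finsupp.ne_iff.1 (Ne.symm hβ)
      have h2 := congrArg (coeff (β - Finsupp.single c 1)) (h0 c)
      rw [coeff_pderiv, tsub_add_cancel_of_le
        (Finsupp.single_le_iff.2 (Nat.one_le_iff_ne_zero.2 hc)), coeff_zero] at h2
      exact (mul_eq_zero.1 h2).resolve_right (by positivity)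
  rw [← evalAt_sub, ← evalAt_sub, h1, evalAt_C, evalAt_C]

/-- A field is zero if it vanishes on the boundary as prescribed and its interior degrees of
freedom are zero. -/
theorem cell_field_eq_zero (F : TetFrames T) {z : VField} {k : ℕ} {r1 r2 : SmoothParam}
    (hr1 : r1.IsCurlParam) (hz : ∀ c, (z c).totalDegree ≤ k + 1)
    (hv : ∀ c, VanishAll T r1 (z c)) (hw : ∀ c, VanishAll T r2 (curlF z c))
    (ht : ∀ o d, coordLin T d o = 0 → dotVec z d ∈ vanish (hull T (faceSet o)) 1)
    (hn : ∀ o, dotVec (curlF z) (F.fn o) ∈ vanish (hull T (faceSet o)) 1)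
    (hd : HasCellDofs T F k r1 r2 z DofData.zero) : z = 0 := by
  obtain ⟨hf1, hf2, hf3⟩ := hr1
  have hcurl : curlF z = 0 := by
    -- The curl is an admissible test function for itself: a divergence-free bubble field with
    -- vanishing normal trace.
    have h1 := hd.1 (curlF z) ⟨fun c => mem_bubble_of_vanishAll T (totalDegree_curlF_le hz c) (hw c),
      fun o => mem_vanish_one.1 (hn o)⟩ (divF_curlF z)
    have h2 := eq_zero_of_cellInt T (fun x => fdot_self_nonneg x _) h1
    funext c
    exact poly_ext fun x => by
      rw [evalAt_eq_zero_of_fdot_self (by rw [h2, evalAt_zero]) c, Pi.zero_apply, evalAt_zero]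
  have hgrad := fun a => gradP_potential (a := a) hcurl
  have hface : ∀ o, potential (T 0) z ∈ vanish (hull T (faceSet o)) 1 := by
    intro o
    -- Three faces contain the base vertex 0. On the fourth, compare with the potential based at
    -- vertex 1: it vanishes there, it has the same gradient, and both potentials vanish at vertex
    -- 2, so they are equal.
    by_cases ho : o = 0
    · subst ho
      have h1 := mem_vanish_one.1 (potential_vanish_face T (o := 0) (i := 1) (by decide) (ht 0))
      have h2 := mem_vanish_one.1 (potential_vanish_face T (o := 1) (i := 0) (by decide) (ht 1))
      have h3 : ∀ x y, _ := eq_of_gradP_eq ((hgrad (T 0)).trans (hgrad (T 1)).symm)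
      refine mem_vanish_one.2 fun x hx => ?_
      have h4 := h3 x (T 2)
      rw [h1 x hx, h1 (T 2) (vertex_mem_hull T (by decide)),
        h2 (T 2) (vertex_mem_hull T (by decide)), sub_zero, sub_zero] at h4
      exact h4
    · exact potential_vanish_face T (Ne.symm ho) (ht o)
  have hsub : ∀ {G : Finset (Fin 4)} {o : Fin 4} (N : ℕ), G ⊆ faceSet o →
      (∀ c, z c ∈ vanish (hull T G) N) → potential (T 0) z ∈ vanish (hull T G) (N + 1) := by
    intro G o N hG h
    refine ⟨fun x hx => mem_vanish_one.1 (hface o) x (hull_mono T hG hx), fun c => ?_⟩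
    have := congrFun (hgrad (T 0)) c
    rw [gradP] at this
    rw [this]
    exact h c
  have hbub : potential (T 0) z ∈ bubble T Finset.univ ((k + 2 : ℕ) : ℤ) (r1.shift 1) := by
    refine mem_bubble_of_vanishAll T (totalDegree_potential_le hz) ⟨fun i => ?_, fun e => ?_, fun o => ?_⟩
    · obtain ⟨o, ho⟩ := exists_ne i
      simp only [SmoothParam.shift]
      rw [show (r1.v + 1 + 1).toNat = (r1.v + 1).toNat + 1 by omega]
      exact hsub (o := o) _ (by simpa [mem_faceSet] using ho.symm) fun c => (hv c).1 i
    · obtain ⟨o, ho1, ho2⟩ : ∃ o, e.1.1 ≠ o ∧ e.1.2 ≠ o := by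
        generalize e.1.1 = a
        generalize e.1.2 = b
        revert a b
        decide
      simp only [SmoothParam.shift]
      rw [show (r1.e + 1 + 1).toNat = (r1.e + 1).toNat + 1 by omega]
      exact hsub _ (edgeSet_ssubset_faceSet ho1 ho2).subset fun c => (hv c).2.1 e
    · simp only [SmoothParam.shift]
      rw [show (r1.f + 1 + 1).toNat = (r1.f + 1).toNat + 1 by omega]
      exact hsub _ subset_rfl fun c => (hv c).2.2 o
  -- The field is the gradient of a bubble function, hence its own test function.
  have h1 := hd.2 _ (by exact_mod_cast hbub)
  rw [hgrad] at h1
  have h2 := eq_zero_of_cellInt T (fun x => fdot_self_nonneg x _) h1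
  funext c
  exact poly_ext fun x => by
    rw [evalAt_eq_zero_of_fdot_self (by rw [h2, evalAt_zero]) c, Pi.zero_apply, evalAt_zero]

theorem edge_traces (F : TetFrames T) {e : TetEdge} {z : VField} {k : ℕ}
    {r1 r2 : SmoothParam} (hr1 : r1.IsCurlParam) (hr2 : r2.IsDivParam) (hr12 : r2.GeOminusOne r1)
    (hk1 : 2 * r1.v + 1 ≤ k) (hk2 : 2 * r2.v + 1 ≤ k) (hz : z ∈ VecPoly (k + 1))
    (h1 : HasVertexDofs T r1 r2 z DofData.zero e.1.1)
    (h2 : HasVertexDofs T r1 r2 z DofData.zero e.1.2)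
    (hd : HasEdgeDofs T F k r1 r2 z DofData.zero e) :
    dotVec z (edgeVec T e) ∈ vanish (hull T (edgeSet e)) 1 ∧
      (∀ c, z c ∈ vanish (hull T (edgeSet e)) (r1.e + 1).toNat) ∧
      ∀ c, curlF z c ∈ vanish (hull T (edgeSet e)) (r2.e + 1).toNat := by
  obtain ⟨d3, d4, d5, d6, d7, d7'⟩ := hd
  have hw := edge_curl_vanish T F hr2 hk2 (totalDegree_curlF_le hz) (divF_curlF z)
    (vertex_vanish T h1).2 (vertex_vanish T h2).2 d6 d7 d7'
  obtain ⟨h3, h4⟩ := edge_field_vanish T F hr1 hr12 hk1 hz (vertex_vanish T h1).1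
    (vertex_vanish T h2).1 hw d3 d4 d5
  exact ⟨h3, h4, hw⟩

theorem face_traces (F : TetFrames T) {o : Fin 4} {z : VField} {k : ℕ}
    {r1 r2 : SmoothParam} (hr1 : r1.IsCurlParam) (hr2 : r2.IsDivParam) (hr12 : r2.GeOminusOne r1)
    (hk1 : 2 * r1.v + 1 ≤ k) (hk2 : 2 * r2.v + 1 ≤ k) (hz : z ∈ VecPoly (k + 1))
    (hv : ∀ i, i ≠ o → HasVertexDofs T r1 r2 z DofData.zero i)
    (he : ∀ e : TetEdge, e.1.1 ≠ o → e.1.2 ≠ o → HasEdgeDofs T F k r1 r2 z DofData.zero e)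
    (hd : HasFaceDofs T F k r1 r2 z DofData.zero o) :
    (∀ d, coordLin T d o = 0 → dotVec z d ∈ vanish (hull T (faceSet o)) 1) ∧
      dotVec (curlF z) (F.fn o) ∈ vanish (hull T (faceSet o)) 1 ∧
      (∀ c, z c ∈ vanish (hull T (faceSet o)) (r1.f + 1).toNat) ∧
      ∀ c, curlF z c ∈ vanish (hull T (faceSet o)) (r2.f + 1).toNat := by
  have het := fun (e : TetEdge) (h1 : e.1.1 ≠ o) (h2 : e.1.2 ≠ o) =>
    edge_traces T F hr1 hr2 hr12 hk1 hk2 hz (hv _ h1) (hv _ h2) (he e h1 h2)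
  exact face_field_vanish T F hr1 hr2 hr12 hk1 hk2 hz (fun i hi => (vertex_vanish T (hv i hi)).1)
    (fun i hi => (vertex_vanish T (hv i hi)).2) (fun e h1 h2 => (het e h1 h2).1)
    (fun e h1 h2 => (het e h1 h2).2.1) (fun e h1 h2 => (het e h1 h2).2.2) hd

theorem eq_zero_of_hasDofs_zero (F : TetFrames T) {z : VField} {k : ℕ}
    {r1 r2 : SmoothParam} (hr1 : r1.IsCurlParam) (hr2 : r2.IsDivParam) (hr12 : r2.GeOminusOne r1)
    (hk1 : 2 * r1.v + 1 ≤ k) (hk2 : 2 * r2.v + 1 ≤ k) (hz : z ∈ VecPoly (k + 1))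
    (h : HasDofs T F k r1 r2 z DofData.zero) : z = 0 := by
  obtain ⟨hv, he, hf, hc⟩ := h
  have h1 := fun i => vertex_vanish T (hv i)
  have h2 := fun e => edge_traces T F hr1 hr2 hr12 hk1 hk2 hz (hv _) (hv _) (he e)
  have h3 := fun o => face_traces T F hr1 hr2 hr12 hk1 hk2 hz (fun i _ => hv i) (fun e _ _ => he e)
    (hf o)
  exact cell_field_eq_zero T F hr1 hz
    (fun c => ⟨fun i => (h1 i).1 c, fun e => (h2 e).2.1 c, fun o => (h3 o).2.2.1 c⟩)
    (fun c => ⟨fun i => (h1 i).2 c, fun e => (h2 e).2.2 c, fun o => (h3 o).2.2.2 c⟩)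
    (fun o => (h3 o).1) (fun o => (h3 o).2.1) hc

theorem jetEq_of_vanish {r : ℤ} {u v : VField} {Z : Set E3}
    (h : ∀ c, u c - v c ∈ vanish Z (r + 1).toNat) {x : E3} (hx : x ∈ Z) : JetEq r u v x :=
  (jetEq_iff r u v x).2 fun c => vanish_anti_set (by simpa using hx) (h c)

theorem conforming (F : TetFrames T) {k : ℕ}
    {r1 r2 : SmoothParam} (hr1 : r1.IsCurlParam) (hr2 : r2.IsDivParam) (hr12 : r2.GeOminusOne r1)
    (hk1 : 2 * r1.v + 1 ≤ k) (hk2 : 2 * r2.v + 1 ≤ k) {u v : VField}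
    (hu : u ∈ VecPoly (k + 1)) (hv : v ∈ VecPoly (k + 1)) (d : DofData) :
    (∀ i : Fin 4, HasVertexDofs T r1 r2 u d i → HasVertexDofs T r1 r2 v d i →
      JetEq r1.v u v (T i) ∧ JetEq r2.v (curlF u) (curlF v) (T i)) ∧
    (∀ e : TetEdge, HasDofsOnEdge T F k r1 r2 u d e → HasDofsOnEdge T F k r1 r2 v d e →
      ∀ x ∈ segment ℝ (T e.1.1) (T e.1.2),
        evalAt x (dotVec u (F.et e)) = evalAt x (dotVec v (F.et e)) ∧
        JetEq r1.e u v x ∧ JetEq r2.e (curlF u) (curlF v) x) ∧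
    (∀ o : Fin 4, HasDofsOnFace T F k r1 r2 u d o → HasDofsOnFace T F k r1 r2 v d o →
      ∀ x ∈ facePts T o,
        (∀ c, evalAt x (tanProj (F.fn o) u c) = evalAt x (tanProj (F.fn o) v c)) ∧
        evalAt x (dotVec (curlF u) (F.fn o)) = evalAt x (dotVec (curlF v) (F.fn o)) ∧
        JetEq r1.f u v x ∧ JetEq r2.f (curlF u) (curlF v) x) := by
  have hz := vecPoly_sub hu hv
  refine ⟨fun i h1 h2 => ?_, fun e h1 h2 x hx => ?_, fun o h1 h2 x hx => ?_⟩
  · have h := vertex_vanish T (h1.sub h2)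
    rw [curlF_sub, hull_singleton] at h
    exact ⟨jetEq_of_vanish h.1 rfl, jetEq_of_vanish h.2 rfl⟩
  · have h := edge_traces T F hr1 hr2 hr12 hk1 hk2 hz (h1.1.sub h2.1) (h1.2.1.sub h2.2.1)
      (h1.2.2.sub h2.2.2)
    rw [curlF_sub, hull_edgeSet] at h
    refine ⟨?_, jetEq_of_vanish h.2.1 hx, jetEq_of_vanish h.2.2 hx⟩
    obtain ⟨a, -, ha⟩ := exists_edge_scale T F e
    rw [← sub_eq_zero, ← evalAt_sub, ← dotVec_sub_left, ha, dotVec_smul, evalAt_smul,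
      mem_vanish_one.1 h.1 x hx, mul_zero]
  · have h := face_traces T F hr1 hr2 hr12 hk1 hk2 hz (fun i hi => (h1.1 i hi).sub (h2.1 i hi))
      (fun e he he' => (h1.2.1 e he he').sub (h2.2.1 e he he')) (h1.2.2.sub h2.2.2)
    rw [curlF_sub] at h
    refine ⟨fun c => ?_, ?_, jetEq_of_vanish h.2.2.1 hx, jetEq_of_vanish h.2.2.2 hx⟩
    · refine evalAt_tanProj_congr (fun t ht => ?_) (F.fn_ne o) c
      rw [← sub_eq_zero, ← evalAt_sub, ← dotVec_sub_left]
      exact mem_vanish_one.1 (h.1 t (face_tangent_coord T F ht)) x hx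
    · rw [← sub_eq_zero, ← evalAt_sub, ← dotVec_sub_left]
      exact mem_vanish_one.1 h.2.1 x hx

end FaceTraces

end CurlFE

end

noncomputable section

namespace CurlFE

/-! ### Fields with prescribed derivatives at one vertex -/

section Jets

theorem evalAt_zero_partialD (β : Fin 3 → ℕ) (q : Poly3) : evalAt 0 (partialD β q) =
    (∏ c, ((β c).factorial : ℝ)) * coeff (Finsupp.equivFunOnFinite.symm β) q := by
  induction h : multiOrder β generalizing β q with
  | zero =>
    have hβ : β = 0 := by
      funext c
      have := Finset.sum_eq_zero_iff.1 h c (Finset.mem_univ c)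
      simpa using this
    subst hβ
    rw [partialD_zero, evalAt]
    have h1 : (Finsupp.equivFunOnFinite.symm (0 : Fin 3 → ℕ)) = 0 := by
      ext
      rfl
    rw [h1]
    simp [← constantCoeff_eq, ← MvPolynomial.eval_zero']
  | succ n ih =>
    obtain ⟨c, γ, rfl⟩ := exists_eq_add_single (β := β) (by omega)
    rw [multiOrder_add_single] at h
    rw [← partialD_pderiv, ih γ _ (by omega), coeff_pderiv]
    have h1 : Finsupp.equivFunOnFinite.symm (γ + Pi.single c 1) =
        Finsupp.equivFunOnFinite.symm γ + Finsupp.single c 1 := by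
      ext l
      simp [Finsupp.single_apply, Pi.single_apply, eq_comm]
    have h2 : ∏ l, (((γ + Pi.single c 1 : Fin 3 → ℕ) l).factorial : ℝ) =
        (γ c + 1) * ∏ l, ((γ l).factorial : ℝ) := by
      rw [← Finset.mul_prod_erase _ _ (Finset.mem_univ c),
        ← Finset.mul_prod_erase _ (fun l => ((γ l).factorial : ℝ)) (Finset.mem_univ c), ← mul_assoc]
      congr 1
      · simp [Nat.factorial_succ]
      · refine Finset.prod_congr rfl fun l hl => ?_
        simp [Finset.ne_of_mem_erase hl]
    rw [h1, h2]
    simp only [Finsupp.equivFunOnFinite_symm_apply_apply]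
    ring

theorem partialD_shiftPoly (a : E3) (β : Fin 3 → ℕ) (q : Poly3) :
    partialD β (shiftPoly a q) = shiftPoly a (partialD β q) := by
  have h : ∀ (c : Fin 3) (n : ℕ) (p : Poly3),
      (pderiv c)^[n] (shiftPoly a p) = shiftPoly a ((pderiv c)^[n] p) := by
    intro c n
    induction n with
    | zero => exact fun p => rfl
    | succ n ih =>
      intro p
      rw [Function.iterate_succ_apply, pderiv_shiftPoly, ih, Function.iterate_succ_apply]
  rw [partialD, h, h, h, partialD]

theorem exists_jet (a : E3) {N : ℕ} {g : (Fin 3 → ℕ) → ℝ} (hg : ∀ β, N < multiOrder β → g β = 0) :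
    ∃ p : Poly3, p.totalDegree ≤ N ∧ ∀ β, evalAt a (partialD β p) = g β := by
  set q : Poly3 := ∑ γ ∈ Fintype.piFinset (fun _ : Fin 3 => Finset.range (N + 1)),
    monomial (Finsupp.equivFunOnFinite.symm γ) (g γ * (∏ c, ((γ c).factorial : ℝ))⁻¹) with hq
  have hdeg : q.totalDegree ≤ N := by
    refine totalDegree_finsetSum_le fun γ _ => ?_
    by_cases h : N < multiOrder γ
    · rw [hg γ h, zero_mul, monomial_zero, totalDegree_zero]
      exact Nat.zero_le _
    · refine (totalDegree_monomial_le _ _).trans ?_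
      rw [Finsupp.sum_fintype _ _ fun _ => rfl]
      exact not_lt.1 h
  refine ⟨shiftPoly (-a) q, (totalDegree_shiftPoly_le _ _).trans hdeg, fun β => ?_⟩
  rw [partialD_shiftPoly, evalAt_shiftPoly, add_neg_cancel, evalAt_zero_partialD, hq, coeff_sum]
  simp only [coeff_monomial, EmbeddingLike.apply_eq_iff_eq, Finset.sum_ite_eq']
  have h1 : (∏ c, ((β c).factorial : ℝ)) ≠ 0 := Finset.prod_ne_zero_iff.2 fun c _ => by positivity
  split_ifs with h
  · field_simp
  · rw [mul_zero, hg β]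
    simp only [Fintype.mem_piFinset, Finset.mem_range, not_forall] at h
    obtain ⟨c, hc⟩ := h
    have : β c ≤ multiOrder β :=
      Finset.single_le_sum (f := β) (fun _ _ => Nat.zero_le _) (Finset.mem_univ c)
    omega

theorem eq_zero_of_jet {a : E3} {p : Poly3} (h : ∀ β, evalAt a (partialD β p) = 0) : p = 0 := by
  have h1 : shiftPoly a p = 0 := by
    ext γ
    have h2 := evalAt_zero_partialD γ (shiftPoly a p)
    rw [partialD_shiftPoly, evalAt_shiftPoly, zero_add, h, eq_comm, mul_eq_zero] at h2
    rw [coeff_zero]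
    convert h2.resolve_left (Finset.prod_ne_zero_iff.2 fun c _ => by positivity)
    ext
    rfl
  rw [← shiftPoly_neg a p, h1, map_zero]

theorem partialD_of_totalDegree_lt {p : Poly3} {β : Fin 3 → ℕ} (h : p.totalDegree < multiOrder β) :
    partialD β p = 0 := by
  induction hn : multiOrder β generalizing β p with
  | zero => omega
  | succ n ih =>
    obtain ⟨c, γ, rfl⟩ := exists_eq_add_single (β := β) (by omega)
    rw [multiOrder_add_single] at h hn
    rw [← partialD_pderiv]
    by_cases h0 : p.totalDegree = 0
    · rw [totalDegree_eq_zero_iff_eq_C.1 h0, pderiv_C]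
      exact (partialD_sum γ (∅ : Finset ℕ) fun _ => 0)
    · refine ih ?_ (by omega)
      have := totalDegree_pderiv_le le_rfl c (p := p)
      omega

variable (T : Tetra)

/-- Values for the degrees of freedom at one vertex are attained. -/
theorem exists_vertex_field {r1 r2 : SmoothParam} {k : ℕ} (h1 : r1.v ≤ k + 1) (h2 : r2.v ≤ k)
    {d : DofData} (hd : d.TraceFree r1 r2) (i : Fin 4) :
    ∃ v ∈ VecPoly (k + 1), HasVertexDofs T r1 r2 v d i := by
  choose A hA hAd using fun c : Fin 3 => exists_jet (T i) (N := r1.v.toNat)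
    (g := fun β => if (multiOrder β : ℤ) ≤ r1.v then d.vert i β c else 0)
    fun β hβ => if_neg (by omega)
  -- `A` is the Taylor polynomial of the field. `w` carries the prescribed derivatives of the curl
  -- and has no terms of order below `max r1.v 0`.
  choose w hw hwd using fun c : Fin 3 => exists_jet (T i) (N := r2.v.toNat)
    (g := fun β => if max r1.v 0 ≤ (multiOrder β : ℤ) ∧ (multiOrder β : ℤ) ≤ r2.v then
      d.vertCurl i β c else 0) fun β hβ => if_neg (by omega)
  -- Outside the prescribed range all derivatives of `w` are zero, so the trace relation is needed
  -- only where it is assumed.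
  have hdiv : divF w = 0 := by
    refine eq_zero_of_jet (a := T i) fun β => ?_
    rw [divF, partialD_sum, evalAt_sum]
    simp only [partialD_pderiv, hwd, multiOrder_add_single]
    by_cases h : max r1.v 0 ≤ ((multiOrder β + 1 : ℕ) : ℤ) ∧ ((multiOrder β + 1 : ℕ) : ℤ) ≤ r2.v
    · simp only [if_pos h]
      exact hd i β (by exact_mod_cast h.1) (by exact_mod_cast h.2)
    · simp only [if_neg h, Finset.sum_const_zero]
  have hwv : ∀ c, w c ∈ vanish {T i} (max r1.v 0).toNat := fun c => by
    rw [mem_vanish_iff]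
    intro β hβ x hx
    obtain rfl : x = T i := hx
    rw [hwd, if_neg (by omega)]
  -- The vector potential of `w` gains one order, so adding it leaves the derivatives of the field
  -- up to order r1.v untouched.
  have hB := vectorPotential_vanish hwv
  refine ⟨A + vectorPotential (T i) w, vecPoly_add (fun c => (hA c).trans (by omega))
    fun c => totalDegree_vectorPotential_le (fun c => (hw c).trans (by omega)) c,
    fun β c hβ => ?_, fun β c hβ hβ' => ?_⟩
  · rw [Pi.add_apply, partialD_add, evalAt_add, hAd, if_pos hβ,
      mem_vanish_iff.1 (hB c) β (by omega) (T i) rfl, add_zero]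
  · rw [curlF_add, curlF_vectorPotential hdiv, Pi.add_apply, partialD_add, evalAt_add, hwd,
      if_pos ⟨hβ, hβ'⟩]
    -- In the prescribed range curl A does not interfere: A has degree at most `r1.v.toNat`, so its
    -- curl has lower degree, and is zero if A is constant.
    have h3 : partialD β (curlF A c) = 0 := by
      have h4 := totalDegree_curlF_le hA c
      rcases Nat.eq_zero_or_pos (multiOrder β) with h5 | h5
      · have h6 : curlF A = 0 := by
          have h7 : ∀ a b, pderiv a (A b) = 0 := fun a b => by
            rw [totalDegree_eq_zero_iff_eq_C.1 (Nat.le_zero.1 ((hA b).trans (by omega))), pderiv_C]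
          funext a
          fin_cases a <;> simp [curlF, h7]
        rw [h6]
        exact (partialD_sum β (∅ : Finset ℕ) fun _ => 0)
      · exact partialD_of_totalDegree_lt (by omega)
    rw [h3, evalAt_zero, zero_add]

theorem HasVertexDofs.congr {r1 r2 : SmoothParam} {u v : VField} {d : DofData} {i : Fin 4}
    (h : HasVertexDofs T r1 r2 v d i) (h1 : ∀ c, u c - v c ∈ vanish (hull T {i}) (r1.v + 1).toNat)
    (h2 : ∀ c, curlF u c - curlF v c ∈ vanish (hull T {i}) (r2.v + 1).toNat) :
    HasVertexDofs T r1 r2 u d i := by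
  rw [hull_singleton] at h1 h2
  refine ⟨fun β c hβ => ?_, fun β c hβ hβ' => ?_⟩
  · rw [← h.1 β c hβ, ← sub_eq_zero, ← evalAt_sub, ← partialD_sub]
    exact mem_vanish_iff.1 (h1 c) β (by omega) _ rfl
  · rw [← h.2 β c hβ hβ', ← sub_eq_zero, ← evalAt_sub, ← partialD_sub]
    exact mem_vanish_iff.1 (h2 c) β (by omega) _ rfl

end Jets

/-! ### Circulations along edges and fields with a given curl -/

section Circulation

variable (T : Tetra)

theorem circ_add (e : TetEdge) (u v : VField) : circ T e (u + v) = circ T e u + circ T e v := by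
  rw [circ, dotVec_add_left, map_add, map_add, circ, circ]

theorem circ_sub (e : TetEdge) (u v : VField) : circ T e (u - v) = circ T e u - circ T e v := by
  rw [circ, dotVec_sub_left, map_sub, map_sub, circ, circ]

theorem circ_smul (e : TetEdge) (a : ℝ) (v : VField) : circ T e (a • v) = a * circ T e v := by
  rw [circ, dotVec_smul_left, map_smul, map_smul, circ, smul_eq_mul]

theorem circ_sum (e : TetEdge) {ι : Type*} (s : Finset ι) (f : ι → VField) :
    circ T e (∑ i ∈ s, f i) = ∑ i ∈ s, circ T e (f i) := by
  induction s using Finset.cons_induction with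
  | empty => simp [circ, dotVec]
  | cons a s ha ih => rw [Finset.sum_cons, Finset.sum_cons, circ_add, ih]

theorem circ_gradP (e : TetEdge) (p : Poly3) :
    circ T e (gradP p) = evalAt (T e.1.2) p - evalAt (T e.1.1) p := by
  rw [circ, dotVec_gradP, edgeVec, ← derivative_edgePoly]
  change ∫ s in (0 : ℝ)..1, _ = _
  rw [intervalIntegral.integral_eq_sub_of_hasDerivAt (f := fun s => (edgePoly T e p).eval s)
    (fun s _ => Polynomial.hasDerivAt _ s) ((Polynomial.continuous _).intervalIntegrable _ _)]
  rw [eval_edgePoly, eval_edgePoly, AffineMap.lineMap_apply_one, AffineMap.lineMap_apply_zero]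

/-- The lowest order edge element basis. -/
def whitney (e : TetEdge) : VField :=
  bary T e.1.1 • gradP (bary T e.1.2) - bary T e.1.2 • gradP (bary T e.1.1)

theorem dotVec_whitney (e : TetEdge) (d : E3) : dotVec (whitney T e) d =
    bary T e.1.1 * C (coordLin T d e.1.2) - bary T e.1.2 * C (coordLin T d e.1.1) := by
  rw [← dirD_bary, ← dirD_bary, ← dotVec_gradP, ← dotVec_gradP, whitney, dotVec_sub_left]
  have h : ∀ (p : Poly3) (w : VField), dotVec (p • w) d = p * dotVec w d := fun p w => by
    rw [dotVec, dotVec, Finset.mul_sum]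
    exact Finset.sum_congr rfl fun c _ => mul_left_comm _ _ _
  rw [h, h]

theorem circ_whitney (e e' : TetEdge) : circ T e' (whitney T e) = if e' = e then 1 else 0 := by
  rw [circ, dotVec_whitney]
  split_ifs with h
  · subst h
    rw [edgeVec, coordLin_vertex_sub, coordLin_vertex_sub, if_pos rfl, if_pos rfl,
      if_neg e'.2.ne', if_neg e'.2.ne]
    simp only [sub_zero, zero_sub, C_1, C_neg, mul_one, mul_neg, sub_neg_eq_add, map_add,
      edgePoly_bary]
    have : unitInt 1 = 1 := by simp [unitInt]
    rw [← map_add, sub_add_cancel, this]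
  · have h1 : ∀ i, i ∉ edgeSet e' → edgePoly T e' (bary T i) = 0 := fun i hi =>
      (edgePoly_eq_zero_iff T e' _).2 (mem_vanish_one.1 (bary_vanish T hi))
    have h2 := edgeVec_tangent T e'
    rcases notMem_edgeSet_of_ne (Ne.symm h : e ≠ e').symm with h3 | h3
    · rw [h2 _ h3]
      simp [h1 _ h3]
    · rw [h2 _ h3]
      simp [h1 _ h3]

/-- This field realises the tangential moments against constants; its curl then tells which fluxes
the curl must have. -/
theorem exists_circ (I : TetEdge → ℝ) : ∃ v ∈ VecPoly 1, ∀ e, circ T e v = I e := by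
  refine ⟨∑ e, I e • whitney T e, fun c => ?_, fun e => ?_⟩
  · rw [Finset.sum_apply]
    refine totalDegree_finsetSum_le fun e _ => ?_
    have h1 : ∀ i j, (bary T i * gradP (bary T j) c).totalDegree ≤ 1 := fun i j => by
      refine (totalDegree_mul _ _).trans ?_
      have h2 := totalDegree_gradP_le (k := 0) (totalDegree_bary_le T j) c
      have h3 := totalDegree_bary_le T i
      omega
    exact (totalDegree_smul_le _ _).trans ((totalDegree_sub _ _).trans (max_le (h1 _ _) (h1 _ _)))
  · rw [circ_sum]
    simp only [circ_smul, circ_whitney, mul_ite, mul_one, mul_zero, Finset.sum_ite_eq,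
      Finset.mem_univ, if_true]

theorem evalAt_vertex_bary (i j : Fin 4) : evalAt (T i) (bary T j) = if j = i then 1 else 0 := by
  rw [evalAt_bary, AffineBasis.coord_apply]

/-- A divergence-free field is the curl of a field with given circulations, if these match the
fluxes through the faces. -/
theorem exists_curl_eq (F : TetFrames T) {k : ℕ} {w x : VField} (hw : w ∈ VecPoly k)
    (hdiv : divF w = 0)
    (hflux : ∀ o, faceInt T o (dotVec w (F.fn o)) = faceInt T o (dotVec (curlF x) (F.fn o))) :
    ∃ v ∈ VecPoly (k + 1), curlF v = w ∧ ∀ e, circ T e v = circ T e x := by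
  set y := vectorPotential (T 0) w with hy
  have hcurl : curlF y = w := curlF_vectorPotential hdiv
  set I : TetEdge → ℝ := fun e => circ T e (y - x) with hI
  have hface : ∀ o, I (faceEdge o 0 1 (by decide)) + I (faceEdge o 1 2 (by decide)) =
      I (faceEdge o 0 2 (by decide)) := by
    intro o
    obtain ⟨c, hc, hv⟩ := faceInt_curl T F o
    have h := hv (y - x)
    rw [curlF_sub, dotVec_sub_left, faceInt_sub, hcurl, hflux, sub_self, eq_comm, mul_eq_zero] at h
    exact sub_eq_zero.1 (h.resolve_left hc)
  -- The wrong circulations add up to zero around each face, so they are differences of vertex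
  -- values. These values are read along the edges from vertex 0 and interpolated by an affine
  -- function.
  set c : Fin 4 → ℝ := fun i => if h : 0 < i then -I ⟨(0, i), h⟩ else 0 with hc
  set p : Poly3 := ∑ i, c i • bary T i with hp
  have hpv : ∀ i, evalAt (T i) p = c i := fun i => by
    rw [hp, evalAt_sum]
    simp only [evalAt_smul, evalAt_vertex_bary]
    simp
  have hpd : p.totalDegree ≤ k + 1 + 1 := totalDegree_finsetSum_le fun i _ =>
    (totalDegree_smul_le _ _).trans ((totalDegree_bary_le T i).trans (by omega))
  refine ⟨y + gradP p, vecPoly_add (totalDegree_vectorPotential_le hw) (totalDegree_gradP_le hpd),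
    by rw [curlF_add, curlF_gradP, hcurl, add_zero], fun e => ?_⟩
  rw [circ_add, circ_gradP, hpv, hpv]
  -- Edges at vertex 0 hold by the choice of `c`; each other edge forms a face with vertex 0, and
  -- the relation on that face applies.
  have key : I e + (c e.1.2 - c e.1.1) = 0 := by
    have f1 : I ⟨(0, 2), by decide⟩ + I ⟨(2, 3), by decide⟩ = I ⟨(0, 3), by decide⟩ := hface 1
    have f2 : I ⟨(0, 1), by decide⟩ + I ⟨(1, 3), by decide⟩ = I ⟨(0, 3), by decide⟩ := hface 2
    have f3 : I ⟨(0, 1), by decide⟩ + I ⟨(1, 2), by decide⟩ = I ⟨(0, 2), by decide⟩ := hface 3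
    have c0 : c 0 = 0 := rfl
    have c1 : c 1 = -I ⟨(0, 1), by decide⟩ := rfl
    have c2 : c 2 = -I ⟨(0, 2), by decide⟩ := rfl
    have c3 : c 3 = -I ⟨(0, 3), by decide⟩ := rfl
    have hcases : ∀ e : TetEdge, e = ⟨(0, 1), by decide⟩ ∨ e = ⟨(0, 2), by decide⟩ ∨
        e = ⟨(0, 3), by decide⟩ ∨ e = ⟨(1, 2), by decide⟩ ∨ e = ⟨(1, 3), by decide⟩ ∨
        e = ⟨(2, 3), by decide⟩ := by decide
    rcases hcases e with rfl | rfl | rfl | rfl | rfl | rfl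
    · rw [c0, c1]; ring
    · rw [c0, c2]; ring
    · rw [c0, c3]; ring
    · rw [c1, c2]; linarith
    · rw [c1, c3]; linarith
    · rw [c2, c3]; linarith
  rw [hI] at key
  simp only [circ_sub] at key
  linarith

end Circulation

end CurlFE

end

noncomputable section

namespace CurlFE

/-! ### Attaining the degrees of freedom of the curl on edges -/

section EdgeCurl

variable (T : Tetra)

/-- Combination of the prescribed components with the dual frame. -/
theorem exists_field_of_frame {a b c : E3} (h : det3 a b c ≠ 0) (α β γ : Poly3) :
    ∃ w : VField, dotVec w a = α ∧ dotVec w b = β ∧ dotVec w c = γ := by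
  refine ⟨fun d => ((det3 a b c)⁻¹ * cross b c d) • α + ((det3 a b c)⁻¹ * cross c a d) • β +
    ((det3 a b c)⁻¹ * cross a b d) • γ, ?_⟩
  have hdot : ∀ x : E3, dotVec (fun d => ((det3 a b c)⁻¹ * cross b c d) • α +
      ((det3 a b c)⁻¹ * cross c a d) • β + ((det3 a b c)⁻¹ * cross a b d) • γ) x =
      ((det3 a b c)⁻¹ * det3 x b c) • α + ((det3 a b c)⁻¹ * det3 x c a) • β +
        ((det3 a b c)⁻¹ * det3 x a b) • γ := by
    intro x
    rw [dotVec_eq, Fin.sum_univ_three]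
    simp only [det3, inner_eq]
    module
  have h0 : ∀ x y : E3, det3 x x y = 0 := fun x y => by
    rw [det3_eq]
    ring
  have h1 : ∀ x y : E3, det3 x y x = 0 := fun x y => by
    rw [det3_eq]
    ring
  rw [hdot, hdot, hdot, h0, h1, h0, h1, h0, h1, det3_cycle a b c,
    ← det3_cycle c a b, inv_mul_cancel₀ h]
  simp

theorem vecPoly_of_frame {a b c : E3} (h : det3 a b c ≠ 0) {w : VField} {k : ℕ}
    (ha : (dotVec w a).totalDegree ≤ k) (hb : (dotVec w b).totalDegree ≤ k)
    (hc : (dotVec w c).totalDegree ≤ k) : w ∈ VecPoly k := fun d =>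
  (mem_restrictTotalDegree (Fin 3) k _).1 (field_mem_of_frame h
    ((mem_restrictTotalDegree (Fin 3) k _).2 ha) ((mem_restrictTotalDegree (Fin 3) k _).2 hb)
    ((mem_restrictTotalDegree (Fin 3) k _).2 hc) d)

variable (F : TetFrames T) (k : ℕ) (r : SmoothParam) (d : DofData)

/-- The degrees of freedom of the curl on an edge. -/
def CurlEdgeDofs (w : VField) (e : TetEdge) : Prop :=
  (∀ j : ℕ, (j : ℤ) ≤ r.e → ∀ q ∈ edgeTest (k - 2 * (r.v + 1) + j),
    edgeMoment T e ((dirD (F.en1 e))^[j] (dotVec w (F.en2 e))) q = d.edgeCurlN2 e j q) ∧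
  (∀ i j : ℕ, i ≤ j → (j : ℤ) ≤ r.e → ∀ q ∈ edgeTest (k - 2 * (r.v + 1) + j),
    edgeMoment T e ((dirD (F.en1 e))^[i] ((dirD (F.en2 e))^[j - i] (dotVec w (F.et e)))) q
      = d.edgeCurlT e j i q) ∧
  (∀ i j : ℕ, i ≤ j → (j : ℤ) ≤ r.e → ∀ q ∈ edgeTest (k - 2 * (r.v + 1) + j),
    edgeMoment T e ((dirD (F.en1 e))^[i] ((dirD (F.en2 e))^[j - i] (dotVec w (F.en1 e)))) q
      = d.edgeCurlN1 e j i q)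

variable {F k r d}

theorem CurlEdgeDofs.add_of_vanish {w y : VField} {e : TetEdge} (h : CurlEdgeDofs T F k r d w e)
    (hy : ∀ c, y c ∈ vanish (hull T (edgeSet e)) (r.e + 1).toNat) :
    CurlEdgeDofs T F k r d (w + y) e := by
  obtain ⟨h1, h2, h3⟩ := h
  refine ⟨fun j hj q hq => ?_, fun i j hij hj q hq => ?_, fun i j hij hj q hq => ?_⟩
  all_goals simp only [dotVec_add_left, iterate_dirD_add, edgeMoment_add_left]
  · rw [h1 j hj q hq, edgeMoment_eq_zero T e (fun x hx => ?_), add_zero]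
    exact evalAt_of_vanish (iterate_dirD_vanish (dotVec_mem hy _) _ _) (by omega) hx
  · rw [h2 i j hij hj q hq, edgeMoment_eq_zero T e (fun x hx => ?_), add_zero]
    exact evalAt_iterate_iterate (dotVec_mem hy _) _ _ _ _ (by omega) hx
  · rw [h3 i j hij hj q hq, edgeMoment_eq_zero T e (fun x hx => ?_), add_zero]
    exact evalAt_iterate_iterate (dotVec_mem hy _) _ _ _ _ (by omega) hx

theorem edgeMomentDual_apply (e : TetEdge) (p : Poly3) (q : Polynomial ℝ) :
    edgeMomentDual T e p q = edgeMoment T e p q := rfl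

variable (F d)

/-- The degrees of freedom on the edge leave some moments of the second normal component free. These
are spent on making the moments of the divergence zero, so that it vanishes on the edge to the order
required later. -/
theorem exists_edge_curl_correction (hr : r.IsDivParam) (hre : -1 ≤ r.e) (hk0 : 1 ≤ k)
    (hk : 2 * r.v + 1 ≤ k)
    {w : VField} (hw : w ∈ VecPoly k) (e : TetEdge)
    (hv : ∀ i, divF w ∈ vanish (hull T {i}) ((r.v + 1).toNat - 1)) :
    ∃ y ∈ VecPoly k, (∀ i c, y c ∈ vanish (hull T {i}) (r.v + 1).toNat) ∧
      (∀ e' ≠ e, ∀ c, y c ∈ vanish (hull T (edgeSet e')) (r.e + 1).toNat) ∧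
      CurlEdgeDofs T F k r d (w + y) e ∧
      divF (w + y) ∈ vanish (hull T (edgeSet e)) ((r.e + 1).toNat - 1) := by
  have hse : 2 * r.e ≤ r.v := by
    unfold SmoothParam.IsDivParam at hr
    omega
  have hdet := edgeVec_det_ne_zero T F e
  have hdet' := edgeStar_det_ne_zero T F e
  obtain ⟨s, hs, hst⟩ := exists_edge_scale T F e
  set a := F.en1 e with ha
  set b := F.en2 e with hb
  set bs := edgeNormalStar T F e with hbs
  obtain ⟨α, α1, α2, α3, α4⟩ := exists_edge_correction T e hdet hk hse fun j i =>
    d.edgeCurlT e j i - edgeMomentDual T e ((dirD a)^[i] ((dirD b)^[j - i] (dotVec w (F.et e))))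
  obtain ⟨β, β1, β2, β3, β4⟩ := exists_edge_correction T e hdet hk hse fun j i =>
    d.edgeCurlN1 e j i - edgeMomentDual T e ((dirD a)^[i] ((dirD b)^[j - i] (dotVec w a)))
  -- The part of det · div(w + y) that does not involve the second normal component; the rest is its
  -- derivative along the completing direction `bs`.
  set R : Poly3 := dirD (cross a b) (dotVec w (edgeVec T e) + s⁻¹ • α) +
    dirD (cross b (edgeVec T e)) (dotVec w a + β) with hR
  -- In the frame `a`, `bs` the pure `a`-derivatives carry the degrees of freedom. Every moment with
  -- a derivative along `bs` cancels a moment of the divergence of one order less.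
  obtain ⟨γ, γ1, γ2, γ3, γ4⟩ := exists_edge_correction T e hdet' hk hse fun j i =>
    if i = j then d.edgeCurlN2 e j - edgeMomentDual T e ((dirD a)^[j] (dotVec w b))
    else -edgeMomentDual T e ((dirD a)^[i] ((dirD bs)^[j - i] (dotVec w b))) -
      edgeMomentDual T e ((dirD a)^[i] ((dirD bs)^[j - i - 1] R))
  obtain ⟨y, yt, ya, yb⟩ := exists_field_of_frame hdet (s⁻¹ • α) β γ
  have yet : dotVec y (F.et e) = α := by
    rw [hst, dotVec_smul, yt, smul_smul, mul_inv_cancel₀ hs, one_smul]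
  have hmem : ∀ W : Submodule ℝ Poly3, α ∈ W → β ∈ W → γ ∈ W → ∀ c, y c ∈ W := fun W h1 h2 h3 =>
    field_mem_of_frame hdet (by rw [yt]; exact W.smul_mem _ h1) (by rw [ya]; exact h2)
      (by rw [yb]; exact h3)
  have hydeg : y ∈ VecPoly k := vecPoly_of_frame hdet
    (by rw [yt]; exact (totalDegree_smul_le _ _).trans α1) (by rw [ya]; exact β1)
    (by rw [yb]; exact γ1)
  have hyv : ∀ i c, y c ∈ vanish (hull T {i}) (r.v + 1).toNat := fun i =>
    hmem _ (α3 i) (β3 i) (γ3 i)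
  refine ⟨y, hydeg, hyv, fun e' he' => hmem _ (α4 e' he') (β4 e' he') (γ4 e' he'),
    ⟨fun j hj q hq => ?_, fun i j hij hj q hq => ?_, fun i j hij hj q hq => ?_⟩, ?_⟩
  · have h := γ2 j j le_rfl hj q hq
    rw [if_pos rfl, Nat.sub_self, Function.iterate_zero, id] at h
    rw [dotVec_add_left, iterate_dirD_add, edgeMoment_add_left, yb, h, LinearMap.sub_apply,
      edgeMomentDual_apply, add_sub_cancel]
  · rw [dotVec_add_left, iterate_dirD_add, iterate_dirD_add, edgeMoment_add_left, yet,
      α2 i j hij hj q hq, LinearMap.sub_apply, edgeMomentDual_apply, add_sub_cancel]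
  · rw [dotVec_add_left, iterate_dirD_add, iterate_dirD_add, edgeMoment_add_left, ya,
      β2 i j hij hj q hq, LinearMap.sub_apply, edgeMomentDual_apply, add_sub_cancel]
  · have hdiv : det3 (edgeVec T e) a b • divF (w + y) = dirD bs (dotVec w b + γ) + R := by
      rw [smul_divF, dotVec_add_left, dotVec_add_left, dotVec_add_left, yt, ya, yb, hR, hbs,
        edgeNormalStar]
      exact add_comm _ _
    have hvy : ∀ i, divF (w + y) ∈ vanish (hull T {i}) (r.v - 1 + 1).toNat := fun i => by
      rw [divF_add]
      refine Submodule.add_mem _ (vanish_mono (by omega) (hv i))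
        (vanish_mono (by omega) (divF_vanish (hyv i)))
    have h := edge_vanish_of_moments T hdet' (p := divF (w + y)) (k := k - 1) (sv := r.v - 1)
      (se := r.e - 1) (totalDegree_divF_le (vecPoly_add hw hydeg)) (by omega) (by omega)
      (hvy _) (hvy _) fun i j hij hj q hq => by
        -- For the divergence the degree and both parameters drop by one, so order j there has the
        -- test space of order j + 1 for the field.
        have hq' : q ∈ edgeTest (k - 2 * (r.v + 1) + (j + 1 : ℕ)) := by
          have hcast : (k : ℤ) - 2 * (r.v + 1) + (j + 1 : ℕ) =
              ((k - 1 : ℕ) : ℤ) - 2 * (r.v - 1 + 1) + j := by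
            push_cast [Nat.cast_sub hk0]
            ring
          rw [hcast]
          exact hq
        have h := γ2 i (j + 1) (by omega) (by push_cast; omega) q hq'
        rw [if_neg (by omega), show j + 1 - i = (j - i) + 1 by omega, Nat.add_sub_cancel,
          LinearMap.sub_apply, LinearMap.neg_apply, edgeMomentDual_apply, edgeMomentDual_apply] at h
        have h2 : edgeMoment T e ((dirD a)^[i] ((dirD bs)^[j - i]
            (det3 (edgeVec T e) a b • divF (w + y)))) q = 0 := by
          rw [Function.iterate_succ_apply] at h
          rw [hdiv, dirD_add, iterate_dirD_add, iterate_dirD_add, iterate_dirD_add,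
            iterate_dirD_add, edgeMoment_add_left, edgeMoment_add_left, h, Function.iterate_succ_apply]
          linarith
        rw [iterate_dirD_smul, iterate_dirD_smul, edgeMoment_smul_left] at h2
        exact (mul_eq_zero.1 h2).resolve_left hdet
    exact vanish_mono (by omega) h

end EdgeCurl

end CurlFE

end

noncomputable section

namespace CurlFE

/-! ### Attaining the degrees of freedom and the flux of the curl on faces -/

section FaceCurl

variable (T : Tetra) (F : TetFrames T)

/-- A field that vanishes at vertices, on edges, and on the other faces up to tangential
components. -/
def FaceLocal (r : SmoothParam) (o : Fin 4) (y : VField) : Prop :=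
  (∀ i c, y c ∈ vanish (hull T {i}) (r.v + 1).toNat) ∧
  (∀ e c, y c ∈ vanish (hull T (edgeSet e)) (r.e + 1).toNat) ∧
  (∀ o' ≠ o, ∀ c, y c ∈ vanish (hull T (faceSet o')) (r.f + 1).toNat) ∧
  ∀ o' ≠ o, dotVec y (F.fn o') ∈ vanish (hull T (faceSet o')) 1

variable {T F} {r : SmoothParam} {o : Fin 4}

theorem FaceLocal.add {y z : VField} (hy : FaceLocal T F r o y) (hz : FaceLocal T F r o z) :
    FaceLocal T F r o (y + z) := by
  obtain ⟨y1, y2, y3, y4⟩ := hy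
  obtain ⟨z1, z2, z3, z4⟩ := hz
  refine ⟨fun i c => Submodule.add_mem _ (y1 i c) (z1 i c),
    fun e c => Submodule.add_mem _ (y2 e c) (z2 e c),
    fun o' h c => Submodule.add_mem _ (y3 o' h c) (z3 o' h c), fun o' h => ?_⟩
  rw [dotVec_add_left]
  exact Submodule.add_mem _ (y4 o' h) (z4 o' h)

theorem FaceLocal.smul {y : VField} (a : ℝ) (hy : FaceLocal T F r o y) :
    FaceLocal T F r o (a • y) := by
  obtain ⟨y1, y2, y3, y4⟩ := hy
  refine ⟨fun i c => Submodule.smul_mem _ a (y1 i c), fun e c => Submodule.smul_mem _ a (y2 e c),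
    fun o' h c => Submodule.smul_mem _ a (y3 o' h c), fun o' h => ?_⟩
  rw [dotVec_smul_left]
  exact Submodule.smul_mem _ a (y4 o' h)

variable (T F)

theorem faceLocal_zero : FaceLocal T F r o 0 :=
  ⟨fun _ _ => Submodule.zero_mem _, fun _ _ => Submodule.zero_mem _,
    fun _ _ _ => Submodule.zero_mem _, fun _ _ => dotVec_mem (fun _ => Submodule.zero_mem _) _⟩

/-- Face bubble functions are normal traces of fields that live at this face. -/
theorem exists_normal_trace (hr : r.IsDivParam) {k : ℕ} (hk0 : 1 ≤ k) (hk : 2 * r.v + 1 ≤ k)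
    {u : Poly3} (hu : u ∈ bubble T (faceSet o) k r) :
    ∃ U ∈ VecPoly k, FaceLocal T F r o U ∧ dotVec U (F.fn o) = u := by
  induction hu using Submodule.span_induction with
  | zero => exact ⟨0, fun _ => by simp, faceLocal_zero T F, by simp [dotVec]⟩
  | add u w _ _ hu hw =>
    obtain ⟨U, hU, hU', rfl⟩ := hu
    obtain ⟨W, hW, hW', rfl⟩ := hw
    exact ⟨U + W, vecPoly_add hU hW, hU'.add hW', dotVec_add_left _ _ _⟩
  | smul a u _ hu =>
    obtain ⟨U, hU, hU', rfl⟩ := hu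
    exact ⟨a • U, fun c => (totalDegree_smul_le _ _).trans (hU c), hU'.smul a, dotVec_smul_left _ _ _⟩
  | mem u hu =>
    obtain ⟨α, hα, rfl⟩ := hu
    obtain ⟨b1, b2, b3, b4, b5, b6⟩ := face_node_bounds hα
    obtain ⟨i, hi0⟩ : ∃ i, α i ≠ 0 := by
      by_contra hcon
      push Not at hcon
      have := hα.2.1
      simp only [hcon, Finset.sum_const_zero] at this
      omega
    have hio : i ≠ o := fun h => hi0 (h ▸ b1)
    -- This direction is transversal to the face and tangential to the two other faces that contain
    -- the vertex i. On the face opposite to i the Bernstein polynomial vanishes because α i ≠ 0.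
    set t := T o - T i with ht
    have hne : (inner ℝ (F.fn o) t : ℝ) ≠ 0 := by
      obtain ⟨h, h0, h1⟩ := exists_height T F o
      rw [h1, ht, coordLin_vertex_sub, if_pos rfl, if_neg hio.symm, sub_zero, mul_one]
      exact h0
    have hdeg : (bernsteinPoly T α).totalDegree ≤ k :=
      totalDegree_of_mem_bubble T (Submodule.subset_span ⟨α, hα, rfl⟩)
    have hdot : ∀ n : E3, dotVec (fun c => (t c / inner ℝ (F.fn o) t) • bernsteinPoly T α) n =
        ((inner ℝ n t : ℝ) / inner ℝ (F.fn o) t) • bernsteinPoly T α := fun n => by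
      rw [dotVec_eq, Fin.sum_univ_three, inner_eq n t]
      module
    have hvan : ∀ (S : Finset (Fin 4)) (s : ℤ), s < ((∑ l ∈ Sᶜ, α l : ℕ) : ℤ) →
        bernsteinPoly T α ∈ vanish (hull T S) (s + 1).toNat := fun S s hs =>
      vanish_mono (by omega) (bernstein_vanish T S α)
    have hre : r.e ≤ r.v ∧ r.f ≤ r.e ∧ r.v < k := by
      unfold SmoothParam.IsDivParam at hr
      omega
    refine ⟨fun c => (t c / inner ℝ (F.fn o) t) • bernsteinPoly T α,
      fun c => (totalDegree_smul_le _ _).trans hdeg, ⟨fun l c => Submodule.smul_mem _ _ (hvan _ _ ?_),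
        fun e c => Submodule.smul_mem _ _ (hvan _ _ ?_),
        fun o' ho' c => Submodule.smul_mem _ _ (hvan _ _ ?_), fun o' ho' => ?_⟩, ?_⟩
    · by_cases hl : l = o
      · rw [hl, b3]
        exact hre.2.2
      · exact b2 l hl
    · by_cases he : o ∈ edgeSet e
      · exact lt_of_le_of_lt hre.1 (b5 e he)
      · exact b4 e he
    · rw [compl_faceSet, Finset.sum_singleton]
      exact lt_of_le_of_lt hre.2.1 (b6 o' ho')
    · rw [hdot]
      by_cases hoi : i = o'
      · refine Submodule.smul_mem _ _ (mem_vanish_one.2 fun x hx => ?_)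
        exact evalAt_bernstein_eq_zero T hx ⟨i, by simp [mem_faceSet, hoi], hi0⟩
      · rw [F.fn_normal o' o i ho'.symm hoi, zero_div, zero_smul]
        exact Submodule.zero_mem _
    · rw [hdot, div_self hne, one_smul]

/-- A single Bernstein polynomial on the face has positive integral. Here the nontriviality of the
face bubble space enters; without it the flux could not be prescribed. -/
theorem exists_bubble_faceInt_ne_zero {m : ℤ} (h : 1 ≤ Module.finrank ℝ (bubble T (faceSet o) m r)) :
    ∃ b ∈ bubble T (faceSet o) m r, faceInt T o b ≠ 0 := by
  obtain ⟨α, hα⟩ : (bubbleNodes (faceSet o) m r).Nonempty := by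
    by_contra hcon
    rw [Set.not_nonempty_iff_eq_empty] at hcon
    rw [bubble, hcon, Set.image_empty, Submodule.span_empty, finrank_bot] at h
    omega
  refine ⟨bernsteinPoly T α, Submodule.subset_span ⟨α, hα, rfl⟩, ?_⟩
  set β : Fin 4 →₀ ℕ := Finsupp.equivFunOnFinite.symm α with hβ
  have h1 : bernsteinPoly T α = phi T (monomial β 1) := by
    rw [phi_monomial, one_smul, hβ]
    rfl
  rw [h1, faceInt_phi T (isHomogeneous_monomial 1 rfl), lam_monomial, 
    if_pos (show ∀ i ∉ faceSet o, β i = 0 from fun i hi => hα.1 i hi)]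
  refine mul_ne_zero (div_ne_zero (faceJac_pos T o).ne' (by positivity)) (mul_ne_zero one_ne_zero ?_)
  exact Finset.prod_ne_zero_iff.2 fun i _ => by positivity

/-- Moments against bubble functions of mean zero can be prescribed together with the mean. -/
theorem exists_face_representer_mean {m : ℤ}
    (h : 1 ≤ Module.finrank ℝ (bubble T (faceSet o) m r)) (ρ : Module.Dual ℝ Poly3) (s : ℝ) :
    ∃ u ∈ bubble T (faceSet o) m r, (∀ q ∈ bubble T (faceSet o) m r, faceInt T o q = 0 →
      faceInt T o (u * q) = ρ q) ∧ faceInt T o u = s := by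
  obtain ⟨b, hb, hb0⟩ := exists_bubble_faceInt_ne_zero T h
  obtain ⟨u, hu, hu'⟩ := exists_face_representer T o m r ρ
  -- `g` represents the mean, so multiples of `g` are invisible to test functions of mean zero. Its
  -- own mean equals the integral of g², which is not zero.
  obtain ⟨g, hg, hg'⟩ := exists_face_representer T o m r (faceLin T o)
  simp only [faceLin_apply] at hg'
  have hg0 : faceInt T o g ≠ 0 := by
    intro h0
    rw [← hg' g hg] at h0
    have h1 := eq_zero_of_faceInt_mul_self T h0
    refine hb0 ?_
    rw [← hg' b hb]
    exact faceInt_eq_zero T o fun x hx => by rw [evalAt_mul, h1 x hx, zero_mul]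
  refine ⟨u + ((s - faceInt T o u) / faceInt T o g) • g,
    Submodule.add_mem _ hu (Submodule.smul_mem _ _ hg), fun q hq hq0 => ?_, ?_⟩
  · rw [add_mul, faceInt_add, hu' q hq, smul_mul_assoc, faceInt_smul, hg' q hq, hq0, mul_zero, add_zero]
  · rw [faceInt_add, faceInt_smul, div_mul_cancel₀ _ hg0]
    ring

/-- The degrees of freedom of the curl on a face. -/
def CurlFaceDofs (T : Tetra) (F : TetFrames T) (k : ℕ) (r : SmoothParam) (d : DofData) (w : VField)
    (o : Fin 4) : Prop :=
  (∀ q ∈ bubble T (faceSet o) k r, faceInt T o q = 0 →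
    faceInt T o (dotVec w (F.fn o) * q) = d.faceCurlN o q) ∧
  (∀ j : ℕ, (j : ℤ) ≤ r.f → ∀ l : Fin 2, ∀ q ∈ bubble T (faceSet o) (k - j) (r.shift (-j)),
    faceInt T o ((dirD (F.fn o))^[j] (dotVec w (F.ft o l)) * q) = d.faceCurlT o j l q)

variable {k : ℕ} {d : DofData}

theorem faceInt_mul_eq_zero {p : Poly3} (hp : p ∈ vanish (hull T (faceSet o)) 1) (q : Poly3) :
    faceInt T o (p * q) = 0 :=
  faceInt_eq_zero T o fun x hx => by rw [evalAt_mul, mem_vanish_one.1 hp x hx, zero_mul]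

theorem CurlFaceDofs.add_of_vanish {w y : VField} (h : CurlFaceDofs T F k r d w o)
    (hn : dotVec y (F.fn o) ∈ vanish (hull T (faceSet o)) 1)
    (hy : ∀ c, y c ∈ vanish (hull T (faceSet o)) (r.f + 1).toNat) :
    CurlFaceDofs T F k r d (w + y) o := by
  obtain ⟨h1, h2⟩ := h
  refine ⟨fun q hq h0 => ?_, fun j hj l q hq => ?_⟩
  · rw [dotVec_add_left, add_mul, faceInt_add, h1 q hq h0, faceInt_mul_eq_zero T hn, add_zero]
  · rw [dotVec_add_left, iterate_dirD_add, add_mul, faceInt_add, h2 j hj l q hq,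
      faceInt_mul_eq_zero T (vanish_mono (by omega)
        (iterate_dirD_vanish (dotVec_mem hy _) (F.fn o) j)), add_zero]

theorem faceInt_normal_add_of_vanish {w y : VField}
    (hn : dotVec y (F.fn o) ∈ vanish (hull T (faceSet o)) 1) :
    faceInt T o (dotVec (w + y) (F.fn o)) = faceInt T o (dotVec w (F.fn o)) := by
  rw [dotVec_add_left, faceInt_add, faceInt_eq_zero T o (mem_vanish_one.1 hn), add_zero]

theorem exists_face_cross : ∃ κ : ℝ, κ ≠ 0 ∧ cross (F.ft o 0) (F.ft o 1) = κ • F.fn o := by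
  obtain ⟨μ, hμ⟩ := cross_eq_smul_normal (a := F.ft o 0) (b := F.ft o 1) (F.fn_ne o)
    (by rw [real_inner_comm]; exact F.ft_tangent o 0)
    (by rw [real_inner_comm]; exact F.ft_tangent o 1)
  refine ⟨μ, ?_, hμ⟩
  rintro rfl
  have hdet := face_det_ne_zero T F o
  rw [det3, hμ, zero_smul, inner_zero_right] at hdet
  exact hdet rfl

variable (d)

/-- The tangential degrees of freedom of the curl on a face can be prescribed without changing the
normal trace, so that the divergence vanishes on the face. -/
theorem exists_face_tangential_correction (hr : r.IsDivParam) (hf : 0 ≤ r.f) (hk0 : 1 ≤ k)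
    (hk : 2 * r.v + 1 ≤ k) {w : VField} (hw : w ∈ VecPoly k)
    (hv : ∀ i, divF w ∈ vanish (hull T {i}) ((r.v + 1).toNat - 1))
    (he : ∀ e, divF w ∈ vanish (hull T (edgeSet e)) ((r.e + 1).toNat - 1)) :
    ∃ y ∈ VecPoly k, FaceLocal T F r o y ∧ dotVec y (F.fn o) ∈ vanish (hull T (faceSet o)) 1 ∧
      (∀ j : ℕ, (j : ℤ) ≤ r.f → ∀ l : Fin 2, ∀ q ∈ bubble T (faceSet o) (k - j) (r.shift (-j)),
        faceInt T o ((dirD (F.fn o))^[j] (dotVec (w + y) (F.ft o l)) * q) = d.faceCurlT o j l q) ∧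
      divF (w + y) ∈ vanish (hull T (faceSet o)) ((r.f + 1).toNat - 1) := by
  have hpar : 2 * r.f ≤ r.e ∧ 2 * r.e ≤ r.v := by
    unfold SmoothParam.IsDivParam at hr
    omega
  have hdet := face_det_ne_zero T F o
  obtain ⟨κ, hκ, hcr⟩ := exists_face_cross T F (o := o)
  choose τ τ1 τ2 τ3 τ4 τ5 using fun l : Fin 2 => exists_face_correction T F o hk hpar.1 hpar.2
    fun j => d.faceCurlT o j l - faceMomentDual T o ((dirD (F.fn o))^[j] (dotVec w (F.ft o l)))
  -- The part of the divergence, suitably scaled, that does not involve the normal component of the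
  -- correction.
  set R : Poly3 := κ⁻¹ • (dirD (cross (F.ft o 1) (F.fn o)) (dotVec w (F.ft o 0) + τ 0) +
    dirD (cross (F.fn o) (F.ft o 0)) (dotVec w (F.ft o 1) + τ 1)) with hR
  -- Moment zero at order 0 keeps the normal trace; the moments of higher order cancel those of the
  -- divergence.
  obtain ⟨ν, ν1, ν2, ν3, ν4, ν5⟩ := exists_face_correction T F o hk hpar.1 hpar.2
    fun j => if j = 0 then 0 else
      -faceMomentDual T o ((dirD (F.fn o))^[j] (dotVec w (F.fn o))) -
        faceMomentDual T o ((dirD (F.fn o))^[j - 1] R)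
  obtain ⟨y, yn, y0, y1⟩ := exists_field_of_frame hdet ν (τ 0) (τ 1)
  have yl : ∀ l, dotVec y (F.ft o l) = τ l := fun l => by
    fin_cases l
    · exact y0
    · exact y1
  have hmem : ∀ W : Submodule ℝ Poly3, ν ∈ W → (∀ l, τ l ∈ W) → ∀ c, y c ∈ W := fun W h1 h2 =>
    field_mem_of_frame hdet (by rw [yn]; exact h1) (by rw [y0]; exact h2 0)
      (by rw [y1]; exact h2 1)
  have hydeg : y ∈ VecPoly k := vecPoly_of_frame hdet (by rw [yn]; exact ν1)
    (by rw [y0]; exact τ1 0) (by rw [y1]; exact τ1 1)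
  have hyv : ∀ i c, y c ∈ vanish (hull T {i}) (r.v + 1).toNat := fun i =>
    hmem _ (ν3 i) fun l => τ3 l i
  have hye : ∀ e c, y c ∈ vanish (hull T (edgeSet e)) (r.e + 1).toNat := fun e =>
    hmem _ (ν4 e) fun l => τ4 l e
  have hyf : ∀ o' ≠ o, ∀ c, y c ∈ vanish (hull T (faceSet o')) (r.f + 1).toNat := fun o' ho' =>
    hmem _ (ν5 o' ho') fun l => τ5 l o' ho'
  have hν : dotVec y (F.fn o) ∈ vanish (hull T (faceSet o)) 1 := by
    rw [yn]
    refine mem_vanish_one.2 (face_eq_zero_of_moments T ν1 (fun i _ => ν3 i) (fun e _ _ => ν4 e)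
      fun q hq _ => ?_)
    have h := ν2 0 (by exact_mod_cast hf) q (by simpa [SmoothParam.shift] using hq)
    simpa using h
  refine ⟨y, hydeg, ⟨hyv, hye, hyf, fun o' ho' => vanish_mono (by omega)
    (dotVec_mem (hyf o' ho') _)⟩, hν, fun j hj l q hq => ?_, ?_⟩
  · rw [dotVec_add_left, iterate_dirD_add, add_mul, faceInt_add, yl, τ2 l j hj q hq,
      LinearMap.sub_apply, faceMomentDual_apply, add_sub_cancel]
  · have hdiv : (κ⁻¹ * det3 (F.fn o) (F.ft o 0) (F.ft o 1)) • divF (w + y) =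
        dirD (F.fn o) (dotVec w (F.fn o) + ν) + R := by
      rw [mul_smul, smul_divF, dotVec_add_left, dotVec_add_left, dotVec_add_left, yn, y0, y1, hR,
        hcr, dirD_smul_dir, add_assoc, smul_add, smul_smul, inv_mul_cancel₀ hκ, one_smul]
    have hne : κ⁻¹ * det3 (F.fn o) (F.ft o 0) (F.ft o 1) ≠ 0 := mul_ne_zero (inv_ne_zero hκ) hdet
    have hvy : ∀ i, divF (w + y) ∈ vanish (hull T {i}) (r.v - 1 + 1).toNat := fun i => by
      rw [divF_add]
      exact Submodule.add_mem _ (vanish_mono (by omega) (hv i))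
        (vanish_mono (by omega) (divF_vanish (hyv i)))
    have hey : ∀ e, divF (w + y) ∈ vanish (hull T (edgeSet e)) (r.e - 1 + 1).toNat := fun e => by
      rw [divF_add]
      exact Submodule.add_mem _ (vanish_mono (by omega) (he e))
        (vanish_mono (by omega) (divF_vanish (hye e)))
    have h := face_vanish_of_moments T F (o := o) (p := divF (w + y)) (k := k - 1)
      (r := ⟨r.v - 1, r.e - 1, r.f - 1⟩) (totalDegree_divF_le (vecPoly_add hw hydeg))
      (by change r.f - 1 ≤ _; omega) (fun i _ => hvy i) (fun e _ _ => hey e) fun j hj q hq => by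
        change (j : ℤ) ≤ r.f - 1 at hj
        have hq' : q ∈ bubble T (faceSet o) (k - (j + 1 : ℕ)) (r.shift (-(j + 1 : ℕ))) := by
          have h1 : (k : ℤ) - (j + 1 : ℕ) = ((k - 1 : ℕ) : ℤ) - j := by
            push_cast [Nat.cast_sub hk0]
            ring
          have h2 : r.shift (-(j + 1 : ℕ)) =
              SmoothParam.shift ⟨r.v - 1, r.e - 1, r.f - 1⟩ (-(j : ℤ)) := by
            simp only [SmoothParam.shift, SmoothParam.mk.injEq]
            push_cast
            refine ⟨by ring, by ring, by ring⟩
          rw [h1, h2]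
          exact hq
        have h := ν2 (j + 1) (by push_cast; omega) q hq'
        rw [if_neg (Nat.succ_ne_zero j), Nat.add_sub_cancel, LinearMap.sub_apply,
          LinearMap.neg_apply, faceMomentDual_apply, faceMomentDual_apply,
          Function.iterate_succ_apply, Function.iterate_succ_apply] at h
        have h2 : faceInt T o ((dirD (F.fn o))^[j]
            ((κ⁻¹ * det3 (F.fn o) (F.ft o 0) (F.ft o 1)) • divF (w + y)) * q) = 0 := by
          rw [hdiv, dirD_add, iterate_dirD_add, iterate_dirD_add, add_mul, add_mul, faceInt_add,
            faceInt_add, h]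
          linarith
        rw [iterate_dirD_smul, smul_mul_assoc, faceInt_smul] at h2
        exact (mul_eq_zero.1 h2).resolve_left hne
    refine vanish_mono ?_ h
    change _ ≤ (r.f - 1 + 1).toNat
    omega

/-- The normal trace, with its mean, is corrected first; the tangential correction that follows
leaves it alone. For r.f = -1 there are no tangential degrees of freedom and no condition on the
divergence. -/
theorem exists_face_curl_correction (hr : r.IsDivParam) (hk0 : 1 ≤ k)
    (hk : 2 * r.v + 1 ≤ k) (hface : 1 ≤ Module.finrank ℝ (bubble T (faceSet o) k r))
    {w : VField} (hw : w ∈ VecPoly k)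
    (hv : ∀ i, divF w ∈ vanish (hull T {i}) ((r.v + 1).toNat - 1))
    (he : ∀ e, divF w ∈ vanish (hull T (edgeSet e)) ((r.e + 1).toNat - 1)) (s : ℝ) :
    ∃ y ∈ VecPoly k, FaceLocal T F r o y ∧ CurlFaceDofs T F k r d (w + y) o ∧
      faceInt T o (dotVec (w + y) (F.fn o)) = s ∧
      divF (w + y) ∈ vanish (hull T (faceSet o)) ((r.f + 1).toNat - 1) := by
  obtain ⟨u, hu, hu1, hu2⟩ := exists_face_representer_mean T hface
    (d.faceCurlN o - faceMomentDual T o (dotVec w (F.fn o)))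
    (s - faceInt T o (dotVec w (F.fn o)))
  obtain ⟨U, hU, hUl, hUn⟩ := exists_normal_trace T F hr hk0 hk hu
  have hn1 : ∀ q ∈ bubble T (faceSet o) k r, faceInt T o q = 0 →
      faceInt T o (dotVec (w + U) (F.fn o) * q) = d.faceCurlN o q := fun q hq hq0 => by
    rw [dotVec_add_left, hUn, add_mul, faceInt_add, hu1 q hq hq0, LinearMap.sub_apply,
      faceMomentDual_apply, add_sub_cancel]
  have hn2 : faceInt T o (dotVec (w + U) (F.fn o)) = s := by
    rw [dotVec_add_left, hUn, faceInt_add, hu2, add_sub_cancel]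
  by_cases hf : 0 ≤ r.f
  · obtain ⟨y, hy, hyl, hyn, hyt, hyd⟩ := exists_face_tangential_correction T F d (o := o) hr hf hk0
      hk (vecPoly_add hw hU)
      (fun i => by rw [divF_add]; exact Submodule.add_mem _ (hv i) (divF_vanish (hUl.1 i)))
      (fun e => by rw [divF_add]; exact Submodule.add_mem _ (he e) (divF_vanish (hUl.2.1 e)))
    refine ⟨U + y, vecPoly_add hU hy, hUl.add hyl, ?_, ?_, ?_⟩
    · rw [← add_assoc]
      refine ⟨fun q hq hq0 => ?_, hyt⟩
      rw [dotVec_add_left, add_mul, faceInt_add, hn1 q hq hq0, faceInt_mul_eq_zero T hyn, add_zero]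
    · rw [← add_assoc, faceInt_normal_add_of_vanish T F hyn, hn2]
    · rw [← add_assoc]
      exact hyd
  · refine ⟨U, hU, hUl, ⟨hn1, fun j hj => absurd hj (by omega)⟩, hn2, ?_⟩
    rw [show (r.f + 1).toNat - 1 = 0 by omega]
    trivial

end FaceCurl

end CurlFE

end

noncomputable section

namespace CurlFE

/-! ### Divergence-free fields with all degrees of freedom of the curl -/

section CurlField

/-- Local corrections that do not disturb each other can be made one after the other. -/
theorem exists_of_local_corrections {ι E : Type*} [Fintype ι] {P : E → Prop} {Q : ι → E → Prop}
    (h : ∀ w, P w → ∀ e, ∃ w', P w' ∧ Q e w' ∧ ∀ e' ≠ e, Q e' w → Q e' w') {w : E} (hw : P w) :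
    ∃ w', P w' ∧ ∀ e, Q e w' := by
  classical
  suffices H : ∀ s : Finset ι, ∃ w', P w' ∧ ∀ e ∈ s, Q e w' by
    obtain ⟨w', h1, h2⟩ := H Finset.univ
    exact ⟨w', h1, fun e => h2 e (Finset.mem_univ e)⟩
  intro s
  induction s using Finset.induction_on with
  | empty => exact ⟨w, hw, by simp⟩
  | insert e s he ih =>
    obtain ⟨u, hu, hu'⟩ := ih
    obtain ⟨w', h1, h2, h3⟩ := h u hu e
    refine ⟨w', h1, fun e' he' => ?_⟩
    rcases Finset.mem_insert.1 he' with rfl | h4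
    · exact h2
    · exact h3 e' (fun h5 => he (h5 ▸ h4)) (hu' e' h4)

variable (T : Tetra) (F : TetFrames T) (d : DofData)

theorem finite_of_mem_bubble {S : Submodule ℝ VField} {m : ℤ} {r : SmoothParam}
    (h : ∀ y ∈ S, ∀ c, y c ∈ bubble T Finset.univ m r) : Module.Finite ℝ S := by
  let f : S →ₗ[ℝ] Fin 3 → bubble T Finset.univ m r :=
    LinearMap.pi fun c => ((LinearMap.proj c).comp S.subtype).codRestrict _ fun y => h y y.2 c
  refine Module.Finite.of_injective f fun x y hxy => Subtype.ext (funext fun c => ?_)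
  exact congrArg Subtype.val (congrFun hxy c)

theorem eq_zero_of_cellInt_fdot {y : VField} (h : cellInt T (fdot y y) = 0) : y = 0 := by
  have h2 := eq_zero_of_cellInt T (fun x => fdot_self_nonneg x _) h
  funext c
  exact poly_ext fun x => by
    rw [evalAt_eq_zero_of_fdot_self (by rw [h2, evalAt_zero]) c, Pi.zero_apply, evalAt_zero]

variable {T F d} {r : SmoothParam} {k : ℕ}

theorem divF_vanish_of_congr {w g : VField} {Z : Set E3} {N : ℕ} (hg : divF g = 0)
    (h : ∀ c, w c - g c ∈ vanish Z N) : divF w ∈ vanish Z (N - 1) := by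
  have h1 := divF_vanish (w := w - g) h
  rwa [divF_sub, hg, sub_zero] at h1

theorem add_sub_mem {W : Submodule ℝ Poly3} {a b c : Poly3} (h : a - c ∈ W) (hb : b ∈ W) :
    a + b - c ∈ W := by
  rw [add_sub_right_comm]
  exact Submodule.add_mem _ h hb

variable (T F d)

/-- Divergence-free fields with prescribed degrees of freedom of the curl. The fluxes through
the faces are those of a given divergence-free field. -/
theorem exists_curl_dofs (hr : r.IsDivParam) (hk0 : 1 ≤ k) (hk : 2 * r.v + 1 ≤ k)
    (hface : ∀ o, 1 ≤ Module.finrank ℝ (bubble T (faceSet o) k r)) {g : Fin 4 → VField}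
    (hg : ∀ i, g i ∈ VecPoly k) (hgd : ∀ i, divF (g i) = 0) {x : VField} (hx : x ∈ VecPoly k)
    (hxd : divF x = 0) :
    ∃ w ∈ VecPoly k, divF w = 0 ∧
      (∀ i c, w c - g i c ∈ vanish (hull T {i}) (r.v + 1).toNat) ∧
      (∀ e, CurlEdgeDofs T F k r d w e) ∧
      (∀ o, CurlFaceDofs T F k r d w o ∧
        faceInt T o (dotVec w (F.fn o)) = faceInt T o (dotVec x (F.fn o))) ∧
      ∀ q ∈ divBubble T F k r, divF q = 0 → cellInt T (fdot w q) = d.cellCurl q := by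
  have hre : -1 ≤ r.e := by
    unfold SmoothParam.IsDivParam at hr
    omega
  choose w1 hw1 hw1' using fun c : Fin 3 => exists_vertex_interpolant T (fun i => g i c) (k := k)
    (N := (r.v + 1).toNat) (fun i => hg i c) (by omega)
  set P : VField → Prop := fun w =>
    w ∈ VecPoly k ∧ ∀ i c, w c - g i c ∈ vanish (hull T {i}) (r.v + 1).toNat with hP
  -- The order of the divergence is carried along with the degrees of freedom: on edges the face
  -- corrections need it, and in the end it makes the divergence a bubble function.
  set Qe : TetEdge → VField → Prop := fun e w => CurlEdgeDofs T F k r d w e ∧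
    divF w ∈ vanish (hull T (edgeSet e)) ((r.e + 1).toNat - 1) with hQe
  set Qf : Fin 4 → VField → Prop := fun o w => (CurlFaceDofs T F k r d w o ∧
    faceInt T o (dotVec w (F.fn o)) = faceInt T o (dotVec x (F.fn o))) ∧
    divF w ∈ vanish (hull T (faceSet o)) ((r.f + 1).toNat - 1) with hQf
  have hPd : ∀ w, P w → ∀ i, divF w ∈ vanish (hull T {i}) ((r.v + 1).toNat - 1) :=
    fun w hw i => divF_vanish_of_congr (hgd i) (hw.2 i)
  have hPadd : ∀ w y, P w → y ∈ VecPoly k →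
      (∀ i c, y c ∈ vanish (hull T {i}) (r.v + 1).toNat) → P (w + y) := fun w y hw hy h =>
    ⟨vecPoly_add hw.1 hy, fun i c => add_sub_mem (hw.2 i c) (h i c)⟩
  have hQeadd : ∀ e w y, Qe e w → (∀ c, y c ∈ vanish (hull T (edgeSet e)) (r.e + 1).toNat) →
      Qe e (w + y) := fun e w y hw h => ⟨hw.1.add_of_vanish T h, by
    rw [divF_add]
    exact Submodule.add_mem _ hw.2 (divF_vanish h)⟩
  have hQfadd : ∀ o w y, Qf o w → (∀ c, y c ∈ vanish (hull T (faceSet o)) (r.f + 1).toNat) →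
      dotVec y (F.fn o) ∈ vanish (hull T (faceSet o)) 1 → Qf o (w + y) := fun o w y hw h hn =>
    ⟨⟨hw.1.1.add_of_vanish T F hn h, by rw [faceInt_normal_add_of_vanish T F hn, hw.1.2]⟩, by
      rw [divF_add]
      exact Submodule.add_mem _ hw.2 (divF_vanish h)⟩
  obtain ⟨w2, hw2, hw2e⟩ : ∃ w, P w ∧ ∀ e, Qe e w := by
    refine exists_of_local_corrections (fun w hw e => ?_) (w := w1) ⟨hw1, fun i c => hw1' c i⟩
    obtain ⟨y, hy, hy1, hy2, hy3⟩ := exists_edge_curl_correction T F d hr hre hk0 hk hw.1 e (hPd w hw)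
    exact ⟨w + y, hPadd w y hw hy hy1, hy3, fun e' he' h => hQeadd e' w y h (hy2 e' he')⟩
  obtain ⟨w3, ⟨hw3, hw3e⟩, hw3f⟩ : ∃ w, (P w ∧ ∀ e, Qe e w) ∧ ∀ o, Qf o w := by
    refine exists_of_local_corrections (fun w hw o => ?_) (w := w2) ⟨hw2, hw2e⟩
    obtain ⟨y, hy, hy1, hy2, hy3, hy4⟩ := exists_face_curl_correction T F d hr hk0 hk (hface o)
      hw.1.1 (hPd w hw.1) (fun e => (hw.2 e).2) (faceInt T o (dotVec x (F.fn o)))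
    exact ⟨w + y, ⟨hPadd w y hw.1 hy hy1.1, fun e => hQeadd e w y (hw.2 e) (hy1.2.1 e)⟩,
      ⟨⟨hy2, hy3⟩, hy4⟩, fun o' ho' h => hQfadd o' w y h (hy1.2.2.1 o' ho') (hy1.2.2.2 o' ho')⟩
  have hbub : ∀ w y, ((P w ∧ ∀ e, Qe e w) ∧ ∀ o, Qf o w) → y ∈ divBubble T F k r →
      ((P (w + y) ∧ ∀ e, Qe e (w + y)) ∧ ∀ o, Qf o (w + y)) := fun w y hw hy => by
    have h := fun c => vanishAll_of_mem_bubble T (hy.1 c)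
    exact ⟨⟨hPadd w y hw.1.1 (fun c => totalDegree_of_mem_bubble T (hy.1 c)) fun i c => (h c).1 i,
      fun e => hQeadd e w y (hw.1.2 e) fun c => (h c).2.1 e⟩,
      fun o => hQfadd o w y (hw.2 o) (fun c => (h c).2.2 o) (mem_vanish_one.2 (hy.2 o))⟩
  -- Subtracting `x`, which is divergence-free and has the same fluxes, makes all fluxes zero
  -- without changing the divergence. A bubble field then removes the divergence and disturbs no
  -- trace.
  obtain ⟨u, hu, hud⟩ := exists_divBubble_divF_eq T F hr hk0 hk (w := w3 - x)
    (vecPoly_sub hw3.1 hx)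
    (fun o => by rw [dotVec_sub_left, faceInt_sub, (hw3f o).1.2, sub_self])
    (fun i => by rw [divF_sub, hxd, sub_zero]; exact hPd w3 hw3 i)
    (fun e => by rw [divF_sub, hxd, sub_zero]; exact (hw3e e).2)
    (fun o => by rw [divF_sub, hxd, sub_zero]; exact (hw3f o).2)
  rw [divF_sub, hxd, sub_zero] at hud
  have hu' : -u ∈ divBubble T F k r := (divBubbleSubmodule T F k r).neg_mem hu
  have h4 := hbub w3 (-u) ⟨⟨hw3, hw3e⟩, hw3f⟩ hu'
  set w4 := w3 + -u with hw4
  have hd4 : divF w4 = 0 := by rw [hw4, ← sub_eq_add_neg, divF_sub, hud, sub_self]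
  -- The interior moments are attained by a divergence-free bubble field, which represents the
  -- missing functional in L².
  set S : Submodule ℝ VField := divBubbleSubmodule T F k r ⊓ LinearMap.ker divLin with hS
  have : Module.Finite ℝ S := finite_of_mem_bubble T (m := k) (r := r) fun y hy => hy.1.1
  obtain ⟨y, hy, hy'⟩ := exists_representer S (fdotLin.compr₂ (cellLin T))
    (fun u _ h => eq_zero_of_cellInt_fdot T h)
    ((d.cellCurl - cellLin T ∘ₗ fdotLin w4) ∘ₗ S.subtype)
  have h5 := hbub w4 y h4 hy.1
  refine ⟨w4 + y, h5.1.1.1, ?_, h5.1.1.2, fun e => (h5.1.2 e).1, fun o => (h5.2 o).1,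
    fun q hq hq0 => ?_⟩
  · rw [divF_add, hd4, zero_add]
    exact hy.2
  · have h6 : cellInt T (fdot y q) = d.cellCurl q - cellInt T (fdot w4 q) := hy' q ⟨hq, hq0⟩
    rw [fdot_add_left, ← cellLin_apply, map_add, cellLin_apply, cellLin_apply, h6, add_sub_cancel]

end CurlField

end CurlFE

end

noncomputable section

namespace CurlFE

/-! ### Correcting the degrees of freedom of the field by gradients -/

section FieldCorrections

/-- The gradient as a linear map. -/
def gradLin : Poly3 →ₗ[ℝ] VField := LinearMap.pi fun c => (pderiv c).toLinearMap

theorem gradLin_apply (p : Poly3) : gradLin p = gradP p := rfl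

theorem gradP_add (p q : Poly3) : gradP (p + q) = gradP p + gradP q := map_add gradLin p q

/-- The tangential part of a field as a linear map. -/
def tanLin (n : E3) : VField →ₗ[ℝ] VField where
  toFun := tanProj n
  map_add' := tanProj_add n
  map_smul' := tanProj_smul n

theorem tanLin_apply (n : E3) (w : VField) : tanLin n w = tanProj n w := rfl

theorem derivative_surjective :
    Function.Surjective (Polynomial.derivative : Polynomial ℝ →ₗ[ℝ] Polynomial ℝ) := by
  intro f
  induction f using Polynomial.induction_on' with
  | add p q hp hq =>
    obtain ⟨P, rfl⟩ := hp
    obtain ⟨Q, rfl⟩ := hq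
    exact ⟨P + Q, map_add _ P Q⟩
  | monomial n a =>
    refine ⟨Polynomial.monomial (n + 1) (a / (n + 1)), ?_⟩
    rw [Polynomial.derivative_monomial, Nat.add_sub_cancel]
    congr 1
    push_cast
    field_simp

variable (T : Tetra) (F : TetFrames T)

/-- Integration by parts on an edge. -/
theorem unitInt_derivative_mul (e : TetEdge) {p : Poly3} (h1 : evalAt (T e.1.1) p = 0)
    (h2 : evalAt (T e.1.2) p = 0) (q : Polynomial ℝ) :
    unitInt (edgePoly T e (dirD (edgeVec T e) p) * q) =
      -unitInt (edgePoly T e p * Polynomial.derivative q) := by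
  have h : unitInt (Polynomial.derivative (edgePoly T e p * q)) = 0 := by
    change ∫ s in (0 : ℝ)..1, _ = _
    rw [intervalIntegral.integral_eq_sub_of_hasDerivAt (f := fun s => (edgePoly T e p * q).eval s)
      (fun s _ => Polynomial.hasDerivAt _ s) ((Polynomial.continuous _).intervalIntegrable _ _)]
    rw [Polynomial.eval_mul, Polynomial.eval_mul, eval_edgePoly, eval_edgePoly,
      AffineMap.lineMap_apply_one, AffineMap.lineMap_apply_zero, h1, h2, zero_mul, zero_mul, sub_zero]
  rw [Polynomial.derivative_mul, map_add, derivative_edgePoly] at h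
  rw [edgeVec]
  linarith

variable (k : ℕ) (r : SmoothParam) (d : DofData)

/-- The degrees of freedom of a field on an edge. -/
def FieldEdgeDofs (v : VField) (e : TetEdge) : Prop :=
  (∀ q ∈ edgeTest (k - 1 - 2 * r.v),
    edgeMoment T e (dotVec v (F.et e)) q = d.edgeT e q) ∧
  (∀ i j : ℕ, i ≤ j → (j : ℤ) ≤ r.e → ∀ q ∈ edgeTest (k - 1 - 2 * r.v + j),
    edgeMoment T e ((dirD (F.en1 e))^[i] ((dirD (F.en2 e))^[j - i] (dotVec v (F.en1 e)))) q
      = d.edgeN1 e j i q) ∧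
  (∀ j : ℕ, (j : ℤ) ≤ r.e → ∀ q ∈ edgeTest (k - 1 - 2 * r.v + j),
    edgeMoment T e ((dirD (F.en2 e))^[j] (dotVec v (F.en2 e))) q = d.edgeN2 e j q)

/-- The degrees of freedom of a field on a face. -/
def FieldFaceDofs (v : VField) (o : Fin 4) : Prop :=
  (∀ p ∈ bubble T (faceSet o) (k + 2) (r.shift 1),
    faceInt T o (fdot (tanProj (F.fn o) v) (tanProj (F.fn o) (gradP p)))
      = d.faceT o (tanProj (F.fn o) (gradP p))) ∧
  (∀ j : ℕ, (j : ℤ) ≤ r.f → ∀ q ∈ bubble T (faceSet o) (k + 1 - j) (r.shift (-j)),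
    faceInt T o ((dirD (F.fn o))^[j] (dotVec v (F.fn o)) * q) = d.faceN o j q)

variable {T F k r d}

theorem gradP_vanish_succ {Z : Set E3} {a : ℤ} (ha : -1 ≤ a) {p : Poly3}
    (h : p ∈ vanish Z (a + 1 + 1).toNat) (c : Fin 3) : gradP p c ∈ vanish Z (a + 1).toNat :=
  vanish_mono (by omega) (gradP_vanish h c)

theorem FieldEdgeDofs.add_gradP {v : VField} {e : TetEdge} (h : FieldEdgeDofs T F k r d v e)
    (hr : -1 ≤ r.e) {p : Poly3} (hp : p ∈ vanish (hull T (edgeSet e)) (r.e + 1 + 1).toNat) :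
    FieldEdgeDofs T F k r d (v + gradP p) e := by
  obtain ⟨h1, h2, h3⟩ := h
  have hg := gradP_vanish_succ hr hp
  obtain ⟨s, -, hs⟩ := exists_edge_scale T F e
  refine ⟨fun q hq => ?_, fun i j hij hj q hq => ?_, fun j hj q hq => ?_⟩
  all_goals simp only [dotVec_add_left, iterate_dirD_add, edgeMoment_add_left]
  · rw [h1 q hq, edgeMoment_eq_zero T e (fun x hx => ?_), add_zero]
    rw [hs, dotVec_smul, dotVec_gradP, evalAt_smul, evalAt_of_vanish (dirD_vanish_of_tangent T
      (edgeSet_nonempty e) (edgeVec_tangent T e) hp) (by omega) hx, mul_zero]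
  · rw [h2 i j hij hj q hq, edgeMoment_eq_zero T e (fun x hx => ?_), add_zero]
    exact evalAt_iterate_iterate (dotVec_mem hg _) _ _ _ _ (by omega) hx
  · rw [h3 j hj q hq, edgeMoment_eq_zero T e (fun x hx => ?_), add_zero]
    exact evalAt_of_vanish (iterate_dirD_vanish (dotVec_mem hg _) _ j) (by omega) hx

theorem evalAt_dirD_face {o : Fin 4} {p : Poly3} (hp : p ∈ vanish (hull T (faceSet o)) 1) {d : E3}
    (hd : coordLin T d o = 0) {x : E3} (hx : x ∈ hull T (faceSet o)) : evalAt x (dirD d p) = 0 :=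
  mem_vanish_one.1 (dirD_vanish_of_tangent T (faceSet_nonempty o) (face_tangent T hd) hp) x hx

theorem evalAt_tanProj_gradP (F : TetFrames T) {o : Fin 4} {p q : Poly3}
    (h : p - q ∈ vanish (hull T (faceSet o)) 1) {x : E3} (hx : x ∈ hull T (faceSet o)) (c : Fin 3) :
    evalAt x (tanProj (F.fn o) (gradP p) c) = evalAt x (tanProj (F.fn o) (gradP q) c) := by
  refine evalAt_tanProj_congr (fun d hd => ?_) (F.fn_ne o) c
  have h1 := evalAt_dirD_face h (face_tangent_coord T F hd) hx
  rw [dotVec_gradP, dotVec_gradP]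
  rw [dirD_sub, evalAt_sub] at h1
  linarith

theorem FieldFaceDofs.add_gradP {v : VField} {o : Fin 4} (h : FieldFaceDofs T F k r d v o)
    (hr : -1 ≤ r.f) {p : Poly3} (hp : p ∈ vanish (hull T (faceSet o)) (r.f + 1 + 1).toNat) :
    FieldFaceDofs T F k r d (v + gradP p) o := by
  obtain ⟨h1, h2⟩ := h
  refine ⟨fun q hq => ?_, fun j hj q hq => ?_⟩
  · rw [tanProj_add, fdot_add_left, faceInt_add, h1 q hq, faceInt_eq_zero T o (fun x hx => ?_),
      add_zero]
    rw [evalAt_fdot]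
    have h0 : p - 0 ∈ vanish (hull T (faceSet o)) 1 := by
      rw [sub_zero]
      exact vanish_mono (by omega) hp
    refine Finset.sum_eq_zero fun c _ => ?_
    rw [evalAt_tanProj_gradP F h0 hx,
      ← gradLin_apply, map_zero, ← tanLin_apply, map_zero, Pi.zero_apply, evalAt_zero, zero_mul]
  · rw [dotVec_add_left, iterate_dirD_add, add_mul, faceInt_add, h2 j hj q hq,
      faceInt_mul_eq_zero T (vanish_mono (by omega)
        (iterate_dirD_vanish (dotVec_mem (gradP_vanish_succ hr hp) _) (F.fn o) j)), add_zero]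

variable (F k d)

/-- The degrees of freedom of a field on an edge can be prescribed by adding a gradient. -/
theorem exists_edge_gradient_correction (hr : r.IsCurlParam) (hk : 2 * r.v + 1 ≤ k) (v : VField)
    (e : TetEdge) (h0 : edgeMoment T e (dotVec v (F.et e)) 1 = d.edgeT e 1) :
    ∃ p : Poly3, p.totalDegree ≤ k + 2 ∧
      (∀ i, p ∈ vanish (hull T {i}) (r.v + 1 + 1).toNat) ∧
      (∀ e' ≠ e, p ∈ vanish (hull T (edgeSet e')) (r.e + 1 + 1).toNat) ∧
      FieldEdgeDofs T F k r d (v + gradP p) e := by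
  obtain ⟨hr1, hr2, hr3⟩ := hr
  obtain ⟨s, hs0, hs⟩ := exists_edge_scale T F e
  -- Integration by parts turns tangential moments of grad p against q into moments of p against q'.
  -- The antiderivative `G` expresses R q by q'; constants of integration do not matter, since `h0`
  -- makes `R` vanish on constants.
  obtain ⟨G, hG⟩ := LinearMap.exists_rightInverse_of_surjective _
    (LinearMap.range_eq_top.2 derivative_surjective)
  set R : Module.Dual ℝ (Polynomial ℝ) := d.edgeT e - edgeMomentDual T e (dotVec v (F.et e)) with hR
  have hRC : ∀ a : ℝ, R (Polynomial.C a) = 0 := fun a => by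
    have h1 : Polynomial.C a = a • (1 : Polynomial ℝ) := by
      rw [Polynomial.smul_eq_C_mul, mul_one]
    rw [h1, map_smul, hR, LinearMap.sub_apply, edgeMomentDual_apply, h0, sub_self, smul_zero]
  have hRG : ∀ q, R (G (Polynomial.derivative q)) = R q := fun q => by
    have h1 : Polynomial.derivative (q - G (Polynomial.derivative q)) = 0 := by
      rw [Polynomial.derivative_sub]
      exact sub_eq_zero.2 (LinearMap.congr_fun hG _).symm
    have h2 := hRC ((q - G (Polynomial.derivative q)).coeff 0)
    rw [← Polynomial.eq_C_of_derivative_eq_zero h1, map_sub] at h2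
    linarith
  -- Moments of p itself serve v·t, with the sign from integration by parts and the scale of the
  -- tangent. Derivatives of p of order j ≥ 1 are derivatives of order j - 1 of grad p: of its
  -- n₂-component for i = 0, of its n₁-component otherwise.
  obtain ⟨p, hp, hp1, hp2, hp3⟩ := exists_edge_correction T e (edgeVec_det_ne_zero T F e)
    (k := k + 2) (sv := r.v + 1) (se := r.e + 1) (by push_cast; omega) (by omega) fun j i =>
      if j = 0 then -s⁻¹ • (R ∘ₗ G) else if i = 0 then d.edgeN2 e (j - 1) -
        edgeMomentDual T e ((dirD (F.en2 e))^[j - 1] (dotVec v (F.en2 e))) else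
        d.edgeN1 e (j - 1) (i - 1) - edgeMomentDual T e
          ((dirD (F.en1 e))^[i - 1] ((dirD (F.en2 e))^[j - i] (dotVec v (F.en1 e))))
  have hcast : ∀ j : ℕ, ((k + 2 : ℕ) : ℤ) - 2 * (r.v + 1 + 1) + (j + 1 : ℕ) =
      k - 1 - 2 * r.v + j := fun j => by
    push_cast
    ring
  refine ⟨p, hp, hp2, hp3, fun q hq => ?_, fun i j hij hj q hq => ?_, fun j hj q hq => ?_⟩
  all_goals simp only [dotVec_add_left, iterate_dirD_add, edgeMoment_add_left]
  · have hq' : Polynomial.derivative q ∈ edgeTest (((k + 2 : ℕ) : ℤ) - 2 * (r.v + 1 + 1) + (0 : ℕ)) := by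
      rw [edgeTest, Polynomial.mem_degreeLT] at hq ⊢
      by_cases hq0 : q = 0
      · rw [hq0, Polynomial.derivative_zero, Polynomial.degree_zero]
        exact WithBot.bot_lt_coe _
      · have h1 := Polynomial.degree_derivative_lt hq0
        rw [Polynomial.degree_eq_natDegree hq0] at hq h1
        have h2 := Nat.cast_lt.1 hq
        refine h1.trans_le (Nat.cast_le.2 ?_)
        push_cast
        omega
    have h1 := hp1 0 0 le_rfl (by push_cast; omega) _ hq'
    rw [if_pos rfl, LinearMap.smul_apply, LinearMap.comp_apply, hRG] at h1
    have h2 : edgeMoment T e (dotVec (gradP p) (F.et e)) q = R q := by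
      rw [hs, dotVec_smul, dotVec_gradP, edgeMoment_smul_left, edgeMoment_eq, unitInt_derivative_mul T e
        (evalAt_of_vanish (hp2 _) (by omega) (by rw [hull_singleton]; rfl))
        (evalAt_of_vanish (hp2 _) (by omega) (by rw [hull_singleton]; rfl)), mul_neg,
        ← edgeMoment_eq]
      have h3 : edgeMoment T e p (Polynomial.derivative q) = -s⁻¹ * R q := h1
      rw [h3]
      field_simp
    rw [h2, hR, LinearMap.sub_apply, edgeMomentDual_apply, add_sub_cancel]
  · have h1 := hp1 (i + 1) (j + 1) (by omega) (by push_cast; omega) q (by rwa [hcast])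
    rw [if_neg (Nat.succ_ne_zero j), if_neg (Nat.succ_ne_zero i), Nat.add_sub_cancel,
      Nat.add_sub_cancel, Nat.add_sub_add_right, LinearMap.sub_apply, edgeMomentDual_apply] at h1
    rw [dotVec_gradP, ← dirD_iterate_comm, ← Function.iterate_succ_apply, h1, add_sub_cancel]
  · have h1 := hp1 0 (j + 1) (by omega) (by push_cast; omega) q (by rwa [hcast])
    rw [if_neg (Nat.succ_ne_zero j), if_pos rfl, Nat.add_sub_cancel, LinearMap.sub_apply,
      edgeMomentDual_apply] at h1
    rw [dotVec_gradP, ← Function.iterate_succ_apply]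
    have h2 : edgeMoment T e ((dirD (F.en2 e))^[j + 1] p) q = _ := h1
    rw [h2, add_sub_cancel]

/-- A function with vanishing tangential gradient is constant on the face, and a bubble function
with this shifted parameter is zero at the vertices. Hence the gradient pairing on the face is
definite. -/
theorem eq_zero_of_tangential_gradient {o : Fin 4} {m : ℤ} (hr : -1 ≤ r.v) {u : Poly3}
    (hu : u ∈ bubble T (faceSet o) m (r.shift 1)) (h : faceInt T o
      (fdot (tanProj (F.fn o) (gradP u)) (tanProj (F.fn o) (gradP u))) = 0) : u = 0 := by
  have h1 := eq_zero_of_faceInt T (fun x _ => fdot_self_nonneg x _) h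
  have h2 : ∀ d, coordLin T d o = 0 → dotVec (gradP u) d ∈ vanish (hull T (faceSet o)) 1 :=
    fun d hd => mem_vanish_one.2 fun x hx => by
      rw [← dotVec_tanProj (inner_normal_eq_zero T F hd), dotVec, evalAt_sum]
      exact Finset.sum_eq_zero fun c _ => by
        rw [evalAt_mul, evalAt_eq_zero_of_fdot_self (h1 x hx) c, mul_zero]
  obtain ⟨i, hi⟩ := exists_ne o
  have h3 := mem_vanish_one.1 (potential_vanish_face T hi h2)
  have h4 : evalAt (T i) u = 0 := by
    refine evalAt_of_vanish (bubble_vanish_of_ssubset T hu (Finset.singleton_nonempty i)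
      (singleton_ssubset_faceSet hi)) ?_ (by rw [hull_singleton]; rfl)
    simp only [SmoothParam.atDim, SmoothParam.shift, Finset.card_singleton]
    norm_num
    omega
  refine bubble_eq_zero_of_hull T (faceSet_nonempty o) hu fun x hx => ?_
  have h5 := eq_of_gradP_eq (gradP_potential (a := T i) (curlF_gradP u)) x (T i)
  rw [h3 x hx, h4, evalAt_potential_self] at h5
  linarith

/-- The degrees of freedom of a field on a face can be prescribed by adding a gradient. -/
theorem exists_face_gradient_correction (hr : r.IsCurlParam) (hk : 2 * r.v + 1 ≤ k) (v : VField)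
    (o : Fin 4) :
    ∃ p : Poly3, p.totalDegree ≤ k + 2 ∧
      (∀ i, p ∈ vanish (hull T {i}) (r.v + 1 + 1).toNat) ∧
      (∀ e, p ∈ vanish (hull T (edgeSet e)) (r.e + 1 + 1).toNat) ∧
      (∀ o' ≠ o, p ∈ vanish (hull T (faceSet o')) (r.f + 1 + 1).toNat) ∧
      FieldFaceDofs T F k r d (v + gradP p) o := by
  obtain ⟨hr1, hr2, hr3⟩ := hr
  -- `u` is the trace on the face whose tangential gradient has the missing moments.
  obtain ⟨u, hu, hu'⟩ := exists_representer (bubble T (faceSet o) (k + 2) (r.shift 1))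
    ((fdotLin.compl₁₂ (tanLin (F.fn o) ∘ₗ gradLin) (tanLin (F.fn o) ∘ₗ gradLin)).compr₂ (faceLin T o))
    (fun u hu h => eq_zero_of_tangential_gradient F (by omega) hu h)
    ((d.faceT o - faceLin T o ∘ₗ fdotLin (tanProj (F.fn o) v)) ∘ₗ tanLin (F.fn o) ∘ₗ gradLin ∘ₗ
      (bubble T (faceSet o) (k + 2) (r.shift 1)).subtype)
  -- The moments of order 0 force p = u on the face. The normal derivatives of p of order j ≥ 1 are
  -- those of order j - 1 of the normal component of its gradient.
  obtain ⟨p, hp, hp1, hp2, hp3, hp4⟩ := exists_face_correction T F o (k := k + 2) (r := r.shift 1)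
    (by simp only [SmoothParam.shift]; push_cast; omega) (by simp only [SmoothParam.shift]; omega)
    (by simp only [SmoothParam.shift]; omega) fun j => if j = 0 then faceMomentDual T o u else
      d.faceN o (j - 1) - faceMomentDual T o ((dirD (F.fn o))^[j - 1] (dotVec v (F.fn o)))
  refine ⟨p, hp, hp2, hp3, hp4, fun q hq => ?_, fun j hj q hq => ?_⟩
  · have hpu : p - u ∈ vanish (hull T (faceSet o)) 1 := by
      refine mem_vanish_one.2 (face_eq_zero_of_moments T (k := k + 2) (r := r.shift 1)
        ((totalDegree_sub _ _).trans (max_le hp (totalDegree_of_mem_bubble T hu)))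
        (fun i hi => Submodule.sub_mem _ (hp2 i) (bubble_vanish_of_ssubset T hu
          (Finset.singleton_nonempty i) (singleton_ssubset_faceSet hi)))
        (fun e h1 h2 => Submodule.sub_mem _ (hp3 e) ?_) fun q hq _ => ?_)
      · have h3 := bubble_vanish_of_ssubset T hu (edgeSet_nonempty e)
          (edgeSet_ssubset_faceSet h1 h2)
        rwa [card_edgeSet] at h3
      · have h3 := hp1 0 (by simp only [SmoothParam.shift]; push_cast; omega) q
          (by simpa [SmoothParam.shift] using hq)
        rw [if_pos rfl, faceMomentDual_apply] at h3
        rw [sub_mul, faceInt_sub]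
        exact sub_eq_zero.2 h3
    have h1 : faceInt T o (fdot (tanProj (F.fn o) (gradP u)) (tanProj (F.fn o) (gradP q))) =
      d.faceT o (tanProj (F.fn o) (gradP q)) -
        faceInt T o (fdot (tanProj (F.fn o) v) (tanProj (F.fn o) (gradP q))) := hu' q hq
    have h2 : faceInt T o (fdot (tanProj (F.fn o) (gradP p)) (tanProj (F.fn o) (gradP q))) =
        faceInt T o (fdot (tanProj (F.fn o) (gradP u)) (tanProj (F.fn o) (gradP q))) :=
      faceInt_congr T o fun x hx => by
        rw [evalAt_fdot, evalAt_fdot]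
        exact Finset.sum_congr rfl fun c _ => by rw [evalAt_tanProj_gradP F hpu hx]
    rw [tanProj_add, fdot_add_left, faceInt_add, h2, h1, add_sub_cancel]
  · have hcast : ((k + 2 : ℕ) : ℤ) - (j + 1 : ℕ) = k + 1 - j := by
      push_cast
      ring
    have hshift : (r.shift 1).shift (-(j + 1 : ℕ)) = r.shift (-(j : ℤ)) := by
      simp only [SmoothParam.shift, SmoothParam.mk.injEq]
      push_cast
      refine ⟨by ring, by ring, by ring⟩
    have h1 := hp1 (j + 1) (by simp only [SmoothParam.shift]; push_cast; omega) q
      (by rwa [hcast, hshift])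
    rw [if_neg (Nat.succ_ne_zero j), Nat.add_sub_cancel, LinearMap.sub_apply,
      faceMomentDual_apply, Function.iterate_succ_apply] at h1
    rw [dotVec_add_left, iterate_dirD_add, add_mul, faceInt_add, dotVec_gradP, h1, add_sub_cancel]

end FieldCorrections

end CurlFE

end

noncomputable section

namespace CurlFE

/-! ### Existence for all degrees of freedom -/

section Unisolvence

variable (T : Tetra) (F : TetFrames T)

/-- The vertex relations hold for the derivatives of a curl. -/
theorem traceFree_of_hasVertexDofs {r1 r2 : SmoothParam} {v : VField} {d : DofData}
    (h : ∀ i, HasVertexDofs T r1 r2 v d i) : d.TraceFree r1 r2 := by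
  intro i β h1 h2
  have h3 : evalAt (T i) (partialD β (divF (curlF v))) = 0 := by
    rw [divF_curlF]
    simp [partialD]
  rw [divF, partialD_sum, evalAt_sum] at h3
  rw [← h3]
  refine Finset.sum_congr rfl fun c _ => ?_
  rw [partialD_pderiv, (h i).2 _ c (by rw [multiOrder_add_single]; push_cast; exact h1)
    (by rw [multiOrder_add_single]; push_cast; exact h2)]

/-- The values of the degrees of freedom of a field. -/
def dofsOf (v : VField) : DofData where
  vert i β c := evalAt (T i) (partialD β (v c))
  vertCurl i β c := evalAt (T i) (partialD β (curlF v c))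
  edgeT e := edgeMomentDual T e (dotVec v (F.et e))
  edgeN1 e j i := edgeMomentDual T e
    ((dirD (F.en1 e))^[i] ((dirD (F.en2 e))^[j - i] (dotVec v (F.en1 e))))
  edgeN2 e j := edgeMomentDual T e ((dirD (F.en2 e))^[j] (dotVec v (F.en2 e)))
  edgeCurlN2 e j := edgeMomentDual T e ((dirD (F.en1 e))^[j] (dotVec (curlF v) (F.en2 e)))
  edgeCurlT e j i := edgeMomentDual T e
    ((dirD (F.en1 e))^[i] ((dirD (F.en2 e))^[j - i] (dotVec (curlF v) (F.et e))))
  edgeCurlN1 e j i := edgeMomentDual T e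
    ((dirD (F.en1 e))^[i] ((dirD (F.en2 e))^[j - i] (dotVec (curlF v) (F.en1 e))))
  faceT o := faceLin T o ∘ₗ fdotLin (tanProj (F.fn o) v)
  faceN o j := faceMomentDual T o ((dirD (F.fn o))^[j] (dotVec v (F.fn o)))
  faceCurlN o := faceMomentDual T o (dotVec (curlF v) (F.fn o))
  faceCurlT o j l := faceMomentDual T o ((dirD (F.fn o))^[j] (dotVec (curlF v) (F.ft o l)))
  cellCurl := cellLin T ∘ₗ fdotLin (curlF v)
  cell := cellLin T ∘ₗ fdotLin v

theorem hasDofs_dofsOf (k : ℕ) (r1 r2 : SmoothParam) (v : VField) :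
    HasDofs T F k r1 r2 v (dofsOf T F v) :=
  ⟨fun _ => ⟨fun _ _ _ => rfl, fun _ _ _ _ => rfl⟩,
    fun _ => ⟨fun _ _ => rfl, fun _ _ _ _ _ _ => rfl, fun _ _ _ _ => rfl, fun _ _ _ _ => rfl,
      fun _ _ _ _ _ _ => rfl, fun _ _ _ _ _ _ => rfl⟩,
    fun _ => ⟨fun _ _ => rfl, fun _ _ _ _ => rfl, fun _ _ _ => rfl, fun _ _ _ _ _ => rfl⟩,
    fun _ _ _ => rfl, fun _ _ => rfl⟩

/-- The degrees of freedom that do not involve the curl can be prescribed by adding a gradient. -/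
theorem exists_gradient_correction (d : DofData) {k : ℕ} {r1 r2 : SmoothParam}
    (hr1 : r1.IsCurlParam) (hr12 : r2.GeOminusOne r1) (hk : 2 * r1.v + 1 ≤ k) {v : VField}
    (hv : v ∈ VecPoly (k + 1)) {g : Fin 4 → VField} (hg : ∀ i, g i ∈ VecPoly (k + 1))
    (hvg : ∀ i c, curlF v c - curlF (g i) c ∈ vanish (hull T {i}) (r2.v + 1).toNat)
    (hcirc : ∀ (e : TetEdge) (p : Poly3), (∀ i, evalAt (T i) p = 0) →
      edgeMoment T e (dotVec (v + gradP p) (F.et e)) 1 = d.edgeT e 1) :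
    ∃ p : Poly3, p.totalDegree ≤ k + 2 ∧
      (∀ i c, (v + gradP p) c - g i c ∈ vanish (hull T {i}) (r1.v + 1).toNat) ∧
      (∀ e, FieldEdgeDofs T F k r1 d (v + gradP p) e) ∧
      (∀ o, FieldFaceDofs T F k r1 d (v + gradP p) o) ∧
      ∀ q ∈ bubble T Finset.univ (k + 2) (r1.shift 1),
        cellInt T (fdot (v + gradP p) (gradP q)) = d.cell (gradP q) := by
  have hf : -1 ≤ r1.f ∧ -1 ≤ r1.e ∧ -1 ≤ r1.v := by
    obtain ⟨h1, h2, h3⟩ := hr1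
    omega
  obtain ⟨hr12v, -, -⟩ := hr12
  -- Zero values at the vertices keep the circulations of v, so `hcirc` stays available for every
  -- edge correction.
  set P : Poly3 → Prop := fun p => p.totalDegree ≤ k + 2 ∧ (∀ i, evalAt (T i) p = 0) ∧
    ∀ i c, (v + gradP p) c - g i c ∈ vanish (hull T {i}) (r1.v + 1).toNat with hP
  have hPadd : ∀ p q, P p → q.totalDegree ≤ k + 2 →
      (∀ i, q ∈ vanish (hull T {i}) (r1.v + 1 + 1).toNat) → P (p + q) := fun p q hp hq hqv => by
    refine ⟨(totalDegree_add _ _).trans (max_le hp.1 hq), fun i => ?_, fun i c => ?_⟩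
    · rw [evalAt_add, hp.2.1 i, evalAt_of_vanish (hqv i) (by omega) (by rw [hull_singleton]; rfl),
        add_zero]
    · rw [gradP_add, ← add_assoc]
      exact add_sub_mem (hp.2.2 i c) (gradP_vanish_succ hf.2.2 (hqv i) c)
  -- At a vertex curl(g i - v) vanishes to order r2.v + 1, so g i - v is the gradient of its
  -- potential up to order r2.v + 2, and r₂ ≥ r₁ ⊖ 1 makes this enough. The potentials at the four
  -- vertices are interpolated.
  have h1 : ∃ p, P p := by
    obtain ⟨p, hp, hp'⟩ := exists_vertex_interpolant T (fun i => potential (T i) (g i - v))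
      (k := k + 2) (N := (r1.v + 1 + 1).toNat)
      (fun i => totalDegree_potential_le (vecPoly_sub (hg i) hv)) (by omega)
    refine ⟨p, hp, fun i => ?_, fun i c => ?_⟩
    · have h2 := evalAt_of_vanish (hp' i) (by omega) (x := T i) (by rw [hull_singleton]; rfl)
      rwa [evalAt_sub, evalAt_potential_self, sub_zero] at h2
    · have h2 := gradP_vanish_succ hf.2.2 (hp' i) c
      have h3 := sub_gradP_potential_vanish (a := T i) (v := g i - v) (N := (r2.v + 1).toNat)
        (fun c => by
          rw [curlF_sub, ← hull_singleton, Pi.sub_apply, ← neg_sub]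
          exact Submodule.neg_mem _ (hvg i c)) c
      rw [← hull_singleton] at h3
      have h4 := Submodule.sub_mem _ h2 (vanish_mono (by omega) h3)
      have h5 : (v + gradP p) c - g i c = gradP (p - potential (T i) (g i - v)) c -
          ((g i - v) c - gradP (potential (T i) (g i - v)) c) := by
        rw [← gradLin_apply (p - _), map_sub, gradLin_apply, gradLin_apply, Pi.add_apply,
          Pi.sub_apply, Pi.sub_apply]
        abel
      rwa [h5]
  obtain ⟨p1, hp1⟩ := h1
  obtain ⟨p2, hp2, hp2e⟩ : ∃ p, P p ∧ ∀ e, FieldEdgeDofs T F k r1 d (v + gradP p) e := by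
    refine exists_of_local_corrections (fun p hp e => ?_) hp1
    obtain ⟨q, hq, hq1, hq2, hq3⟩ := exists_edge_gradient_correction F k d hr1 hk (v + gradP p) e
      (hcirc e p hp.2.1)
    refine ⟨p + q, hPadd p q hp hq hq1, ?_, fun e' he' h => ?_⟩
    · rwa [gradP_add, ← add_assoc]
    · rw [gradP_add, ← add_assoc]
      exact h.add_gradP hf.2.1 (hq2 e' he')
  obtain ⟨p3, ⟨hp3, hp3e⟩, hp3f⟩ : ∃ p, (P p ∧ ∀ e, FieldEdgeDofs T F k r1 d (v + gradP p) e) ∧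
      ∀ o, FieldFaceDofs T F k r1 d (v + gradP p) o := by
    refine exists_of_local_corrections (fun p hp o => ?_) ⟨hp2, hp2e⟩
    obtain ⟨q, hq, hq1, hq2, hq3, hq4⟩ := exists_face_gradient_correction F k d hr1 hk
      (v + gradP p) o
    refine ⟨p + q, ⟨hPadd p q hp.1 hq hq1, fun e => ?_⟩, ?_, fun o' ho' h => ?_⟩
    · rw [gradP_add, ← add_assoc]
      exact (hp.2 e).add_gradP hf.2.1 (hq2 e)
    · rwa [gradP_add, ← add_assoc]
    · rw [gradP_add, ← add_assoc]
      exact h.add_gradP hf.1 (hq3 o' ho')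
  -- The interior moments are attained by the gradient of a bubble function; the pairing is definite
  -- because such a function vanishes at the vertices.
  obtain ⟨q, hq, hq'⟩ := exists_representer (bubble T Finset.univ (k + 2) (r1.shift 1))
    ((fdotLin.compl₁₂ gradLin gradLin).compr₂ (cellLin T)) (fun u hu h => by
      have h2 : gradP u = gradP 0 :=
        (eq_zero_of_cellInt_fdot T (y := gradP u) h).trans (map_zero gradLin).symm
      refine poly_ext fun x => ?_
      have h3 := eq_of_gradP_eq h2 x (T 0)
      have h4 := (vanishAll_of_mem_bubble T hu).1 0
      rw [evalAt_of_vanish h4 (x := T 0) (by simp only [SmoothParam.shift]; omega)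
        (by rw [hull_singleton]; rfl)] at h3
      rw [evalAt_zero, evalAt_zero, sub_zero, sub_zero] at h3
      rw [h3, evalAt_zero])
    ((d.cell - cellLin T ∘ₗ fdotLin (v + gradP p3)) ∘ₗ gradLin ∘ₗ
      (bubble T Finset.univ (k + 2) (r1.shift 1)).subtype)
  have hqv := vanishAll_of_mem_bubble T hq
  refine ⟨p3 + q, ?_, fun i c => ?_, fun e => ?_, fun o => ?_, fun p hp => ?_⟩
  · exact (totalDegree_add _ _).trans (max_le hp3.1 (totalDegree_of_mem_bubble T hq))
  all_goals rw [gradP_add, ← add_assoc]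
  · exact add_sub_mem (hp3.2.2 i c) (gradP_vanish_succ hf.2.2 (hqv.1 i) c)
  · exact (hp3e e).add_gradP hf.2.1 (hqv.2.1 e)
  · exact (hp3f o).add_gradP hf.1 (hqv.2.2 o)
  · have h6 : cellInt T (fdot (gradP q) (gradP p)) =
      d.cell (gradP p) - cellInt T (fdot (v + gradP p3) (gradP p)) := hq' p hp
    rw [fdot_add_left, ← cellLin_apply, map_add, cellLin_apply, cellLin_apply, h6, add_sub_cancel]

/-- There is a field with given degrees of freedom. -/
theorem exists_hasDofs {r1 r2 : SmoothParam} {k : ℕ} (hr1 : r1.IsCurlParam) (hr2 : r2.IsDivParam)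
    (hr12 : r2.GeOminusOne r1) (hk : 1 ≤ k) (hk1 : 2 * r1.v + 1 ≤ k) (hk2 : 2 * r2.v + 1 ≤ k)
    (hface : ∀ o : Fin 4, 1 ≤ Module.finrank ℝ (bubble T (faceSet o) k r2)) {d : DofData}
    (hd : d.TraceFree r1 r2) : ∃ v ∈ VecPoly (k + 1), HasDofs T F k r1 r2 v d := by
  choose g hg hg' using exists_vertex_field T (r1 := r1) (r2 := r2) (k := k) (by omega) (by omega) hd
  choose s hs0 hs using exists_edge_scale T F
  -- The degree of freedom against q = 1 uses the chosen tangent, s e times the edge vector, and arc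
  -- length; dividing by both gives the circulation.
  obtain ⟨x, hx, hx'⟩ := exists_circ T fun e => d.edgeT e 1 / (s e * dist (T e.1.1) (T e.1.2))
  obtain ⟨w, hw, hw0, hwv, hwe, hwf, hwc⟩ := exists_curl_dofs T F d hr2 hk hk2 hface
    (fun i => totalDegree_curlF_le (hg i)) (fun i => divF_curlF (g i))
    (x := curlF x) (fun c => (totalDegree_curlF_le hx c).trans (Nat.zero_le k)) (divF_curlF x)
  -- From here on curl v = w is fixed; gradients adjust all the rest.
  obtain ⟨v, hv, hvw, hvx⟩ := exists_curl_eq T F hw hw0 fun o => (hwf o).2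
  obtain ⟨p, hp, hpv, hpe, hpf, hpc⟩ := exists_gradient_correction T F d hr1 hr12 hk1 hv hg
    (fun i c => by rw [hvw]; exact hwv i c) (fun e p hp => by
      have h1 : circ T e (v + gradP p) = d.edgeT e 1 / (s e * dist (T e.1.1) (T e.1.2)) := by
        rw [circ_add, circ_gradP, hp, hp, sub_zero, add_zero, hvx, hx']
      rw [circ] at h1
      rw [hs, dotVec_smul, edgeMoment_smul_left, edgeMoment_eq, mul_one, h1]
      have h2 := (edge_dist_pos T e).ne'
      have h3 := hs0 e
      field_simp)
  have hcurl : curlF (v + gradP p) = w := by rw [curlF_add, curlF_gradP, add_zero, hvw]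
  refine ⟨v + gradP p, vecPoly_add hv (totalDegree_gradP_le hp), fun i => ?_, fun e => ?_,
    fun o => ?_, ?_, hpc⟩
  · exact (hg' i).congr T (hpv i) fun c => by rw [hcurl]; exact hwv i c
  · have h := hwe e
    rw [← hcurl] at h
    exact ⟨(hpe e).1, (hpe e).2.1, (hpe e).2.2, h⟩
  · have h := (hwf o).1
    rw [← hcurl] at h
    exact ⟨(hpf o).1, (hpf o).2, h⟩
  · rw [hcurl]
    exact hwc

end Unisolvence

end CurlFE

end

theorem mainTheorem10 (T : Tetra) (F : TetFrames T) (r1 r2 : SmoothParam) (k : ℕ)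
    (hr1 : r1.IsCurlParam) (hr2 : r2.IsDivParam) (hr12 : r2.GeOminusOne r1)
    (hk : 1 ≤ k) (hk1 : 2 * r1.v + 1 ≤ k) (hk2 : 2 * r2.v + 1 ≤ k)
    (hface : ∀ o : Fin 4, 1 ≤ Module.finrank ℝ (bubble T (faceSet o) k r2)) :
    -- the degrees of freedom are unisolvent
    (∀ v ∈ VecPoly (k + 1), ∀ d : DofData, HasDofs T F k r1 r2 v d → d.TraceFree r1 r2) ∧
    (∀ v ∈ VecPoly (k + 1), ∃ d : DofData, HasDofs T F k r1 r2 v d) ∧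
    (∀ d : DofData, d.TraceFree r1 r2 →
      ∃! v : VField, v ∈ VecPoly (k + 1) ∧ HasDofs T F k r1 r2 v d) ∧
    -- single-valued degrees of freedom on a vertex, an edge or a face determine the traces there
    (∀ u ∈ VecPoly (k + 1), ∀ v ∈ VecPoly (k + 1), ∀ d : DofData,
      (∀ i : Fin 4, HasVertexDofs T r1 r2 u d i → HasVertexDofs T r1 r2 v d i →
        JetEq r1.v u v (T i) ∧ JetEq r2.v (curlF u) (curlF v) (T i)) ∧
      (∀ e : TetEdge, HasDofsOnEdge T F k r1 r2 u d e → HasDofsOnEdge T F k r1 r2 v d e →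
        ∀ x ∈ segment ℝ (T e.1.1) (T e.1.2),
          evalAt x (dotVec u (F.et e)) = evalAt x (dotVec v (F.et e)) ∧
          JetEq r1.e u v x ∧ JetEq r2.e (curlF u) (curlF v) x) ∧
      (∀ o : Fin 4, HasDofsOnFace T F k r1 r2 u d o → HasDofsOnFace T F k r1 r2 v d o →
        ∀ x ∈ facePts T o,
          (∀ c, evalAt x (tanProj (F.fn o) u c) = evalAt x (tanProj (F.fn o) v c)) ∧
          evalAt x (dotVec (curlF u) (F.fn o)) = evalAt x (dotVec (curlF v) (F.fn o)) ∧
          JetEq r1.f u v x ∧ JetEq r2.f (curlF u) (curlF v) x)) := by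
  refine ⟨fun v _ d h => traceFree_of_hasVertexDofs T h.1,
    fun v _ => ⟨dofsOf T F v, hasDofs_dofsOf T F k r1 r2 v⟩, fun d hd => ?_,
    fun u hu v hv d => conforming T F hr1 hr2 hr12 hk1 hk2 hu hv d⟩
  obtain ⟨v, hv, hvd⟩ := exists_hasDofs T F hr1 hr2 hr12 hk hk1 hk2 hface hd
  refine ⟨v, ⟨hv, hvd⟩, fun u ⟨hu, hud⟩ => sub_eq_zero.1 ?_⟩
  exact eq_zero_of_hasDofs_zero T F hr1 hr2 hr12 hk1 hk2 (vecPoly_sub hu hv)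
    ⟨fun i => (hud.1 i).sub (hvd.1 i), fun e => (hud.2.1 e).sub (hvd.2.1 e),
      fun o => (hud.2.2.1 o).sub (hvd.2.2.1 o), hud.2.2.2.sub hvd.2.2.2⟩
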